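/- Let $\mathcal N\ge 1$ be a square-free integer, $k\ge 4$ an integer, and $\chi$ a Dirichlet character modulo $\mathcal N$ with $\chi(-1)=(-1)^k$. For $d\mid\mathcal N$ write $\chi_d$ for the component of $\chi$ modulo $d$, so that $\chi=\chi_d\,\chi_{\mathcal N/d}$ (explicitly, $\chi_d(a)=\chi(b)$ where $b\equiv a\ (d)$, $b\equiv 1\ (\mathcal N/d)$). **Eisenstein series.** Let $\Gamma_\infty\subset Sp_2(\mathbb Z)$ be the subgroup of matrices $\begin{pmatrix}A&B\\C&D\end{pmatrix}$ ($2\times2$ blocks) with $C=0$, and $\Gamma_0(\mathcal N)$ the subgroup with $C\equiv0\ (\mathcal N)$. Let $\mathfrak h_{(2)}$ be the set of complex symmetric $2\times 2$ matrices with positive definite imaginary part. For $\gamma_0=\begin{pmatrix}*&*\\M_0&*\end{pmatrix}\in Sp_2(\mathbb Z)$ such that $\chi_q^2=1$ for every prime $q\mid\mathcal N$ with $\operatorname{rank}_q M_0=1$, put $$\mathbb E_{\gamma_0}(\tau)=\sum\overline\chi(\det D_\gamma)\,\det(C_{\gamma_0\gamma}\tau+D_{\gamma_0\gamma})^{-k}\qquad(\tau\in\mathfrak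 h_{(2)}),$$ where $\Gamma_\infty\gamma_0\gamma$, with $\gamma\in\Gamma_0(\mathcal N)$, runs once over the $\Gamma_0(\mathcal N)$-orbit of $\Gamma_\infty\gamma_0$. The space $\mathrm{Eis}^{(2)}_k(\mathcal N,\chi)$ of degree 2 Siegel Eisenstein series of weight $k$, level $\mathcal N$, character $\chi$ is the complex span of these $\mathbb E_{\gamma_0}$. For positive integers with $\mathcal N_0\mathcal N_1\mathcal N_2=\mathcal N$ and $\chi_{\mathcal N_1}^2=1$ let $\mathbb E_{(\mathcal N_0,\mathcal N_1,\mathcal N_2)}=\mathbb E_{\gamma_0}$ for $\gamma_0=\begin{pmatrix}I&0\\M&I\end{pmatrix}$, where $M$ is an integral diagonal matrix congruent to $0$ modulo $\mathcal N_0$, to $\mathrm{diag}(1,0)$ modulo $\mathcal N_1$ and to $I$ modulo $\mathcal N_2$. **Hecke operators.** For a real matrix $g=\begin{pmatrix}A&B\\C&D\end{pmatrix}$ of symplectic similitude with positive multiplier let $(f|g)(\tau)=(\det g)^{k/2}\det(C\tau+D)^{-k}f((A\tau+B)(C\tau+D)^{-1})$. For a prime $p$ let $$f|T(p)=p^{k-3}\sum_\gamma\overline\chi(\det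 D_\gamma)\,f|\delta^{-1}\gamma,\qquad f|T_1(p^2)=p^{k-3}\sum_\gamma\overline\chi(\det D_\gamma)\,f|\delta_1^{-1}\gamma,$$ where $\delta=\mathrm{diag}(p,p,1,1)$, $\delta_1=\mathrm{diag}(p,1,1/p,1)$, and $\gamma$ runs over representatives of $(\delta\Gamma_0(\mathcal N)\delta^{-1}\cap\Gamma_0(\mathcal N))\backslash\Gamma_0(\mathcal N)$, respectively of the same quotient with $\delta_1$ in place of $\delta$. **Theorem.** The space $\mathrm{Eis}^{(2)}_k(\mathcal N,\chi)$ has a basis $\{\widetilde{\mathbb E}_\rho\}$ indexed by the triples $\rho=(\mathcal N_0,\mathcal N_1,\mathcal N_2)$ of positive integers with $\mathcal N_0\mathcal N_1\mathcal N_2=\mathcal N$ and $\chi_{\mathcal N_1}^2=1$, given by $$\widetilde{\mathbb E}_\rho=\sum_{Q_0Q_0'\mid\mathcal N_0,\ Q_1\mid\mathcal N_1}a_\rho(Q_0)\,b_\rho(Q_0')\,c_\rho(Q_1)\;\mathbb E_{(\mathcal N_0/(Q_0Q_0'),\ Q_0\mathcal N_1/Q_1,\ Q_0'Q_1\mathcal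 N_2)}$$ (terms with zero coefficient are omitted), where $a_\rho,b_\rho,c_\rho$ are extended multiplicatively from the following values at primes. For a prime $q\mid\mathcal N_0$, $$a_\rho(q)=-\frac{\chi_{\mathcal N_1\mathcal N_2}(q)\,q^{-1}(q-1)}{\chi_{\mathcal N_0/q}(q)q^{k-1}-\chi_{\mathcal N_1\mathcal N_2}(q)}\ \text{ if }\chi_q=1,\qquad a_\rho(q)=0\text{ otherwise},$$ $$b_\rho(q)=\begin{cases}-\dfrac{\chi_{\mathcal N_2}(q^2)\,q^{-1}(q-1)\,(\chi_{\mathcal N_0/q}(q)q^{k-3}-\chi_{\mathcal N_1\mathcal N_2}(q))}{(\chi_{\mathcal N_0/q}(q)q^{k-1}-\chi_{\mathcal N_1\mathcal N_2}(q))(\chi_{\mathcal N_0/q}(q^2)q^{2k-3}-\chi_{\mathcal N_2}(q^2))}&\text{if }\chi_q=1,\\[2ex]-\dfrac{\left(\frac{-1}{q}\right)\chi_{\mathcal N_2}(q^2)\,q^{-2}(q-1)}{\chi_{\mathcal N_0/q}(q^2)q^{2k-3}-\chi_{\mathcal N_2}(q^2)}&\text{if }\chi_q\ne1,\ \chi_q^2=1,\\[1ex]0&\text{if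 }\chi_q^2\neq 1,\end{cases}$$ and for a prime $q\mid\mathcal N_1$, $$c_\rho(q)=-\frac{\chi_{\mathcal N_2}(q)\,q^{-2}(q^2-1)}{\chi_{\mathcal N_0\mathcal N_1/q}(q)q^{k-2}-\chi_{\mathcal N_2}(q)}\ \text{ if }\chi_q=1,\qquad c_\rho(q)=0\text{ otherwise}.$$ For every such $\rho$ and every prime $p$, $\widetilde{\mathbb E}_\rho|T(p)=\lambda(p)\widetilde{\mathbb E}_\rho$ and $\widetilde{\mathbb E}_\rho|T_1(p^2)=\lambda_1(p^2)\widetilde{\mathbb E}_\rho$, where $$\lambda(p)=\begin{cases}(\chi_{\mathcal N_0\mathcal N_1}(p)p^{k-1}+\chi_{\mathcal N_2}(p))(\chi_{\mathcal N_0}(p)p^{k-2}+\chi_{\mathcal N_1\mathcal N_2}(p))&\text{if }p\nmid\mathcal N,\\ \chi_{\mathcal N_0}(p^2)\chi_{\mathcal N_1}(p)p^{2k-3}&\text{if }p\mid\mathcal N_2,\\ \chi_{\mathcal N_0\mathcal N_2}(p)p^{k-1}&\text{if }p\mid\mathcal N_1,\\ \chi_{\mathcal N_1}(p)\chi_{\mathcal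 N_2}(p^2)&\text{if }p\mid\mathcal N_0,\end{cases}$$ $$\lambda_1(p^2)=\begin{cases}(p+1)\bigl(\chi_{\mathcal N_0}(p^2)p^{2k-3}+\chi(p)p^{k-3}(p-1)+\chi_{\mathcal N_2}(p^2)\bigr)&\text{if }p\nmid\mathcal N,\\ \chi_{\mathcal N_0}(p^2)(p+1)p^{2k-3}&\text{if }p\mid\mathcal N_2,\\ \chi_{\mathcal N_0}(p^2)p^{2k-2}+\chi_{\mathcal N_2}(p^2)p&\text{if }p\mid\mathcal N_1,\\ \chi_{\mathcal N_2}(p^2)(p+1)&\text{if }p\mid\mathcal N_0.\end{cases}$$ -/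

import Mathlib

open Matrix
open scoped ComplexConjugate

namespace SiegelEisenstein

noncomputable section

/-! ### Groups -/

/-- `Sp₂(ℤ)`: integral symplectic `4 × 4` matrices, in `2 × 2` blocks. -/
abbrev Sp : Type := symplecticGroup (Fin 2) ℤ

/-- The lower left block `C` of `γ = (A B; C D)`. -/
def blockC (γ : Sp) : Matrix (Fin 2) (Fin 2) ℤ := γ.1.toBlocks₂₁

/-- The lower right block `D` of `γ = (A B; C D)`. -/
def blockD (γ : Sp) : Matrix (Fin 2) (Fin 2) ℤ := γ.1.toBlocks₂₂

theorem blockC_mul (γ γ' : Sp) :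
    blockC (γ * γ') =
      blockC γ * γ'.1.toBlocks₁₁ + blockD γ * blockC γ' := by
  ext i j
  simp [blockC, blockD, toBlocks₂₁, toBlocks₂₂, toBlocks₁₁, Matrix.mul_apply,
    Fintype.sum_sum_type]

theorem blockC_inv (γ : Sp) : blockC γ⁻¹ = -(blockC γ)ᵀ := by
  have h : ((γ⁻¹ : Sp) : Matrix _ _ ℤ) = (-J (Fin 2) ℤ) * (γ : Matrix _ _ ℤ)ᵀ * J (Fin 2) ℤ :=
    SymplecticGroup.coe_inv γ
  unfold blockC
  rw [h, ← fromBlocks_toBlocks γ.1]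
  simp [J, fromBlocks_transpose, fromBlocks_multiply, fromBlocks_neg]

/-- `Γ₀(N)`: the elements of `Sp₂(ℤ)` with `C ≡ 0 (mod N)`. -/
def Gamma0 (N : ℕ) : Subgroup Sp where
  carrier := {γ | ∀ i j, (N : ℤ) ∣ blockC γ i j}
  one_mem' := by
    intro i j
    simp [blockC, toBlocks₂₁]
  mul_mem' := by
    intro a b ha hb i j
    rw [blockC_mul, Matrix.add_apply, Matrix.mul_apply, Matrix.mul_apply]
    exact dvd_add (Finset.dvd_sum fun l _ => (ha i l).mul_right _)
      (Finset.dvd_sum fun l _ => (hb l j).mul_left _)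
  inv_mem' := by
    intro a ha i j
    rw [blockC_inv]
    simpa using ha j i

/-- `Γ_∞`: the elements of `Sp₂(ℤ)` with `C = 0`. -/
def GammaInf : Subgroup Sp where
  carrier := {γ | blockC γ = 0}
  one_mem' := by
    ext i j
    simp [blockC, toBlocks₂₁]
  mul_mem' := by
    intro a b ha hb
    have ha : blockC a = 0 := ha
    have hb : blockC b = 0 := hb
    change blockC (a * b) = 0
    rw [blockC_mul, ha, hb]
    simp
  inv_mem' := by
    intro a ha
    have ha : blockC a = 0 := ha
    change blockC a⁻¹ = 0
    rw [blockC_inv, ha]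
    simp

/-- `GSp₂⁺(ℝ)`: real matrices with `g J ᵗg = ν J` for some `ν > 0`. -/
def GSpPos : Subgroup (GL (Fin 2 ⊕ Fin 2) ℝ) where
  carrier := {g | ∃ ν : ℝ, 0 < ν ∧
    (g : Matrix _ _ ℝ) * J (Fin 2) ℝ * (g : Matrix _ _ ℝ)ᵀ = ν • J (Fin 2) ℝ}
  one_mem' := ⟨1, one_pos, by simp⟩
  mul_mem' := by
    rintro a b ⟨ν, hν, ha⟩ ⟨μ, hμ, hb⟩
    refine ⟨ν * μ, mul_pos hν hμ, ?_⟩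
    have : ((a * b : GL _ ℝ) : Matrix _ _ ℝ) * J (Fin 2) ℝ * ((a * b : GL _ ℝ) : Matrix _ _ ℝ)ᵀ
        = (a : Matrix _ _ ℝ) * ((b : Matrix _ _ ℝ) * J (Fin 2) ℝ * (b : Matrix _ _ ℝ)ᵀ)
          * (a : Matrix _ _ ℝ)ᵀ := by
      simp [Matrix.transpose_mul, Matrix.mul_assoc]
    rw [this, hb, Matrix.mul_smul, Matrix.smul_mul, ha, smul_smul, mul_comm]
  inv_mem' := by
    rintro a ⟨ν, hν, ha⟩
    refine ⟨ν⁻¹, inv_pos.mpr hν, ?_⟩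
    have h1 : (a⁻¹).1 * a.1 = 1 := by
      rw [← Units.val_mul]; simp
    have h2 : a.1ᵀ * (a⁻¹).1ᵀ = 1 := by
      rw [← Matrix.transpose_mul, h1, Matrix.transpose_one]
    have h3 : J (Fin 2) ℝ = ν⁻¹ • (a.1 * J (Fin 2) ℝ * a.1ᵀ) := by
      rw [ha, smul_smul, inv_mul_cancel₀ hν.ne', one_smul]
    calc (a⁻¹).1 * J (Fin 2) ℝ * (a⁻¹).1ᵀ
        = (a⁻¹).1 * (ν⁻¹ • (a.1 * J (Fin 2) ℝ * a.1ᵀ)) * (a⁻¹).1ᵀ := by rw [← h3]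
      _ = ν⁻¹ • (((a⁻¹).1 * a.1) * J (Fin 2) ℝ * (a.1ᵀ * (a⁻¹).1ᵀ)) := by
        simp only [Matrix.mul_smul, Matrix.smul_mul, Matrix.mul_assoc]
      _ = _ := by rw [h1, h2, Matrix.one_mul, Matrix.mul_one]

/-- The inclusion `Sp₂(ℤ) → GSp₂⁺(ℝ)`. -/
def toGSpPos : Sp →* GSpPos :=
  MonoidHom.codRestrict
    (MonoidHom.toHomUnits
      ((Int.castRingHom ℝ).mapMatrix.toMonoidHom.comp (symplecticGroup (Fin 2) ℤ).subtype))
    GSpPos (by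
      intro γ
      refine ⟨1, one_pos, ?_⟩
      rw [one_smul]
      exact SymplecticGroup.mem_iff.mp (SymplecticGroup.map_mem γ.2 (Int.castRingHom ℝ)))

/-! ### The Siegel upper half-space of degree 2 and the slash action -/

/-- `𝔥₍₂₎`: complex symmetric `2 × 2` matrices with positive definite imaginary part. -/
abbrev H2 : Type :=
  {τ : Matrix (Fin 2) (Fin 2) ℂ // τ.IsSymm ∧ (τ.map Complex.im).PosDef}

/-- `C τ + D` for `g = (A B; C D)`. -/
def denom (g : GSpPos) (τ : H2) : Matrix (Fin 2) (Fin 2) ℂ :=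
  g.1.1.toBlocks₂₁.map Complex.ofReal * τ.1
    + g.1.1.toBlocks₂₂.map Complex.ofReal

/-- `A τ + B` for `g = (A B; C D)`. -/
def numer (g : GSpPos) (τ : H2) : Matrix (Fin 2) (Fin 2) ℂ :=
  g.1.1.toBlocks₁₁.map Complex.ofReal * τ.1
    + g.1.1.toBlocks₁₂.map Complex.ofReal

theorem transpose_mul_J_mul {g : Matrix (Fin 2 ⊕ Fin 2) (Fin 2 ⊕ Fin 2) ℝ} {ν : ℝ}
    (hν : 0 < ν) (hg : g * J (Fin 2) ℝ * gᵀ = ν • J (Fin 2) ℝ) :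
    gᵀ * J (Fin 2) ℝ * g = ν • J (Fin 2) ℝ := by
  have h1 : g * (-ν⁻¹ • (J (Fin 2) ℝ * gᵀ * J (Fin 2) ℝ)) = 1 := by
    rw [Matrix.mul_smul, ← Matrix.mul_assoc, ← Matrix.mul_assoc, hg, Matrix.smul_mul,
      J_squared, smul_smul]
    simp [hν.ne']
  have h2 := mul_eq_one_comm.mp h1
  have h3 := congrArg (fun X => ν • (J (Fin 2) ℝ * X)) h2
  simp only [Matrix.mul_one] at h3
  rw [← h3, Matrix.smul_mul, Matrix.mul_smul, smul_smul, ← Matrix.mul_assoc, ← Matrix.mul_assoc,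
    ← Matrix.mul_assoc, J_squared]
  simp [hν.ne']

theorem cross_identity (A B C D σ τ : Matrix (Fin 2) (Fin 2) ℂ) (ν : ℂ)
    (h₁ : Cᵀ * A - Aᵀ * C = 0) (h₂ : Cᵀ * B - Aᵀ * D = -(ν • 1))
    (h₃ : Dᵀ * A - Bᵀ * C = ν • 1) (h₄ : Dᵀ * B - Bᵀ * D = 0) :
    (C * σ + D)ᵀ * (A * τ + B) - (A * σ + B)ᵀ * (C * τ + D) = ν • (τ - σᵀ) := by
  have : (C * σ + D)ᵀ * (A * τ + B) - (A * σ + B)ᵀ * (C * τ + D)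
      = σᵀ * (Cᵀ * A - Aᵀ * C) * τ + σᵀ * (Cᵀ * B - Aᵀ * D) + (Dᵀ * A - Bᵀ * C) * τ
        + (Dᵀ * B - Bᵀ * D) := by
    simp only [Matrix.transpose_add, Matrix.transpose_mul]
    noncomm_ring
  rw [this, h₁, h₂, h₃, h₄]
  simp [smul_sub]
  abel

/-- `ᵗ(Cσ+D)(Aτ+B) - ᵗ(Aσ+B)(Cτ+D) = ν (τ - ᵗσ)` for `g ∈ GSp₂⁺(ℝ)` with multiplier `ν`. -/
theorem exists_cross_identity (g : GSpPos) : ∃ ν : ℝ, 0 < ν ∧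
    ∀ σ τ : Matrix (Fin 2) (Fin 2) ℂ,
      (g.1.1.toBlocks₂₁.map Complex.ofReal * σ + g.1.1.toBlocks₂₂.map Complex.ofReal)ᵀ
        * (g.1.1.toBlocks₁₁.map Complex.ofReal * τ + g.1.1.toBlocks₁₂.map Complex.ofReal)
      - (g.1.1.toBlocks₁₁.map Complex.ofReal * σ + g.1.1.toBlocks₁₂.map Complex.ofReal)ᵀ
        * (g.1.1.toBlocks₂₁.map Complex.ofReal * τ + g.1.1.toBlocks₂₂.map Complex.ofReal)
      = (ν : ℂ) • (τ - σᵀ) := by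
  obtain ⟨ν, hν, hg⟩ := g.2
  refine ⟨ν, hν, fun σ τ => ?_⟩
  have h := transpose_mul_J_mul hν hg
  rw [← fromBlocks_toBlocks g.1.1] at h
  simp only [J, fromBlocks_transpose, fromBlocks_multiply, fromBlocks_smul] at h
  obtain ⟨e₁, e₂, e₃, e₄⟩ := fromBlocks_inj.mp h
  have key : ∀ {X Y Z W V : Matrix (Fin 2) (Fin 2) ℝ}, Xᵀ * Y - Zᵀ * W = V →
      (X.map Complex.ofReal)ᵀ * Y.map Complex.ofReal
        - (Z.map Complex.ofReal)ᵀ * W.map Complex.ofReal = V.map Complex.ofReal := by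
    rintro X Y Z W V rfl
    ext i j
    simp [Matrix.mul_apply]
  apply cross_identity
  · rw [key (V := 0)]
    · ext; simp
    · simpa [sub_eq_add_neg] using e₁
  · rw [key (V := -(ν • 1))]
    · ext i j; simp [Matrix.one_apply]; split_ifs <;> simp
    · simpa [sub_eq_add_neg] using e₂
  · rw [key (V := ν • 1)]
    · ext i j; simp [Matrix.one_apply]; split_ifs <;> simp
    · simpa [sub_eq_add_neg] using e₃
  · rw [key (V := 0)]
    · ext; simp
    · simpa [sub_eq_add_neg] using e₄

open scoped ComplexOrder in
theorem posDef_map_ofReal {Y : Matrix (Fin 2) (Fin 2) ℝ} (hY : Y.PosDef) :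
    (Y.map Complex.ofReal).PosDef := by
  have hs : Y 1 0 = Y 0 1 := by simpa using hY.isHermitian.apply 0 1
  refine Matrix.PosDef.of_dotProduct_mulVec_pos ?_ ?_
  · ext i j
    simpa using hY.isHermitian.apply i j
  · intro x hx
    have hre : star x ⬝ᵥ (Y.map Complex.ofReal *ᵥ x)
        = ((star (fun i => (x i).re) ⬝ᵥ (Y *ᵥ fun i => (x i).re)
          + star (fun i => (x i).im) ⬝ᵥ (Y *ᵥ fun i => (x i).im) : ℝ) : ℂ) := by
      apply Complex.ext <;>
        simp [dotProduct, mulVec, Fin.sum_univ_two, hs] <;> ring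
    rw [hre]
    have hp : ∀ v : Fin 2 → ℝ, 0 ≤ star v ⬝ᵥ (Y *ᵥ v) := fun v =>
      hY.posSemidef.dotProduct_mulVec_nonneg v
    have : 0 < star (fun i => (x i).re) ⬝ᵥ (Y *ᵥ fun i => (x i).re)
          + star (fun i => (x i).im) ⬝ᵥ (Y *ᵥ fun i => (x i).im) := by
      by_cases h : (fun i => (x i).re) = 0
      · have h' : (fun i => (x i).im) ≠ 0 := by
          intro h'
          apply hx
          ext i
          exact Complex.ext (congrFun h i) (congrFun h' i)
        exact add_pos_of_nonneg_of_pos (hp _) (hY.dotProduct_mulVec_pos h')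
      · exact add_pos_of_pos_of_nonneg (hY.dotProduct_mulVec_pos h) (hp _)
    exact_mod_cast this

theorem H2_sub_conjTranspose (τ : H2) :
    τ.1 - τ.1ᴴ = (2 * Complex.I) • (τ.1.map Complex.im).map Complex.ofReal := by
  ext i j
  have h : τ.1 j i = τ.1 i j := τ.2.1.apply i j
  simp only [Matrix.sub_apply, Matrix.conjTranspose_apply, h, Matrix.smul_apply, Matrix.map_apply,
    smul_eq_mul]
  apply Complex.ext <;> simp; ring

theorem denom_cross (g : GSpPos) (τ : H2) : ∃ ν : ℝ, 0 < ν ∧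
    (denom g τ)ᵀ * numer g τ - (numer g τ)ᵀ * denom g τ = 0 ∧
    (denom g τ)ᴴ * numer g τ - (numer g τ)ᴴ * denom g τ =
      (ν : ℂ) • ((2 * Complex.I) • (τ.1.map Complex.im).map Complex.ofReal) := by
  obtain ⟨ν, hν, h⟩ := exists_cross_identity g
  refine ⟨ν, hν, ?_, ?_⟩
  · have := h τ.1 τ.1
    rw [τ.2.1.eq, sub_self, smul_zero] at this
    exact this
  · rw [← H2_sub_conjTranspose]
    have e : ∀ X Y : Matrix (Fin 2) (Fin 2) ℝ,
        (X.map Complex.ofReal * τ.1 + Y.map Complex.ofReal)ᴴ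
          = (X.map Complex.ofReal * τ.1.map (starRingEnd ℂ) + Y.map Complex.ofReal)ᵀ := by
      intro X Y
      ext i j
      simp [Matrix.mul_apply]
    have := h (τ.1.map (starRingEnd ℂ)) τ.1
    rw [← e, ← e] at this
    exact this

open scoped ComplexOrder in
theorem isUnit_det_denom (g : GSpPos) (τ : H2) : IsUnit (denom g τ).det := by
  obtain ⟨ν, hν, -, h⟩ := denom_cross g τ
  rw [isUnit_iff_ne_zero]
  intro h0
  obtain ⟨v, hv, hv0⟩ := Matrix.exists_mulVec_eq_zero_iff.mpr h0
  have hpos := (posDef_map_ofReal τ.2.2).dotProduct_mulVec_pos hv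
  have h1 := congrArg (fun X => star v ⬝ᵥ (X *ᵥ v)) h
  simp only [Matrix.sub_mulVec, dotProduct_sub, ← Matrix.mulVec_mulVec, hv0, Matrix.mulVec_zero,
    dotProduct_zero, Matrix.smul_mulVec, dotProduct_smul, smul_eq_mul] at h1
  rw [Matrix.dotProduct_mulVec, ← Matrix.star_mulVec, hv0] at h1
  simp only [star_zero, zero_dotProduct, sub_zero] at h1
  have : (ν : ℂ) ≠ 0 := by exact_mod_cast hν.ne'
  exact (mul_ne_zero this (mul_ne_zero (by simp) hpos.ne')) h1.symm

open scoped ComplexOrder in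
theorem numer_mul_inv_mem (g : GSpPos) (τ : H2) :
    (numer g τ * (denom g τ)⁻¹).IsSymm ∧
      ((numer g τ * (denom g τ)⁻¹).map Complex.im).PosDef := by
  obtain ⟨ν, hν, h1, h2⟩ := denom_cross g τ
  have hQ := isUnit_det_denom g τ
  have hQT : IsUnit (denom g τ)ᵀ.det := by rwa [Matrix.det_transpose]
  have hQH : IsUnit (denom g τ)ᴴ.det := by
    rw [Matrix.det_conjTranspose]; exact hQ.star
  have hsymm : (numer g τ * (denom g τ)⁻¹).IsSymm := by
    unfold Matrix.IsSymm
    rw [Matrix.transpose_mul, Matrix.transpose_nonsing_inv]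
    have h1' := sub_eq_zero.mp h1
    calc (denom g τ)ᵀ⁻¹ * (numer g τ)ᵀ
        = (denom g τ)ᵀ⁻¹ * ((numer g τ)ᵀ * denom g τ) * (denom g τ)⁻¹ := by
          rw [← Matrix.mul_assoc, Matrix.mul_nonsing_inv_cancel_right _ _ hQ]
      _ = _ := by
          rw [← h1', Matrix.nonsing_inv_mul_cancel_left _ _ hQT]
  refine ⟨hsymm, ?_⟩
  set W := numer g τ * (denom g τ)⁻¹ with hW
  have hP : numer g τ = W * denom g τ := by
    rw [hW, Matrix.nonsing_inv_mul_cancel_right _ _ hQ]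
  clear_value W
  have hWs : ∀ i j, W j i = W i j := fun i j => hsymm.apply i j
  have hWH : W - Wᴴ = (2 * Complex.I) • (W.map Complex.im).map Complex.ofReal := by
    ext i j
    simp only [Matrix.sub_apply, Matrix.conjTranspose_apply, hWs i j, Matrix.smul_apply,
      Matrix.map_apply, smul_eq_mul]
    apply Complex.ext <;> simp; ring
  have h3 : (denom g τ)ᴴ * (W.map Complex.im).map Complex.ofReal * denom g τ
      = (ν : ℂ) • (τ.1.map Complex.im).map Complex.ofReal := by
    have h4 : (denom g τ)ᴴ * (W - Wᴴ) * denom g τ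
        = (ν : ℂ) • ((2 * Complex.I) • (τ.1.map Complex.im).map Complex.ofReal) := by
      rw [← h2, hP]
      simp only [Matrix.conjTranspose_mul]
      noncomm_ring
    rw [hWH, Matrix.mul_smul, Matrix.smul_mul, smul_comm] at h4
    exact smul_right_injective _ (by simp : (2 * Complex.I) ≠ 0) h4
  refine Matrix.PosDef.of_dotProduct_mulVec_pos ?_ ?_
  · ext i j
    simp [hWs i j]
  · intro x hx
    set X : Fin 2 → ℂ := fun i => (x i : ℂ) with hX
    set u := (denom g τ)⁻¹ *ᵥ X with hu
    have hXu : X = denom g τ *ᵥ u := by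
      rw [hu, Matrix.mulVec_mulVec, Matrix.mul_nonsing_inv _ hQ, Matrix.one_mulVec]
    have hX0 : X ≠ 0 := by
      intro h
      apply hx
      ext i
      simpa [hX] using congrFun h i
    have hu0 : u ≠ 0 := by
      intro h
      exact hX0 (by rw [hXu, h, Matrix.mulVec_zero])
    have hpos := (posDef_map_ofReal τ.2.2).dotProduct_mulVec_pos hu0
    have h5 : star X ⬝ᵥ ((W.map Complex.im).map Complex.ofReal *ᵥ X)
        = (ν : ℂ) * (star u ⬝ᵥ ((τ.1.map Complex.im).map Complex.ofReal *ᵥ u)) := by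
      rw [hXu, Matrix.star_mulVec, ← Matrix.dotProduct_mulVec, Matrix.mulVec_mulVec,
        Matrix.mulVec_mulVec, h3, Matrix.smul_mulVec, dotProduct_smul,
        smul_eq_mul]
    have h6 : star X ⬝ᵥ ((W.map Complex.im).map Complex.ofReal *ᵥ X)
        = ((star x ⬝ᵥ (W.map Complex.im *ᵥ x) : ℝ) : ℂ) := by
      simp [hX, dotProduct, mulVec]
    have h7 : (0 : ℂ) < ((star x ⬝ᵥ (W.map Complex.im *ᵥ x) : ℝ) : ℂ) := by
      rw [← h6, h5]
      exact mul_pos (by exact_mod_cast hν) hpos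
    exact_mod_cast h7

/-- `g ∘ τ = (A τ + B)(C τ + D)⁻¹`. -/
def moebius (g : GSpPos) (τ : H2) : H2 :=
  ⟨numer g τ * (denom g τ)⁻¹, numer_mul_inv_mem g τ⟩

/-- `(f | g)(τ) = (det g)^{k/2} det(C τ + D)^{-k} f(g ∘ τ)`. -/
def slash (k : ℕ) (f : H2 → ℂ) (g : GSpPos) : H2 → ℂ := fun τ =>
  ((g.1.1.det ^ ((k : ℝ) / 2) : ℝ) : ℂ) * (denom g τ).det ^ (-(k : ℤ)) * f (moebius g τ)

/-! ### Dirichlet characters -/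

/-- The component `χ_d`, a character modulo `d`, of a character `χ` modulo `N`, for `d` a divisor
of `N` coprime to `N / d`: `χ_d(a) = χ(b)` where `b ≡ a (mod d)` and `b ≡ 1 (mod N / d)`.
(For other `d` the value is the trivial character.) -/
def component {N : ℕ} (χ : DirichletCharacter ℂ N) (d : ℕ) : DirichletCharacter ℂ d :=
  if h : N = d * (N / d) ∧ d.Coprime (N / d) then
    MulChar.ofUnitHom (χ.toUnitHom.comp
      ((Units.map (((ZMod.ringEquivCongr h.1).trans (ZMod.chineseRemainder h.2)).symm :
          ZMod d × ZMod (N / d) →* ZMod N)).comp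
        ((MulEquiv.prodUnits (M := ZMod d) (N := ZMod (N / d))).symm.toMonoidHom.comp
          (MonoidHom.inl (ZMod d)ˣ (ZMod (N / d))ˣ))))
  else 1

/-- The value `χ_d(n)`. -/
def chi {N : ℕ} (χ : DirichletCharacter ℂ N) (d n : ℕ) : ℂ := component χ d (n : ZMod d)

/-! ### Eisenstein series -/

/-- `Γ_∞ \ Sp₂(ℤ)`. -/
abbrev InfCosets : Type := Quotient (QuotientGroup.rightRel GammaInf)

/-- The orbit of the coset `Γ_∞ γ₀` under right multiplication by `Γ₀(N)`. -/
def cuspOrbit (N : ℕ) (γ₀ : Sp) : Set InfCosets :=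
  Set.range fun γ : Gamma0 N => (Quotient.mk _ (γ₀ * γ) : InfCosets)

/-- `(1 | γ)(τ) = det(C τ + D)^{-k}`. -/
def oneSlash (k : ℕ) (γ : Sp) (τ : H2) : ℂ :=
  ((blockC γ).map (Int.cast : ℤ → ℂ) * τ.1 + (blockD γ).map (Int.cast : ℤ → ℂ)).det ^ (-(k : ℤ))

/-- The Eisenstein series `E_{γ₀}(τ) = ∑ conj χ(det D_γ) (1 | γ₀ γ)(τ)`, where `Γ_∞ γ₀ γ`, with
`γ ∈ Γ₀(N)`, runs over the `Γ₀(N)`-orbit of `Γ_∞ γ₀`. -/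
def eisenstein {N : ℕ} (k : ℕ) (χ : DirichletCharacter ℂ N) (γ₀ : Sp) : H2 → ℂ := fun τ =>
  ∑' c : cuspOrbit N γ₀,
    conj (χ (((blockD (c.2.choose : Sp)).det : ℤ) : ZMod N)) * oneSlash k (γ₀ * c.2.choose) τ

/-- The condition under which the summands of `E_{γ₀}` depend only on the cosets `Γ_∞ γ₀ γ`:
`χ_q² = 1` for every prime `q ∣ N` with `rank_q M₀ = 1`, where `γ₀ = (* *; M₀ N₀)`. -/
def IsAdmissible {N : ℕ} (χ : DirichletCharacter ℂ N) (γ₀ : Sp) : Prop :=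
  ∀ q : ℕ, q.Prime → q ∣ N →
    ((blockC γ₀).map (Int.cast : ℤ → ZMod q)).rank = 1 → component χ q ^ 2 = 1

/-- The space of degree 2 Siegel Eisenstein series of weight `k`, level `N`, character `χ`. -/
def eisensteinSpace {N : ℕ} (k : ℕ) (χ : DirichletCharacter ℂ N) : Submodule ℂ (H2 → ℂ) :=
  Submodule.span ℂ {f | ∃ γ₀ : Sp, IsAdmissible χ γ₀ ∧ f = eisenstein k χ γ₀}

/-- For pairwise coprime `N₀, N₁, N₂`, an integral diagonal matrix congruent to `0` modulo `N₀`,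
to `diag(1, 0)` modulo `N₁` and to the identity modulo `N₂`. -/
def cuspMatrix (N₀ N₁ N₂ : ℕ) : Matrix (Fin 2) (Fin 2) ℤ :=
  diagonal ![N₀ * Nat.gcdA N₀ (N₁ * N₂), (N₀ * N₁ : ℕ) * Nat.gcdA (N₀ * N₁) N₂]

theorem cuspMatrix_congr {N₀ N₁ N₂ : ℕ} (h : Squarefree (N₀ * N₁ * N₂)) :
    (∀ i j, (N₀ : ℤ) ∣ cuspMatrix N₀ N₁ N₂ i j) ∧
    (∀ i j, (N₁ : ℤ) ∣ (cuspMatrix N₀ N₁ N₂ - diagonal ![1, 0] : Matrix (Fin 2) (Fin 2) ℤ) i j) ∧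
    (∀ i j, (N₂ : ℤ) ∣ (cuspMatrix N₀ N₁ N₂ - 1 : Matrix (Fin 2) (Fin 2) ℤ) i j) := by
  have h1 : Nat.gcd N₀ (N₁ * N₂) = 1 := Nat.coprime_of_squarefree_mul (by rwa [← mul_assoc])
  have h2 : Nat.gcd (N₀ * N₁) N₂ = 1 := Nat.coprime_of_squarefree_mul h
  have e1 := Nat.gcd_eq_gcd_ab N₀ (N₁ * N₂)
  have e2 := Nat.gcd_eq_gcd_ab (N₀ * N₁) N₂
  rw [h1] at e1
  rw [h2] at e2
  push_cast at e1 e2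
  refine ⟨?_, ?_, ?_⟩ <;> intro i j <;> fin_cases i <;> fin_cases j <;>
    simp [cuspMatrix, mul_assoc]
  · exact ⟨-(N₂ * Nat.gcdB N₀ (N₁ * N₂)), by linear_combination -e1⟩
  · exact ⟨N₀ * Nat.gcdA (N₀ * N₁) N₂, by ring⟩
  · exact ⟨-(N₁ * Nat.gcdB N₀ (N₁ * N₂)), by linear_combination -e1⟩
  · exact ⟨-(Nat.gcdB (N₀ * N₁) N₂), by linear_combination -e2⟩

/-- `γ_ρ = (I 0; M_ρ I)` for `ρ = (N₀, N₁, N₂)`. -/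
def cuspRep (N₀ N₁ N₂ : ℕ) : Sp :=
  ⟨fromBlocks 1 0 (cuspMatrix N₀ N₁ N₂) 1,
    SymplecticGroup.fromBlocks_mem_iff.mpr (by simp [cuspMatrix])⟩

/-- `E_ρ` for `ρ = (N₀, N₁, N₂)`. -/
def cuspEisenstein {N : ℕ} (k : ℕ) (χ : DirichletCharacter ℂ N) (N₀ N₁ N₂ : ℕ) : H2 → ℂ :=
  eisenstein k χ (cuspRep N₀ N₁ N₂)

/-- The index set: triples of positive integers with `N₀ N₁ N₂ = N` and `χ_{N₁}² = 1`. -/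
structure CuspIndex {N : ℕ} (χ : DirichletCharacter ℂ N) where
  N₀ : ℕ
  N₁ : ℕ
  N₂ : ℕ
  prod_eq : N₀ * N₁ * N₂ = N
  sq_eq_one : component χ N₁ ^ 2 = 1

/-! ### Hecke operators -/

/-- An invertible diagonal matrix `diag(a₁, a₂, d₁, d₂)` with `a₁ d₁ = a₂ d₂ > 0`. -/
def diagGSp (a d : Fin 2 → ℝ) (ν : ℝ) (hν : 0 < ν) (h : ∀ i, a i * d i = ν) : GSpPos :=
  ⟨GeneralLinearGroup.mkOfDetNeZero (diagonal (Sum.elim a d)) (by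
      rw [det_diagonal, Fintype.prod_sum_type]
      simp only [Sum.elim_inl, Sum.elim_inr]
      rw [← Finset.prod_mul_distrib]
      simp [h, hν.ne']), ν, hν, by
      ext i j
      rcases i with i | i <;> rcases j with j | j <;>
        simp [GeneralLinearGroup.mkOfDetNeZero, J, Matrix.one_apply]
      · split_ifs with hij
        · rw [← hij, h]
        · rfl
      · split_ifs with hij
        · rw [← hij, mul_comm, h]
        · rfl⟩

/-- `δ = diag(p, p, 1, 1)`. -/
def heckeDelta (p : ℕ) (hp : p.Prime) : GSpPos :=
  diagGSp ![p, p] ![1, 1] p (by exact_mod_cast hp.pos) (by intro i; fin_cases i <;> simp)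

/-- `δ₁ = diag(p, 1, 1/p, 1)`. -/
def heckeDelta₁ (p : ℕ) (hp : p.Prime) : GSpPos :=
  diagGSp ![p, 1] ![(p : ℝ)⁻¹, 1] 1 one_pos
    (by have : (p : ℝ) ≠ 0 := by exact_mod_cast hp.ne_zero
        intro i; fin_cases i <;> simp [this])

/-- `δ Γ₀(N) δ⁻¹ ∩ Γ₀(N)`, as a subgroup of `Γ₀(N)`. -/
def heckeSubgroup (N : ℕ) (δ : GSpPos) : Subgroup (Gamma0 N) :=
  ((((Gamma0 N).map toGSpPos).map (MulAut.conj δ).toMonoidHom).comap toGSpPos).subgroupOf (Gamma0 N)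

/-- `f ↦ p^{k-3} ∑_γ conj χ(det D_γ) f | δ⁻¹ γ`, with `γ` running over representatives of
`(δ Γ₀(N) δ⁻¹ ∩ Γ₀(N)) \ Γ₀(N)`. -/
def heckeOp {N : ℕ} (k : ℕ) (χ : DirichletCharacter ℂ N) (p : ℕ) (δ : GSpPos) (f : H2 → ℂ) :
    H2 → ℂ := fun τ =>
  (p : ℂ) ^ ((k : ℤ) - 3) *
    ∑ᶠ c : Quotient (QuotientGroup.rightRel (heckeSubgroup N δ)),
      conj (χ (((blockD (c.out : Sp)).det : ℤ) : ZMod N)) *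
        slash k f (δ⁻¹ * toGSpPos (c.out : Sp)) τ

/-- `f | T(p)`. -/
def heckeT {N : ℕ} (k : ℕ) (χ : DirichletCharacter ℂ N) (p : ℕ) (hp : p.Prime) (f : H2 → ℂ) :
    H2 → ℂ :=
  heckeOp k χ p (heckeDelta p hp) f

/-- `f | T₁(p²)`. -/
def heckeT₁ {N : ℕ} (k : ℕ) (χ : DirichletCharacter ℂ N) (p : ℕ) (hp : p.Prime) (f : H2 → ℂ) :
    H2 → ℂ :=
  heckeOp k χ p (heckeDelta₁ p hp) f

/-! ### The eigenforms and their eigenvalues -/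

open Classical in
/-- `a_ρ(q)`, for a prime `q ∣ N₀`. -/
def coeffA {N : ℕ} (k : ℕ) (χ : DirichletCharacter ℂ N) (ρ : CuspIndex χ) (q : ℕ) : ℂ :=
  if component χ q = 1 then
    -(chi χ (ρ.N₁ * ρ.N₂) q * (q : ℂ)⁻¹ * ((q : ℂ) - 1)) /
      (chi χ (ρ.N₀ / q) q * (q : ℂ) ^ ((k : ℤ) - 1) - chi χ (ρ.N₁ * ρ.N₂) q)
  else 0

open Classical in
/-- `b_ρ(q)`, for a prime `q ∣ N₀`; `jacobiSym (-1) q` is the Legendre symbol of `-1` modulo the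
prime `q`, which is odd in the case where it occurs. -/
def coeffB {N : ℕ} (k : ℕ) (χ : DirichletCharacter ℂ N) (ρ : CuspIndex χ) (q : ℕ) : ℂ :=
  if component χ q = 1 then
    -(chi χ ρ.N₂ (q ^ 2) * (q : ℂ)⁻¹ * ((q : ℂ) - 1) *
        (chi χ (ρ.N₀ / q) q * (q : ℂ) ^ ((k : ℤ) - 3) - chi χ (ρ.N₁ * ρ.N₂) q)) /
      ((chi χ (ρ.N₀ / q) q * (q : ℂ) ^ ((k : ℤ) - 1) - chi χ (ρ.N₁ * ρ.N₂) q) *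
        (chi χ (ρ.N₀ / q) (q ^ 2) * (q : ℂ) ^ (2 * (k : ℤ) - 3) - chi χ ρ.N₂ (q ^ 2)))
  else if component χ q ^ 2 = 1 then
    -((jacobiSym (-1) q : ℂ) * chi χ ρ.N₂ (q ^ 2) * (q : ℂ) ^ (-2 : ℤ) * ((q : ℂ) - 1)) /
      (chi χ (ρ.N₀ / q) (q ^ 2) * (q : ℂ) ^ (2 * (k : ℤ) - 3) - chi χ ρ.N₂ (q ^ 2))
  else 0

open Classical in
/-- `c_ρ(q)`, for a prime `q ∣ N₁`. -/
def coeffC {N : ℕ} (k : ℕ) (χ : DirichletCharacter ℂ N) (ρ : CuspIndex χ) (q : ℕ) : ℂ :=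
  if component χ q = 1 then
    -(chi χ ρ.N₂ q * (q : ℂ) ^ (-2 : ℤ) * ((q : ℂ) ^ 2 - 1)) /
      (chi χ (ρ.N₀ * (ρ.N₁ / q)) q * (q : ℂ) ^ ((k : ℤ) - 2) - chi χ ρ.N₂ q)
  else 0

/-- The eigenform attached to `ρ = (N₀, N₁, N₂)`:
`∑ a_ρ(Q₀) b_ρ(Q₀') c_ρ(Q₁) E_{(N₀/(Q₀Q₀'), Q₀N₁/Q₁, Q₀'Q₁N₂)}` over `Q₀Q₀' ∣ N₀`, `Q₁ ∣ N₁`, the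
coefficients being extended multiplicatively from primes. -/
def eigenform {N : ℕ} (k : ℕ) (χ : DirichletCharacter ℂ N) (ρ : CuspIndex χ) : H2 → ℂ :=
  ∑ Q₀ ∈ ρ.N₀.divisors, ∑ Q₀' ∈ (ρ.N₀ / Q₀).divisors, ∑ Q₁ ∈ ρ.N₁.divisors,
    ((∏ q ∈ Q₀.primeFactors, coeffA k χ ρ q) * (∏ q ∈ Q₀'.primeFactors, coeffB k χ ρ q) *
      (∏ q ∈ Q₁.primeFactors, coeffC k χ ρ q)) •
      cuspEisenstein k χ (ρ.N₀ / (Q₀ * Q₀')) (Q₀ * (ρ.N₁ / Q₁)) (Q₀' * Q₁ * ρ.N₂)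

/-- `λ(p)`. -/
def eigenvalueT {N : ℕ} (k : ℕ) (χ : DirichletCharacter ℂ N) (ρ : CuspIndex χ) (p : ℕ) : ℂ :=
  if p ∣ ρ.N₂ then
    chi χ ρ.N₀ (p ^ 2) * chi χ ρ.N₁ p * (p : ℂ) ^ (2 * (k : ℤ) - 3)
  else if p ∣ ρ.N₁ then
    chi χ (ρ.N₀ * ρ.N₂) p * (p : ℂ) ^ ((k : ℤ) - 1)
  else if p ∣ ρ.N₀ then
    chi χ ρ.N₁ p * chi χ ρ.N₂ (p ^ 2)
  else
    (chi χ (ρ.N₀ * ρ.N₁) p * (p : ℂ) ^ ((k : ℤ) - 1) + chi χ ρ.N₂ p) *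
      (chi χ ρ.N₀ p * (p : ℂ) ^ ((k : ℤ) - 2) + chi χ (ρ.N₁ * ρ.N₂) p)

/-- `λ₁(p²)`. -/
def eigenvalueT₁ {N : ℕ} (k : ℕ) (χ : DirichletCharacter ℂ N) (ρ : CuspIndex χ) (p : ℕ) : ℂ :=
  if p ∣ ρ.N₂ then
    chi χ ρ.N₀ (p ^ 2) * ((p : ℂ) + 1) * (p : ℂ) ^ (2 * (k : ℤ) - 3)
  else if p ∣ ρ.N₁ then
    chi χ ρ.N₀ (p ^ 2) * (p : ℂ) ^ (2 * (k : ℤ) - 2) + chi χ ρ.N₂ (p ^ 2) * (p : ℂ)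
  else if p ∣ ρ.N₀ then
    chi χ ρ.N₂ (p ^ 2) * ((p : ℂ) + 1)
  else
    ((p : ℂ) + 1) * (chi χ ρ.N₀ (p ^ 2) * (p : ℂ) ^ (2 * (k : ℤ) - 3) +
      χ (p : ZMod N) * (p : ℂ) ^ ((k : ℤ) - 3) * ((p : ℂ) - 1) + chi χ ρ.N₂ (p ^ 2))

end

end SiegelEisenstein

open SiegelEisenstein

/-! A coset of `GammaInf` in `Sp` is a Lagrangian plane, and up to sign it is a primitive integral
vector of five Plücker coordinates on a quadric. In these coordinates `det (C τ + D)` is a linear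
form and right multiplication acts linearly. An Eisenstein series is thus a sum over such vectors
`v` of `f v` times the `-k`-th power of a linear form. By `exists_diagCusp_orbit` the orbits of
`Gamma0 N` are classified by the ranks of `C` modulo the primes `q ∣ N`. Hence the series of a
triple belongs to a product over `q` of local functions `loc₀`, `loc₁`, `loc₂`
(`cuspEisenstein_eq`), and the eigenform of `ρ` belongs to a product of local linear combinations
`eigenFam` (`eigenform_eq`): expanding this product gives the sum over `Q₀`, `Q₀'`, `Q₁`.

A Hecke operator replaces a section on `GSpPos` by a finite sum of its right translates
(`heckeOp_sectionSum`), so an eigenvalue equation need only be checked at one diagonal cusp in each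
orbit (`heckeOp_eq_smul`). There every summand factors over the primes. If `p ^ a` is the power of
`p` extracted from the translated Plücker vector, a prime `q ≠ p` contributes just a power of
`χ_q(p)` that depends on `a` and on the rank at `q`. The coefficients of `eigenFam` are nonzero only
at ranks where this power is the same as at the rank of `ρ` (`eigenFam_twist`), so the primes `q ≠
p` together contribute a factor depending on `a` alone. What remains at `p` is a count weighted by
character sums. For `p ∣ N` it is a triangular system in the three ranks (`heckeT_eigen_of_dvd`,
`heckeT₁_eigen_of_dvd`): its diagonal gives the eigenvalues, and its eigenvectors have the entries
`a_ρ(p)`, `b_ρ(p)`, `c_ρ(p)`. For `p ∤ N` it is a count of cosets according to `a`.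

Absolute convergence for `k ≥ 4` comes from counting integral points on the quadric
(`summable_quadric`). Letting `τ = i y` go to infinity, after a translation by `Sp`, recovers the
value of `f` at any cusp (`tendsto_sectionSum`, `eq_zero_of_plSum_eq_zero`). Since `eigenFam` is
unitriangular with respect to the ranks, the eigenforms are linearly independent, and their number
bounds the dimension of the space from above. -/

namespace SiegelEisenstein

noncomputable section

/-! ### Plücker coordinates of Lagrangian planes -/

section Plucker

variable {R S : Type*} [CommRing R] [CommRing S]

/-- The Plücker coordinates `(det C, adj(C) D, det D)` of a Lagrangian pair `(C D)`; the middle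
block is symmetric and contributes three coordinates. -/
def plucker (C D : Matrix (Fin 2) (Fin 2) R) : Fin 5 → R :=
  ![C 0 0 * C 1 1 - C 0 1 * C 1 0, C 1 1 * D 0 0 - C 0 1 * D 1 0,
    C 1 1 * D 0 1 - C 0 1 * D 1 1, C 0 0 * D 1 1 - C 1 0 * D 0 1,
    D 0 0 * D 1 1 - D 0 1 * D 1 0]

/-- The quadric satisfied by the Plücker coordinates. -/
def OnQuadric (v : Fin 5 → R) : Prop := v 1 * v 3 - v 2 ^ 2 = v 0 * v 4

/-- A row of the middle block of `act`. -/
def actRow (x y z w : R) (B D : Matrix (Fin 2) (Fin 2) R) (v : Fin 5 → R) (j : Fin 2) : R :=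
  v 0 * (x * B 0 j + y * B 1 j) + (x * v 1 + y * v 2) * D 0 j + (x * v 2 + y * v 3) * D 1 j
    + (z * v 3 - w * v 2) * B 0 j + (w * v 1 - z * v 2) * B 1 j + v 4 * (z * D 0 j + w * D 1 j)

/-- An outer coordinate of `act`. -/
def actDet (A C : Matrix (Fin 2) (Fin 2) R) (v : Fin 5 → R) : R :=
  v 0 * (A 0 0 * A 1 1 - A 0 1 * A 1 0) + C 0 0 * (A 1 1 * v 1 - A 0 1 * v 2)
    + C 0 1 * (A 0 0 * v 2 - A 1 0 * v 1) + C 1 0 * (A 1 1 * v 2 - A 0 1 * v 3)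
    + C 1 1 * (A 0 0 * v 3 - A 1 0 * v 2) + v 4 * (C 0 0 * C 1 1 - C 0 1 * C 1 0)

/-- The action on Plücker coordinates of right multiplication by `(A B; C D)`. -/
def act (A B C D : Matrix (Fin 2) (Fin 2) R) (v : Fin 5 → R) : Fin 5 → R :=
  ![actDet A C v, actRow (A 1 1) (-A 0 1) (C 1 1) (-C 0 1) B D v 0,
    actRow (A 1 1) (-A 0 1) (C 1 1) (-C 0 1) B D v 1,
    actRow (-A 1 0) (A 0 0) (-C 1 0) (C 0 0) B D v 1, actDet B D v]

theorem isotropic_entry {C D : Matrix (Fin 2) (Fin 2) R} (h : C * Dᵀ = D * Cᵀ) :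
    C 0 0 * D 1 0 + C 0 1 * D 1 1 = D 0 0 * C 1 0 + D 0 1 * C 1 1 := by
  simpa [Matrix.mul_apply, Fin.sum_univ_two] using congrFun (congrFun h 0) 1

/-- This is `det (adj(C) D) = det C · det D`, with `adj(C) D` symmetric by isotropy. -/
theorem plucker_onQuadric {C D : Matrix (Fin 2) (Fin 2) R} (h : C * Dᵀ = D * Cᵀ) :
    OnQuadric (plucker C D) := by
  have h := isotropic_entry h
  simp only [OnQuadric, plucker, Matrix.cons_val]
  linear_combination (C 1 1 * D 0 1 - C 0 1 * D 1 1) * h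

/-- The six minors of order two of `(C D)` transform linearly, by the exterior square. Isotropy
makes `adj(C) D` symmetric, so two of the minors agree up to sign and five coordinates suffice; each
identity holds modulo that one relation. -/
theorem plucker_mul {C D : Matrix (Fin 2) (Fin 2) R} (h : C * Dᵀ = D * Cᵀ)
    (A' B' C' D' : Matrix (Fin 2) (Fin 2) R) :
    plucker (C * A' + D * C') (C * B' + D * D') = act A' B' C' D' (plucker C D) := by
  have h := isotropic_entry h
  ext i
  fin_cases i <;>
    simp only [act, actRow, actDet, plucker, Matrix.mul_apply, Matrix.add_apply, Fin.sum_univ_two,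
      Matrix.cons_val, Fin.zero_eta, Fin.mk_one, Fin.reduceFinMk]
  · linear_combination (C' 0 1 * A' 0 0 - C' 0 0 * A' 0 1) * h
  · linear_combination (-A' 0 1 * D' 0 0 + C' 0 1 * B' 0 0) * h
  · linear_combination (-A' 0 1 * D' 0 1 + C' 0 1 * B' 0 1) * h
  · linear_combination (A' 0 0 * D' 0 1 - C' 0 0 * B' 0 1) * h
  · linear_combination (D' 0 1 * B' 0 0 - D' 0 0 * B' 0 1) * h

theorem plucker_mul_left (P C D : Matrix (Fin 2) (Fin 2) R) :
    plucker (P * C) (P * D) = P.det • plucker C D := by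
  ext i
  fin_cases i <;>
    simp [plucker, Matrix.mul_apply, Fin.sum_univ_two, Matrix.det_fin_two] <;> ring

theorem plucker_map (f : R →+* S) (C D : Matrix (Fin 2) (Fin 2) R) :
    plucker (C.map f) (D.map f) = fun i => f (plucker C D i) := by
  ext i
  fin_cases i <;> simp [plucker]

theorem act_map (f : R →+* S) (A B C D : Matrix (Fin 2) (Fin 2) R) (v : Fin 5 → R) :
    act (A.map f) (B.map f) (C.map f) (D.map f) (fun i => f (v i))
      = fun i => f (act A B C D v i) := by
  ext i
  fin_cases i <;> simp [act, actRow, actDet]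

end Plucker

end

end SiegelEisenstein

namespace SiegelEisenstein

noncomputable section

/-! ### Blocks of symplectic similitudes -/

section Blocks

variable {R : Type*} [CommRing R]

theorem toBlocks₁₁_mul (g h : Matrix (Fin 2 ⊕ Fin 2) (Fin 2 ⊕ Fin 2) R) :
    (g * h).toBlocks₁₁ = g.toBlocks₁₁ * h.toBlocks₁₁ + g.toBlocks₁₂ * h.toBlocks₂₁ := by
  ext i j
  simp [toBlocks₂₁, toBlocks₁₂, toBlocks₁₁, Matrix.mul_apply, Fintype.sum_sum_type]

theorem toBlocks₁₂_mul (g h : Matrix (Fin 2 ⊕ Fin 2) (Fin 2 ⊕ Fin 2) R) :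
    (g * h).toBlocks₁₂ = g.toBlocks₁₁ * h.toBlocks₁₂ + g.toBlocks₁₂ * h.toBlocks₂₂ := by
  ext i j
  simp [toBlocks₂₂, toBlocks₁₂, toBlocks₁₁, Matrix.mul_apply, Fintype.sum_sum_type]

theorem toBlocks₂₁_mul (g h : Matrix (Fin 2 ⊕ Fin 2) (Fin 2 ⊕ Fin 2) R) :
    (g * h).toBlocks₂₁ = g.toBlocks₂₁ * h.toBlocks₁₁ + g.toBlocks₂₂ * h.toBlocks₂₁ := by
  ext i j
  simp [toBlocks₂₁, toBlocks₂₂, toBlocks₁₁, Matrix.mul_apply, Fintype.sum_sum_type]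

theorem toBlocks₂₂_mul (g h : Matrix (Fin 2 ⊕ Fin 2) (Fin 2 ⊕ Fin 2) R) :
    (g * h).toBlocks₂₂ = g.toBlocks₂₁ * h.toBlocks₁₂ + g.toBlocks₂₂ * h.toBlocks₂₂ := by
  ext i j
  simp [toBlocks₂₁, toBlocks₂₂, toBlocks₁₂, Matrix.mul_apply, Fintype.sum_sum_type]

theorem blocks_of_similitude {g : Matrix (Fin 2 ⊕ Fin 2) (Fin 2 ⊕ Fin 2) R} {ν : R}
    (hg : g * J (Fin 2) R * gᵀ = ν • J (Fin 2) R) :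
    g.toBlocks₁₁ * g.toBlocks₁₂ᵀ = g.toBlocks₁₂ * g.toBlocks₁₁ᵀ ∧
    g.toBlocks₂₁ * g.toBlocks₂₂ᵀ = g.toBlocks₂₂ * g.toBlocks₂₁ᵀ ∧
    g.toBlocks₁₁ * g.toBlocks₂₂ᵀ - g.toBlocks₁₂ * g.toBlocks₂₁ᵀ = ν • 1 := by
  rw [← fromBlocks_toBlocks g] at hg
  simp only [J, fromBlocks_transpose, fromBlocks_multiply, fromBlocks_smul] at hg
  obtain ⟨e₁, e₂, e₃, e₄⟩ := fromBlocks_inj.mp hg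
  simp at e₁ e₂ e₃ e₄
  refine ⟨?_, ?_, ?_⟩
  · exact (sub_eq_zero.mp (by rw [← e₁]; abel)).symm
  · exact (sub_eq_zero.mp (by rw [← e₄]; abel)).symm
  · rw [← neg_inj, ← e₂]; abel

end Blocks

/-- The upper left block of `γ = (A B; C D)`. -/
def blockA (γ : Sp) : Matrix (Fin 2) (Fin 2) ℤ := γ.1.toBlocks₁₁

/-- The upper right block of `γ = (A B; C D)`. -/
def blockB (γ : Sp) : Matrix (Fin 2) (Fin 2) ℤ := γ.1.toBlocks₁₂

theorem blockA_mul (γ γ' : Sp) :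
    blockA (γ * γ') = blockA γ * blockA γ' + blockB γ * blockC γ' := toBlocks₁₁_mul _ _

theorem blockB_mul (γ γ' : Sp) :
    blockB (γ * γ') = blockA γ * blockB γ' + blockB γ * blockD γ' := toBlocks₁₂_mul _ _

theorem blockC_mul' (γ γ' : Sp) :
    blockC (γ * γ') = blockC γ * blockA γ' + blockD γ * blockC γ' := toBlocks₂₁_mul _ _

theorem blockD_mul (γ γ' : Sp) :
    blockD (γ * γ') = blockC γ * blockB γ' + blockD γ * blockD γ' := toBlocks₂₂_mul _ _

theorem Sp_relations (γ : Sp) :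
    blockA γ * (blockB γ)ᵀ = blockB γ * (blockA γ)ᵀ ∧
    blockC γ * (blockD γ)ᵀ = blockD γ * (blockC γ)ᵀ ∧
    blockA γ * (blockD γ)ᵀ - blockB γ * (blockC γ)ᵀ = 1 := by
  have := blocks_of_similitude (g := γ.1) (ν := 1)
    (by rw [one_smul]; exact SymplecticGroup.mem_iff.mp γ.2)
  rw [one_smul] at this
  exact this

theorem Sp_relations' (γ : Sp) :
    (blockA γ)ᵀ * blockC γ = (blockC γ)ᵀ * blockA γ ∧
    (blockB γ)ᵀ * blockD γ = (blockD γ)ᵀ * blockB γ ∧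
    (blockA γ)ᵀ * blockD γ - (blockC γ)ᵀ * blockB γ = 1 := by
  have h : fromBlocks (blockA γ) (blockB γ) (blockC γ) (blockD γ) ∈ symplecticGroup (Fin 2) ℤ := by
    have := γ.2
    rwa [← fromBlocks_toBlocks γ.1] at this
  exact SymplecticGroup.fromBlocks_mem_iff.mp h

theorem Sp_inv_val (γ : Sp) : (γ⁻¹ : Sp).1 =
    fromBlocks (blockD γ)ᵀ (-(blockB γ)ᵀ) (-(blockC γ)ᵀ) (blockA γ)ᵀ := by
  have h : ((γ⁻¹ : Sp) : Matrix _ _ ℤ) = (-J (Fin 2) ℤ) * (γ : Matrix _ _ ℤ)ᵀ * J (Fin 2) ℤ :=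
    SymplecticGroup.coe_inv γ
  rw [h]
  conv_lhs => rw [← fromBlocks_toBlocks γ.1]
  simp [J, fromBlocks_transpose, fromBlocks_multiply, fromBlocks_neg, blockA, blockB, blockC,
    blockD]

theorem blockA_inv (γ : Sp) : blockA γ⁻¹ = (blockD γ)ᵀ := by
  rw [blockA, Sp_inv_val, toBlocks_fromBlocks₁₁]

theorem blockB_inv (γ : Sp) : blockB γ⁻¹ = -(blockB γ)ᵀ := by
  rw [blockB, Sp_inv_val, toBlocks_fromBlocks₁₂]

theorem blockD_inv (γ : Sp) : blockD γ⁻¹ = (blockA γ)ᵀ := by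
  rw [blockD, Sp_inv_val, toBlocks_fromBlocks₂₂]

theorem GSp_relations (g : GSpPos) : ∃ ν : ℝ, 0 < ν ∧
    g.1.1.toBlocks₂₁ * g.1.1.toBlocks₂₂ᵀ = g.1.1.toBlocks₂₂ * g.1.1.toBlocks₂₁ᵀ ∧
    g.1.1.toBlocks₁₁ * g.1.1.toBlocks₂₂ᵀ - g.1.1.toBlocks₁₂ * g.1.1.toBlocks₂₁ᵀ = ν • 1 := by
  obtain ⟨ν, hν, h⟩ := g.2
  exact ⟨ν, hν, (blocks_of_similitude h).2⟩

theorem GSp_mul_val (g h : GSpPos) : (g * h).1.1 = g.1.1 * h.1.1 := rfl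

theorem toGSpPos_val (γ : Sp) : (toGSpPos γ).1.1 = γ.1.map (Int.cast : ℤ → ℝ) := rfl

theorem toGSpPos_block₂₁ (γ : Sp) :
    (toGSpPos γ).1.1.toBlocks₂₁ = (blockC γ).map (Int.cast : ℤ → ℝ) := rfl

theorem toGSpPos_block₂₂ (γ : Sp) :
    (toGSpPos γ).1.1.toBlocks₂₂ = (blockD γ).map (Int.cast : ℤ → ℝ) := rfl

theorem toGSpPos_block₁₁ (γ : Sp) :
    (toGSpPos γ).1.1.toBlocks₁₁ = (blockA γ).map (Int.cast : ℤ → ℝ) := rfl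

theorem toGSpPos_block₁₂ (γ : Sp) :
    (toGSpPos γ).1.1.toBlocks₁₂ = (blockB γ).map (Int.cast : ℤ → ℝ) := rfl

theorem det_toGSpPos (γ : Sp) : (toGSpPos γ).1.1.det = 1 := by
  have h : (toGSpPos γ).1.1.det = ((γ.1.det : ℤ) : ℝ) := by
    rw [toGSpPos_val]
    exact (Int.cast_det (R := ℝ) γ.1).symm
  rw [h, SymplecticGroup.det_eq_one γ.2, Int.cast_one]

/-! ### The Siegel parabolic -/

/-- The Siegel parabolic of `GSp₂⁺(ℝ)`: the elements with `C = 0`. -/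
def Parabolic : Subgroup GSpPos where
  carrier := {g | g.1.1.toBlocks₂₁ = 0}
  one_mem' := by
    ext i j
    simp [toBlocks₂₁]
  mul_mem' := by
    intro a b ha hb
    have ha : a.1.1.toBlocks₂₁ = 0 := ha
    have hb : b.1.1.toBlocks₂₁ = 0 := hb
    change (a * b).1.1.toBlocks₂₁ = 0
    rw [GSp_mul_val, toBlocks₂₁_mul, ha, hb]
    simp
  inv_mem' := by
    intro a ha
    have ha : a.1.1.toBlocks₂₁ = 0 := ha
    change (a⁻¹).1.1.toBlocks₂₁ = 0
    obtain ⟨ν, hν, -, h⟩ := GSp_relations a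
    have h1 : (a⁻¹).1.1 * a.1.1 = 1 := by
      rw [← GSp_mul_val, inv_mul_cancel]; rfl
    have h2 := toBlocks₂₁_mul (a⁻¹).1.1 a.1.1
    have h3 : (1 : Matrix (Fin 2 ⊕ Fin 2) (Fin 2 ⊕ Fin 2) ℝ).toBlocks₂₁ = 0 := by
      ext i j
      simp [toBlocks₂₁]
    rw [h1, ha, h3, mul_zero, add_zero] at h2
    rw [ha, transpose_zero, mul_zero, sub_zero] at h
    have h4 : (a⁻¹).1.1.toBlocks₂₁ * (ν • 1) = 0 := by
      rw [← h, ← mul_assoc, ← h2, zero_mul]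
    rw [Matrix.mul_smul, mul_one] at h4
    exact (smul_eq_zero.mp h4).resolve_left hν.ne'

theorem mem_Parabolic {g : GSpPos} : g ∈ Parabolic ↔ g.1.1.toBlocks₂₁ = 0 := Iff.rfl

/-- `det D` for `g = (A B; C D)`. -/
def detD (g : GSpPos) : ℝ := g.1.1.toBlocks₂₂.det

theorem detD_ne_zero {p : GSpPos} (hp : p ∈ Parabolic) : detD p ≠ 0 := by
  obtain ⟨ν, hν, -, h⟩ := GSp_relations p
  rw [mem_Parabolic.mp hp, transpose_zero, mul_zero, sub_zero] at h
  have h1 := congrArg Matrix.det h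
  rw [det_mul, det_transpose] at h1
  intro h0
  rw [detD] at h0
  rw [h0, mul_zero, det_smul, det_one] at h1
  simp at h1
  exact (pow_pos hν 2).ne h1

/-- The Plücker coordinates of the lower half of `g`. -/
def plG (g : GSpPos) : Fin 5 → ℝ := plucker g.1.1.toBlocks₂₁ g.1.1.toBlocks₂₂

/-- The Plücker coordinates of the lower half of `γ ∈ Sp₂(ℤ)`. -/
def plZ (γ : Sp) : Fin 5 → ℤ := plucker (blockC γ) (blockD γ)

theorem plG_toGSpPos (γ : Sp) : plG (toGSpPos γ) = fun i => ((plZ γ i : ℤ) : ℝ) :=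
  plucker_map (Int.castRingHom ℝ) _ _

theorem plG_mul (g h : GSpPos) : plG (g * h) =
    act h.1.1.toBlocks₁₁ h.1.1.toBlocks₁₂ h.1.1.toBlocks₂₁ h.1.1.toBlocks₂₂ (plG g) := by
  obtain ⟨ν, hν, h1, -⟩ := GSp_relations g
  rw [plG, GSp_mul_val, toBlocks₂₁_mul, toBlocks₂₂_mul, plucker_mul h1]
  rfl

theorem plZ_mul (γ γ' : Sp) : plZ (γ * γ') =
    act (blockA γ') (blockB γ') (blockC γ') (blockD γ') (plZ γ) := by
  rw [plZ, blockC_mul', blockD_mul, plucker_mul (Sp_relations γ).2.1]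
  rfl

theorem plZ_onQuadric (γ : Sp) : OnQuadric (plZ γ) := plucker_onQuadric (Sp_relations γ).2.1

theorem plZ_one : plZ 1 = ![0, 0, 0, 0, 1] := by
  ext i
  fin_cases i <;> simp [plZ, plucker, blockC, blockD, toBlocks₂₁, toBlocks₂₂]

theorem lower_mul_of_mem {p : GSpPos} (hp : p ∈ Parabolic) (g : GSpPos) :
    (p * g).1.1.toBlocks₂₁ = p.1.1.toBlocks₂₂ * g.1.1.toBlocks₂₁ ∧
    (p * g).1.1.toBlocks₂₂ = p.1.1.toBlocks₂₂ * g.1.1.toBlocks₂₂ := by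
  rw [GSp_mul_val, toBlocks₂₁_mul, toBlocks₂₂_mul, mem_Parabolic.mp hp]
  simp

/-- The Plücker vector of a coset of `Parabolic` is well defined up to a real scalar, and the scalar
is the factor whose `k`-th power governs a section. -/
theorem plG_parabolic_mul {p : GSpPos} (hp : p ∈ Parabolic) (g : GSpPos) :
    plG (p * g) = detD p • plG g := by
  obtain ⟨h1, h2⟩ := lower_mul_of_mem hp g
  rw [plG, h1, h2, plucker_mul_left]
  rfl

/-! ### The automorphy factor -/

theorem denom_mul (g h : GSpPos) (τ : H2) :
    denom (g * h) τ = denom g (moebius h τ) * denom h τ := by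
  have hm : (moebius h τ).1 * denom h τ = numer h τ :=
    Matrix.nonsing_inv_mul_cancel_right _ _ (isUnit_det_denom h τ)
  have e : ∀ X Y : Matrix (Fin 2) (Fin 2) ℝ, (X * Y).map Complex.ofReal
      = X.map Complex.ofReal * Y.map Complex.ofReal := fun X Y =>
    Matrix.map_mul (f := Complex.ofRealHom)
  have e' : ∀ X Y : Matrix (Fin 2) (Fin 2) ℝ, (X + Y).map Complex.ofReal
      = X.map Complex.ofReal + Y.map Complex.ofReal := fun X Y =>
    Matrix.map_add _ (fun _ _ => Complex.ofReal_add _ _) X Y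
  conv_rhs => rw [denom, add_mul, mul_assoc, hm]
  rw [denom, GSp_mul_val, toBlocks₂₁_mul, toBlocks₂₂_mul, e', e', e, e, e, e, numer, denom]
  noncomm_ring

/-- The linear form `v ↦ det(C τ + D)` on Plücker coordinates. -/
def linForm (τ : H2) (v : Fin 5 → ℝ) : ℂ :=
  v 0 * (τ.1 0 0 * τ.1 1 1 - τ.1 0 1 ^ 2) + v 1 * τ.1 1 1 - 2 * v 2 * τ.1 0 1 + v 3 * τ.1 0 0 + v 4

/-- The coefficient of the off-diagonal entry of `τ` is a sum of two minors that are equal by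
isotropy, whence the factor `2` in `linForm`. -/
theorem det_denom (g : GSpPos) (τ : H2) : (denom g τ).det = linForm τ (plG g) := by
  obtain ⟨ν, hν, h, -⟩ := GSp_relations g
  have h := isotropic_entry h
  have hs : τ.1 1 0 = τ.1 0 1 := τ.2.1.apply 0 1
  have h := congrArg (fun x : ℝ => (x : ℂ)) h
  push_cast at h
  simp only [denom, linForm, plG, plucker, Matrix.det_fin_two, Matrix.add_apply, Matrix.mul_apply,
    Fin.sum_univ_two, Matrix.map_apply, hs, Matrix.cons_val]
  push_cast
  linear_combination (-τ.1 0 1) * h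

theorem oneSlash_eq (k : ℕ) (γ : Sp) (τ : H2) :
    oneSlash k γ τ = (denom (toGSpPos γ) τ).det ^ (-(k : ℤ)) := by
  rw [oneSlash, denom, toGSpPos_block₂₁, toGSpPos_block₂₂]
  have e : ∀ X : Matrix (Fin 2) (Fin 2) ℤ, (X.map (Int.cast : ℤ → ℝ)).map Complex.ofReal
      = X.map (Int.cast : ℤ → ℂ) := by
    intro X
    ext i j
    simp
  rw [e, e]

end

end SiegelEisenstein

namespace SiegelEisenstein

noncomputable section

/-! ### Some elements of `Sp₂(ℤ)` -/

/-- The product embedding of `SL₂ × SL₂`. -/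
def spPair (x y z w : Fin 2 → ℤ) (h : ∀ i, x i * w i - y i * z i = 1) : Sp :=
  ⟨fromBlocks (diagonal x) (diagonal y) (diagonal z) (diagonal w),
    SymplecticGroup.fromBlocks_mem_iff.mpr (by
      refine ⟨?_, ?_, ?_⟩
      · simp [mul_comm]
      · simp [mul_comm]
      · ext i j
        have := h i
        rcases eq_or_ne i j with rfl | hij
        · simp; linear_combination this
        · simp [hij])⟩

/-- The Levi element `(U 0; 0 ᵗU⁻¹)`. -/
def spLevi (U : Matrix (Fin 2) (Fin 2) ℤ) (h : U.det = 1) : Sp :=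
  ⟨fromBlocks U 0 0 U.adjugateᵀ,
    SymplecticGroup.fromBlocks_mem_iff.mpr (by
      refine ⟨by simp, by simp, ?_⟩
      rw [← transpose_mul, adjugate_mul, h]
      simp)⟩

/-- The unipotent element `(1 Y; 0 1)`. -/
def spUpper (Y : Matrix (Fin 2) (Fin 2) ℤ) (h : Yᵀ = Y) : Sp :=
  ⟨fromBlocks 1 Y 0 1, SymplecticGroup.fromBlocks_mem_iff.mpr (by simp [h])⟩

/-- The unipotent element `(1 0; M 1)`. -/
def spLower (M : Matrix (Fin 2) (Fin 2) ℤ) (h : Mᵀ = M) : Sp :=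
  ⟨fromBlocks 1 0 M 1, SymplecticGroup.fromBlocks_mem_iff.mpr (by simp [h])⟩

section
variable (x y z w : Fin 2 → ℤ) (h : ∀ i, x i * w i - y i * z i = 1)
theorem blockA_spPair : blockA (spPair x y z w h) = diagonal x := toBlocks_fromBlocks₁₁ ..
theorem blockB_spPair : blockB (spPair x y z w h) = diagonal y := toBlocks_fromBlocks₁₂ ..
theorem blockC_spPair : blockC (spPair x y z w h) = diagonal z := toBlocks_fromBlocks₂₁ ..
theorem blockD_spPair : blockD (spPair x y z w h) = diagonal w := toBlocks_fromBlocks₂₂ ..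
end

section
variable (U : Matrix (Fin 2) (Fin 2) ℤ) (h : U.det = 1)
theorem blockA_spLevi : blockA (spLevi U h) = U := toBlocks_fromBlocks₁₁ ..
theorem blockB_spLevi : blockB (spLevi U h) = 0 := toBlocks_fromBlocks₁₂ ..
theorem blockC_spLevi : blockC (spLevi U h) = 0 := toBlocks_fromBlocks₂₁ ..
theorem blockD_spLevi : blockD (spLevi U h) = U.adjugateᵀ := toBlocks_fromBlocks₂₂ ..
end

section
variable (Y : Matrix (Fin 2) (Fin 2) ℤ) (h : Yᵀ = Y)
theorem blockA_spUpper : blockA (spUpper Y h) = 1 := toBlocks_fromBlocks₁₁ ..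
theorem blockB_spUpper : blockB (spUpper Y h) = Y := toBlocks_fromBlocks₁₂ ..
theorem blockC_spUpper : blockC (spUpper Y h) = 0 := toBlocks_fromBlocks₂₁ ..
theorem blockD_spUpper : blockD (spUpper Y h) = 1 := toBlocks_fromBlocks₂₂ ..
theorem blockA_spLower : blockA (spLower Y h) = 1 := toBlocks_fromBlocks₁₁ ..
theorem blockB_spLower : blockB (spLower Y h) = 0 := toBlocks_fromBlocks₁₂ ..
theorem blockC_spLower : blockC (spLower Y h) = Y := toBlocks_fromBlocks₂₁ ..
theorem blockD_spLower : blockD (spLower Y h) = 1 := toBlocks_fromBlocks₂₂ ..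
end

/-! ### The Iwasawa decomposition -/

/-- Euclid's algorithm as a column operation: the primitive vector proportional to `(b, -a)` is
completed to determinant one by the Bézout coefficients. -/
theorem exists_unimodular_kill (a b : ℤ) :
    ∃ x y z w : ℤ, x * w - y * z = 1 ∧ a * x + b * z = 0 := by
  by_cases h : a = 0 ∧ b = 0
  · exact ⟨1, 0, 0, 1, by simp [h.1, h.2]⟩
  · have hg : (Int.gcd a b : ℤ) ≠ 0 := by
      simpa [Int.gcd_eq_zero_iff] using h
    obtain ⟨a', ha⟩ := Int.gcd_dvd_left a b
    obtain ⟨b', hb⟩ := Int.gcd_dvd_right a b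
    have hbez := Int.gcd_eq_gcd_ab a b
    refine ⟨b', Int.gcdA a b, -a', Int.gcdB a b, ?_, ?_⟩
    · apply mul_left_cancel₀ hg
      generalize (Int.gcd a b : ℤ) = g at *
      linear_combination -hbez - Int.gcdB a b * hb - Int.gcdA a b * ha
    · generalize (Int.gcd a b : ℤ) = g at *
      linear_combination b' * ha - a' * hb

theorem isotropic_mul {C D : Matrix (Fin 2) (Fin 2) ℤ} (h : C * Dᵀ = D * Cᵀ) (γ : Sp) :
    (C * blockA γ + D * blockC γ) * (C * blockB γ + D * blockD γ)ᵀ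
      = (C * blockB γ + D * blockD γ) * (C * blockA γ + D * blockC γ)ᵀ := by
  obtain ⟨h1, h2, h3⟩ := Sp_relations γ
  have h4 : blockD γ * (blockA γ)ᵀ - blockC γ * (blockB γ)ᵀ = 1 := by
    simpa using congrArg transpose h3
  rw [← sub_eq_zero] at h h1 h2 ⊢
  simp only [transpose_add, transpose_mul]
  calc _ = C * (blockA γ * (blockB γ)ᵀ - blockB γ * (blockA γ)ᵀ) * Cᵀ
      + C * (blockA γ * (blockD γ)ᵀ - blockB γ * (blockC γ)ᵀ) * Dᵀ
      - D * (blockD γ * (blockA γ)ᵀ - blockC γ * (blockB γ)ᵀ) * Cᵀ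
      + D * (blockC γ * (blockD γ)ᵀ - blockD γ * (blockC γ)ᵀ) * Dᵀ := by noncomm_ring
    _ = 0 := by rw [h1, h2, h3, h4]; simpa using h

theorem exists_kill_of_mul {C D : Matrix (Fin 2) (Fin 2) ℤ} (γ : Sp)
    (h : ∃ γ' : Sp, (C * blockA γ + D * blockC γ) * blockA γ'
      + (C * blockB γ + D * blockD γ) * blockC γ' = 0) :
    ∃ γ' : Sp, C * blockA γ' + D * blockC γ' = 0 := by
  obtain ⟨γ', h⟩ := h
  refine ⟨γ * γ', ?_⟩
  rw [← h, blockA_mul, blockC_mul']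
  noncomm_ring

/-- A Levi element turns the first row of `D` into `(d, 0)` with `d ≠ 0`. Isotropy then forces `C 1
0 = 0`, and the only entry of `C` left is killed by `SL₂` in the second coordinate plane. -/
theorem exists_mul_lower_eq_zero_of_row {C D : Matrix (Fin 2) (Fin 2) ℤ} (h : C * Dᵀ = D * Cᵀ)
    (hC : ∀ j, C 0 j = 0) (hD : D 0 ≠ 0) : ∃ γ : Sp, C * blockA γ + D * blockC γ = 0 := by
  obtain ⟨x, y, z, w, h1, h2⟩ := exists_unimodular_kill (D 0 1) (D 0 0)
  have hU : (!![x, -y; -z, w] : Matrix (Fin 2) (Fin 2) ℤ).det = 1 := by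
    rw [det_fin_two_of]; linear_combination h1
  set γ₁ := spLevi !![x, -y; -z, w] hU with hγ₁
  apply exists_kill_of_mul γ₁
  have hiso := isotropic_entry (isotropic_mul h γ₁)
  have hC' : ∀ j, (C * blockA γ₁ + D * blockC γ₁) 0 j = 0 := by
    intro j
    rw [hγ₁, blockA_spLevi, blockC_spLevi]
    simp [Matrix.mul_apply, hC]
  have hD01 : (C * blockB γ₁ + D * blockD γ₁) 0 1 = 0 := by
    rw [hγ₁, blockB_spLevi, blockD_spLevi]
    simp [Matrix.mul_apply, Fin.sum_univ_two, adjugate_fin_two]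
    linear_combination h2
  have hD00 : (C * blockB γ₁ + D * blockD γ₁) 0 0 ≠ 0 := by
    rw [hγ₁, blockB_spLevi, blockD_spLevi]
    simp [Matrix.mul_apply, Fin.sum_univ_two, adjugate_fin_two]
    intro h3
    apply hD
    ext j
    fin_cases j
    · simp; linear_combination x * h3 - D 0 0 * h1 - y * h2
    · simp; linear_combination -z * h3 - D 0 1 * h1 + w * h2
  clear_value γ₁
  generalize C * blockA γ₁ + D * blockC γ₁ = C' at *
  generalize C * blockB γ₁ + D * blockD γ₁ = D' at *
  rw [hC', hC', hD01] at hiso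
  have hC10 : C' 1 0 = 0 := by
    have : D' 0 0 * C' 1 0 = 0 := by linear_combination -hiso
    exact (mul_eq_zero.mp this).resolve_left hD00
  obtain ⟨x, y, z, w, h1, h2⟩ := exists_unimodular_kill (C' 1 1) (D' 1 1)
  refine ⟨spPair ![1, x] ![0, y] ![0, z] ![1, w] ?_, ?_⟩
  · intro i; fin_cases i <;> simp [h1]
  · rw [blockA_spPair, blockC_spPair]
    ext i j
    fin_cases i <;> fin_cases j <;> simp [hC', hC10, hD01, h2]

/-- This is the Iwasawa decomposition `GSp(ℚ) = P(ℚ) Sp(ℤ)` read on the lower half `(C D)`, which is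
not assumed to have full rank. The embedded `SL₂ × SL₂` clears the first row of `C`, after which the
preceding lemma applies; if the first row of `(C D)` vanishes, the same group clears the second row
at once. -/
theorem exists_mul_lower_eq_zero {C D : Matrix (Fin 2) (Fin 2) ℤ} (h : C * Dᵀ = D * Cᵀ) :
    ∃ γ : Sp, C * blockA γ + D * blockC γ = 0 := by
  by_cases h0 : C 0 = 0 ∧ D 0 = 0
  · obtain ⟨x, y, z, w, h1, h2⟩ := exists_unimodular_kill (C 1 0) (D 1 0)
    obtain ⟨x', y', z', w', h1', h2'⟩ := exists_unimodular_kill (C 1 1) (D 1 1)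
    refine ⟨spPair ![x, x'] ![y, y'] ![z, z'] ![w, w'] ?_, ?_⟩
    · intro i; fin_cases i <;> simpa
    · rw [blockA_spPair, blockC_spPair]
      have e1 : ∀ j, C 0 j = 0 := fun j => congrFun h0.1 j
      have e2 : ∀ j, D 0 j = 0 := fun j => congrFun h0.2 j
      ext i j
      fin_cases i <;> fin_cases j <;> simp [e1, e2, h2, h2']
  obtain ⟨x, y, z, w, h1, h2⟩ := exists_unimodular_kill (C 0 0) (D 0 0)
  obtain ⟨x', y', z', w', h1', h2'⟩ := exists_unimodular_kill (C 0 1) (D 0 1)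
  have hγ : ∀ i, ![x, x'] i * ![w, w'] i - ![y, y'] i * ![z, z'] i = 1 := by
    intro i; fin_cases i <;> simpa
  set γ₁ := spPair ![x, x'] ![y, y'] ![z, z'] ![w, w'] hγ with hγ₁
  apply exists_kill_of_mul γ₁
  have hiso := isotropic_mul h γ₁
  have hC0 : ∀ j, (C * blockA γ₁ + D * blockC γ₁) 0 j = 0 := by
    intro j
    rw [hγ₁, blockA_spPair, blockC_spPair]
    fin_cases j <;> simp [h2, h2']
  have hD0 : (C * blockB γ₁ + D * blockD γ₁) 0 ≠ 0 := by
    intro hD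
    apply h0
    have e0 : ∀ j, (C * blockB γ₁ + D * blockD γ₁) 0 j = 0 := fun j => congrFun hD j
    rw [hγ₁, blockB_spPair, blockD_spPair] at e0
    have e00 := e0 0
    have e01 := e0 1
    simp at e00 e01
    constructor
    · ext j
      fin_cases j
      · simp; linear_combination w * h2 - C 0 0 * h1 - z * e00
      · simp; linear_combination w' * h2' - C 0 1 * h1' - z' * e01
    · ext j
      fin_cases j
      · simp; linear_combination x * e00 - D 0 0 * h1 - y * h2
      · simp; linear_combination x' * e01 - D 0 1 * h1' - y' * h2'
  exact exists_mul_lower_eq_zero_of_row hiso hC0 hD0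

/-- The elements of `GSp₂⁺(ℝ)` whose lower half spans a rational Lagrangian plane. -/
def IsRational (g : GSpPos) : Prop := ∃ p ∈ Parabolic, ∃ γ : Sp, g = p * toGSpPos γ

/-- This is how the translates by Hecke matrices, whose entries may have denominators, are seen to
stay in `Parabolic · Sp`. -/
theorem isRational_of_integral {g : GSpPos} {t : ℝ} (ht : t ≠ 0)
    {C D : Matrix (Fin 2) (Fin 2) ℤ} (hC : t • g.1.1.toBlocks₂₁ = C.map (Int.cast : ℤ → ℝ))
    (hD : t • g.1.1.toBlocks₂₂ = D.map (Int.cast : ℤ → ℝ)) : IsRational g := by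
  obtain ⟨ν, -, h, -⟩ := GSp_relations g
  have hinj : Function.Injective
      (fun X : Matrix (Fin 2) (Fin 2) ℤ => X.map (Int.cast : ℤ → ℝ)) :=
    Matrix.map_injective Int.cast_injective
  have em : ∀ X Y : Matrix (Fin 2) (Fin 2) ℤ, (X * Y).map (Int.cast : ℤ → ℝ)
      = X.map (Int.cast : ℤ → ℝ) * Y.map (Int.cast : ℤ → ℝ) := fun X Y =>
    Matrix.map_mul (f := Int.castRingHom ℝ)
  have hiso : C * Dᵀ = D * Cᵀ := by
    apply hinj
    simp only
    rw [em, em, transpose_map, transpose_map, ← hC, ← hD]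
    simp [h]
  obtain ⟨γ, hγ⟩ := exists_mul_lower_eq_zero hiso
  refine ⟨g * toGSpPos γ, ?_, γ⁻¹, by simp⟩
  rw [mem_Parabolic, GSp_mul_val, toBlocks₂₁_mul, toGSpPos_block₁₁, toGSpPos_block₂₁]
  have h0 : C.map (Int.cast : ℤ → ℝ) * (blockA γ).map (Int.cast : ℤ → ℝ)
      + D.map (Int.cast : ℤ → ℝ) * (blockC γ).map (Int.cast : ℤ → ℝ) = 0 := by
    rw [← em, ← em, ← Matrix.map_add _ (fun _ _ => Int.cast_add _ _), hγ]
    ext; simp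
  rw [← hC, ← hD, Matrix.smul_mul, Matrix.smul_mul, ← smul_add] at h0
  exact (smul_eq_zero.mp h0).resolve_left ht

/-! ### Sections and their Eisenstein series -/

/-- Functions on `GSp₂⁺(ℝ)` that transform on the left under the Siegel parabolic. -/
def IsSection (k : ℕ) (Φ : GSpPos → ℂ) : Prop :=
  ∀ p ∈ Parabolic, ∀ g, Φ (p * g) = (detD p : ℂ) ^ k * Φ g

/-- The Eisenstein series attached to a section. -/
def sectionSum (k : ℕ) (Φ : GSpPos → ℂ) : H2 → ℂ := fun τ =>
  ∑' c : Quotient (QuotientGroup.rightRel Parabolic),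
    Φ c.out * (denom c.out τ).det ^ (-(k : ℤ))

theorem det_denom_parabolic_mul {p : GSpPos} (hp : p ∈ Parabolic) (g : GSpPos) (τ : H2) :
    (denom (p * g) τ).det = detD p * (denom g τ).det := by
  rw [det_denom, det_denom, plG_parabolic_mul hp]
  simp [linForm]
  ring

theorem IsSection.term_mul {k : ℕ} {Φ : GSpPos → ℂ} (hΦ : IsSection k Φ) {p : GSpPos}
    (hp : p ∈ Parabolic) (g : GSpPos) (τ : H2) :
    Φ (p * g) * (denom (p * g) τ).det ^ (-(k : ℤ)) = Φ g * (denom g τ).det ^ (-(k : ℤ)) := by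
  have h : (detD p : ℂ) ≠ 0 := by exact_mod_cast detD_ne_zero hp
  rw [hΦ p hp, det_denom_parabolic_mul hp, mul_zpow, _root_.zpow_neg, zpow_natCast]
  field_simp

theorem IsSection.term_out {k : ℕ} {Φ : GSpPos → ℂ} (hΦ : IsSection k Φ) (g : GSpPos) (τ : H2) :
    Φ (Quotient.mk (QuotientGroup.rightRel Parabolic) g).out *
      (denom (Quotient.mk (QuotientGroup.rightRel Parabolic) g).out τ).det ^ (-(k : ℤ))
      = Φ g * (denom g τ).det ^ (-(k : ℤ)) := by
  have h := Quotient.mk_out (s := QuotientGroup.rightRel Parabolic) g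
  have h := QuotientGroup.rightRel_apply.mp h
  have := hΦ.term_mul h (Quotient.mk (QuotientGroup.rightRel Parabolic) g).out τ
  rw [← this]
  simp

theorem IsSection.mul_right {k : ℕ} {Φ : GSpPos → ℂ} (hΦ : IsSection k Φ) (h : GSpPos) :
    IsSection k (fun g => Φ (g * h)) := by
  intro p hp g
  simp only [mul_assoc]
  exact hΦ p hp _

/-- Right multiplication on the cosets of the Siegel parabolic. -/
def cosetMulRight (h : GSpPos) : Quotient (QuotientGroup.rightRel Parabolic) ≃
    Quotient (QuotientGroup.rightRel Parabolic) :=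
  Quotient.congr (Equiv.mulRight h) (by
    intro a b
    rw [QuotientGroup.rightRel_apply, QuotientGroup.rightRel_apply]
    simp)

/-- Right translation by `h` permutes the cosets of `Parabolic`, and the cocycle relation
`denom_mul` converts the automorphy factor at `moebius h τ` into the one at `τ`. -/
theorem slash_sectionSum {k : ℕ} {Φ : GSpPos → ℂ} (hΦ : IsSection k Φ) (h : GSpPos) :
    slash k (sectionSum k Φ) h =
      ((h.1.1.det ^ ((k : ℝ) / 2) : ℝ) : ℂ) • sectionSum k (fun g => Φ (g * h⁻¹)) := by
  ext τ
  rw [slash, Pi.smul_apply, smul_eq_mul, mul_assoc]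
  congr 1
  rw [sectionSum, ← tsum_mul_left]
  conv_rhs => rw [sectionSum, ← (cosetMulRight h).tsum_eq]
  apply tsum_congr
  intro c
  have e : cosetMulRight h c = Quotient.mk _ (c.out * h) := by
    conv_lhs => rw [← c.out_eq]
    rfl
  rw [e, (hΦ.mul_right h⁻¹).term_out, denom_mul, det_mul, mul_zpow]
  simp
  ring

end

end SiegelEisenstein

namespace SiegelEisenstein

noncomputable section

/-! ### Primitive vectors and sections supported on rational planes -/

/-- No prime divides all the coordinates. -/
def IsPrimitiveVec (w : Fin 5 → ℤ) : Prop := ∀ l : ℕ, l.Prime → ∃ i, ¬ (l : ℤ) ∣ w i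

section
variable {R : Type*} [CommRing R] (A B C D : Matrix (Fin 2) (Fin 2) R)

theorem act_sub (v v' : Fin 5 → R) : act A B C D (v - v') = act A B C D v - act A B C D v' := by
  ext i
  fin_cases i <;> simp [act, actRow, actDet] <;> ring

theorem act_smul (t : R) (v : Fin 5 → R) : act A B C D (t • v) = t • act A B C D v := by
  ext i
  fin_cases i <;> simp [act, actRow, actDet] <;> ring

theorem act_dvd {m : R} {v : Fin 5 → R} (h : ∀ i, m ∣ v i) (i : Fin 5) : m ∣ act A B C D v i := by
  choose w hw using h
  have : v = m • w := by ext i; simp [hw]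
  rw [this, act_smul]
  simp

theorem act_dvd_sub {m : R} {v v' : Fin 5 → R} (h : ∀ i, m ∣ v i - v' i) (i : Fin 5) :
    m ∣ act A B C D v i - act A B C D v' i := by
  have := act_dvd A B C D (v := v - v') h i
  rwa [act_sub] at this

end

/-- A common prime divisor would persist under the action of `γ⁻¹`, which produces the vector `(0,
0, 0, 0, 1)` of the identity. -/
theorem plZ_primitive (γ : Sp) : IsPrimitiveVec (plZ γ) := by
  intro l hl
  by_contra! h
  have h1 := act_dvd (blockA γ⁻¹) (blockB γ⁻¹) (blockC γ⁻¹) (blockD γ⁻¹) h 4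
  rw [← plZ_mul, mul_inv_cancel, plZ_one] at h1
  simp at h1
  have := Int.isUnit_iff_natAbs_eq.mp (isUnit_of_dvd_one (by simpa using h1 : (l : ℤ) ∣ 1))
  simp at this
  exact hl.one_lt.ne' this

theorem IsPrimitiveVec.exists_ne_zero {w : Fin 5 → ℤ} (hw : IsPrimitiveVec w) : ∃ i, w i ≠ 0 := by
  obtain ⟨i, hi⟩ := hw 2 Nat.prime_two
  exact ⟨i, fun h => hi (by simp [h])⟩

theorem IsPrimitiveVec.natAbs_eq_one {w w' : Fin 5 → ℤ} (hw : IsPrimitiveVec w) {a b : ℤ}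
    (hab : IsCoprime a b) (h : ∀ i, a * w' i = b * w i) : a.natAbs = 1 := by
  by_contra h1
  obtain ⟨l, hl, hla⟩ := Nat.exists_prime_and_dvd h1
  obtain ⟨i, hi⟩ := hw l hl
  have hla' : (l : ℤ) ∣ a := Int.natCast_dvd.mpr hla
  have hp : Prime (l : ℤ) := Nat.prime_iff_prime_int.mp hl
  have : (l : ℤ) ∣ b * w i := by rw [← h]; exact hla'.mul_right _
  rcases hp.dvd_or_dvd this with h2 | h2
  · exact hp.not_isUnit (hab.isUnit_of_dvd' hla' h2)
  · exact hi h2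

/-- The ratio of the two scalars is rational, say `a / b` in lowest terms; primitivity of either
vector then forces `a` and `b` to be units. -/
theorem IsPrimitiveVec.unique {w w' : Fin 5 → ℤ} (hw : IsPrimitiveVec w) (hw' : IsPrimitiveVec w')
    {t t' : ℝ} (ht : t ≠ 0) (ht' : t' ≠ 0) (h : ∀ i, t * w i = t' * w' i) :
    (t' = t ∧ w' = w) ∨ (t' = -t ∧ w' = -w) := by
  obtain ⟨i, hi⟩ := hw.exists_ne_zero
  have hi' : w' i ≠ 0 := by
    intro h0
    have := h i
    rw [h0] at this
    simp [ht, hi] at this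
  set g : ℤ := ((Int.gcd (w i) (w' i) : ℕ) : ℤ) with hg
  have hg0 : g ≠ 0 := by simp [hg, Int.gcd_eq_zero_iff, hi]
  obtain ⟨a, ha⟩ : g ∣ w i := Int.gcd_dvd_left _ _
  obtain ⟨b, hb⟩ : g ∣ w' i := Int.gcd_dvd_right _ _
  have hab : IsCoprime a b := by
    refine ⟨Int.gcdA (w i) (w' i), Int.gcdB (w i) (w' i), ?_⟩
    have := Int.gcd_eq_gcd_ab (w i) (w' i)
    apply mul_left_cancel₀ hg0
    rw [← hg] at this
    linear_combination -this - Int.gcdA (w i) (w' i) * ha - Int.gcdB (w i) (w' i) * hb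
  have hta : t * a = t' * b := by
    have hgR : (g : ℝ) ≠ 0 := by exact_mod_cast hg0
    apply mul_left_cancel₀ hgR
    have := h i
    rw [ha, hb] at this
    push_cast at this
    linear_combination this
  have hb0 : b ≠ 0 := by rintro rfl; simp at hb; exact hi' hb
  have key : ∀ j, a * w' j = b * w j := by
    intro j
    have h1 : t' * ((a * w' j : ℤ) : ℝ) = t' * ((b * w j : ℤ) : ℝ) := by
      push_cast
      linear_combination (-(a : ℝ)) * h j + w j * hta
    exact_mod_cast mul_left_cancel₀ ht' h1
  have ha1 := hw.natAbs_eq_one hab key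
  have hb1 := hw'.natAbs_eq_one hab.symm (fun j => (key j).symm)
  rcases Int.natAbs_eq a with h1 | h1 <;> rcases Int.natAbs_eq b with h2 | h2 <;>
    rw [ha1] at h1 <;> rw [hb1] at h2 <;> subst h1 <;> subst h2 <;> simp at hta key
  · exact Or.inl ⟨hta.symm, funext key⟩
  · refine Or.inr ⟨by linarith, funext fun j => ?_⟩
    simp [key]
  · refine Or.inr ⟨by linarith, funext fun j => ?_⟩
    have := key j
    simp; linarith
  · exact Or.inl ⟨hta.symm, funext key⟩

open Classical in
/-- The section supported on the rational planes whose value on `Sp₂(ℤ)` is a given function of the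
Plücker coordinates. -/
def ratSection (k : ℕ) (f : (Fin 5 → ℤ) → ℂ) (g : GSpPos) : ℂ :=
  if h : IsRational g then (detD h.choose : ℂ) ^ k * f (plZ h.choose_spec.2.choose) else 0

/-- The parity needed for `f` to define a section. -/
def HasParity (k : ℕ) (f : (Fin 5 → ℤ) → ℂ) : Prop := ∀ w, f (-w) = (-1) ^ k * f w

theorem ratSection_of_not {k : ℕ} {f : (Fin 5 → ℤ) → ℂ} {g : GSpPos} (h : ¬ IsRational g) :
    ratSection k f g = 0 := dif_neg h

/-- The decomposition chosen in `ratSection` is not unique, but the Plücker vector of `g` determines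
`detD` and the integral vector up to a common sign, which `HasParity` absorbs. -/
theorem ratSection_eq {k : ℕ} {f : (Fin 5 → ℤ) → ℂ} (hf : HasParity k f) {g : GSpPos}
    (hg : IsRational g) {t : ℝ} (ht : t ≠ 0) {w : Fin 5 → ℤ} (hw : IsPrimitiveVec w)
    (h : ∀ i, plG g i = t * w i) : ratSection k f g = (t : ℂ) ^ k * f w := by
  rw [ratSection, dif_pos hg]
  have h1 := hg.choose_spec.1
  have h2 := hg.choose_spec.2.choose_spec
  set p := hg.choose
  set γ := hg.choose_spec.2.choose
  have h3 : ∀ i, t * w i = detD p * (plZ γ i : ℤ) := by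
    intro i
    rw [← h i, h2, plG_parabolic_mul h1, plG_toGSpPos]
    rfl
  rcases hw.unique (plZ_primitive γ) ht (detD_ne_zero h1) h3 with ⟨h4, h5⟩ | ⟨h4, h5⟩
  · rw [h4, h5]
  · rw [h4, h5, hf]
    push_cast
    rw [neg_pow (t : ℂ)]
    have : ((-1 : ℂ) ^ k) * (-1) ^ k = 1 := by rw [← mul_pow]; simp
    linear_combination (t : ℂ) ^ k * f w * this

theorem IsRational.parabolic_mul {p g : GSpPos} (hp : p ∈ Parabolic) :
    IsRational (p * g) ↔ IsRational g := by
  constructor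
  · rintro ⟨p', hp', γ, h⟩
    exact ⟨p⁻¹ * p', mul_mem (inv_mem hp) hp', γ, by rw [mul_assoc, ← h]; simp⟩
  · rintro ⟨p', hp', γ, rfl⟩
    exact ⟨p * p', mul_mem hp hp', γ, by rw [mul_assoc]⟩

theorem IsRational.mul_Sp {g : GSpPos} (γ : Sp) : IsRational (g * toGSpPos γ) ↔ IsRational g := by
  constructor
  · rintro ⟨p', hp', γ', h⟩
    refine ⟨p', hp', γ' * γ⁻¹, ?_⟩
    rw [map_mul, ← mul_assoc, ← h]; simp
  · rintro ⟨p', hp', γ', rfl⟩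
    exact ⟨p', hp', γ' * γ, by rw [map_mul, mul_assoc]⟩

theorem isRational_toGSpPos (γ : Sp) : IsRational (toGSpPos γ) := ⟨1, one_mem _, γ, by simp⟩

theorem ratSection_toGSpPos {k : ℕ} {f : (Fin 5 → ℤ) → ℂ} (hf : HasParity k f) (γ : Sp) :
    ratSection k f (toGSpPos γ) = f (plZ γ) := by
  rw [ratSection_eq hf (isRational_toGSpPos γ) one_ne_zero (plZ_primitive γ)]
  · simp
  · simp [plG_toGSpPos]

theorem isSection_ratSection {k : ℕ} {f : (Fin 5 → ℤ) → ℂ} (hf : HasParity k f) :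
    IsSection k (ratSection k f) := by
  intro p hp g
  by_cases hg : IsRational g
  · obtain ⟨p', hp', γ, rfl⟩ := hg
    have e : ∀ q ∈ Parabolic, ∀ i, plG (q * toGSpPos γ) i = detD q * (plZ γ i : ℤ) := by
      intro q hq i
      rw [plG_parabolic_mul hq, plG_toGSpPos]
      rfl
    have hdet : detD (p * p') = detD p * detD p' := by
      rw [detD, (lower_mul_of_mem hp p').2, det_mul]; rfl
    rw [ratSection_eq hf ⟨p', hp', γ, rfl⟩ (detD_ne_zero hp') (plZ_primitive γ) (e p' hp'),
      ← mul_assoc, ratSection_eq hf ⟨p * p', mul_mem hp hp', γ, rfl⟩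
        (detD_ne_zero (mul_mem hp hp')) (plZ_primitive γ) (e _ (mul_mem hp hp')), hdet]
    push_cast
    ring
  · rw [ratSection_of_not hg, ratSection_of_not (by rwa [IsRational.parabolic_mul hp]), mul_zero]

theorem IsSection.ext_of_rational {k : ℕ} {Φ Ψ : GSpPos → ℂ} (hΦ : IsSection k Φ)
    (hΨ : IsSection k Ψ) (h0 : ∀ g, ¬ IsRational g → Φ g = Ψ g)
    (h : ∀ γ : Sp, Φ (toGSpPos γ) = Ψ (toGSpPos γ)) : Φ = Ψ := by
  ext g
  by_cases hg : IsRational g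
  · obtain ⟨p, hp, γ, rfl⟩ := hg
    rw [hΦ p hp, hΨ p hp, h]
  · exact h0 g hg

end

end SiegelEisenstein

namespace SiegelEisenstein

noncomputable section

/-! ### Components of Dirichlet characters -/

section Characters

variable {N : ℕ}

/-- Any integral lift computes the component; the Chinese remainder isomorphism in the definition of
`component` plays no further role. -/
theorem component_apply (hN : Squarefree N)
    (χ : DirichletCharacter ℂ N) {d : ℕ} (hd : d ∣ N) {n b : ℤ} (h1 : (d : ℤ) ∣ b - n)
    (h2 : ((N / d : ℕ) : ℤ) ∣ b - 1) : component χ d (n : ZMod d) = χ (b : ZMod N) := by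
  have hNd : N = d * (N / d) := (Nat.mul_div_cancel' hd).symm
  have hc : d.Coprime (N / d) := Nat.coprime_of_squarefree_mul (hNd ▸ hN)
  have e1 : (n : ZMod d) = (b : ZMod d) := (ZMod.intCast_eq_intCast_iff_dvd_sub _ _ _).mpr h1
  have e2 : (1 : ZMod (N / d)) = (b : ZMod (N / d)) := by
    have := (ZMod.intCast_eq_intCast_iff_dvd_sub 1 b (N / d)).mpr h2
    simpa using this
  rw [component, dif_pos ⟨hNd, hc⟩]
  by_cases hu : IsUnit (n : ZMod d)
  · obtain ⟨u, hu⟩ := hu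
    rw [← hu, MulChar.ofUnitHom_coe]
    simp only [MonoidHom.comp_apply]
    rw [MulChar.coe_toUnitHom]
    congr 1
    simp only [Units.coe_map]
    change ((ZMod.ringEquivCongr hNd).trans (ZMod.chineseRemainder hc)).symm ((u : ZMod d), 1) = _
    rw [RingEquiv.symm_apply_eq, map_intCast]
    rw [hu, e1, e2]
    rfl
  · rw [MulChar.map_nonunit _ hu, MulChar.map_nonunit]
    intro hb
    apply hu
    rw [e1]
    have := hb.map (ZMod.castHom hd (ZMod d))
    simpa using this

theorem exists_component_lift (hN : Squarefree N) {d : ℕ} (hd : d ∣ N) (n : ℤ) :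
    ∃ b : ℤ, (d : ℤ) ∣ b - n ∧ ((N / d : ℕ) : ℤ) ∣ b - 1 := by
  have hNd : N = d * (N / d) := (Nat.mul_div_cancel' hd).symm
  have hc : d.Coprime (N / d) := Nat.coprime_of_squarefree_mul (hNd ▸ hN)
  obtain ⟨x, y, h⟩ := Nat.isCoprime_iff_coprime.mpr hc
  exact ⟨n + x * d * (1 - n), ⟨x * (1 - n), by ring⟩, ⟨-(y * (1 - n)), by
    linear_combination (1 - n) * h⟩⟩

/-- If `b` and `c` are the lifts for `d` and `e`, then `b * c` is a lift for `d * e`. -/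
theorem component_mul_apply (hN : Squarefree N)
    (χ : DirichletCharacter ℂ N) {d e : ℕ} (hde : d * e ∣ N) (n : ℤ) :
    component χ (d * e) (n : ZMod (d * e)) =
      component χ d (n : ZMod d) * component χ e (n : ZMod e) := by
  obtain ⟨f, hf⟩ := hde
  have hd : d ∣ N := ⟨e * f, by rw [hf, mul_assoc]⟩
  have he : e ∣ N := ⟨d * f, by rw [hf]; ring⟩
  have hN0 : 0 < N := Nat.pos_of_ne_zero hN.ne_zero
  have hd0 : 0 < d := Nat.pos_of_dvd_of_pos hd hN0
  have he0 : 0 < e := Nat.pos_of_dvd_of_pos he hN0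
  have q1 : N / d = e * f := by rw [hf, mul_assoc, Nat.mul_div_cancel_left _ hd0]
  have q2 : N / e = d * f := by
    rw [hf, mul_comm d e, mul_assoc, Nat.mul_div_cancel_left _ he0]
  have q3 : N / (d * e) = f := by rw [hf, Nat.mul_div_cancel_left _ (Nat.mul_pos hd0 he0)]
  obtain ⟨b, hb1, hb2⟩ := exists_component_lift hN hd n
  obtain ⟨c, hc1, hc2⟩ := exists_component_lift hN he n
  rw [component_apply hN χ hd hb1 hb2, component_apply hN χ he hc1 hc2, ← map_mul,
    ← Int.cast_mul]
  rw [q1] at hb2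
  rw [q2] at hc2
  push_cast at hb2 hc2
  apply component_apply hN χ ⟨f, hf⟩
  · have hcop : IsCoprime (d : ℤ) (e : ℤ) :=
      Nat.isCoprime_iff_coprime.mpr (Nat.coprime_of_squarefree_mul
        (hN.squarefree_of_dvd ⟨f, hf⟩))
    push_cast
    apply hcop.mul_dvd
    · have : b * c - n = (b - n) * c + n * (c - 1) := by ring
      rw [this]
      exact dvd_add (hb1.mul_right _) ((dvd_of_mul_right_dvd hc2).mul_left _)
    · have : b * c - n = (c - n) * b + n * (b - 1) := by ring
      rw [this]
      exact dvd_add (hc1.mul_right _) ((dvd_of_mul_right_dvd hb2).mul_left _)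
  · rw [q3]
    have : b * c - 1 = (b - 1) * c + (c - 1) := by ring
    rw [this]
    exact dvd_add ((dvd_of_mul_left_dvd hb2).mul_right _) (dvd_of_mul_left_dvd hc2)

theorem component_one_apply (hN : Squarefree N)
    (χ : DirichletCharacter ℂ N) (n : ℤ) : component χ 1 (n : ZMod 1) = 1 := by
  rw [component_apply hN χ (one_dvd N) (b := 1) (by simp) (by simp)]
  simp

theorem component_self_apply (hN : Squarefree N)
    (χ : DirichletCharacter ℂ N) (n : ℤ) : component χ N (n : ZMod N) = χ (n : ZMod N) :=
  component_apply hN χ dvd_rfl (by simp)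
    (by rw [Nat.div_self (Nat.pos_of_ne_zero hN.ne_zero)]; simp)

theorem component_eq_prod (hN : Squarefree N)
    (χ : DirichletCharacter ℂ N) {d : ℕ} (hd : d ∣ N) (n : ℤ) :
    component χ d (n : ZMod d) = ∏ q ∈ d.primeFactors, component χ q (n : ZMod q) := by
  induction d using induction_on_primes with
  | zero => exact absurd (zero_dvd_iff.mp hd) hN.ne_zero
  | one => simpa using component_one_apply hN χ n
  | prime_mul p a hp ih =>
    have hpa : p.Coprime a := Nat.coprime_of_squarefree_mul (hN.squarefree_of_dvd hd)
    have ha : a ≠ 0 := by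
      rintro rfl
      rw [mul_zero] at hd
      exact hN.ne_zero (zero_dvd_iff.mp hd)
    have hnot : p ∉ a.primeFactors := by
      intro h
      exact (Nat.Prime.coprime_iff_not_dvd hp).mp hpa (Nat.dvd_of_mem_primeFactors h)
    rw [component_mul_apply hN χ hd, ih (dvd_of_mul_left_dvd hd), hpa.primeFactors_mul,
      hp.primeFactors, Finset.prod_union (by simpa using hnot), Finset.prod_singleton]

theorem character_eq_prod (hN : Squarefree N)
    (χ : DirichletCharacter ℂ N) (n : ℤ) :
    χ (n : ZMod N) = ∏ q ∈ N.primeFactors, component χ q (n : ZMod q) := by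
  rw [← component_self_apply hN, component_eq_prod hN χ dvd_rfl]

theorem chi_eq_prod (hN : Squarefree N)
    (χ : DirichletCharacter ℂ N) {d : ℕ} (hd : d ∣ N) (n : ℕ) :
    chi χ d n = ∏ q ∈ d.primeFactors, component χ q (n : ZMod q) := by
  rw [chi]
  simpa using component_eq_prod hN χ hd n

/-- A unit modulo `q` is extended to a unit modulo `q * e` that is `1` modulo `e`, so that the other
component contributes `1`. -/
theorem component_sq_of_dvd (hN : Squarefree N)
    (χ : DirichletCharacter ℂ N) {d q : ℕ} (hd : d ∣ N) (hq : q ∣ d) (h : component χ d ^ 2 = 1) :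
    component χ q ^ 2 = 1 := by
  obtain ⟨e, rfl⟩ := hq
  ext u
  obtain ⟨n, hn⟩ := ZMod.intCast_surjective (u : ZMod q)
  have hN0 : 0 < N := Nat.pos_of_ne_zero hN.ne_zero
  have hq0 : 0 < q := Nat.pos_of_dvd_of_pos (dvd_of_mul_right_dvd hd) hN0
  obtain ⟨b, h1, h2⟩ := exists_component_lift (hN.squarefree_of_dvd hd) (dvd_mul_right q e) n
  rw [Nat.mul_div_cancel_left _ hq0] at h2
  have e1 : (b : ZMod q) = (n : ZMod q) :=
    ((ZMod.intCast_eq_intCast_iff_dvd_sub _ _ _).mpr h1).symm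
  have e2 : (b : ZMod e) = 1 := by
    have := ((ZMod.intCast_eq_intCast_iff_dvd_sub 1 b e).mpr h2).symm
    simpa using this
  have h3 := component_mul_apply hN χ hd b
  rw [e2, map_one, mul_one, e1, hn] at h3
  have hu : IsUnit (b : ZMod (q * e)) := by
    by_contra hu
    rw [MulChar.map_nonunit _ hu] at h3
    exact (u.isUnit.map (component χ q)).ne_zero h3.symm
  have h4 := congrArg (fun ψ : DirichletCharacter ℂ (q * e) => ψ (b : ZMod (q * e))) h
  rw [MulChar.pow_apply' _ two_ne_zero, MulChar.one_apply hu, h3] at h4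
  rw [MulChar.pow_apply' _ two_ne_zero, h4, MulChar.one_apply u.isUnit]

theorem component_sq_of_primes (hN : Squarefree N)
    (χ : DirichletCharacter ℂ N) {d : ℕ} (hd : d ∣ N)
    (h : ∀ q ∈ d.primeFactors, component χ q ^ 2 = 1) : component χ d ^ 2 = 1 := by
  ext u
  obtain ⟨n, hn⟩ := ZMod.intCast_surjective (u : ZMod d)
  rw [MulChar.one_apply u.isUnit, MulChar.pow_apply' _ two_ne_zero, ← hn,
    component_eq_prod hN χ hd, ← Finset.prod_pow]
  apply Finset.prod_eq_one
  intro q hq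
  rw [← MulChar.pow_apply' _ two_ne_zero, h q hq]
  apply MulChar.one_apply
  have := u.isUnit.map (ZMod.castHom (Nat.dvd_of_mem_primeFactors hq) (ZMod q))
  rw [← hn] at this
  simpa using this

end Characters

/-! ### The local functions -/

section Local

variable {q : ℕ}

open Classical in
/-- The local function of a prime where `C` has rank `0`. -/
def loc₀ (ψ : DirichletCharacter ℂ q) (v : Fin 5 → ZMod q) : ℂ :=
  if v 0 = 0 ∧ v 1 = 0 ∧ v 2 = 0 ∧ v 3 = 0 then conj (ψ (v 4)) else 0

open Classical in
/-- The value of a quadratic character on a symmetric matrix of rank one. -/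
def rankOneChar (ψ : DirichletCharacter ℂ q) (a e : ZMod q) : ℂ := if a = 0 then ψ e else ψ a

open Classical in
/-- The local function of a prime where `C` has rank `1`. -/
def loc₁ (ψ : DirichletCharacter ℂ q) (v : Fin 5 → ZMod q) : ℂ :=
  if v 0 = 0 then rankOneChar ψ (v 1) (v 3) else 0

/-- The local function of a prime where `C` has rank `2`. -/
def loc₂ (ψ : DirichletCharacter ℂ q) (v : Fin 5 → ZMod q) : ℂ := ψ (v 0)

/-- A linear combination of the three local functions. -/
def locSum (ψ : DirichletCharacter ℂ q) (κ : Fin 3 → ℂ) (v : Fin 5 → ZMod q) : ℂ :=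
  κ 0 * loc₀ ψ v + κ 1 * loc₁ ψ v + κ 2 * loc₂ ψ v

variable [Fact q.Prime]

theorem conj_char (ψ : DirichletCharacter ℂ q) (a : ZMod q) : conj (ψ a) = ψ a⁻¹ := by
  rw [← MulChar.inv_apply']
  exact MulChar.star_apply' ψ a

theorem char_sq_mul {ψ : DirichletCharacter ℂ q} (h : ψ ^ 2 = 1) {x : ZMod q} (hx : x ≠ 0) :
    ψ x * ψ x = 1 := by
  rw [← pow_two, ← MulChar.pow_apply' _ two_ne_zero, h]
  exact MulChar.one_apply (isUnit_iff_ne_zero.mpr hx)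

/-- Both diagonal entries of `s · (x, y)ᵗ(x, y)` are `s` times a square, and a quadratic character
ignores nonzero squares. This is why rank one requires `χ_q² = 1`. -/
theorem rankOneChar_eq {ψ : DirichletCharacter ℂ q} (h : ψ ^ 2 = 1) {s x y : ZMod q}
    (hxy : x ≠ 0 ∨ y ≠ 0) : rankOneChar ψ (s * x ^ 2) (s * y ^ 2) = ψ s := by
  rw [rankOneChar]
  by_cases hs : s = 0
  · simp [hs]
  by_cases hx : x = 0
  · have hy : y ≠ 0 := hxy.resolve_left (not_not.mpr hx)
    simp only [hx]
    simp [pow_two, char_sq_mul h hy]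
  · rw [if_neg (mul_ne_zero hs (pow_ne_zero 2 hx)), map_mul, map_pow, pow_two, char_sq_mul h hx, mul_one]

theorem exists_rankOne {a b e : ZMod q} (h : a * e = b ^ 2) :
    ∃ s x y : ZMod q, (x ≠ 0 ∨ y ≠ 0) ∧ a = s * x ^ 2 ∧ b = s * (x * y) ∧ e = s * y ^ 2 := by
  by_cases ha : a = 0
  · subst ha
    have hb : b = 0 := by
      rw [zero_mul] at h
      exact pow_eq_zero_iff two_ne_zero |>.mp h.symm
    exact ⟨e, 0, 1, by simp, by simp, by simp [hb], by simp⟩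
  · refine ⟨a⁻¹, a, b, Or.inl ha, ?_, ?_, ?_⟩
    · field_simp
    · field_simp
    · field_simp; linear_combination h

theorem rankOneChar_ne_zero {ψ : DirichletCharacter ℂ q} {a b e : ZMod q} (hq : a * e = b ^ 2)
    (h0 : a ≠ 0 ∨ b ≠ 0 ∨ e ≠ 0) : rankOneChar ψ a e ≠ 0 := by
  have hψ : ∀ x : ZMod q, x ≠ 0 → ψ x ≠ 0 := fun x hx =>
    ((isUnit_iff_ne_zero.mpr hx).map ψ).ne_zero
  rw [rankOneChar]
  split_ifs with ha
  · apply hψ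
    rintro rfl
    subst ha
    simp at h0
    apply h0
    rw [mul_zero] at hq
    exact pow_eq_zero_iff two_ne_zero |>.mp hq.symm
  · exact hψ _ ha

end Local

end

end SiegelEisenstein

namespace SiegelEisenstein

noncomputable section

section Local

variable {q : ℕ} [Fact q.Prime]

/-! ### Equivariance of the local functions -/

theorem conj_char_mul_of_eq_one (ψ : DirichletCharacter ℂ q) {a b : ZMod q} (h : a * b = 1) :
    ψ a = conj (ψ b) := by
  rw [conj_char]
  congr 1
  exact eq_inv_of_mul_eq_one_left h

theorem loc₀_smul (ψ : DirichletCharacter ℂ q) {t : ZMod q} (ht : t ≠ 0) (v : Fin 5 → ZMod q) :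
    loc₀ ψ (t • v) = conj (ψ t) * loc₀ ψ v := by
  simp [loc₀, ht]

theorem loc₁_smul (ψ : DirichletCharacter ℂ q) {t : ZMod q} (ht : t ≠ 0) (v : Fin 5 → ZMod q) :
    loc₁ ψ (t • v) = ψ t * loc₁ ψ v := by
  simp [loc₁, rankOneChar, ht]

theorem loc₂_smul (ψ : DirichletCharacter ℂ q) (t : ZMod q) (v : Fin 5 → ZMod q) :
    loc₂ ψ (t • v) = ψ t * loc₂ ψ v := by
  simp [loc₂]

theorem locSum_neg (ψ : DirichletCharacter ℂ q) (κ : Fin 3 → ℂ) (v : Fin 5 → ZMod q) :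
    locSum ψ κ (-v) = ψ (-1) * locSum ψ κ v := by
  have h : (-1 : ZMod q) ≠ 0 := by simp
  have e : -v = (-1 : ZMod q) • v := by simp
  have hc : ψ (-1) = conj (ψ (-1)) := conj_char_mul_of_eq_one ψ (by simp)
  rw [e, locSum, loc₀_smul ψ h, loc₁_smul ψ h, loc₂_smul, locSum, ← hc]
  ring

/-- The entries of `A = ᵗD⁻¹`. -/
theorem entries_of_transpose_mul {A D : Matrix (Fin 2) (Fin 2) (ZMod q)} (h : Aᵀ * D = 1) :
    A.det * D.det = 1 ∧ A 0 0 = A.det * D 1 1 ∧ A 0 1 = -(A.det * D 1 0) ∧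
      A 1 0 = -(A.det * D 0 1) ∧ A 1 1 = A.det * D 0 0 := by
  have h1 : A.det * D.det = 1 := by
    rw [← det_transpose A, ← det_mul, h, det_one]
  have h2 : Aᵀ = A.det • D.adjugate := by
    calc Aᵀ = Aᵀ * (D * D.adjugate) * (A.det • 1) := by
          rw [mul_adjugate, Matrix.mul_smul, Matrix.mul_smul, mul_one, mul_one, smul_smul, h1,
            one_smul]
      _ = _ := by rw [← mul_assoc, h, one_mul, Matrix.mul_smul, mul_one]
  rw [adjugate_fin_two] at h2
  refine ⟨h1, ?_, ?_, ?_, ?_⟩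
  · simpa using congrFun (congrFun h2 0) 0
  · simpa using congrFun (congrFun h2 1) 0
  · simpa using congrFun (congrFun h2 0) 1
  · simpa using congrFun (congrFun h2 1) 1

/-- Modulo `q ∣ N`, elements of `Gamma0 N` have `C = 0` and `A = ᵗD⁻¹`. On vectors with `v 0 = 0`
they act on the middle block, a symmetric matrix `Q`, by `Q ↦ det A · ᵗD Q D`. -/
theorem act_upper {A D : Matrix (Fin 2) (Fin 2) (ZMod q)} (h : Aᵀ * D = 1)
    (B : Matrix (Fin 2) (Fin 2) (ZMod q)) (v : Fin 5 → ZMod q) :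
    act A B 0 D v 0 = A.det * v 0 ∧
    (v 0 = 0 → act A B 0 D v 1 =
      A.det * (v 1 * D 0 0 ^ 2 + 2 * v 2 * (D 0 0 * D 1 0) + v 3 * D 1 0 ^ 2)) ∧
    (v 0 = 0 → act A B 0 D v 2 =
      A.det * (v 1 * (D 0 0 * D 0 1) + v 2 * (D 0 0 * D 1 1 + D 1 0 * D 0 1)
        + v 3 * (D 1 0 * D 1 1))) ∧
    (v 0 = 0 → act A B 0 D v 3 =
      A.det * (v 1 * D 0 1 ^ 2 + 2 * v 2 * (D 0 1 * D 1 1) + v 3 * D 1 1 ^ 2)) ∧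
    (v 0 = 0 → v 1 = 0 → v 2 = 0 → v 3 = 0 → act A B 0 D v 4 = D.det * v 4) := by
  obtain ⟨h0, h1, h2, h3, h4⟩ := entries_of_transpose_mul h
  refine ⟨?_, ?_, ?_, ?_, ?_⟩
  · simp [act, actDet, det_fin_two, mul_comm]
  · intro hv; simp [act, actRow, hv, h2, h4]; ring
  · intro hv; simp [act, actRow, hv, h2, h4]; ring
  · intro hv; simp [act, actRow, hv, h1, h3]; ring
  · intro hv0 hv1 hv2 hv3; simp [act, actDet, hv0, hv1, hv2, hv3, det_fin_two]; ring

/-- The support must be preserved in both directions. If the new middle block vanishes, write the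
old one, which has rank at most one by the quadric, as `s · (x, y)ᵗ(x, y)`; invertibility of `D`
gives `s = 0`. -/
theorem loc₀_act (ψ : DirichletCharacter ℂ q) {A D : Matrix (Fin 2) (Fin 2) (ZMod q)}
    (h : Aᵀ * D = 1) (B : Matrix (Fin 2) (Fin 2) (ZMod q)) {v : Fin 5 → ZMod q}
    (hv : OnQuadric v) : loc₀ ψ (act A B 0 D v) = conj (ψ D.det) * loc₀ ψ v := by
  obtain ⟨h0, h1, h2, h3, h4⟩ := act_upper h B v
  have hdet := (entries_of_transpose_mul h).1
  have hA : A.det ≠ 0 := left_ne_zero_of_mul_eq_one hdet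
  have hD : D.det ≠ 0 := right_ne_zero_of_mul_eq_one hdet
  by_cases hz : v 0 = 0 ∧ v 1 = 0 ∧ v 2 = 0 ∧ v 3 = 0
  · obtain ⟨z0, z1, z2, z3⟩ := hz
    rw [loc₀, if_pos ⟨by simp [h0, z0], by simp [h1 z0, z1, z2, z3], by simp [h2 z0, z1, z2, z3],
      by simp [h3 z0, z1, z2, z3]⟩, loc₀, if_pos ⟨z0, z1, z2, z3⟩, h4 z0 z1 z2 z3, map_mul, map_mul]
  · rw [loc₀, loc₀, if_neg hz, mul_zero, if_neg]
    rintro ⟨z0, z1, z2, z3⟩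
    apply hz
    rw [h0] at z0
    have hv0 : v 0 = 0 := (mul_eq_zero.mp z0).resolve_left hA
    rw [h1 hv0] at z1
    rw [h3 hv0] at z3
    rw [OnQuadric, hv0, zero_mul] at hv
    obtain ⟨s, x, y, hxy, ha, hb, he⟩ := exists_rankOne (sub_eq_zero.mp hv)
    have e1 : A.det * s * (x * D 0 0 + y * D 1 0) ^ 2 = 0 := by
      rw [← z1, ha, hb, he]; ring
    have e3 : A.det * s * (x * D 0 1 + y * D 1 1) ^ 2 = 0 := by
      rw [← z3, ha, hb, he]; ring
    have hs : s = 0 := by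
      by_contra hs
      have f1 := (mul_eq_zero.mp e1).resolve_left (mul_ne_zero hA hs)
      have f3 := (mul_eq_zero.mp e3).resolve_left (mul_ne_zero hA hs)
      have f1 := pow_eq_zero_iff two_ne_zero |>.mp f1
      have f3 := pow_eq_zero_iff two_ne_zero |>.mp f3
      have hx : x = 0 := by
        have : x * D.det = 0 := by rw [det_fin_two]; linear_combination D 1 1 * f1 - D 1 0 * f3
        exact (mul_eq_zero.mp this).resolve_right hD
      have hy : y = 0 := by
        have : y * D.det = 0 := by rw [det_fin_two]; linear_combination D 0 0 * f3 - D 0 1 * f1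
        exact (mul_eq_zero.mp this).resolve_right hD
      simp [hx, hy] at hxy
    exact ⟨hv0, by rw [ha, hs]; simp, by rw [hb, hs]; simp, by rw [he, hs]; simp⟩

/-- For `Q = s · (x, y)ᵗ(x, y)` the action replaces `s` by `det A · s` and `(x, y)` by another
nonzero vector, so the value is multiplied by `ψ (det A)`, which is the conjugate of `ψ (det D)`. -/
theorem loc₁_act {ψ : DirichletCharacter ℂ q} (hψ : ψ ^ 2 = 1)
    {A D : Matrix (Fin 2) (Fin 2) (ZMod q)} (h : Aᵀ * D = 1)
    (B : Matrix (Fin 2) (Fin 2) (ZMod q)) {v : Fin 5 → ZMod q}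
    (hv : OnQuadric v) : loc₁ ψ (act A B 0 D v) = conj (ψ D.det) * loc₁ ψ v := by
  obtain ⟨h0, h1, -, h3, -⟩ := act_upper h B v
  have hdet := (entries_of_transpose_mul h).1
  have hA : A.det ≠ 0 := left_ne_zero_of_mul_eq_one hdet
  have hD : D.det ≠ 0 := right_ne_zero_of_mul_eq_one hdet
  rw [loc₁, loc₁, h0]
  by_cases hv0 : v 0 = 0
  · rw [if_pos hv0, if_pos (by simp [hv0]), h1 hv0, h3 hv0]
    rw [OnQuadric, hv0, zero_mul] at hv
    obtain ⟨s, x, y, hxy, ha, hb, he⟩ := exists_rankOne (sub_eq_zero.mp hv)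
    rw [ha, hb, he, rankOneChar_eq hψ hxy, ← conj_char_mul_of_eq_one ψ hdet, ← map_mul,
      ← rankOneChar_eq hψ (s := A.det * s) (x := x * D 0 0 + y * D 1 0)
        (y := x * D 0 1 + y * D 1 1)]
    · congr 1 <;> ring
    · by_contra! hc
      obtain ⟨f1, f3⟩ := hc
      have hx : x = 0 := by
        have : x * D.det = 0 := by rw [det_fin_two]; linear_combination D 1 1 * f1 - D 1 0 * f3
        exact (mul_eq_zero.mp this).resolve_right hD
      have hy : y = 0 := by
        have : y * D.det = 0 := by rw [det_fin_two]; linear_combination D 0 0 * f3 - D 0 1 * f1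
        exact (mul_eq_zero.mp this).resolve_right hD
      simp [hx, hy] at hxy
  · rw [if_neg hv0, if_neg (mul_ne_zero hA hv0), mul_zero]

theorem locSum_act {ψ : DirichletCharacter ℂ q} {κ : Fin 3 → ℂ} (hκ : κ 1 ≠ 0 → ψ ^ 2 = 1)
    {A D : Matrix (Fin 2) (Fin 2) (ZMod q)} (h : Aᵀ * D = 1)
    (B : Matrix (Fin 2) (Fin 2) (ZMod q)) {v : Fin 5 → ZMod q}
    (hv : OnQuadric v) : locSum ψ κ (act A B 0 D v) = conj (ψ D.det) * locSum ψ κ v := by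
  have h2 : loc₂ ψ (act A B 0 D v) = conj (ψ D.det) * loc₂ ψ v := by
    rw [loc₂, (act_upper h B v).1, map_mul,
      conj_char_mul_of_eq_one ψ (entries_of_transpose_mul h).1, loc₂]
  have h1 : κ 1 * loc₁ ψ (act A B 0 D v) = conj (ψ D.det) * (κ 1 * loc₁ ψ v) := by
    by_cases hk : κ 1 = 0
    · simp [hk]
    · rw [loc₁_act (hκ hk) h B hv]; ring
  rw [locSum, locSum, h1, h2, loc₀_act ψ h B hv]
  ring

end Local

/-! ### The global function attached to a family of local coefficients -/

section Family

variable {N : ℕ}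

/-- The product over the primes `q ∣ N` of linear combinations of the local functions. -/
def famFun (χ : DirichletCharacter ℂ N) (κ : ℕ → Fin 3 → ℂ) (w : Fin 5 → ℤ) : ℂ :=
  ∏ q ∈ N.primeFactors, locSum (component χ q) (κ q) (fun i => (w i : ZMod q))

/-- The rank one local functions occur only for quadratic characters. -/
def IsAdmissibleFam (χ : DirichletCharacter ℂ N) (κ : ℕ → Fin 3 → ℂ) : Prop :=
  ∀ q ∈ N.primeFactors, κ q 1 ≠ 0 → component χ q ^ 2 = 1

/-- Each local factor is multiplied by `χ_q(-1)`, and these multiply to `χ(-1)`. -/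
theorem famFun_hasParity (hN : Squarefree N) {k : ℕ} {χ : DirichletCharacter ℂ N}
    (hχ : χ (-1) = (-1) ^ k) (κ : ℕ → Fin 3 → ℂ) : HasParity k (famFun χ κ) := by
  intro w
  have h1 : ((-1) ^ k : ℂ) = ∏ q ∈ N.primeFactors, component χ q (-1 : ZMod q) := by
    rw [← hχ]
    simpa using character_eq_prod hN χ (-1)
  rw [h1, famFun, famFun, ← Finset.prod_mul_distrib]
  apply Finset.prod_congr rfl
  intro q hq
  have : Fact q.Prime := ⟨Nat.prime_of_mem_primeFactors hq⟩
  rw [← locSum_neg]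
  congr 1
  ext i
  simp

theorem onQuadric_cast {v : Fin 5 → ℤ} (h : OnQuadric v) (q : ℕ) :
    OnQuadric (fun i => (v i : ZMod q)) := by
  have := congrArg (Int.cast : ℤ → ZMod q) h
  simp only [OnQuadric]
  push_cast at this
  exact this

theorem map_eq_zero_of_dvd {C : Matrix (Fin 2) (Fin 2) ℤ} {q : ℕ} (h : ∀ i j, (q : ℤ) ∣ C i j) :
    C.map (Int.cast : ℤ → ZMod q) = 0 := by
  ext i j
  simpa using (ZMod.intCast_zmod_eq_zero_iff_dvd _ _).mpr (h i j)

theorem transpose_mul_map {γ : Sp} {q : ℕ} (h : ∀ i j, (q : ℤ) ∣ blockC γ i j) :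
    ((blockA γ).map (Int.cast : ℤ → ZMod q))ᵀ * (blockD γ).map (Int.cast : ℤ → ZMod q) = 1 := by
  have h1 := congrArg (fun X : Matrix (Fin 2) (Fin 2) ℤ => X.map (Int.castRingHom (ZMod q)))
    (Sp_relations' γ).2.2
  have h2 := map_eq_zero_of_dvd h
  simp only [Matrix.map_sub _ (map_sub (Int.castRingHom (ZMod q))), Matrix.map_mul,
    transpose_map, Matrix.map_one _ (map_zero (Int.castRingHom (ZMod q))) (map_one _)] at h1
  have h3 : (blockC γ).map (Int.castRingHom (ZMod q)) = 0 := h2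
  rw [h3] at h1
  simpa using h1

/-- Modulo each `q ∣ N` the element `γ` lies in the Siegel parabolic, so `locSum_act` applies prime
by prime. -/
theorem famFun_mul_Gamma0 (hN : Squarefree N) {χ : DirichletCharacter ℂ N} {κ : ℕ → Fin 3 → ℂ}
    (hκ : IsAdmissibleFam χ κ) (γ' : Sp) {γ : Sp} (hγ : γ ∈ Gamma0 N) :
    famFun χ κ (plZ (γ' * γ)) = conj (χ ((blockD γ).det : ZMod N)) * famFun χ κ (plZ γ') := by
  rw [character_eq_prod hN, map_prod, famFun, famFun, ← Finset.prod_mul_distrib]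
  apply Finset.prod_congr rfl
  intro q hq
  have : Fact q.Prime := ⟨Nat.prime_of_mem_primeFactors hq⟩
  have hC : ∀ i j, (q : ℤ) ∣ blockC γ i j := fun i j =>
    (Int.natCast_dvd_natCast.mpr (Nat.dvd_of_mem_primeFactors hq)).trans (hγ i j)
  have h1 := locSum_act (hκ q hq) (transpose_mul_map hC) ((blockB γ).map (Int.cast : ℤ → ZMod q))
    (onQuadric_cast (plZ_onQuadric γ') q)
  have h2 := act_map (Int.castRingHom (ZMod q)) (blockA γ) (blockB γ) (blockC γ) (blockD γ)
    (plZ γ')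
  rw [← plZ_mul] at h2
  have h3 : (blockC γ).map (Int.castRingHom (ZMod q)) = 0 := map_eq_zero_of_dvd hC
  rw [h3] at h2
  have h4 : ((blockD γ).map (Int.cast : ℤ → ZMod q)).det = ((blockD γ).det : ZMod q) :=
    (Int.cast_det (R := ZMod q) (blockD γ)).symm
  rw [h4] at h1
  rw [← h1]
  congr 1
  exact h2.symm

end Family

end

end SiegelEisenstein

namespace SiegelEisenstein

noncomputable section

/-! ### Congruences -/

theorem exists_crt (s : Finset ℕ) (m c : ℕ → ℤ)
    (h : ∀ a ∈ s, ∀ b ∈ s, a ≠ b → IsCoprime (m a) (m b)) :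
    ∃ n : ℤ, ∀ q ∈ s, m q ∣ n - c q := by
  induction s using Finset.induction_on with
  | empty => exact ⟨0, by simp⟩
  | insert a s ha ih =>
    obtain ⟨n, hn⟩ := ih (fun x hx y hy => h x (Finset.mem_insert_of_mem hx) y
      (Finset.mem_insert_of_mem hy))
    have hcop : IsCoprime (m a) (∏ q ∈ s, m q) := by
      apply IsCoprime.prod_right
      intro q hq
      exact h a (Finset.mem_insert_self a s) q (Finset.mem_insert_of_mem hq)
        (fun e => ha (e ▸ hq))
    obtain ⟨x, y, hxy⟩ := hcop
    refine ⟨n + y * (∏ q ∈ s, m q) * (c a - n), ?_⟩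
    intro q hq
    rcases Finset.mem_insert.mp hq with rfl | hq
    · exact ⟨-x * (c q - n), by linear_combination (c q - n) * hxy⟩
    · have h1 := hn q hq
      have h2 : m q ∣ ∏ q ∈ s, m q := Finset.dvd_prod_of_mem m hq
      have : n + y * (∏ q ∈ s, m q) * (c a - n) - c q
          = (n - c q) + (∏ q ∈ s, m q) * (y * (c a - n)) := by ring
      rw [this]
      exact dvd_add h1 (h2.mul_right _)

theorem isCoprime_of_primes {a b : ℕ} (ha : a.Prime) (hb : b.Prime) (h : a ≠ b) :
    IsCoprime (a : ℤ) (b : ℤ) :=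
  Nat.isCoprime_iff_coprime.mpr ((Nat.coprime_primes ha hb).mpr h)

theorem exists_crt_primeFactors (N : ℕ) (c : ∀ q : ℕ, ZMod q) :
    ∃ n : ℤ, ∀ q ∈ N.primeFactors, (n : ZMod q) = c q := by
  choose c' hc' using fun q => ZMod.intCast_surjective (c q)
  obtain ⟨n, hn⟩ := exists_crt N.primeFactors (fun q => (q : ℤ)) c' (by
    intro a ha b hb hab
    exact isCoprime_of_primes (Nat.prime_of_mem_primeFactors ha)
      (Nat.prime_of_mem_primeFactors hb) hab)
  refine ⟨n, fun q hq => ?_⟩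
  rw [← hc' q]
  exact ((ZMod.intCast_eq_intCast_iff_dvd_sub _ _ _).mpr (hn q hq)).symm

theorem dvd_of_primeFactors {N : ℕ} (hN : Squarefree N) {n : ℤ}
    (h : ∀ q ∈ N.primeFactors, (n : ZMod q) = 0) : (N : ℤ) ∣ n := by
  rw [← Nat.prod_primeFactors_of_squarefree hN]
  push_cast
  apply Finset.prod_dvd_of_coprime
  · intro a ha b hb hab
    exact isCoprime_of_primes (Nat.prime_of_mem_primeFactors ha)
      (Nat.prime_of_mem_primeFactors hb) hab
  · intro q hq
    exact (ZMod.intCast_zmod_eq_zero_iff_dvd _ _).mp (h q hq)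

/-- A vector that is nonzero modulo every prime dividing `N` is, modulo `N`, the first row of a
unimodular matrix. -/
theorem exists_unimodular_row {N : ℕ} (hN : N ≠ 0) (x y : ∀ q : ℕ, ZMod q)
    (h : ∀ q ∈ N.primeFactors, x q ≠ 0 ∨ y q ≠ 0) :
    ∃ U : Matrix (Fin 2) (Fin 2) ℤ, U.det = 1 ∧
      ∀ q ∈ N.primeFactors, (U 0 0 : ZMod q) = x q ∧ (U 0 1 : ZMod q) = y q := by
  obtain ⟨a, ha⟩ := exists_crt_primeFactors N x
  obtain ⟨b₀, hb₀⟩ := exists_crt_primeFactors N y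
  -- A nonzero second entry is needed for its set of prime divisors to be finite; if the lift is `0`
  -- it is replaced by `N`.
  obtain ⟨b, hb0, hb⟩ : ∃ b : ℤ, b ≠ 0 ∧ ∀ q ∈ N.primeFactors, (b : ZMod q) = y q := by
    by_cases h0 : b₀ = 0
    · refine ⟨N, by exact_mod_cast hN, fun q hq => ?_⟩
      rw [← hb₀ q hq, h0]
      simpa using (ZMod.natCast_eq_zero_iff _ _).mpr (Nat.dvd_of_mem_primeFactors hq)
    · exact ⟨b₀, h0, hb₀⟩
  -- A prime divisor of `b` divides exactly one of `a` and `t`, and if it divides `a` it cannot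
  -- divide `N`, the vector being nonzero there. Hence `a + N t` is prime to `b`.
  set t : ℤ := ∏ l ∈ b.natAbs.primeFactors.filter (fun l : ℕ => ¬ (l : ℤ) ∣ a), (l : ℤ) with ht
  have hcop : IsCoprime (a + N * t) b := by
    rw [Int.isCoprime_iff_gcd_eq_one]
    by_contra hg
    obtain ⟨l, hl, hlg⟩ := Nat.exists_prime_and_dvd hg
    have hlp : Prime (l : ℤ) := Nat.prime_iff_prime_int.mp hl
    have h1 : (l : ℤ) ∣ a + N * t := (Int.natCast_dvd_natCast.mpr hlg).trans (Int.gcd_dvd_left _ _)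
    have h2 : (l : ℤ) ∣ b := (Int.natCast_dvd_natCast.mpr hlg).trans (Int.gcd_dvd_right _ _)
    have hlb : l ∈ b.natAbs.primeFactors := by
      rw [Nat.mem_primeFactors]
      exact ⟨hl, Int.natCast_dvd.mp h2, by simpa using hb0⟩
    by_cases hla : (l : ℤ) ∣ a
    · have h3 : (l : ℤ) ∣ N * t := (dvd_add_right hla).mp h1
      rcases hlp.dvd_or_dvd h3 with h4 | h4
      · have hlN : l ∈ N.primeFactors := by
          rw [Nat.mem_primeFactors]
          exact ⟨hl, Int.natCast_dvd_natCast.mp h4, hN⟩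
        rcases h l hlN with h5 | h5
        · apply h5
          rw [← ha l hlN]
          exact (ZMod.intCast_zmod_eq_zero_iff_dvd _ _).mpr hla
        · apply h5
          rw [← hb l hlN]
          exact (ZMod.intCast_zmod_eq_zero_iff_dvd _ _).mpr h2
      · obtain ⟨l', hl', hd⟩ := (Prime.dvd_finsetProd_iff hlp _).mp h4
        rw [Finset.mem_filter] at hl'
        have := (Nat.prime_dvd_prime_iff_eq hl (Nat.prime_of_mem_primeFactors hl'.1)).mp
          (Int.natCast_dvd_natCast.mp hd)
        subst this
        exact hl'.2 hla
    · have h4 : (l : ℤ) ∣ t :=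
        Finset.dvd_prod_of_mem (fun l : ℕ => (l : ℤ)) (Finset.mem_filter.mpr ⟨hlb, hla⟩)
      exact hla ((dvd_add_left (h4.mul_left _)).mp h1)
  obtain ⟨u, v, huv⟩ := hcop
  refine ⟨!![a + N * t, b; -v, u], ?_, fun q hq => ⟨?_, ?_⟩⟩
  · rw [det_fin_two_of]; linear_combination huv
  · have : (N : ZMod q) = 0 := (ZMod.natCast_eq_zero_iff _ _).mpr (Nat.dvd_of_mem_primeFactors hq)
    simp [ha q hq, this]
  · simp [hb q hq]

/-! ### Orbits of cusps -/

open Classical in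
/-- The rank modulo `q` of the block `C`, read off from the Plücker coordinates. -/
def rankMod (q : ℕ) (v : Fin 5 → ℤ) : Fin 3 :=
  if (v 0 : ZMod q) ≠ 0 then 2
  else if (v 1 : ZMod q) = 0 ∧ (v 2 : ZMod q) = 0 ∧ (v 3 : ZMod q) = 0 then 0 else 1

theorem det_map_cast (C : Matrix (Fin 2) (Fin 2) ℤ) (q : ℕ) :
    (C.map (Int.cast : ℤ → ZMod q)).det = ((C 0 0 * C 1 1 - C 0 1 * C 1 0 : ℤ) : ZMod q) := by
  simp [det_fin_two]

/-- The middle coordinates vanish, so `adj(C) D = 0`, while `det D ≠ 0`; hence `adj(C)` and `C`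
vanish. -/
theorem eq_zero_of_plucker {R : Type*} [CommRing R] [IsDomain R] {C D : Matrix (Fin 2) (Fin 2) R}
    (h : C * Dᵀ = D * Cᵀ) (h1 : plucker C D 1 = 0) (h2 : plucker C D 2 = 0)
    (h3 : plucker C D 3 = 0) (h4 : plucker C D 4 ≠ 0) : C = 0 := by
  have hsym := isotropic_entry h
  simp only [plucker, Matrix.cons_val] at h1 h2 h3 h4
  have key : ∀ x : R, x * (D 0 0 * D 1 1 - D 0 1 * D 1 0) = 0 → x = 0 := fun x hx =>
    (mul_eq_zero.mp hx).resolve_right h4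
  ext i j
  fin_cases i <;> fin_cases j <;> apply key
  · change C 0 0 * _ = 0
    linear_combination D 0 0 * h3 - D 0 1 * hsym - D 0 1 * h2
  · change C 0 1 * _ = 0
    linear_combination D 0 1 * h1 - D 0 0 * h2
  · change C 1 0 * _ = 0
    linear_combination D 1 0 * h3 - D 1 1 * hsym - D 1 1 * h2
  · change C 1 1 * _ = 0
    linear_combination D 1 1 * h1 - D 1 0 * h2

theorem isotropic_map (γ : Sp) (q : ℕ) :
    (blockC γ).map (Int.castRingHom (ZMod q)) * ((blockD γ).map (Int.castRingHom (ZMod q)))ᵀ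
      = (blockD γ).map (Int.castRingHom (ZMod q))
        * ((blockC γ).map (Int.castRingHom (ZMod q)))ᵀ := by
  have := congrArg (fun X : Matrix (Fin 2) (Fin 2) ℤ => X.map (Int.castRingHom (ZMod q)))
    (Sp_relations γ).2.1
  simpa only [Matrix.map_mul, transpose_map] using this

/-- Primitivity supplies the missing hypothesis that `det D` is nonzero modulo `q`. -/
theorem blockC_map_eq_zero {q : ℕ} [Fact q.Prime] {γ : Sp}
    (h0 : (plZ γ 0 : ZMod q) = 0) (h1 : (plZ γ 1 : ZMod q) = 0) (h2 : (plZ γ 2 : ZMod q) = 0)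
    (h3 : (plZ γ 3 : ZMod q) = 0) : (blockC γ).map (Int.cast : ℤ → ZMod q) = 0 := by
  have e := plucker_map (Int.castRingHom (ZMod q)) (blockC γ) (blockD γ)
  apply eq_zero_of_plucker (isotropic_map γ q)
  · rw [e]; exact h1
  · rw [e]; exact h2
  · rw [e]; exact h3
  · rw [e]
    intro h4
    obtain ⟨i, hi⟩ := plZ_primitive γ q (Fact.out)
    apply hi
    rw [← ZMod.intCast_zmod_eq_zero_iff_dvd]
    fin_cases i
    exacts [h0, h1, h2, h3, h4]

/-! ### Normal forms of the lower left block over a field. -/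

section LocalOrbit

variable {F : Type*} [Field F]

theorem exists_rank_one_factor {C : Matrix (Fin 2) (Fin 2) F} (h0 : C ≠ 0) (hdet : C.det = 0) :
    ∃ x n : Fin 2 → F, (x 0 ≠ 0 ∨ x 1 ≠ 0) ∧ (n 0 ≠ 0 ∨ n 1 ≠ 0) ∧ ∀ i j, C i j = x i * n j := by
  rw [det_fin_two] at hdet
  by_cases hr : C 0 0 = 0 ∧ C 0 1 = 0
  · refine ⟨![0, 1], C 1, by simp, ?_, ?_⟩
    · by_contra! hc
      apply h0
      ext i j
      fin_cases i <;> fin_cases j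
      exacts [hr.1, hr.2, hc.1, hc.2]
    · intro i j
      fin_cases i <;> fin_cases j <;> simp [hr.1, hr.2]
  · by_cases h00 : C 0 0 = 0
    · have h01 : C 0 1 ≠ 0 := fun h => hr ⟨h00, h⟩
      have h10 : C 1 0 = 0 := by
        rw [h00, zero_mul, zero_sub, neg_eq_zero] at hdet
        exact (mul_eq_zero.mp hdet).resolve_left h01
      refine ⟨![1, C 1 1 / C 0 1], C 0, by simp, Or.inr h01, ?_⟩
      intro i j
      fin_cases i <;> fin_cases j <;> simp [h00, h10, h01]
    · refine ⟨![1, C 1 0 / C 0 0], C 0, by simp, Or.inl h00, ?_⟩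
      intro i j
      fin_cases i <;> fin_cases j <;> simp [h00]
      field_simp
      linear_combination hdet

/-- With `C = x ᵗn` and first row of `U` equal to `x`, the matrix on the right is `x (ᵗx A + (ᵗx S
x) ᵗn)`. Symmetry of `ᵗA C` forces `ᵗx A = l · ᵗn`, so it suffices that `ᵗx S x = 1 - l`, which a
diagonal `S` achieves because `x ≠ 0`. -/
theorem exists_sym_of_rank_one {A C : Matrix (Fin 2) (Fin 2) F} (h : Aᵀ * C = Cᵀ * A)
    {x n : Fin 2 → F} (hx : x 0 ≠ 0 ∨ x 1 ≠ 0) (hn : n 0 ≠ 0 ∨ n 1 ≠ 0)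
    (hC : ∀ i j, C i j = x i * n j) {U : Matrix (Fin 2) (Fin 2) F} (hU : U 0 = x) :
    ∃ S : Matrix (Fin 2) (Fin 2) F, Sᵀ = S ∧
      C = Uᵀ * diagonal ![1, 0] * U * (A + S * C) := by
  have h1 : (A 0 0 * x 0 + A 1 0 * x 1) * n 1 = (A 0 1 * x 0 + A 1 1 * x 1) * n 0 := by
    have := congrFun (congrFun h 0) 1
    simp [Matrix.mul_apply, Fin.sum_univ_two, hC] at this
    linear_combination this
  obtain ⟨l, hl0, hl1⟩ : ∃ l, A 0 0 * x 0 + A 1 0 * x 1 = l * n 0 ∧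
      A 0 1 * x 0 + A 1 1 * x 1 = l * n 1 := by
    rcases hn with hn | hn
    · refine ⟨(A 0 0 * x 0 + A 1 0 * x 1) / n 0, by field_simp, ?_⟩
      field_simp; linear_combination -h1
    · refine ⟨(A 0 1 * x 0 + A 1 1 * x 1) / n 1, ?_, by field_simp⟩
      field_simp; linear_combination h1
  obtain ⟨s, t, hst⟩ : ∃ s t : F, s * x 0 ^ 2 + t * x 1 ^ 2 = 1 - l := by
    rcases hx with hx | hx
    · exact ⟨(1 - l) / x 0 ^ 2, 0, by field_simp; ring⟩
    · exact ⟨0, (1 - l) / x 1 ^ 2, by field_simp; ring⟩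
  have hU0 : U 0 0 = x 0 := congrFun hU 0
  have hU1 : U 0 1 = x 1 := congrFun hU 1
  refine ⟨diagonal ![s, t], by simp, ?_⟩
  ext i j
  have key : ∀ j, A 0 j * x 0 + A 1 j * x 1 = l * n j := by
    intro j; fin_cases j; exacts [hl0, hl1]
  simp [Matrix.mul_apply, Fin.sum_univ_two, hC, diagonal_apply]
  fin_cases i <;> simp [hU0, hU1]
  · linear_combination (-x 0) * key j - x 0 * n j * hst
  · linear_combination (-x 1) * key j - x 1 * n j * hst

/-- Solving for `S` gives `(ᵗU U)⁻¹ - A C⁻¹`; the second term is symmetric because `ᵗA C` is. -/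
theorem exists_sym_of_invertible {A C : Matrix (Fin 2) (Fin 2) F} (h : Aᵀ * C = Cᵀ * A)
    (hC : C.det ≠ 0) {U : Matrix (Fin 2) (Fin 2) F} (hU : U.det = 1) :
    ∃ S : Matrix (Fin 2) (Fin 2) F, Sᵀ = S ∧ C = Uᵀ * U * (A + S * C) := by
  have hCu : IsUnit C.det := isUnit_iff_ne_zero.mpr hC
  have hCu' : IsUnit Cᵀ.det := by rwa [det_transpose]
  have hUu : IsUnit (Uᵀ * U).det := by simp [hU]
  refine ⟨(Uᵀ * U)⁻¹ - A * C⁻¹, ?_, ?_⟩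
  · rw [transpose_sub, transpose_nonsing_inv, transpose_mul, transpose_transpose, transpose_mul,
      transpose_nonsing_inv]
    congr 1
    calc Cᵀ⁻¹ * Aᵀ = Cᵀ⁻¹ * (Aᵀ * C) * C⁻¹ := by
          rw [← mul_assoc, mul_nonsing_inv_cancel_right _ _ hCu]
      _ = A * C⁻¹ := by rw [h, nonsing_inv_mul_cancel_left _ _ hCu']
  · rw [sub_mul, nonsing_inv_mul_cancel_right _ _ hCu, add_sub_cancel,
      mul_nonsing_inv_cancel_left _ _ hUu]

end LocalOrbit

/-- The cusp `(1 0; M 1)` with `M = diag(m₀, m₁)`. -/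
def diagCusp (m : Fin 2 → ℤ) : Sp := spLower (diagonal m) (diagonal_transpose m)

theorem plZ_diagCusp (m : Fin 2 → ℤ) : plZ (diagCusp m) = ![m 0 * m 1, m 1, 0, m 0, 1] := by
  rw [plZ, diagCusp, blockC_spLower, blockD_spLower]
  ext i
  fin_cases i <;> simp [plucker]

/-- The diagonal entries of a cusp in normal form, of given ranks modulo the primes. -/
def IsNormalCusp (m : Fin 2 → ℤ) (q : ℕ) (r : Fin 3) : Prop :=
  (m 0 : ZMod q) = (if r = 0 then 0 else 1) ∧ (m 1 : ZMod q) = (if r = 2 then 1 else 0)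

/-- The cusps are classified by the ranks of `C` modulo the primes `q ∣ N`. Multiplying `γ` on the
left by the Levi element of `U` and a translation by `T`, then by the inverse of the diagonal cusp,
gives an element of `Gamma0 N` as soon as `C ≡ ᵗU diag(m) U (A + T C)` modulo every `q`. Locally
this is solvable, with a condition on `U` only at primes of rank one and there only on its first
row. The first rows are glued by `exists_unimodular_row`, the translations by the Chinese remainder
theorem. -/
theorem exists_diagCusp_orbit {N : ℕ} (hN : Squarefree N) (γ : Sp) {m : Fin 2 → ℤ}
    (hm : ∀ q ∈ N.primeFactors, IsNormalCusp m q (rankMod q (plZ γ))) :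
    ∃ δ ∈ GammaInf, ∃ γ' ∈ Gamma0 N, γ = δ * diagCusp m * γ' := by
  classical
  have hloc : ∀ q : ℕ, ∃ x y : ZMod q, (q ∈ N.primeFactors → (x ≠ 0 ∨ y ≠ 0) ∧
      ∀ U : Matrix (Fin 2) (Fin 2) (ZMod q), U.det = 1 → U 0 0 = x → U 0 1 = y →
      ∃ S : Matrix (Fin 2) (Fin 2) (ZMod q), Sᵀ = S ∧
        (blockC γ).map (Int.cast : ℤ → ZMod q) =
          Uᵀ * diagonal ![(m 0 : ZMod q), (m 1 : ZMod q)] * U *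
            ((blockA γ).map (Int.cast : ℤ → ZMod q)
              + S * (blockC γ).map (Int.cast : ℤ → ZMod q))) := by
    intro q
    by_cases hq : q ∈ N.primeFactors
    swap
    · exact ⟨0, 0, fun h => absurd h hq⟩
    have : Fact q.Prime := ⟨Nat.prime_of_mem_primeFactors hq⟩
    have hsym : ((blockA γ).map (Int.cast : ℤ → ZMod q))ᵀ * (blockC γ).map (Int.cast : ℤ → ZMod q)
        = ((blockC γ).map (Int.cast : ℤ → ZMod q))ᵀ * (blockA γ).map (Int.cast : ℤ → ZMod q) := by
      have := congrArg (fun X : Matrix (Fin 2) (Fin 2) ℤ => X.map (Int.castRingHom (ZMod q)))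
        (Sp_relations' γ).1
      simp only [Matrix.map_mul, transpose_map] at this
      exact this
    have hdet : ((blockC γ).map (Int.cast : ℤ → ZMod q)).det = (plZ γ 0 : ZMod q) := by
      rw [det_map_cast]; rfl
    obtain ⟨hm0, hm1⟩ := hm q hq
    by_cases h0 : (plZ γ 0 : ZMod q) = 0
    · by_cases h1 : (plZ γ 1 : ZMod q) = 0 ∧ (plZ γ 2 : ZMod q) = 0 ∧ (plZ γ 3 : ZMod q) = 0
      · have hr : rankMod q (plZ γ) = 0 := by rw [rankMod, if_neg (by simpa using h0), if_pos h1]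
        have hC := blockC_map_eq_zero h0 h1.1 h1.2.1 h1.2.2
        -- In rank zero any `U` works; `(1, 0)` is an arbitrary nonzero row. The same choice serves
        -- in rank two.
        refine ⟨1, 0, fun _ => ⟨by simp, fun U _ _ _ => ⟨0, by simp, ?_⟩⟩⟩
        rw [hr] at hm0 hm1
        have hd : diagonal ![(m 0 : ZMod q), (m 1 : ZMod q)] = 0 := by
          ext i j
          fin_cases i <;> fin_cases j <;> simp [hm0, hm1]
        rw [hC, hd]
        simp
      · have hr : rankMod q (plZ γ) = 1 := by rw [rankMod, if_neg (by simpa using h0), if_neg h1]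
        have hC0 : (blockC γ).map (Int.cast : ℤ → ZMod q) ≠ 0 := by
          intro hC
          apply h1
          have e : ∀ i j, (blockC γ i j : ZMod q) = 0 := fun i j => congrFun (congrFun hC i) j
          simp [plZ, plucker, e]
        obtain ⟨x, n, hx, hn, hC⟩ := exists_rank_one_factor hC0 (hdet.trans h0)
        refine ⟨x 0, x 1, fun _ => ⟨hx, fun U _ hU0 hU1 => ?_⟩⟩
        rw [hr] at hm0 hm1
        have hUx : U 0 = x := by ext j; fin_cases j; exacts [hU0, hU1]
        obtain ⟨S, hS, h⟩ := exists_sym_of_rank_one hsym hx hn hC hUx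
        refine ⟨S, hS, ?_⟩
        have hd : ![(m 0 : ZMod q), (m 1 : ZMod q)] = ![1, 0] := by simp [hm0, hm1]
        rw [hd]
        exact h
    · have hr : rankMod q (plZ γ) = 2 := by rw [rankMod, if_pos h0]
      refine ⟨1, 0, fun _ => ⟨by simp, fun U hU _ _ => ?_⟩⟩
      rw [hr] at hm0 hm1
      obtain ⟨S, hS, h⟩ := exists_sym_of_invertible hsym (by rwa [hdet]) hU
      refine ⟨S, hS, ?_⟩
      have hd : diagonal ![(m 0 : ZMod q), (m 1 : ZMod q)] = 1 := by
        ext i j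
        fin_cases i <;> fin_cases j <;> simp [hm0, hm1]
      rw [hd, mul_one]
      exact h
  choose x y hxy using hloc
  obtain ⟨U, hU, hUq⟩ := exists_unimodular_row hN.ne_zero x y (fun q hq => (hxy q hq).1)
  have hS : ∀ q : ℕ, ∃ S : Matrix (Fin 2) (Fin 2) (ZMod q), q ∈ N.primeFactors → Sᵀ = S ∧
      (blockC γ).map (Int.cast : ℤ → ZMod q) =
        (U.map (Int.cast : ℤ → ZMod q))ᵀ * diagonal ![(m 0 : ZMod q), (m 1 : ZMod q)]
          * U.map (Int.cast : ℤ → ZMod q) * ((blockA γ).map (Int.cast : ℤ → ZMod q)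
              + S * (blockC γ).map (Int.cast : ℤ → ZMod q)) := by
    intro q
    by_cases hq : q ∈ N.primeFactors
    · obtain ⟨S, hS⟩ := (hxy q hq).2 (U.map (Int.cast : ℤ → ZMod q))
        (by rw [det_map_cast, ← det_fin_two, hU, Int.cast_one]) (hUq q hq).1 (hUq q hq).2
      exact ⟨S, fun _ => hS⟩
    · exact ⟨0, fun h => absurd h hq⟩
  choose S hS using hS
  obtain ⟨s0, hs0⟩ := exists_crt_primeFactors N (fun q => S q 0 0)
  obtain ⟨s1, hs1⟩ := exists_crt_primeFactors N (fun q => S q 0 1)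
  obtain ⟨s2, hs2⟩ := exists_crt_primeFactors N (fun q => S q 1 1)
  set T : Matrix (Fin 2) (Fin 2) ℤ := !![s0, s1; s1, s2] with hT
  have hTs : Tᵀ = T := by ext i j; fin_cases i <;> fin_cases j <;> rfl
  have hTq : ∀ q ∈ N.primeFactors, T.map (Int.cast : ℤ → ZMod q) = S q := by
    intro q hq
    have hsym := congrFun (congrFun (hS q hq).1 1) 0
    rw [transpose_apply] at hsym
    ext i j
    fin_cases i <;> fin_cases j <;> simp [hT, hs0 q hq, hs1 q hq, hs2 q hq]
    exact hsym
  set π := spLevi U hU * spUpper T hTs with hπ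
  have hπC : blockC π = 0 := by
    rw [hπ, blockC_mul', blockC_spLevi, blockC_spUpper]
    simp
  refine ⟨π⁻¹, inv_mem hπC, (diagCusp m)⁻¹ * (π * γ), ?_, by group⟩
  have hinv : (diagCusp m)⁻¹ = spLower (-diagonal m) (by simp) := by
    apply Subtype.ext
    rw [Sp_inv_val, diagCusp, blockA_spLower, blockB_spLower, blockC_spLower, blockD_spLower]
    simp [spLower]
  have hblock : blockC ((diagCusp m)⁻¹ * (π * γ)) =
      U.adjugateᵀ * (blockC γ - Uᵀ * diagonal m * U * (blockA γ + T * blockC γ)) := by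
    simp only [hinv, blockC_mul', blockC_spLower, blockD_spLower, hπ, mul_assoc, blockA_mul,
      blockA_spLevi, blockB_spLevi, blockC_spLevi, blockD_spLevi, blockA_spUpper, blockB_spUpper,
      blockC_spUpper, blockD_spUpper]
    have hUU : U.adjugateᵀ * Uᵀ = 1 := by
      rw [← transpose_mul, mul_adjugate, hU]; simp
    rw [mul_sub, ← mul_assoc, ← mul_assoc, ← mul_assoc, hUU]
    noncomm_ring
  intro i j
  rw [hblock, Matrix.mul_apply]
  apply Finset.dvd_sum
  intro l _
  apply Dvd.dvd.mul_left
  apply dvd_of_primeFactors hN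
  intro q hq
  have h1 := (hS q hq).2
  rw [← hTq q hq] at h1
  have h2 : (diagonal ![(m 0 : ZMod q), (m 1 : ZMod q)] : Matrix (Fin 2) (Fin 2) (ZMod q))
      = (diagonal m).map (Int.castRingHom (ZMod q)) := by
    ext i j
    fin_cases i <;> fin_cases j <;> simp
  rw [h2] at h1
  have h3 : (blockC γ - Uᵀ * diagonal m * U * (blockA γ + T * blockC γ)).map
      (Int.castRingHom (ZMod q)) = 0 := by
    rw [Matrix.map_sub _ (map_sub (Int.castRingHom (ZMod q)))]
    simp only [Matrix.map_mul, Matrix.map_add _ (map_add (Int.castRingHom (ZMod q)))]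
    exact sub_eq_zero.mpr h1
  exact congrFun (congrFun h3 l) j

end

end SiegelEisenstein

namespace SiegelEisenstein

noncomputable section

/-! ### Counting integral points on the quadric -/

theorem succ_pow_four_le (e : ℕ) : (e + 1) ^ 4 ≤ 256 * 2 ^ e := by
  have h1 : e + 1 ≤ 4 * 2 ^ (e / 4) := by
    have : e / 4 + 1 ≤ 2 ^ (e / 4) := Nat.lt_two_pow_self
    omega
  calc (e + 1) ^ 4 ≤ (4 * 2 ^ (e / 4)) ^ 4 := Nat.pow_le_pow_left h1 4
    _ = 256 * 2 ^ (e / 4 * 4) := by rw [mul_pow, ← pow_mul]; norm_num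
    _ ≤ 256 * 2 ^ e := by
      gcongr
      · norm_num
      · exact Nat.div_mul_le_self e 4

/-- For `p ≥ 16` one has `(e + 1)^4 ≤ 16^e ≤ p^e`; each of the fewer than `16` smaller primes costs
a factor `256`. The resulting bound `d(n) ≪ n^{1/4}` is what the point count needs. -/
theorem card_divisors_pow_four_le {n : ℕ} (hn : n ≠ 0) :
    n.divisors.card ^ 4 ≤ 256 ^ 16 * n := by
  have h1 : ∀ p ∈ n.primeFactors, (n.factorization p + 1) ^ 4 ≤
      (if p < 16 then 256 else 1) * p ^ n.factorization p := by
    intro p hp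
    have hp2 := (Nat.prime_of_mem_primeFactors hp).two_le
    split_ifs with h
    · exact (succ_pow_four_le _).trans (by gcongr)
    · rw [one_mul]
      calc (n.factorization p + 1) ^ 4 ≤ (2 ^ n.factorization p) ^ 4 := by
            gcongr; exact Nat.lt_two_pow_self
        _ = 16 ^ n.factorization p := by rw [← pow_mul, mul_comm, pow_mul]; norm_num
        _ ≤ p ^ n.factorization p := by gcongr; omega
  have h2 : ∏ p ∈ n.primeFactors, (if p < 16 then 256 else 1) ≤ 256 ^ 16 := by
    rw [Finset.prod_ite, Finset.prod_const, Finset.prod_const_one, mul_one]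
    apply Nat.pow_le_pow_right (by norm_num)
    calc _ ≤ (Finset.range 16).card := by
          apply Finset.card_le_card
          intro p hp
          simpa using (Finset.mem_filter.mp hp).2
      _ = 16 := by simp
  rw [Nat.card_divisors hn, ← Finset.prod_pow]
  calc _ ≤ ∏ p ∈ n.primeFactors, (if p < 16 then 256 else 1) * p ^ n.factorization p :=
        Finset.prod_le_prod' h1
    _ = (∏ p ∈ n.primeFactors, (if p < 16 then 256 else 1)) *
        ∏ p ∈ n.primeFactors, p ^ n.factorization p := Finset.prod_mul_distrib
    _ ≤ 256 ^ 16 * n := by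
      have h3 : ∏ p ∈ n.primeFactors, p ^ n.factorization p = n :=
        Nat.prod_factorization_pow_eq_self hn
      rw [h3]
      gcongr

/-- Summability by counting in fibres. -/
theorem summable_of_fiber {α β γ : Type*} (π : α → β) (e : α → γ) (s : β → Finset γ)
    (F : α → ℝ) (G : β → ℝ) (hF : ∀ a, 0 ≤ F a) (hG : ∀ b, 0 ≤ G b)
    (he : ∀ a, e a ∈ s (π a)) (hinj : ∀ a a', π a = π a' → e a = e a' → a = a')
    (hFG : ∀ a, F a ≤ G (π a)) (hsum : Summable fun b => ((s b).card : ℝ) * G b) :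
    Summable F := by
  have h1 : Summable fun x : (Σ b, s b) => G x.1 := by
    rw [summable_sigma_of_nonneg (fun x => hG x.1)]
    refine ⟨fun b => Summable.of_finite, ?_⟩
    simpa using hsum
  have h2 := h1.comp_injective (i := fun a : α => (⟨π a, ⟨e a, he a⟩⟩ : Σ b, s b)) (by
    intro a a' h
    simp only [Sigma.mk.injEq] at h
    obtain ⟨h3, h4⟩ := h
    apply hinj a a' h3
    have := (Subtype.heq_iff_coe_eq (by intro x; rw [h3])).mp h4
    exact this)
  exact Summable.of_nonneg_of_le hF hFG h2

/-- A convenient height on triples. -/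
def height₃ (t : ℤ × ℤ × ℤ) : ℝ := 1 + |(t.1 : ℝ)| + |(t.2.1 : ℝ)| + |(t.2.2 : ℝ)|

/-- A convenient height on vectors of Plücker coordinates. -/
def height₅ (v : Fin 5 → ℤ) : ℝ :=
  1 + |(v 0 : ℝ)| + |(v 1 : ℝ)| + |(v 2 : ℝ)| + |(v 3 : ℝ)| + |(v 4 : ℝ)|

theorem one_le_height₃ (t : ℤ × ℤ × ℤ) : 1 ≤ height₃ t := by
  have := abs_nonneg (t.1 : ℝ); have := abs_nonneg (t.2.1 : ℝ); have := abs_nonneg (t.2.2 : ℝ)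
  rw [height₃]; linarith

theorem summable_int_rpow : Summable fun n : ℤ => (1 + |(n : ℝ)|) ^ (-(7 / 6) : ℝ) := by
  have h0 : Summable fun n : ℕ => ((n : ℝ) + 1) ^ (-(7 / 6) : ℝ) := by
    have h := (summable_nat_add_iff 1).mpr
      ((Real.summable_nat_rpow (p := -(7 / 6))).mpr (by norm_num))
    simpa only [Nat.cast_add, Nat.cast_one] using h
  have e : ∀ n : ℕ, ((n : ℝ) + 1) = 1 + |(((n : ℕ) : ℤ) : ℝ)| := fun n => by
    rw [Int.cast_natCast, abs_of_nonneg (Nat.cast_nonneg n), add_comm]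
  refine Summable.of_nat_of_neg (f := fun n : ℤ => (1 + |(n : ℝ)|) ^ (-(7 / 6) : ℝ))
    (h0.congr fun n => by rw [e]) (h0.congr fun n => by rw [Int.cast_neg, abs_neg, e])

/-- The exponent `7 / 2` is three times `7 / 6 > 1`, one share for each coordinate. -/
theorem summable_height₃ : Summable fun t : ℤ × ℤ × ℤ => height₃ t ^ (-(7 / 2) : ℝ) := by
  have h0 : ∀ n : ℤ, (0 : ℝ) ≤ (1 + |(n : ℝ)|) ^ (-(7 / 6) : ℝ) := fun n => by positivity
  have h1 := summable_int_rpow.mul_of_nonneg summable_int_rpow h0 h0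
  have h2 := summable_int_rpow.mul_of_nonneg h1 h0 (fun x => mul_nonneg (h0 _) (h0 _))
  refine Summable.of_nonneg_of_le (fun t => ?_) (fun t => ?_) h2
  · exact Real.rpow_nonneg (by linarith [one_le_height₃ t]) _
  · have hpos : 0 < height₃ t := by linarith [one_le_height₃ t]
    have a1 := abs_nonneg (t.1 : ℝ)
    have a2 := abs_nonneg (t.2.1 : ℝ)
    have a3 := abs_nonneg (t.2.2 : ℝ)
    have e : height₃ t ^ (-(7 / 2) : ℝ) = height₃ t ^ (-(7 / 6) : ℝ) *
        (height₃ t ^ (-(7 / 6) : ℝ) * height₃ t ^ (-(7 / 6) : ℝ)) := by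
      rw [← Real.rpow_add hpos, ← Real.rpow_add hpos]; norm_num
    have key : ∀ x : ℝ, 0 < x → x ≤ height₃ t →
        height₃ t ^ (-(7 / 6) : ℝ) ≤ x ^ (-(7 / 6) : ℝ) := fun x hx hxt =>
      Real.rpow_le_rpow_of_nonpos hx hxt (by norm_num)
    rw [e]
    have k1 := key (1 + |(t.1 : ℝ)|) (by positivity) (by rw [height₃]; linarith)
    have k2 := key (1 + |(t.2.1 : ℝ)|) (by positivity) (by rw [height₃]; linarith)
    have k3 := key (1 + |(t.2.2 : ℝ)|) (by positivity) (by rw [height₃]; linarith)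
    have hp : 0 ≤ height₃ t ^ (-(7 / 6) : ℝ) := Real.rpow_nonneg hpos.le _
    gcongr

theorem summable_height₃_four : Summable fun t : ℤ × ℤ × ℤ => (height₃ t ^ 4)⁻¹ := by
  refine Summable.of_nonneg_of_le (fun t => ?_) (fun t => ?_) summable_height₃
  · have := one_le_height₃ t; positivity
  · have h1 := one_le_height₃ t
    rw [← Real.rpow_natCast, ← Real.rpow_neg (by linarith)]
    exact Real.rpow_le_rpow_of_exponent_le h1 (by norm_num)

/-- When `v 0 * v 4 = 0`, the quadric gives `v 1 * v 3 = (v 2)^2`. The triple `(v 0 + v 4, v 1 + v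
3, v 2)` therefore determines `v` up to which of `v 0`, `v 4` vanishes and the order of `v 1`, `v
3`, so its fibres have at most four points. -/
theorem summable_quadric_degenerate :
    Summable fun v : {v : Fin 5 → ℤ // OnQuadric v ∧ v 0 * v 4 = 0} => (height₅ v.1 ^ 4)⁻¹ := by
  refine summable_of_fiber (γ := Bool × Bool)
    (fun v => (v.1 0 + v.1 4, v.1 1 + v.1 3, v.1 2))
    (fun v => (decide (v.1 0 = 0), decide (v.1 1 ≤ v.1 3))) (fun _ => Finset.univ) _
    (fun t => (height₃ t ^ 4)⁻¹) ?_ ?_ ?_ ?_ ?_ ?_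
  · intro v; have : 0 ≤ height₅ v.1 := by rw [height₅]; positivity
    positivity
  · intro t; have := one_le_height₃ t; positivity
  · intro v; simp
  · rintro ⟨v, hv, hv0⟩ ⟨w, hw, hw0⟩ h1 h2
    simp only [Prod.mk.injEq, decide_eq_decide] at h1 h2
    obtain ⟨e1, e2, e3⟩ := h1
    obtain ⟨e4, e5⟩ := h2
    apply Subtype.ext
    simp only [OnQuadric] at hv hw
    have f0 : v 0 = w 0 ∧ v 4 = w 4 := by
      by_cases h : v 0 = 0
      · have h' := e4.mp h
        exact ⟨by rw [h, h'], by linarith⟩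
      · have h' : w 0 ≠ 0 := fun hh => h (e4.mpr hh)
        have g1 := (mul_eq_zero.mp hv0).resolve_left h
        have g2 := (mul_eq_zero.mp hw0).resolve_left h'
        exact ⟨by linarith, by rw [g1, g2]⟩
    have f1 : v 1 - v 3 = w 1 - w 3 := by
      have hsq : (v 1 - v 3) ^ 2 = (w 1 - w 3) ^ 2 := by
        have g1 : v 1 * v 3 = w 1 * w 3 := by
          rw [hv0] at hv
          rw [hw0] at hw
          rw [e3] at hv
          linarith
        calc (v 1 - v 3) ^ 2 = (v 1 + v 3) ^ 2 - 4 * (v 1 * v 3) := by ring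
          _ = (w 1 + w 3) ^ 2 - 4 * (w 1 * w 3) := by rw [e2, g1]
          _ = _ := by ring
      rcases sq_eq_sq_iff_eq_or_eq_neg.mp hsq with h | h
      · exact h
      · by_cases hle : v 1 ≤ v 3
        · have := e5.mp hle; omega
        · have : ¬ w 1 ≤ w 3 := fun hh => hle (e5.mpr hh)
          omega
    ext i
    fin_cases i
    · exact f0.1
    · change v 1 = w 1; omega
    · exact e3
    · change v 3 = w 3; omega
    · exact f0.2
  · intro v
    have h1 := one_le_height₃ (v.1 0 + v.1 4, v.1 1 + v.1 3, v.1 2)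
    gcongr
    simp only [height₃, height₅]
    push_cast
    have := abs_add_le (v.1 0 : ℝ) (v.1 4)
    have := abs_add_le (v.1 1 : ℝ) (v.1 3)
    linarith
  · exact summable_height₃_four.mul_left _

/-- The integers dividing `m`. -/
def intDivisors (m : ℤ) : Finset ℤ :=
  m.natAbs.divisors.image (fun n : ℕ => (n : ℤ)) ∪ m.natAbs.divisors.image (fun n : ℕ => -(n : ℤ))

theorem card_intDivisors_le (m : ℤ) : (intDivisors m).card ≤ 2 * m.natAbs.divisors.card := by
  refine (Finset.card_union_le _ _).trans ?_
  have h1 := Finset.card_image_le (s := m.natAbs.divisors) (f := fun n : ℕ => (n : ℤ))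
  have h2 := Finset.card_image_le (s := m.natAbs.divisors) (f := fun n : ℕ => -(n : ℤ))
  omega

theorem mem_intDivisors {m x : ℤ} (hm : m ≠ 0) (h : x ∣ m) : x ∈ intDivisors m := by
  have h1 : x.natAbs ∈ m.natAbs.divisors := by
    rw [Nat.mem_divisors]
    exact ⟨Int.natAbs_dvd_natAbs.mpr h, by simpa using hm⟩
  rw [intDivisors, Finset.mem_union, Finset.mem_image, Finset.mem_image]
  rcases Int.natAbs_eq x with hx | hx
  · exact Or.inl ⟨_, h1, hx.symm⟩
  · exact Or.inr ⟨_, h1, hx.symm⟩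

theorem card_intDivisors_le_rpow {m : ℤ} (hm : m ≠ 0) {h : ℝ} (h1 : 1 ≤ h) (hmh : |(m : ℝ)| ≤ h ^ 2) :
    ((intDivisors m).card : ℝ) ≤ 2 * 256 ^ 4 * h ^ (1 / 2 : ℝ) := by
  have h2 := card_divisors_pow_four_le (n := m.natAbs) (by simpa using hm)
  have h3 : ((m.natAbs.divisors.card : ℝ)) ^ 4 ≤ (256 ^ 4 * h ^ (1 / 2 : ℝ)) ^ 4 := by
    have : ((m.natAbs.divisors.card : ℝ)) ^ 4 ≤ 256 ^ 16 * (m.natAbs : ℝ) := by exact_mod_cast h2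
    refine this.trans ?_
    have e : (h ^ (1 / 2 : ℝ)) ^ 4 = h ^ 2 := by
      rw [← Real.rpow_natCast, ← Real.rpow_mul (by linarith)]
      norm_num
    rw [mul_pow, e, ← pow_mul]
    have hm' : (m.natAbs : ℝ) ≤ h ^ 2 := by rwa [Nat.cast_natAbs, Int.cast_abs]
    gcongr
  have hp : (0 : ℝ) ≤ 256 ^ 4 * h ^ (1 / 2 : ℝ) := by positivity
  have h4 := le_of_pow_le_pow_left₀ four_ne_zero hp h3
  have h5 : ((intDivisors m).card : ℝ) ≤ 2 * (m.natAbs.divisors.card : ℝ) := by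
    exact_mod_cast card_intDivisors_le m
  linarith

-- For fixed `v 1`, `v 2`, `v 3` the coordinate `v 0` is a divisor of the nonzero integer `v 1 * v 3
-- - (v 2)^2`, which is at most the square of the height `h`. The divisor bound leaves `O(h^{1/2})`
-- choices, and `-4 + 1/2 = -7/2` is still summable over triples.
open Classical in
theorem summable_quadric_nondegenerate :
    Summable fun v : {v : Fin 5 → ℤ // OnQuadric v ∧ v 0 * v 4 ≠ 0} => (height₅ v.1 ^ 4)⁻¹ := by
  refine summable_of_fiber (γ := ℤ) (fun v => (v.1 1, v.1 2, v.1 3)) (fun v => v.1 0)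
    (fun t => if t.1 * t.2.2 - t.2.1 ^ 2 = 0 then ∅ else intDivisors (t.1 * t.2.2 - t.2.1 ^ 2)) _
    (fun t => (height₃ t ^ 4)⁻¹) ?_ ?_ ?_ ?_ ?_ ?_
  · intro v; have : 0 ≤ height₅ v.1 := by rw [height₅]; positivity
    positivity
  · intro t; have := one_le_height₃ t; positivity
  · rintro ⟨v, hv, hv0⟩
    rw [OnQuadric] at hv
    simp only [hv, if_neg hv0]
    exact mem_intDivisors hv0 (dvd_mul_right _ _)
  · rintro ⟨v, hv, hv0⟩ ⟨w, hw, hw0⟩ h1 h2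
    simp only [Prod.mk.injEq] at h1 h2
    obtain ⟨e1, e2, e3⟩ := h1
    apply Subtype.ext
    simp only [OnQuadric] at hv hw
    have h4 : v 4 = w 4 := by
      apply mul_left_cancel₀ (left_ne_zero_of_mul hv0)
      rw [← hv, h2, ← hw, e1, e2, e3]
    ext i
    fin_cases i
    exacts [h2, e1, e2, e3, h4]
  · intro v
    have h1 := one_le_height₃ (v.1 1, v.1 2, v.1 3)
    gcongr
    simp only [height₃, height₅]
    have := abs_nonneg (v.1 0 : ℝ)
    have := abs_nonneg (v.1 4 : ℝ)
    linarith
  · refine Summable.of_nonneg_of_le (fun t => ?_) (fun t => ?_)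
      (summable_height₃.mul_left (2 * 256 ^ 4))
    · have := one_le_height₃ t; positivity
    · have h1 := one_le_height₃ t
      have hpos : 0 < height₃ t := by linarith
      by_cases hm : t.1 * t.2.2 - t.2.1 ^ 2 = 0
      · rw [if_pos hm]
        simp
        positivity
      · rw [if_neg hm]
        have h2 : |((t.1 * t.2.2 - t.2.1 ^ 2 : ℤ) : ℝ)| ≤ height₃ t ^ 2 := by
          push_cast
          have h3 : |(t.1 : ℝ) * t.2.2 - (t.2.1 : ℝ) ^ 2| ≤ |(t.1 : ℝ)| * |(t.2.2 : ℝ)|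
              + |(t.2.1 : ℝ)| ^ 2 := by
            refine (abs_sub _ _).trans ?_
            rw [abs_mul, abs_pow]
          refine h3.trans ?_
          rw [height₃]
          have a1 := abs_nonneg (t.1 : ℝ)
          have a2 := abs_nonneg (t.2.1 : ℝ)
          have a3 := abs_nonneg (t.2.2 : ℝ)
          nlinarith [mul_nonneg a1 a2, mul_nonneg a1 a3, mul_nonneg a2 a3]
        have h3 := card_intDivisors_le_rpow hm h1 h2
        have e : height₃ t ^ (-(7 / 2) : ℝ) = height₃ t ^ (1 / 2 : ℝ) * (height₃ t ^ 4)⁻¹ := by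
          rw [← Real.rpow_natCast, ← Real.rpow_neg hpos.le, ← Real.rpow_add hpos]
          norm_num
        rw [e, ← mul_assoc]
        gcongr

theorem summable_quadric :
    Summable fun v : {v : Fin 5 → ℤ // OnQuadric v} => (height₅ v.1 ^ 4)⁻¹ := by
  have h1 : Summable ((fun v : Fin 5 → ℤ => (height₅ v ^ 4)⁻¹) ∘
      ((↑) : {v : Fin 5 → ℤ | OnQuadric v ∧ v 0 * v 4 = 0} → Fin 5 → ℤ)) :=
    summable_quadric_degenerate
  have h2 : Summable ((fun v : Fin 5 → ℤ => (height₅ v ^ 4)⁻¹) ∘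
      ((↑) : {v : Fin 5 → ℤ | OnQuadric v ∧ v 0 * v 4 ≠ 0} → Fin 5 → ℤ)) :=
    summable_quadric_nondegenerate
  rw [summable_subtype_iff_indicator] at h1 h2
  change Summable ((fun v : Fin 5 → ℤ => (height₅ v ^ 4)⁻¹) ∘
      ((↑) : {v : Fin 5 → ℤ | OnQuadric v} → Fin 5 → ℤ))
  rw [summable_subtype_iff_indicator]
  refine (h1.add h2).congr fun v => ?_
  classical
  simp only [Set.indicator_apply, Set.mem_ofPred_eq]
  by_cases ha : OnQuadric v <;> by_cases hb : v 0 * v 4 = 0 <;> simp [ha, hb]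

end

end SiegelEisenstein

namespace SiegelEisenstein

noncomputable section

/-! ### Absolute convergence -/

theorem linForm_smul (τ : H2) (t : ℝ) (v : Fin 5 → ℝ) : linForm τ (t • v) = t * linForm τ v := by
  simp only [linForm, Pi.smul_apply, smul_eq_mul]
  push_cast
  ring

/-- With `v 0 = 0` the middle block has rank at most one, and `v 1` times the imaginary part of the
linear form is the positive definite form `Im τ` at `(-v 2, v 1)`. Hence `v 1 = v 2 = 0`, then `v 3
= 0`, and the real part gives `v 4 = 0`. -/
theorem linForm_ne_zero_of_zero {τ : H2} {v : Fin 5 → ℝ} (hv : OnQuadric v) (h0 : v 0 = 0)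
    (h : linForm τ v = 0) : v = 0 := by
  have hs : τ.1 1 0 = τ.1 0 1 := τ.2.1.apply 0 1
  have hpos : ∀ x y : ℝ, (x ≠ 0 ∨ y ≠ 0) →
      0 < x ^ 2 * (τ.1 0 0).im + 2 * x * y * (τ.1 0 1).im + y ^ 2 * (τ.1 1 1).im := by
    intro x y hxy
    have hne : (![x, y] : Fin 2 → ℝ) ≠ 0 := by
      intro h
      have h0 := congrFun h 0
      have h1 := congrFun h 1
      simp at h0 h1
      tauto
    have := τ.2.2.dotProduct_mulVec_pos hne
    simp [dotProduct, mulVec, Fin.sum_univ_two, hs] at this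
    linarith
  have him := congrArg Complex.im h
  simp [linForm, h0] at him
  simp only [OnQuadric, h0, zero_mul] at hv
  have h1 : v 1 = 0 ∧ v 2 = 0 := by
    by_contra hc
    have := hpos (-v 2) (v 1) (by simp only [ne_eq, neg_eq_zero]; tauto)
    have e : (-v 2) ^ 2 * (τ.1 0 0).im + 2 * -v 2 * v 1 * (τ.1 0 1).im + v 1 ^ 2 * (τ.1 1 1).im
        = 0 := by linear_combination v 1 * him - (τ.1 0 0).im * hv
    linarith
  have h3 : v 3 = 0 := by
    by_contra hc
    have := hpos (v 3) 0 (Or.inl hc)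
    rw [h1.1, h1.2] at him
    simp at him
    rcases him with him | him
    · exact hc him
    · rw [him] at this; simp at this
  have hre := congrArg Complex.re h
  simp [linForm, h0, h1.1, h1.2, h3] at hre
  ext i
  fin_cases i
  exacts [h0, h1.1, h1.2, h3, hre]

/-- If `v 0 ≠ 0`, then `(v 0 · 1, Q)`, with `Q` the middle block, is the lower half of a similitude
whose automorphy factor is `v 0` times the linear form; such factors never vanish. -/
theorem linForm_ne_zero {τ : H2} {v : Fin 5 → ℝ} (hv : OnQuadric v) (h : linForm τ v = 0) :
    v = 0 := by
  by_cases h0 : v 0 = 0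
  · exact linForm_ne_zero_of_zero hv h0 h
  exfalso
  have hs : τ.1 1 0 = τ.1 0 1 := τ.2.1.apply 0 1
  let Q : Matrix (Fin 2) (Fin 2) ℝ := !![v 1, v 2; v 2, v 3]
  let X : Matrix (Fin 2 ⊕ Fin 2) (Fin 2 ⊕ Fin 2) ℝ := fromBlocks 0 (-v 0 • 1) (v 0 • 1) Q
  have hQ : Qᵀ = Q := by ext i j; fin_cases i <;> fin_cases j <;> rfl
  have hX : X * J (Fin 2) ℝ * Xᵀ = (v 0 ^ 2) • J (Fin 2) ℝ := by
    simp only [X, J, fromBlocks_transpose, fromBlocks_multiply, fromBlocks_smul, hQ]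
    congr 1 <;> simp [smul_smul, sq]
  have hv2 : 0 < v 0 ^ 2 := by positivity
  have hdet : X.det ≠ 0 := by
    intro hd
    have := congrArg Matrix.det hX
    rw [det_mul, det_mul, hd, det_smul] at this
    simp [h0] at this
    exact (isUnit_iff_ne_zero.mp (Matrix.isUnit_det_J (l := Fin 2) (R := ℝ))) this
  let g : GSpPos := ⟨GeneralLinearGroup.mkOfDetNeZero X hdet, v 0 ^ 2, hv2, hX⟩
  have hu := (isUnit_det_denom g τ).ne_zero
  apply hu
  have h1 : (denom g τ).det = v 0 * linForm τ v := by
    have e1 : g.1.1.toBlocks₂₁ = v 0 • 1 := rfl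
    have e2 : g.1.1.toBlocks₂₂ = Q := rfl
    have hv' : ((v 1 : ℂ) * v 3 - v 2 ^ 2) = v 0 * v 4 := by exact_mod_cast hv
    rw [denom, e1, e2, det_fin_two]
    simp [Matrix.mul_apply, Fin.sum_univ_two, Q, linForm, hs]
    linear_combination hv'
  rw [h1, h, mul_zero]

/-- Both sides are homogeneous of degree one, so the minimum of the norm of the linear form on the
compact intersection of the quadric with the unit sphere serves as `ε`. -/
theorem exists_linForm_bound (τ : H2) : ∃ ε > 0, ∀ v : Fin 5 → ℝ, OnQuadric v →
    ε * ‖v‖ ≤ ‖linForm τ v‖ := by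
  have hcont : Continuous fun v : Fin 5 → ℝ => ‖linForm τ v‖ := by
    unfold linForm
    fun_prop
  have hclosed : IsClosed {v : Fin 5 → ℝ | OnQuadric v} := by
    unfold OnQuadric
    exact isClosed_eq (by fun_prop) (by fun_prop)
  have hcomp : IsCompact (Metric.sphere (0 : Fin 5 → ℝ) 1 ∩ {v | OnQuadric v}) :=
    (isCompact_sphere _ _).inter_right hclosed
  have hscale : ∀ ε, (∀ v ∈ Metric.sphere (0 : Fin 5 → ℝ) 1 ∩ {v | OnQuadric v},
      ε ≤ ‖linForm τ v‖) → ∀ v : Fin 5 → ℝ, OnQuadric v → ε * ‖v‖ ≤ ‖linForm τ v‖ := by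
    intro ε h v hv
    by_cases h0 : v = 0
    · simp [h0]
    have hn : 0 < ‖v‖ := norm_pos_iff.mpr h0
    have h1 := h (‖v‖⁻¹ • v) ⟨by simp [norm_smul, hn.ne'], by
      simp only [OnQuadric, Set.mem_ofPred_eq, Pi.smul_apply, smul_eq_mul] at hv ⊢
      linear_combination (‖v‖⁻¹ ^ 2) * hv⟩
    rw [linForm_smul, norm_mul, Complex.norm_real, norm_inv, norm_norm] at h1
    rwa [inv_mul_eq_div, le_div_iff₀ hn] at h1
  rcases (Metric.sphere (0 : Fin 5 → ℝ) 1 ∩ {v | OnQuadric v}).eq_empty_or_nonempty with he | hne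
  · exact ⟨1, one_pos, hscale 1 (by rw [he]; simp)⟩
  · obtain ⟨v₀, hv₀, hmin⟩ := hcomp.exists_isMinOn hne hcont.continuousOn
    refine ⟨‖linForm τ v₀‖, ?_, hscale _ fun v hv => hmin hv⟩
    rw [gt_iff_lt, norm_pos_iff]
    intro h
    have := linForm_ne_zero hv₀.2 h
    have h1 := hv₀.1
    rw [this] at h1
    simp at h1

theorem mem_GammaInf {γ : Sp} : γ ∈ GammaInf ↔ blockC γ = 0 := Iff.rfl

theorem mem_GammaInf_of_plZ {γ : Sp} (h1 : plZ γ 1 = 0) (h2 : plZ γ 2 = 0) (h3 : plZ γ 3 = 0)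
    (h4 : plZ γ 4 ≠ 0) : γ ∈ GammaInf :=
  mem_GammaInf.mpr (eq_zero_of_plucker (Sp_relations γ).2.1 h1 h2 h3 h4)

/-- Acting by `γ⁻¹` reduces to the Plücker vector of the identity, whose vanishing middle
coordinates give `C = 0`. -/
theorem plZ_injective_mod {γ γ' : Sp} (h : plZ γ = plZ γ') : γ' * γ⁻¹ ∈ GammaInf := by
  have h1 : plZ (γ' * γ⁻¹) = plZ 1 := by
    rw [plZ_mul, ← h, ← plZ_mul, mul_inv_cancel]
  rw [plZ_one] at h1
  apply mem_GammaInf_of_plZ <;> rw [h1] <;> simp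

theorem plZ_out_injective : Function.Injective fun c : InfCosets => plZ c.out := by
  intro c c' h
  have := plZ_injective_mod h
  rw [← c.out_eq, ← c'.out_eq]
  exact Quotient.sound (QuotientGroup.rightRel_apply.mpr this)

theorem oneSlash_eq_linForm (k : ℕ) (γ : Sp) (τ : H2) :
    oneSlash k γ τ = linForm τ (fun i => (plZ γ i : ℝ)) ^ (-(k : ℤ)) := by
  rw [oneSlash_eq, det_denom, plG_toGSpPos]

theorem onQuadric_intCast {v : Fin 5 → ℤ} (h : OnQuadric v) :
    OnQuadric (fun i => (v i : ℝ)) := by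
  unfold OnQuadric at *
  beta_reduce
  exact_mod_cast h

theorem one_le_norm_intCast {v : Fin 5 → ℤ} (h : ∃ i, v i ≠ 0) : 1 ≤ ‖fun i => (v i : ℝ)‖ := by
  obtain ⟨i, hi⟩ := h
  refine le_trans ?_ (norm_le_pi_norm (fun i => (v i : ℝ)) i)
  rw [Real.norm_eq_abs]
  exact_mod_cast Int.one_le_abs hi

theorem summable_norm_oneSlash {k : ℕ} (hk : 4 ≤ k) (τ : H2) :
    Summable fun c : InfCosets => ‖oneSlash k c.out τ‖ := by
  obtain ⟨ε, hε, hb⟩ := exists_linForm_bound τ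
  have h1 := (summable_quadric.comp_injective
    (i := fun c : InfCosets => (⟨plZ c.out, plZ_onQuadric _⟩ : {v : Fin 5 → ℤ // OnQuadric v}))
    (by
      intro c c' h
      exact plZ_out_injective (congrArg Subtype.val h))).mul_left ((ε ^ k)⁻¹ * 6 ^ 4)
  refine Summable.of_nonneg_of_le (fun _ => norm_nonneg _) (fun c => ?_) h1
  set v := plZ c.out with hv
  set w : Fin 5 → ℝ := fun i => (v i : ℝ) with hw
  have hn : 1 ≤ ‖w‖ := one_le_norm_intCast (plZ_primitive c.out).exists_ne_zero
  -- There are six summands: the five coordinates are bounded by the supremum norm, and `1` is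
  -- bounded by it because the vector is integral and nonzero.
  have hh : height₅ v ≤ 6 * ‖w‖ := by
    have : ∀ i, |(v i : ℝ)| ≤ ‖w‖ := fun i => norm_le_pi_norm w i
    unfold height₅
    linarith [this 0, this 1, this 2, this 3, this 4]
  have hh1 : 1 ≤ height₅ v := by
    unfold height₅
    linarith [abs_nonneg (v 0 : ℝ), abs_nonneg (v 1 : ℝ), abs_nonneg (v 2 : ℝ),
      abs_nonneg (v 3 : ℝ), abs_nonneg (v 4 : ℝ)]
  have hl := hb w (onQuadric_intCast (plZ_onQuadric c.out))
  rw [oneSlash_eq_linForm, norm_zpow, _root_.zpow_neg, zpow_natCast]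
  change (‖linForm τ w‖ ^ k)⁻¹ ≤ (ε ^ k)⁻¹ * 6 ^ 4 * (height₅ v ^ 4)⁻¹
  calc (‖linForm τ w‖ ^ k)⁻¹ ≤ ((ε * ‖w‖) ^ k)⁻¹ := by gcongr
    _ = (ε ^ k)⁻¹ * (‖w‖ ^ k)⁻¹ := by rw [mul_pow, mul_inv]
    -- Here `4 ≤ k` enters, together with `1 ≤ ‖w‖`.
    _ ≤ (ε ^ k)⁻¹ * (‖w‖ ^ 4)⁻¹ := by gcongr
    _ ≤ (ε ^ k)⁻¹ * ((height₅ v / 6) ^ 4)⁻¹ := by gcongr; linarith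
    _ = (ε ^ k)⁻¹ * 6 ^ 4 * (height₅ v ^ 4)⁻¹ := by rw [div_pow, inv_div]; ring

/-- Termwise absolute convergence of the series of a section. -/
def SectionSummable (k : ℕ) (Φ : GSpPos → ℂ) : Prop :=
  ∀ τ, Summable fun c : Quotient (QuotientGroup.rightRel Parabolic) =>
    Φ c.out * (denom c.out τ).det ^ (-(k : ℤ))

theorem toGSpPos_mem_Parabolic {γ : Sp} : toGSpPos γ ∈ Parabolic ↔ γ ∈ GammaInf := by
  rw [mem_Parabolic, mem_GammaInf, toGSpPos_block₂₁]
  constructor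
  · intro h
    ext i j
    have := congrFun (congrFun h i) j
    simpa using this
  · intro h
    rw [h]
    ext; simp

/-- The coset of `Γ_∞ γ` in `Parabolic \ GSp₂⁺(ℝ)`. -/
def infCosetMap (c : InfCosets) : Quotient (QuotientGroup.rightRel Parabolic) :=
  Quotient.mk _ (toGSpPos c.out)

theorem infCosetMap_injective : Function.Injective infCosetMap := by
  intro c c' h
  have h1 := QuotientGroup.rightRel_apply.mp (Quotient.exact h)
  rw [← map_inv, ← map_mul, toGSpPos_mem_Parabolic] at h1
  rw [← c.out_eq, ← c'.out_eq]
  exact Quotient.sound (QuotientGroup.rightRel_apply.mpr h1)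

theorem mem_range_infCosetMap {c : Quotient (QuotientGroup.rightRel Parabolic)}
    (h : IsRational c.out) : c ∈ Set.range infCosetMap := by
  obtain ⟨p, hp, γ, hγ⟩ := h
  refine ⟨Quotient.mk _ γ, ?_⟩
  rw [infCosetMap, ← c.out_eq]
  refine Quotient.sound (QuotientGroup.rightRel_apply.mpr ?_)
  have h1 := QuotientGroup.rightRel_apply.mp (Quotient.mk_out (s := QuotientGroup.rightRel GammaInf) γ)
  rw [← toGSpPos_mem_Parabolic, map_mul, map_inv] at h1
  rw [hγ, mul_assoc]
  exact mul_mem hp h1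

section

variable {k : ℕ} {Φ : GSpPos → ℂ}

theorem IsSection.support_subset (h0 : ∀ g, ¬ IsRational g → Φ g = 0) (τ : H2) :
    Function.support (fun c : Quotient (QuotientGroup.rightRel Parabolic) =>
      Φ c.out * (denom c.out τ).det ^ (-(k : ℤ))) ⊆ Set.range infCosetMap := by
  intro c hc
  apply mem_range_infCosetMap
  by_contra h
  exact hc (by simp [h0 _ h])

theorem IsSection.term_infCosetMap (hΦ : IsSection k Φ) (τ : H2) (c : InfCosets) :
    Φ (infCosetMap c).out * (denom (infCosetMap c).out τ).det ^ (-(k : ℤ))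
      = Φ (toGSpPos c.out) * oneSlash k c.out τ := by
  rw [infCosetMap, hΦ.term_out, oneSlash_eq]

theorem IsSection.term_infCoset (hΦ : IsSection k Φ) (τ : H2) (γ : Sp) :
    Φ (toGSpPos (Quotient.mk (QuotientGroup.rightRel GammaInf) γ).out) *
      oneSlash k (Quotient.mk (QuotientGroup.rightRel GammaInf) γ).out τ
      = Φ (toGSpPos γ) * oneSlash k γ τ := by
  have h := QuotientGroup.rightRel_apply.mp
    (Quotient.mk_out (s := QuotientGroup.rightRel GammaInf) γ)
  rw [← toGSpPos_mem_Parabolic] at h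
  rw [oneSlash_eq, oneSlash_eq, ← hΦ.term_mul h, ← map_mul, inv_mul_cancel_right]

/-- Sections live on the real group so that Hecke matrices can translate them; vanishing off the
rational planes reduces the series to the cosets of `GammaInf` in `Sp`. -/
theorem IsSection.sectionSum_eq (hΦ : IsSection k Φ) (h0 : ∀ g, ¬ IsRational g → Φ g = 0)
    (τ : H2) : sectionSum k Φ τ = ∑' c : InfCosets, Φ (toGSpPos c.out) * oneSlash k c.out τ := by
  rw [sectionSum, ← infCosetMap_injective.tsum_eq (IsSection.support_subset h0 τ)]
  exact tsum_congr fun c => hΦ.term_infCosetMap τ c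

theorem IsSection.summable_of_bounded (hΦ : IsSection k Φ) (h0 : ∀ g, ¬ IsRational g → Φ g = 0)
    (hk : 4 ≤ k) {K : ℝ} (hK : ∀ γ : Sp, ‖Φ (toGSpPos γ)‖ ≤ K) : SectionSummable k Φ := by
  intro τ
  rw [← infCosetMap_injective.summable_iff fun c hc => by
    by_contra h
    exact hc (IsSection.support_subset h0 τ h)]
  refine Summable.of_norm_bounded ((summable_norm_oneSlash hk τ).mul_left K) fun c => ?_
  rw [Function.comp_apply, hΦ.term_infCosetMap, norm_mul]
  gcongr
  exact hK _

end

theorem SectionSummable.mul_right {k : ℕ} {Φ : GSpPos → ℂ} (hΦ : IsSection k Φ)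
    (h : SectionSummable k Φ) (g : GSpPos) : SectionSummable k (fun x => Φ (x * g)) := by
  intro τ
  rw [← (cosetMulRight g⁻¹).summable_iff]
  have h1 := (h (moebius g⁻¹ τ)).mul_right ((denom g⁻¹ τ).det ^ (-(k : ℤ)))
  refine h1.congr fun c => ?_
  have e : cosetMulRight g⁻¹ c = Quotient.mk _ (c.out * g⁻¹) := by
    conv_lhs => rw [← c.out_eq]
    rfl
  rw [Function.comp_apply, e, (hΦ.mul_right g).term_out, denom_mul, det_mul, mul_zpow]
  simp
  ring

theorem sectionSum_sum {k : ℕ} {ι : Type*} (s : Finset ι) (a : ι → ℂ) (Φ : ι → GSpPos → ℂ)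
    (h : ∀ i ∈ s, SectionSummable k (Φ i)) :
    sectionSum k (fun g => ∑ i ∈ s, a i * Φ i g) = ∑ i ∈ s, a i • sectionSum k (Φ i) := by
  ext τ
  simp only [sectionSum, Finset.sum_apply, Pi.smul_apply, smul_eq_mul, ← tsum_mul_left]
  rw [← Summable.tsum_finsetSum fun i hi => (h i hi τ).mul_left (a i)]
  refine tsum_congr fun c => ?_
  rw [Finset.sum_mul]
  exact Finset.sum_congr rfl fun i _ => by ring

/-! ### The value at the cusp -/

/-- The point `i y` of the upper half-space. -/
def imPoint (y : ℝ) (hy : 0 < y) : H2 :=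
  ⟨(Complex.I * y) • 1, by simp [Matrix.IsSymm], by
    have : (((Complex.I * y) • (1 : Matrix (Fin 2) (Fin 2) ℂ)).map Complex.im)
        = y • (1 : Matrix (Fin 2) (Fin 2) ℝ) := by
      ext i j
      by_cases h : i = j <;> simp [h]
    rw [this]
    exact Matrix.PosDef.one.smul hy⟩

/-- The quadric turns the cross terms `2 y² (v 1 * v 3 - v 0 * v 4)` into `2 y² (v 2)²`. All terms
are then nonnegative and increasing in `y`, which gives both the domination by `y = 1` and the decay
used for the limit. -/
theorem normSq_linForm_imPoint {y : ℝ} (hy : 0 < y) {v : Fin 5 → ℝ} (hv : OnQuadric v) :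
    ‖linForm (imPoint y hy) v‖ ^ 2
      = v 4 ^ 2 + y ^ 4 * v 0 ^ 2 + y ^ 2 * (v 1 ^ 2 + v 3 ^ 2 + 2 * v 2 ^ 2) := by
  rw [← Complex.normSq_eq_norm_sq]
  unfold OnQuadric at hv
  have e : linForm (imPoint y hy) v
      = ((v 4 - y ^ 2 * v 0 : ℝ) : ℂ) + ((y * (v 1 + v 3) : ℝ) : ℂ) * Complex.I := by
    simp [linForm, imPoint]
    linear_combination ((v 0 : ℂ) * y ^ 2) * Complex.I_sq
  rw [e, Complex.normSq_add_mul_I]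
  linear_combination (2 * y ^ 2) * hv

theorem norm_linForm_imPoint_mono {y : ℝ} (hy : 1 ≤ y) {v : Fin 5 → ℝ} (hv : OnQuadric v) :
    ‖linForm (imPoint 1 one_pos) v‖ ≤ ‖linForm (imPoint y (by linarith)) v‖ := by
  rw [← abs_of_nonneg (norm_nonneg (linForm (imPoint 1 one_pos) v)),
    ← abs_of_nonneg (norm_nonneg (linForm (imPoint y _) v)), ← sq_le_sq,
    normSq_linForm_imPoint _ hv, normSq_linForm_imPoint _ hv]
  have h2 : 1 ≤ y ^ 2 := one_le_pow₀ hy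
  have h4 : 1 ≤ y ^ 4 := one_le_pow₀ hy
  gcongr

theorem le_norm_linForm_imPoint {y : ℝ} (hy : 1 ≤ y) {v : Fin 5 → ℤ} (hv : OnQuadric v)
    (h : v 0 ≠ 0 ∨ v 1 ≠ 0 ∨ v 2 ≠ 0 ∨ v 3 ≠ 0) :
    y ≤ ‖linForm (imPoint y (by linarith)) (fun i => (v i : ℝ))‖ := by
  have hy0 : 0 ≤ y := by linarith
  apply le_of_sq_le_sq _ (norm_nonneg _)
  rw [normSq_linForm_imPoint _ (onQuadric_intCast hv)]
  have key : ∀ n : ℤ, n ≠ 0 → (1 : ℝ) ≤ (n : ℝ) ^ 2 := by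
    intro n hn
    have := Int.one_le_abs hn
    have : (1 : ℤ) ≤ n ^ 2 := by nlinarith [sq_abs n]
    exact_mod_cast this
  have h2 : 1 ≤ y ^ 2 := one_le_pow₀ hy
  have s0 := sq_nonneg (v 0 : ℝ)
  have s1 := sq_nonneg (v 1 : ℝ)
  have s2 := sq_nonneg (v 2 : ℝ)
  have s3 := sq_nonneg (v 3 : ℝ)
  have s4 := sq_nonneg (v 4 : ℝ)
  have e : y ^ 4 = y ^ 2 * y ^ 2 := by ring
  have hs : 1 ≤ y ^ 2 * (v 0 : ℝ) ^ 2 + ((v 1 : ℝ) ^ 2 + (v 3 : ℝ) ^ 2 + 2 * (v 2 : ℝ) ^ 2) := by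
    have : (v 0 : ℝ) ^ 2 ≤ y ^ 2 * (v 0 : ℝ) ^ 2 := by nlinarith
    rcases h with h | h | h | h <;> have := key _ h <;> linarith
  rw [e]
  nlinarith

-- As `y → ∞` every summand tends to `0` except that of the identity coset, whose automorphy factor
-- is constant. The series at `y = 1` dominates.
open Classical in
theorem tendsto_sectionSum {k : ℕ} {Φ : GSpPos → ℂ} (hΦ : IsSection k Φ)
    (h0 : ∀ g, ¬ IsRational g → Φ g = 0) (hk : 4 ≤ k) {K : ℝ}
    (hK : ∀ γ : Sp, ‖Φ (toGSpPos γ)‖ ≤ K) :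
    Filter.Tendsto (fun n : ℕ => sectionSum k Φ (imPoint (n + 1) (by positivity))) Filter.atTop
      (nhds (Φ 1)) := by
  have hlim : Φ 1 = ∑' c : InfCosets, if c = Quotient.mk _ 1 then Φ 1 else 0 := by
    rw [tsum_ite_eq]
  rw [hlim]
  simp only [hΦ.sectionSum_eq h0]
  have hK0 : 0 ≤ K := (norm_nonneg _).trans (hK 1)
  refine tendsto_tsum_of_dominated_convergence
    (bound := fun c : InfCosets => K * ‖oneSlash k c.out (imPoint 1 one_pos)‖)
    ((summable_norm_oneSlash hk _).mul_left K) ?_ ?_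
  · intro c
    by_cases hc : c = Quotient.mk _ 1
    · subst hc
      simp only [if_true]
      refine tendsto_const_nhds.congr fun n => ?_
      rw [hΦ.term_infCoset, map_one, oneSlash_eq_linForm, plZ_one]
      simp [linForm]
    · rw [if_neg hc]
      have hne : plZ c.out 0 ≠ 0 ∨ plZ c.out 1 ≠ 0 ∨ plZ c.out 2 ≠ 0 ∨ plZ c.out 3 ≠ 0 := by
        by_contra! h
        apply hc
        rw [← c.out_eq]
        refine Quotient.sound (QuotientGroup.rightRel_apply.mpr ?_)
        rw [one_mul]
        refine inv_mem (mem_GammaInf_of_plZ h.2.1 h.2.2.1 h.2.2.2 fun h4 => ?_)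
        obtain ⟨i, hi⟩ := (plZ_primitive c.out).exists_ne_zero
        fin_cases i
        exacts [hi h.1, hi h.2.1, hi h.2.2.1, hi h.2.2.2, hi h4]
      have hz : Filter.Tendsto (fun n : ℕ => K * ((n : ℝ) + 1)⁻¹) Filter.atTop (nhds 0) := by
        simpa [one_div] using tendsto_one_div_add_atTop_nhds_zero_nat.const_mul K
      refine squeeze_zero_norm (fun n => ?_) hz
      rw [norm_mul, oneSlash_eq_linForm, norm_zpow, _root_.zpow_neg, zpow_natCast]
      have h1 := le_norm_linForm_imPoint (y := (n : ℝ) + 1) (by simp) (plZ_onQuadric c.out) hne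
      have h2 : (n : ℝ) + 1 ≤ ((n : ℝ) + 1) ^ k := le_self_pow₀ (by simp) (by omega)
      have h3 := h2.trans (pow_le_pow_left₀ (by positivity) h1 k)
      have h4 : (0 : ℝ) < (n : ℝ) + 1 := by positivity
      gcongr
      exact hK _
  · filter_upwards with n c
    rw [norm_mul]
    gcongr
    · exact hK _
    · rw [oneSlash_eq_linForm, oneSlash_eq_linForm, norm_zpow, norm_zpow, _root_.zpow_neg,
        _root_.zpow_neg, zpow_natCast, zpow_natCast]
      have := norm_linForm_imPoint_mono (y := (n : ℝ) + 1) (by simp)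
        (onQuadric_intCast (plZ_onQuadric c.out))
      gcongr
      have h1 := linForm_ne_zero (τ := imPoint 1 one_pos) (onQuadric_intCast (plZ_onQuadric c.out))
      refine pow_pos (norm_pos_iff.mpr fun h2 => ?_) k
      obtain ⟨i, hi⟩ := (plZ_primitive c.out).exists_ne_zero
      exact hi (by simpa using congrFun (h1 h2) i)

/-! ### Eisenstein series of functions on Plücker coordinates -/

/-- The Eisenstein series attached to a function on Plücker coordinates. -/
def plSum (k : ℕ) (f : (Fin 5 → ℤ) → ℂ) : H2 → ℂ := sectionSum k (ratSection k f)

theorem ratSection_summable {k : ℕ} (hk : 4 ≤ k) {f : (Fin 5 → ℤ) → ℂ} (hf : HasParity k f)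
    {K : ℝ} (hK : ∀ w, ‖f w‖ ≤ K) : SectionSummable k (ratSection k f) :=
  (isSection_ratSection hf).summable_of_bounded (fun _ => ratSection_of_not) hk
    fun γ => by rw [ratSection_toGSpPos hf]; exact hK _

theorem ratSection_sum {k : ℕ} {ι : Type*} (s : Finset ι) (a : ι → ℂ)
    (f : ι → (Fin 5 → ℤ) → ℂ) :
    ratSection k (fun w => ∑ i ∈ s, a i * f i w) = fun g => ∑ i ∈ s, a i * ratSection k (f i) g := by
  ext g
  by_cases hg : IsRational g
  · simp only [ratSection, dif_pos hg, Finset.mul_sum]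
    exact Finset.sum_congr rfl fun i _ => by ring
  · simp [ratSection_of_not hg]

theorem plSum_sum {k : ℕ} (hk : 4 ≤ k) {ι : Type*} (s : Finset ι) (a : ι → ℂ)
    (f : ι → (Fin 5 → ℤ) → ℂ) (hf : ∀ i ∈ s, HasParity k (f i))
    (hK : ∀ i ∈ s, ∃ K : ℝ, ∀ w, ‖f i w‖ ≤ K) :
    plSum k (fun w => ∑ i ∈ s, a i * f i w) = ∑ i ∈ s, a i • plSum k (f i) := by
  rw [plSum, ratSection_sum, sectionSum_sum]
  · rfl
  · intro i hi
    obtain ⟨K, hK⟩ := hK i hi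
    exact ratSection_summable hk (hf i hi) hK

/-- Slashing by `γ⁻¹` moves the cusp of `γ` to infinity, where the limit reads off the value of `f`
at `plZ γ`. -/
theorem eq_zero_of_plSum_eq_zero {k : ℕ} (hk : 4 ≤ k) {f : (Fin 5 → ℤ) → ℂ} (hf : HasParity k f)
    {K : ℝ} (hK : ∀ w, ‖f w‖ ≤ K) (h : plSum k f = 0) (γ : Sp) : f (plZ γ) = 0 := by
  have hsec := isSection_ratSection hf
  have h1 := slash_sectionSum hsec (toGSpPos γ⁻¹)
  rw [← plSum, h, det_toGSpPos] at h1
  have h2 : slash k (0 : H2 → ℂ) (toGSpPos γ⁻¹) = 0 := by ext τ; simp [slash]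
  rw [h2] at h1
  simp only [Real.one_rpow, Complex.ofReal_one, one_smul, map_inv, inv_inv] at h1
  have h3 := tendsto_sectionSum (hsec.mul_right (toGSpPos γ))
    (fun g hg => ratSection_of_not (by rwa [IsRational.mul_Sp])) hk (K := K)
    (fun γ' => by rw [← map_mul, ratSection_toGSpPos hf]; exact hK _)
  rw [← h1] at h3
  have h4 := tendsto_nhds_unique h3 tendsto_const_nhds
  rwa [one_mul, ratSection_toGSpPos hf] at h4

end

end SiegelEisenstein

namespace SiegelEisenstein

noncomputable section

/-! ### Eisenstein series as series over Plücker coordinates -/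

section

variable {q : ℕ} [Fact q.Prime]

/-- The three local functions have disjoint supports, distinguished by the rank of `C` modulo `q`,
so only one coefficient of `κ` matters at each vector. -/
theorem locSum_eq_mul (ψ : DirichletCharacter ℂ q) (κ : Fin 3 → ℂ) (w : Fin 5 → ℤ) :
    locSum ψ κ (fun i => (w i : ZMod q))
      = κ (rankMod q w) * locSum ψ (fun _ => 1) (fun i => (w i : ZMod q)) := by
  have hz : ψ 0 = 0 := MulChar.map_zero ψ
  rw [rankMod]
  by_cases h0 : (w 0 : ZMod q) = 0
  · by_cases h : (w 1 : ZMod q) = 0 ∧ (w 2 : ZMod q) = 0 ∧ (w 3 : ZMod q) = 0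
    · simp [locSum, loc₀, loc₁, loc₂, rankOneChar, h0, h, hz]
    · simp [locSum, loc₀, loc₁, loc₂, h0, h, hz]
  · simp [locSum, loc₀, loc₁, loc₂, h0]

theorem locSum_ne_zero (ψ : DirichletCharacter ℂ q) (γ : Sp) :
    locSum ψ (fun _ => 1) (fun i => (plZ γ i : ZMod q)) ≠ 0 := by
  have hψ : ∀ x : ZMod q, x ≠ 0 → ψ x ≠ 0 := fun x hx =>
    ((isUnit_iff_ne_zero.mpr hx).map ψ).ne_zero
  have hz : ψ 0 = 0 := MulChar.map_zero ψ
  by_cases h0 : (plZ γ 0 : ZMod q) = 0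
  · by_cases h : (plZ γ 1 : ZMod q) = 0 ∧ (plZ γ 2 : ZMod q) = 0 ∧ (plZ γ 3 : ZMod q) = 0
    · obtain ⟨i, hi⟩ := plZ_primitive γ q Fact.out
      rw [← ZMod.intCast_zmod_eq_zero_iff_dvd] at hi
      have h4 : (plZ γ 4 : ZMod q) ≠ 0 := by
        fin_cases i
        exacts [absurd h0 hi, absurd h.1 hi, absurd h.2.1 hi, absurd h.2.2 hi, hi]
      simpa [locSum, loc₀, loc₁, loc₂, rankOneChar, h0, h, hz] using hψ _ h4
    · have hq := onQuadric_cast (plZ_onQuadric γ) q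
      simp only [OnQuadric, h0, zero_mul] at hq
      have := rankOneChar_ne_zero (ψ := ψ) (sub_eq_zero.mp hq) (by tauto)
      simpa [locSum, loc₀, loc₁, loc₂, h0, h, hz] using this
  · simpa [locSum, loc₀, loc₁, loc₂, h0] using hψ _ h0

theorem rankMod_diagCusp {m : Fin 2 → ℤ} {r : Fin 3} (h : IsNormalCusp m q r) :
    rankMod q (plZ (diagCusp m)) = r := by
  obtain ⟨h0, h1⟩ := h
  rw [plZ_diagCusp, rankMod]
  fin_cases r <;> simp at h0 h1 <;> simp [h0, h1]

theorem locSum_diagCusp (ψ : DirichletCharacter ℂ q) (κ : Fin 3 → ℂ) {m : Fin 2 → ℤ} {r : Fin 3}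
    (h : IsNormalCusp m q r) : locSum ψ κ (fun i => (plZ (diagCusp m) i : ZMod q)) = κ r := by
  rw [locSum_eq_mul, rankMod_diagCusp h, plZ_diagCusp]
  obtain ⟨h0, h1⟩ := h
  have hz : ψ 0 = 0 := MulChar.map_zero ψ
  fin_cases r <;> simp at h0 h1 <;> simp [locSum, loc₀, loc₁, loc₂, rankOneChar, h0, h1, hz]

theorem rank_blockC (γ : Sp) :
    ((blockC γ).map (Int.cast : ℤ → ZMod q)).rank = 1 ↔ rankMod q (plZ γ) = 1 := by
  set C := (blockC γ).map (Int.cast : ℤ → ZMod q) with hC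
  have hdet : C.det = (plZ γ 0 : ZMod q) := by rw [hC, det_map_cast]; rfl
  rw [rankMod]
  by_cases h0 : (plZ γ 0 : ZMod q) = 0
  · by_cases h : (plZ γ 1 : ZMod q) = 0 ∧ (plZ γ 2 : ZMod q) = 0 ∧ (plZ γ 3 : ZMod q) = 0
    · have : C = 0 := blockC_map_eq_zero h0 h.1 h.2.1 h.2.2
      rw [this, Matrix.rank_zero]
      simp [h0, h]
    · have hC0 : C ≠ 0 := by
        intro hC
        apply h
        have e : ∀ i j, (blockC γ i j : ZMod q) = 0 := fun i j => congrFun (congrFun hC i) j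
        simp [plZ, plucker, e]
      obtain ⟨x, n, -, -, hx⟩ := exists_rank_one_factor hC0 (hdet.trans h0)
      have h1 : C.rank ≤ 1 := by
        have : C = vecMulVec x n := by ext i j; exact hx i j
        rw [this]
        exact rank_vecMulVec_le x n
      have h2 : C.rank ≠ 0 := by
        intro h
        apply hC0
        rw [Matrix.rank, Submodule.finrank_eq_zero, LinearMap.range_eq_bot] at h
        ext i j
        have := congrFun (LinearMap.congr_fun h (Pi.single j 1)) i
        simpa using this
      simp [h0, h]
      omega
  · rw [Matrix.rank_of_det_ne_zero (by rwa [hdet])]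
    simp [h0]

end

section Family

variable {N : ℕ}

theorem famFun_eq_mul (χ : DirichletCharacter ℂ N) (κ : ℕ → Fin 3 → ℂ) (w : Fin 5 → ℤ) :
    famFun χ κ w = (∏ q ∈ N.primeFactors, κ q (rankMod q w)) * famFun χ (fun _ _ => 1) w := by
  rw [famFun, famFun, ← Finset.prod_mul_distrib]
  refine Finset.prod_congr rfl fun q hq => ?_
  have : Fact q.Prime := ⟨Nat.prime_of_mem_primeFactors hq⟩
  exact locSum_eq_mul _ _ _

theorem famFun_plZ_ne_zero (χ : DirichletCharacter ℂ N) (γ : Sp) :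
    famFun χ (fun _ _ => 1) (plZ γ) ≠ 0 := by
  refine Finset.prod_ne_zero_iff.mpr fun q hq => ?_
  have : Fact q.Prime := ⟨Nat.prime_of_mem_primeFactors hq⟩
  exact locSum_ne_zero _ _

theorem famFun_diagCusp (χ : DirichletCharacter ℂ N) (κ : ℕ → Fin 3 → ℂ) {m : Fin 2 → ℤ}
    {r : ℕ → Fin 3} (h : ∀ q ∈ N.primeFactors, IsNormalCusp m q (r q)) :
    famFun χ κ (plZ (diagCusp m)) = ∏ q ∈ N.primeFactors, κ q (r q) := by
  refine Finset.prod_congr rfl fun q hq => ?_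
  have : Fact q.Prime := ⟨Nat.prime_of_mem_primeFactors hq⟩
  exact locSum_diagCusp _ _ (h q hq)

theorem famFun_bounded (χ : DirichletCharacter ℂ N) (κ : ℕ → Fin 3 → ℂ) :
    ∃ K : ℝ, ∀ w, ‖famFun χ κ w‖ ≤ K := by
  refine ⟨∏ q ∈ N.primeFactors, (‖κ q 0‖ + ‖κ q 1‖ + ‖κ q 2‖), fun w => ?_⟩
  rw [famFun, norm_prod]
  refine Finset.prod_le_prod (fun _ _ => norm_nonneg _) fun q _ => ?_
  set ψ := component χ q
  set v : Fin 5 → ZMod q := fun i => (w i : ZMod q)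
  have hψ := DirichletCharacter.norm_le_one ψ
  have h0 : ‖loc₀ ψ v‖ ≤ 1 := by rw [loc₀]; split_ifs <;> simp [hψ]
  have h1 : ‖loc₁ ψ v‖ ≤ 1 := by rw [loc₁, rankOneChar]; split_ifs <;> simp [hψ]
  have h2 : ‖loc₂ ψ v‖ ≤ 1 := hψ _
  rw [locSum]
  refine (norm_add₃_le ..).trans ?_
  simp only [norm_mul]
  gcongr <;> exact mul_le_of_le_one_right (norm_nonneg _) ‹_›

theorem exists_normalCusp (N : ℕ) (r : ℕ → Fin 3) :
    ∃ m : Fin 2 → ℤ, ∀ q ∈ N.primeFactors, IsNormalCusp m q (r q) := by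
  obtain ⟨m0, h0⟩ := exists_crt_primeFactors N (fun q => if r q = 0 then 0 else 1)
  obtain ⟨m1, h1⟩ := exists_crt_primeFactors N (fun q => if r q = 2 then 1 else 0)
  exact ⟨![m0, m1], fun q hq => ⟨h0 q hq, h1 q hq⟩⟩

theorem exists_orbit_of_rankMod (hN : Squarefree N) {γ γ₀ : Sp}
    (h : ∀ q ∈ N.primeFactors, rankMod q (plZ γ) = rankMod q (plZ γ₀)) :
    ∃ δ ∈ GammaInf, ∃ γ' ∈ Gamma0 N, γ = δ * γ₀ * γ' := by
  obtain ⟨m, hm⟩ := exists_normalCusp N fun q => rankMod q (plZ γ₀)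
  obtain ⟨δ, hδ, γ', hγ', e⟩ := exists_diagCusp_orbit hN γ
    (fun q hq => by rw [h q hq]; exact hm q hq)
  obtain ⟨δ₀, hδ₀, γ₀', hγ₀', e₀⟩ := exists_diagCusp_orbit hN γ₀ hm
  exact ⟨δ * δ₀⁻¹, mul_mem hδ (inv_mem hδ₀), γ₀'⁻¹ * γ', mul_mem (inv_mem hγ₀') hγ', by
    rw [e, e₀]; group⟩

/-- The family selecting one rank at each prime. -/
def rankFam (r : ℕ → Fin 3) (q : ℕ) : Fin 3 → ℂ := Pi.single (r q) 1

theorem rankFam_one_ne_zero {r : ℕ → Fin 3} {q : ℕ} (h : rankFam r q 1 ≠ 0) : r q = 1 := by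
  by_contra hne
  exact h (by rw [rankFam, Pi.single_eq_of_ne (Ne.symm hne)])

/-- By `exists_orbit_of_rankMod` the function is supported on the orbit of `γ₀`. On `γ₀ γ` it equals
its value at `γ₀` times the conjugate of `χ (det D_γ)`, whichever `γ` represents the coset; this
makes the choice in `eisenstein` harmless. -/
theorem plSum_rankFam {k : ℕ} (hN : Squarefree N) {χ : DirichletCharacter ℂ N}
    (hχ : χ (-1) = (-1) ^ k) {γ₀ : Sp} {r : ℕ → Fin 3} (hadm : IsAdmissibleFam χ (rankFam r))
    (hr : ∀ q ∈ N.primeFactors, rankMod q (plZ γ₀) = r q) :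
    plSum k (famFun χ (rankFam r)) = famFun χ (rankFam r) (plZ γ₀) • eisenstein k χ γ₀ := by
  have hpar := famFun_hasParity hN hχ (rankFam r)
  have hsec := isSection_ratSection hpar
  ext τ
  rw [plSum, hsec.sectionSum_eq (fun _ => ratSection_of_not), Pi.smul_apply, smul_eq_mul,
    eisenstein, ← tsum_mul_left]
  rw [← tsum_subtype_eq_of_support_subset (s := cuspOrbit N γ₀)]
  · refine tsum_congr fun c => ?_
    have hc : (Quotient.mk _ (γ₀ * c.2.choose) : InfCosets) = c.1 := c.2.choose_spec
    conv_lhs => rw [← hc]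
    rw [hsec.term_infCoset, ratSection_toGSpPos hpar, famFun_mul_Gamma0 hN hadm _ c.2.choose.2]
    ring
  · intro c hc
    have h1 : famFun χ (rankFam r) (plZ c.out) ≠ 0 := by
      intro h
      exact hc (by simp only [ratSection_toGSpPos hpar, h, zero_mul])
    rw [famFun_eq_mul] at h1
    have h2 := Finset.prod_ne_zero_iff.mp (left_ne_zero_of_mul h1)
    obtain ⟨δ, hδ, γ', hγ', e⟩ := exists_orbit_of_rankMod hN (γ := c.out) (γ₀ := γ₀) (by
      intro q hq
      by_contra hne
      exact h2 q hq (by rw [rankFam, Pi.single_eq_of_ne (by rwa [← hr q hq])]))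
    refine ⟨⟨γ', hγ'⟩, ?_⟩
    rw [← c.out_eq]
    refine Quotient.sound (QuotientGroup.rightRel_apply.mpr ?_)
    rw [e]
    simpa [mul_assoc] using hδ

/-- The ranks modulo primes of the cusp attached to `(N₀, N₁, N₂)`. -/
def tripleRank (N₁ N₂ q : ℕ) : Fin 3 := if q ∣ N₂ then 2 else if q ∣ N₁ then 1 else 0

theorem cuspRep_eq (N₀ N₁ N₂ : ℕ) : cuspRep N₀ N₁ N₂ =
    diagCusp ![N₀ * Nat.gcdA N₀ (N₁ * N₂), (N₀ * N₁ : ℕ) * Nat.gcdA (N₀ * N₁) N₂] := rfl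

theorem isNormalCusp_cuspRep (hN : Squarefree N) {N₀ N₁ N₂ : ℕ} (h : N₀ * N₁ * N₂ = N) {q : ℕ}
    (hq : q ∈ N.primeFactors) :
    IsNormalCusp ![N₀ * Nat.gcdA N₀ (N₁ * N₂), (N₀ * N₁ : ℕ) * Nat.gcdA (N₀ * N₁) N₂] q
      (tripleRank N₁ N₂ q) := by
  have hp := Nat.prime_of_mem_primeFactors hq
  have hqN := Nat.dvd_of_mem_primeFactors hq
  obtain ⟨h0, h1, h2⟩ := cuspMatrix_congr (h.symm ▸ hN)
  rw [tripleRank]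
  have key : ∀ (a : ℕ) {M : Matrix (Fin 2) (Fin 2) ℤ}, q ∣ a → (∀ i j, (a : ℤ) ∣ M i j) →
      ∀ i j, (M i j : ZMod q) = 0 := fun a M ha hM i j =>
    (ZMod.intCast_zmod_eq_zero_iff_dvd _ _).mpr ((Int.natCast_dvd_natCast.mpr ha).trans (hM i j))
  by_cases d2 : q ∣ N₂
  · have e := key N₂ d2 h2
    have e0 := e 0 0
    have e1 := e 1 1
    simp only [cuspMatrix, Matrix.sub_apply, diagonal_apply_eq, Matrix.one_apply_eq, Int.cast_sub,
      Int.cast_one, sub_eq_zero] at e0 e1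
    exact ⟨by simpa [d2] using e0, by simpa [d2] using e1⟩
  by_cases d1 : q ∣ N₁
  · have e := key N₁ d1 h1
    have e0 := e 0 0
    have e1 := e 1 1
    simp only [cuspMatrix, Matrix.sub_apply, diagonal_apply_eq, Int.cast_sub, Matrix.cons_val_zero,
      Matrix.cons_val_one, Int.cast_one, Int.cast_zero, sub_eq_zero] at e0 e1
    exact ⟨by simpa [d1, d2] using e0, by simpa [d1, d2] using e1⟩
  · have d0 : q ∣ N₀ := by
      rw [← h] at hqN
      rcases hp.dvd_mul.mp hqN with h | h
      · exact (hp.dvd_mul.mp h).resolve_right d1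
      · exact absurd h d2
    have e := key N₀ d0 h0
    have e0 := e 0 0
    have e1 := e 1 1
    simp only [cuspMatrix, diagonal_apply_eq] at e0 e1
    exact ⟨by simpa [d1, d2] using e0, by simpa [d1, d2] using e1⟩

theorem rankMod_cuspRep (hN : Squarefree N) {N₀ N₁ N₂ : ℕ} (h : N₀ * N₁ * N₂ = N) :
    ∀ q ∈ N.primeFactors, rankMod q (plZ (cuspRep N₀ N₁ N₂)) = tripleRank N₁ N₂ q := by
  intro q hq
  have : Fact q.Prime := ⟨Nat.prime_of_mem_primeFactors hq⟩
  exact rankMod_diagCusp (isNormalCusp_cuspRep hN h hq)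

theorem cuspEisenstein_eq {k : ℕ} (hN : Squarefree N) {χ : DirichletCharacter ℂ N}
    (hχ : χ (-1) = (-1) ^ k) {N₀ N₁ N₂ : ℕ} (h : N₀ * N₁ * N₂ = N)
    (hadm : IsAdmissibleFam χ (rankFam (tripleRank N₁ N₂))) :
    cuspEisenstein k χ N₀ N₁ N₂ = plSum k (famFun χ (rankFam (tripleRank N₁ N₂))) := by
  have hn := fun q hq => isNormalCusp_cuspRep hN h (q := q) hq
  rw [plSum_rankFam hN hχ (γ₀ := cuspRep N₀ N₁ N₂) hadm, cuspRep_eq, famFun_diagCusp χ _ hn]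
  · simp [rankFam, cuspEisenstein, cuspRep_eq]
  · exact rankMod_cuspRep hN h

theorem isAdmissibleFam_rankFam_iff {χ : DirichletCharacter ℂ N} {γ₀ : Sp} {r : ℕ → Fin 3}
    (hr : ∀ q ∈ N.primeFactors, rankMod q (plZ γ₀) = r q) (hN : N ≠ 0) :
    IsAdmissibleFam χ (rankFam r) ↔ IsAdmissible χ γ₀ := by
  have e : ∀ q, rankFam r q 1 ≠ 0 ↔ r q = 1 := by
    intro q
    rw [rankFam, Pi.single_apply]
    by_cases h : r q = 1 <;> simp [h, eq_comm]
  constructor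
  · intro h q hq hqN hrank
    have : Fact q.Prime := ⟨hq⟩
    have hm : q ∈ N.primeFactors := Nat.mem_primeFactors.mpr ⟨hq, hqN, hN⟩
    exact h q hm ((e q).mpr ((hr q hm) ▸ (rank_blockC γ₀).mp hrank))
  · intro h q hq hk
    have : Fact q.Prime := ⟨Nat.prime_of_mem_primeFactors hq⟩
    exact h q Fact.out (Nat.dvd_of_mem_primeFactors hq)
      ((rank_blockC γ₀).mpr ((hr q hq).trans ((e q).mp hk)))

/-! ### The eigenforms -/

/-- For squarefree `n` the divisors are the subsets of the set of its primes, so this is the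
expansion of a product of binomials. -/
theorem sum_divisors_prod {n : ℕ} (hn : Squarefree n) (F G : ℕ → ℂ) :
    ∑ d ∈ n.divisors, (∏ q ∈ d.primeFactors, F q) * ∏ q ∈ (n / d).primeFactors, G q
      = ∏ q ∈ n.primeFactors, (F q + G q) := by
  rw [Finset.prod_add]
  have hd : ∀ {d}, d ∈ n.divisors → n = d * (n / d) := fun h =>
    (Nat.mul_div_cancel' (Nat.dvd_of_mem_divisors h)).symm
  refine Finset.sum_bij' (fun d _ => d.primeFactors) (fun t _ => ∏ p ∈ t, p) ?_ ?_ ?_ ?_ ?_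
  · intro d h
    rw [Finset.mem_powerset]
    exact Nat.primeFactors_mono (Nat.dvd_of_mem_divisors h) hn.ne_zero
  · intro t h
    rw [Finset.mem_powerset] at h
    rw [Nat.mem_divisors]
    refine ⟨?_, hn.ne_zero⟩
    conv_rhs => rw [← Nat.prod_primeFactors_of_squarefree hn]
    exact Finset.prod_dvd_prod_of_subset _ _ _ h
  · intro d h
    exact Nat.prod_primeFactors_of_squarefree
      (hn.squarefree_of_dvd (Nat.dvd_of_mem_divisors h))
  · intro t h
    rw [Finset.mem_powerset] at h
    exact Nat.primeFactors_prod fun p hp => Nat.prime_of_mem_primeFactors (h hp)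
  · intro d h
    have hc : d.Coprime (n / d) := Nat.coprime_of_squarefree_mul ((hd h) ▸ hn)
    have : n.primeFactors \ d.primeFactors = (n / d).primeFactors := by
      conv_lhs => rw [hd h, hc.primeFactors_mul]
      rw [Finset.union_sdiff_cancel_left hc.disjoint_primeFactors]
    rw [this]

theorem prod_primeFactors_mul {a b : ℕ} (h : Squarefree (a * b)) (F : ℕ → ℂ) :
    ∏ q ∈ (a * b).primeFactors, F q = (∏ q ∈ a.primeFactors, F q) * ∏ q ∈ b.primeFactors, F q := by
  have hc := Nat.coprime_of_squarefree_mul h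
  rw [hc.primeFactors_mul, Finset.prod_union hc.disjoint_primeFactors]

theorem not_dvd_of_mem_primeFactors {a b q : ℕ} (h : Squarefree (a * b)) (hq : q ∈ a.primeFactors) :
    ¬ q ∣ b := by
  intro hb
  have hp := Nat.prime_of_mem_primeFactors hq
  exact hp.one_lt.ne' (Nat.eq_one_of_dvd_coprimes (Nat.coprime_of_squarefree_mul h)
    (Nat.dvd_of_mem_primeFactors hq) hb)

theorem prod_triple (hN : Squarefree N) {N₀ N₁ N₂ : ℕ} (h : N₀ * N₁ * N₂ = N) {F F₀ F₁ F₂ : ℕ → ℂ}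
    (h0 : ∀ q, ¬ q ∣ N₁ → ¬ q ∣ N₂ → F q = F₀ q)
    (h1 : ∀ q, q ∣ N₁ → ¬ q ∣ N₂ → F q = F₁ q) (h2 : ∀ q, q ∣ N₂ → F q = F₂ q) :
    ∏ q ∈ N.primeFactors, F q = (∏ q ∈ N₀.primeFactors, F₀ q) * (∏ q ∈ N₁.primeFactors, F₁ q)
      * ∏ q ∈ N₂.primeFactors, F₂ q := by
  subst h
  have hN1 : Squarefree (N₀ * (N₁ * N₂)) := by rwa [← mul_assoc]
  have hN2 : Squarefree (N₁ * N₂) := hN1.squarefree_of_dvd (dvd_mul_left _ _)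
  have hN3 : Squarefree (N₀ * N₁) := hN.squarefree_of_dvd (dvd_mul_right _ _)
  rw [prod_primeFactors_mul hN, prod_primeFactors_mul hN3]
  congr 1
  · congr 1
    · refine Finset.prod_congr rfl fun q hq => h0 q (not_dvd_of_mem_primeFactors hN3 hq) ?_
      exact fun hd => not_dvd_of_mem_primeFactors hN1 hq (hd.mul_left _)
    · exact Finset.prod_congr rfl fun q hq => h1 q (Nat.dvd_of_mem_primeFactors hq)
        (not_dvd_of_mem_primeFactors hN2 hq)
  · exact Finset.prod_congr rfl fun q hq => h2 q (Nat.dvd_of_mem_primeFactors hq)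

theorem div_mul_triple {n₀ n₁ a b c : ℕ} (ha : a ∣ n₀) (hb : b ∣ n₀ / a) (hc : c ∣ n₁) (n₂ : ℕ) :
    n₀ / a / b * (a * (n₁ / c)) * (b * c * n₂) = n₀ * n₁ * n₂ := by
  calc _ = a * (b * (n₀ / a / b)) * (c * (n₁ / c)) * n₂ := by ring
    _ = _ := by rw [Nat.mul_div_cancel' hb, Nat.mul_div_cancel' ha, Nat.mul_div_cancel' hc]

theorem famFun_tripleRank (hN : Squarefree N) (χ : DirichletCharacter ℂ N) {N₀ N₁ N₂ : ℕ}
    (h : N₀ * N₁ * N₂ = N) (w : Fin 5 → ℤ) :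
    famFun χ (rankFam (tripleRank N₁ N₂)) w =
      (∏ q ∈ N₀.primeFactors, loc₀ (component χ q) (fun i => (w i : ZMod q))) *
      (∏ q ∈ N₁.primeFactors, loc₁ (component χ q) (fun i => (w i : ZMod q))) *
      ∏ q ∈ N₂.primeFactors, loc₂ (component χ q) (fun i => (w i : ZMod q)) := by
  rw [famFun]
  apply prod_triple hN h
  · intro q h1 h2
    simp [rankFam, tripleRank, h1, h2, locSum]
  · intro q h1 h2
    simp [rankFam, tripleRank, h1, h2, locSum]
  · intro q h2
    simp [rankFam, tripleRank, h2, locSum]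

/-- The local coefficients of the eigenform attached to `ρ`. -/
def eigenFam (k : ℕ) (χ : DirichletCharacter ℂ N) (ρ : CuspIndex χ) (q : ℕ) : Fin 3 → ℂ :=
  if q ∣ ρ.N₂ then ![0, 0, 1]
  else if q ∣ ρ.N₁ then ![0, 1, coeffC k χ ρ q]
  else ![1, coeffA k χ ρ q, coeffB k χ ρ q]

theorem CuspIndex.N₁_dvd {χ : DirichletCharacter ℂ N} (ρ : CuspIndex χ) : ρ.N₁ ∣ N :=
  ⟨ρ.N₀ * ρ.N₂, ρ.prod_eq.symm.trans (by ring)⟩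

theorem CuspIndex.sq_of_dvd (hN : Squarefree N) {χ : DirichletCharacter ℂ N} (ρ : CuspIndex χ)
    {q : ℕ} (hq : q ∣ ρ.N₁) : component χ q ^ 2 = 1 :=
  component_sq_of_dvd hN χ ρ.N₁_dvd hq ρ.sq_eq_one

theorem sq_of_coeffA_ne_zero {k : ℕ} {χ : DirichletCharacter ℂ N} {ρ : CuspIndex χ} {q : ℕ}
    (h : coeffA k χ ρ q ≠ 0) : component χ q ^ 2 = 1 := by
  by_cases h1 : component χ q = 1
  · simp [h1]
  · exact absurd (by rw [coeffA, if_neg h1]) h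

theorem eigenFam_admissible (hN : Squarefree N) {k : ℕ} {χ : DirichletCharacter ℂ N}
    (ρ : CuspIndex χ) : IsAdmissibleFam χ (eigenFam k χ ρ) := by
  intro q _ h
  rw [eigenFam] at h
  split_ifs at h with h2 h1
  · simp at h
  · exact ρ.sq_of_dvd hN h1
  · exact sq_of_coeffA_ne_zero h

/-- Each prime of `N₀` contributes a trinomial and each prime of `N₁` a binomial. In the expansion
`Q₀` collects the primes moved from rank `0` to `1`, `Q₀'` those moved from `0` to `2`, and `Q₁`
those moved from `1` to `2`. -/
theorem famFun_eigenFam (hN : Squarefree N) (k : ℕ) (χ : DirichletCharacter ℂ N) (ρ : CuspIndex χ)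
    (w : Fin 5 → ℤ) :
    famFun χ (eigenFam k χ ρ) w =
      ∑ Q₀ ∈ ρ.N₀.divisors, ∑ Q₀' ∈ (ρ.N₀ / Q₀).divisors, ∑ Q₁ ∈ ρ.N₁.divisors,
        ((∏ q ∈ Q₀.primeFactors, coeffA k χ ρ q) * (∏ q ∈ Q₀'.primeFactors, coeffB k χ ρ q) *
          (∏ q ∈ Q₁.primeFactors, coeffC k χ ρ q)) *
        famFun χ (rankFam (tripleRank (Q₀ * (ρ.N₁ / Q₁)) (Q₀' * Q₁ * ρ.N₂))) w := by
  set A₀ : ℕ → ℂ := fun q => loc₀ (component χ q) (fun i => (w i : ZMod q)) with hA₀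
  set A₁ : ℕ → ℂ := fun q => loc₁ (component χ q) (fun i => (w i : ZMod q)) with hA₁
  set A₂ : ℕ → ℂ := fun q => loc₂ (component χ q) (fun i => (w i : ZMod q)) with hA₂
  have hN0 : Squarefree ρ.N₀ := hN.squarefree_of_dvd
    ⟨ρ.N₁ * ρ.N₂, by rw [← mul_assoc, ρ.prod_eq]⟩
  have hN1 : Squarefree ρ.N₁ := hN.squarefree_of_dvd ρ.N₁_dvd
  rw [famFun, prod_triple hN ρ.prod_eq
    (F₀ := fun q => coeffA k χ ρ q * A₁ q + (coeffB k χ ρ q * A₂ q + A₀ q))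
    (F₁ := fun q => coeffC k χ ρ q * A₂ q + A₁ q) (F₂ := A₂)]
  · rw [← sum_divisors_prod hN0, Finset.sum_mul, Finset.sum_mul]
    refine Finset.sum_congr rfl fun Q₀ hQ₀ => ?_
    have e0 := Nat.mul_div_cancel' (Nat.dvd_of_mem_divisors hQ₀)
    rw [← sum_divisors_prod (hN0.squarefree_of_dvd ⟨Q₀, by rw [mul_comm, e0]⟩), Finset.mul_sum,
      Finset.sum_mul, Finset.sum_mul]
    refine Finset.sum_congr rfl fun Q₀' hQ₀' => ?_
    rw [← sum_divisors_prod hN1, Finset.mul_sum, Finset.sum_mul]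
    refine Finset.sum_congr rfl fun Q₁ hQ₁ => ?_
    have hprod : ρ.N₀ / Q₀ / Q₀' * (Q₀ * (ρ.N₁ / Q₁)) * (Q₀' * Q₁ * ρ.N₂) = N :=
      (div_mul_triple (Nat.dvd_of_mem_divisors hQ₀) (Nat.dvd_of_mem_divisors hQ₀')
        (Nat.dvd_of_mem_divisors hQ₁) _).trans ρ.prod_eq
    have hs1 : Squarefree (Q₀ * (ρ.N₁ / Q₁)) := hN.squarefree_of_dvd
      ((dvd_mul_left _ _).trans ((dvd_mul_right _ _).trans hprod.dvd))
    have hs2 : Squarefree (Q₀' * Q₁ * ρ.N₂) :=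
      hN.squarefree_of_dvd ((dvd_mul_left _ _).trans hprod.dvd)
    rw [famFun_tripleRank hN χ hprod, prod_primeFactors_mul hs1, prod_primeFactors_mul hs2,
      prod_primeFactors_mul (hs2.squarefree_of_dvd (dvd_mul_right _ _))]
    simp only [Finset.prod_mul_distrib]
    ring
  · intro q h1 h2
    simp [eigenFam, h1, h2, locSum, hA₀, hA₁, hA₂]
    ring
  · intro q h1 h2
    simp [eigenFam, h1, h2, locSum, hA₁, hA₂]
    ring
  · intro q h2
    simp [eigenFam, h2, locSum, hA₂]

theorem rankFam_admissible_of_coeffA (hN : Squarefree N) {k : ℕ} {χ : DirichletCharacter ℂ N}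
    (ρ : CuspIndex χ) {Q₀ Q₁ M : ℕ} (hQ₀ : Q₀ ∈ ρ.N₀.divisors) (hQ₁ : Q₁ ∈ ρ.N₁.divisors)
    (hc : ∏ q ∈ Q₀.primeFactors, coeffA k χ ρ q ≠ 0) :
    IsAdmissibleFam χ (rankFam (tripleRank (Q₀ * (ρ.N₁ / Q₁)) M)) := by
  intro q hq h
  have h1 := rankFam_one_ne_zero h
  have hd : q ∣ Q₀ * (ρ.N₁ / Q₁) := by
    by_contra hd
    rw [tripleRank, if_neg hd] at h1
    split_ifs at h1 <;> simp at h1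
  have hp := Nat.prime_of_mem_primeFactors hq
  rcases hp.dvd_mul.mp hd with hd | hd
  · have hm : q ∈ Q₀.primeFactors := Nat.mem_primeFactors.mpr
      ⟨hp, hd, (Nat.pos_of_mem_divisors hQ₀).ne'⟩
    exact sq_of_coeffA_ne_zero (Finset.prod_ne_zero_iff.mp hc q hm)
  · exact ρ.sq_of_dvd hN (hd.trans (Nat.div_dvd_of_dvd (Nat.dvd_of_mem_divisors hQ₁)))

theorem eigenform_eq (hN : Squarefree N) {k : ℕ} (hk : 4 ≤ k) {χ : DirichletCharacter ℂ N}
    (hχ : χ (-1) = (-1) ^ k) (ρ : CuspIndex χ) :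
    eigenform k χ ρ = plSum k (famFun χ (eigenFam k χ ρ)) := by
  have e : famFun χ (eigenFam k χ ρ) = fun w => _ := funext (famFun_eigenFam hN k χ ρ)
  rw [e, eigenform]
  simp only [Finset.sum_sigma']
  rw [plSum_sum hk]
  · refine Finset.sum_congr rfl fun x hx => ?_
    obtain ⟨Q₀, Q₀', Q₁⟩ := x
    simp only [Finset.mem_sigma] at hx
    obtain ⟨hQ₀, hQ₀', hQ₁⟩ := hx
    simp only at hQ₀' ⊢
    -- A term with vanishing coefficient may belong to an inadmissible triple, where
    -- `cuspEisenstein_eq` is not available.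
    by_cases hc : ∏ q ∈ Q₀.primeFactors, coeffA k χ ρ q = 0
    · simp [hc]
    congr 1
    apply cuspEisenstein_eq hN hχ
    · rw [← Nat.div_div_eq_div_mul]
      exact (div_mul_triple (Nat.dvd_of_mem_divisors hQ₀) (Nat.dvd_of_mem_divisors hQ₀')
        (Nat.dvd_of_mem_divisors hQ₁) _).trans ρ.prod_eq
    · exact rankFam_admissible_of_coeffA hN ρ hQ₀ hQ₁ hc
  · intro i _
    exact famFun_hasParity hN hχ _
  · intro i _
    exact famFun_bounded χ _

end Family

end

end SiegelEisenstein

namespace SiegelEisenstein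

noncomputable section

/-! ### Hecke operators on Eisenstein series of sections -/

section

variable {N : ℕ}

/-- The automorphy factor `γ ↦ conj χ(det D_γ)` on `Γ₀(N)`. -/
def charD (χ : DirichletCharacter ℂ N) (γ : Sp) : ℂ := conj (χ ((blockD γ).det : ZMod N))

/-- Only the left factor needs `C ≡ 0`: then the lower right block of the product is congruent to
the product of the lower right blocks. -/
theorem charD_mul (χ : DirichletCharacter ℂ N) {γ : Sp} (hγ : γ ∈ Gamma0 N) (γ' : Sp) :
    charD χ (γ * γ') = charD χ γ * charD χ γ' := by
  rw [charD, charD, charD, ← map_mul, ← map_mul]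
  congr 2
  have h0 : (blockC γ).map (Int.cast : ℤ → ZMod N) = 0 := map_eq_zero_of_dvd hγ
  have e : ∀ X : Matrix (Fin 2) (Fin 2) ℤ,
      ((X.det : ℤ) : ZMod N) = (X.map (Int.castRingHom (ZMod N))).det := fun X =>
    Int.cast_det (R := ZMod N) X
  have h1 : (blockC γ).map (Int.castRingHom (ZMod N)) = 0 := h0
  rw [e, e, e, blockD_mul, ← det_mul, Matrix.map_add _ (map_add _), Matrix.map_mul, Matrix.map_mul,
    h1, zero_mul, zero_add]

theorem charD_one (χ : DirichletCharacter ℂ N) : charD χ 1 = 1 := by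
  have : blockD 1 = 1 := by ext i j; simp [blockD, toBlocks₂₂, Matrix.one_apply]
  simp [charD, this]

theorem charD_inv_mul (χ : DirichletCharacter ℂ N) {γ : Sp} (hγ : γ ∈ Gamma0 N) :
    charD χ γ * charD χ γ⁻¹ = 1 := by
  rw [← charD_mul χ hγ, mul_inv_cancel, charD_one]

/-- Sections transforming on the right under `Γ₀(N)` by the character `χ`. -/
def IsEquivariant (χ : DirichletCharacter ℂ N) (Φ : GSpPos → ℂ) : Prop :=
  ∀ g, ∀ γ ∈ Gamma0 N, Φ (g * toGSpPos γ) = charD χ γ * Φ g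

theorem ratSection_equivariant (hN : Squarefree N) {k : ℕ} {χ : DirichletCharacter ℂ N}
    (hχ : χ (-1) = (-1) ^ k) {κ : ℕ → Fin 3 → ℂ} (hκ : IsAdmissibleFam χ κ) :
    IsEquivariant χ (ratSection k (famFun χ κ)) := by
  have hpar := famFun_hasParity hN hχ κ
  have hsec := isSection_ratSection hpar
  intro g γ hγ
  by_cases hg : IsRational g
  · obtain ⟨p, hp, γ', rfl⟩ := hg
    rw [mul_assoc, hsec p hp, hsec p hp, ← map_mul, ratSection_toGSpPos hpar,
      ratSection_toGSpPos hpar, famFun_mul_Gamma0 hN hκ _ hγ, charD]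
    ring
  · rw [ratSection_of_not hg, ratSection_of_not (by rwa [IsRational.mul_Sp]), mul_zero]

/-- Membership in `δ Γ₀(N) δ⁻¹`. -/
def HeckeMem (N : ℕ) (δ : GSpPos) (γ : Sp) : Prop :=
  ∃ γ' ∈ Gamma0 N, toGSpPos γ * δ = δ * toGSpPos γ'

theorem mem_heckeSubgroup {δ : GSpPos} {γ : Gamma0 N} :
    γ ∈ heckeSubgroup N δ ↔ HeckeMem N δ γ := by
  rw [heckeSubgroup, Subgroup.mem_subgroupOf, Subgroup.mem_comap]
  constructor
  · rintro ⟨x, ⟨γ', hγ', rfl⟩, h⟩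
    refine ⟨γ', hγ', ?_⟩
    simp only [MulEquiv.toMonoidHom_eq_coe, MonoidHom.coe_coe, MulAut.conj_apply] at h
    rw [← h]; group
  · rintro ⟨γ', hγ', h⟩
    refine ⟨toGSpPos γ', ⟨γ', hγ', rfl⟩, ?_⟩
    simp only [MulEquiv.toMonoidHom_eq_coe, MonoidHom.coe_coe, MulAut.conj_apply]
    rw [← h]; group

/-- For block diagonal `δ` the lower right blocks are conjugate, so their determinants agree. -/
theorem charD_of_heckeMem (χ : DirichletCharacter ℂ N) {δ : GSpPos} {γ γ' : Sp}
    (hB : δ.1.1.toBlocks₁₂ = 0) (hC : δ.1.1.toBlocks₂₁ = 0)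
    (h : toGSpPos γ * δ = δ * toGSpPos γ') : charD χ γ = charD χ γ' := by
  have h1 := congrArg (fun g : GSpPos => g.1.1.toBlocks₂₂) h
  simp only [GSp_mul_val, toBlocks₂₂_mul, hB, hC, mul_zero, zero_mul, zero_add,
    toGSpPos_block₂₂] at h1
  have hδ : δ.1.1.toBlocks₂₂.det ≠ 0 := detD_ne_zero (p := δ) hC
  have h2 := congrArg Matrix.det h1
  rw [det_mul, det_mul, mul_comm] at h2
  have h3 := mul_left_cancel₀ hδ h2
  have e : ∀ X : Matrix (Fin 2) (Fin 2) ℤ, (X.map (Int.cast : ℤ → ℝ)).det = ((X.det : ℤ) : ℝ) :=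
    fun X => (Int.cast_det (R := ℝ) X).symm
  rw [e, e] at h3
  have h4 : (blockD γ).det = (blockD γ').det := by exact_mod_cast h3
  rw [charD, charD, h4]

/-- The summand of a Hecke operator depends only on the coset of the Hecke subgroup: the factors of
`charD` from `h` and from its conjugate cancel. Explicit representatives may thus replace
`Quotient.out`. -/
theorem IsEquivariant.heckeTerm {χ : DirichletCharacter ℂ N} {Φ : GSpPos → ℂ}
    (hΦ : IsEquivariant χ Φ) {δ : GSpPos} (hB : δ.1.1.toBlocks₁₂ = 0) (hC : δ.1.1.toBlocks₂₁ = 0)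
    {h : Sp} (hh : h ∈ Gamma0 N) (hm : HeckeMem N δ h) (γ : Sp) (g : GSpPos) :
    charD χ (h * γ) * Φ (g * ((toGSpPos (h * γ))⁻¹ * δ))
      = charD χ γ * Φ (g * ((toGSpPos γ)⁻¹ * δ)) := by
  obtain ⟨h', hh', e⟩ := hm
  have e1 : g * ((toGSpPos (h * γ))⁻¹ * δ) = g * ((toGSpPos γ)⁻¹ * δ) * toGSpPos h'⁻¹ := by
    have : (toGSpPos h)⁻¹ * δ = δ * (toGSpPos h')⁻¹ := by
      rw [inv_mul_eq_iff_eq_mul, ← mul_assoc, e]; group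
    rw [map_mul, _root_.mul_inv_rev, map_inv, mul_assoc (toGSpPos γ)⁻¹, this]
    group
  rw [e1, hΦ _ _ (inv_mem hh'), charD_mul χ hh, charD_of_heckeMem χ hB hC e]
  linear_combination (charD χ γ * Φ (g * ((toGSpPos γ)⁻¹ * δ))) * charD_inv_mul χ hh'

/-- A complete and irredundant system of representatives for the Hecke operator of `δ`. -/
structure IsHeckeSystem (N : ℕ) (δ : GSpPos) {R : Type*} (rep : R → Sp) : Prop where
  mem : ∀ i, rep i ∈ Gamma0 N
  inj : ∀ i j, HeckeMem N δ (rep i * (rep j)⁻¹) → i = j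
  surj : ∀ γ ∈ Gamma0 N, ∃ i, HeckeMem N δ (γ * (rep i)⁻¹)

theorem IsHeckeSystem.bijective {δ : GSpPos} {R : Type*} {rep : R → Sp}
    (h : IsHeckeSystem N δ rep) : Function.Bijective fun i =>
      (Quotient.mk (QuotientGroup.rightRel (heckeSubgroup N δ)) ⟨rep i, h.mem i⟩) := by
  constructor
  · intro i j hij
    have h1 := QuotientGroup.rightRel_apply.mp (Quotient.exact hij)
    rw [mem_heckeSubgroup] at h1
    exact (h.inj j i h1).symm
  · intro c
    obtain ⟨i, hi⟩ := h.surj _ c.out.2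
    refine ⟨i, ?_⟩
    rw [← c.out_eq]
    refine Quotient.sound (QuotientGroup.rightRel_apply.mpr ?_)
    rw [mem_heckeSubgroup]
    exact hi

theorem sectionSum_smul {k : ℕ} (a : ℂ) (Φ : GSpPos → ℂ) :
    a • sectionSum k Φ = sectionSum k (fun g => a * Φ g) := by
  ext τ
  rw [Pi.smul_apply, smul_eq_mul, sectionSum, sectionSum, ← tsum_mul_left]
  exact tsum_congr fun c => by ring

theorem heckeOp_sectionSum {k : ℕ} {χ : DirichletCharacter ℂ N} {Φ : GSpPos → ℂ}
    (hsec : IsSection k Φ) (heq : IsEquivariant χ Φ) (hsum : SectionSummable k Φ) (p : ℕ)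
    {δ : GSpPos} (hB : δ.1.1.toBlocks₁₂ = 0) (hC : δ.1.1.toBlocks₂₁ = 0) {R : Type*} [Fintype R]
    {rep : R → Sp} (hR : IsHeckeSystem N δ rep) :
    heckeOp k χ p δ (sectionSum k Φ) =
      ((p : ℂ) ^ ((k : ℤ) - 3) * (((δ⁻¹).1.1.det ^ ((k : ℝ) / 2) : ℝ) : ℂ)) •
        sectionSum k (fun g => ∑ i, charD χ (rep i) * Φ (g * ((toGSpPos (rep i))⁻¹ * δ))) := by
  rw [sectionSum_sum _ _ _ fun i _ => SectionSummable.mul_right hsec hsum _]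
  ext τ
  rw [heckeOp, Pi.smul_apply, smul_eq_mul, mul_assoc]
  congr 1
  rw [Finset.sum_apply, Finset.mul_sum, ← finsum_eq_sum_of_fintype]
  symm
  apply finsum_eq_of_bijective _ hR.bijective
  intro i
  set c := Quotient.mk (QuotientGroup.rightRel (heckeSubgroup N δ)) ⟨rep i, hR.mem i⟩ with hc
  have h1 := QuotientGroup.rightRel_apply.mp
    (Quotient.mk_out (s := QuotientGroup.rightRel (heckeSubgroup N δ)) ⟨rep i, hR.mem i⟩)
  rw [← hc] at h1
  set h : Gamma0 N := ⟨rep i, hR.mem i⟩ * (c.out)⁻¹ with hh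
  have e1 : (rep i) = (h : Sp) * (c.out : Sp) := by simp [hh]
  have hterm : (fun g => charD χ (rep i) * Φ (g * ((toGSpPos (rep i))⁻¹ * δ)))
      = fun g => charD χ (c.out : Sp) * Φ (g * ((toGSpPos (c.out : Sp))⁻¹ * δ)) := by
    ext g
    rw [e1]
    exact heq.heckeTerm hB hC h.2 (mem_heckeSubgroup.mp h1) _ g
  have hsl := slash_sectionSum hsec (δ⁻¹ * toGSpPos (c.out : Sp))
  rw [hsl]
  have hdet : (δ⁻¹ * toGSpPos (c.out : Sp)).1.1.det = (δ⁻¹).1.1.det := by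
    rw [GSp_mul_val, det_mul, det_toGSpPos, mul_one]
  rw [hdet]
  simp only [Pi.smul_apply, smul_eq_mul, _root_.mul_inv_rev, inv_inv]
  have hmul : ∀ (a : ℂ) (Ψ : GSpPos → ℂ), a * sectionSum k Ψ τ
      = sectionSum k (fun g => a * Ψ g) τ := fun a Ψ => congrFun (sectionSum_smul a Ψ) τ
  rw [hmul, hterm, ← hmul]
  exact mul_left_comm _ _ _

/-- The translated sum is again a section, and it is equivariant under `Gamma0 N`. Two such
functions agree once they agree at one representative of each double coset, here `γ₁`. -/
theorem heckeOp_eq_smul {k : ℕ} {χ : DirichletCharacter ℂ N} {Φ : GSpPos → ℂ}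
    (hsec : IsSection k Φ) (heq : IsEquivariant χ Φ) (hsum : SectionSummable k Φ)
    (h0 : ∀ g, ¬ IsRational g → Φ g = 0) (p : ℕ)
    {δ : GSpPos} (hB : δ.1.1.toBlocks₁₂ = 0) (hC : δ.1.1.toBlocks₂₁ = 0)
    (hδ : ∀ g, IsRational (g * δ) → IsRational g) {R : Type*} [Fintype R]
    {rep : R → Sp} (hR : IsHeckeSystem N δ rep) {lam : ℂ}
    (h : ∀ γ : Sp, ∃ π ∈ GammaInf, ∃ γ₁ : Sp, ∃ γ' ∈ Gamma0 N, γ = π * γ₁ * γ' ∧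
      ((p : ℂ) ^ ((k : ℤ) - 3) * (((δ⁻¹).1.1.det ^ ((k : ℝ) / 2) : ℝ) : ℂ)) *
        ∑ i, charD χ (rep i) * Φ (toGSpPos γ₁ * ((toGSpPos (rep i))⁻¹ * δ))
        = lam * Φ (toGSpPos γ₁)) :
    heckeOp k χ p δ (sectionSum k Φ) = lam • sectionSum k Φ := by
  rw [heckeOp_sectionSum hsec heq hsum p hB hC hR, sectionSum_smul, sectionSum_smul]
  congr 1
  set c := ((p : ℂ) ^ ((k : ℤ) - 3) * (((δ⁻¹).1.1.det ^ ((k : ℝ) / 2) : ℝ) : ℂ))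
  have hs : IsSection k fun g =>
      c * ∑ i, charD χ (rep i) * Φ (g * ((toGSpPos (rep i))⁻¹ * δ)) := by
    intro q hq g
    simp only [mul_assoc q, hsec q hq, Finset.mul_sum]
    exact Finset.sum_congr rfl fun i _ => by ring
  apply hs.ext_of_rational (Ψ := fun g => lam * Φ g)
  · intro q hq g
    simp only [hsec q hq]; ring
  · intro g hg
    rw [h0 g hg, mul_zero, Finset.sum_eq_zero, mul_zero]
    intro i _
    rw [h0, mul_zero]
    intro hr
    rw [← mul_assoc] at hr
    have := hδ _ hr
    rw [← map_inv, IsRational.mul_Sp] at this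
    exact hg this
  · intro γ
    obtain ⟨π, hπ, γ₁, γ', hγ', rfl, h1⟩ := h γ
    have hπ' := toGSpPos_mem_Parabolic.mpr hπ
    rw [map_mul, map_mul, mul_assoc (toGSpPos π), hsec _ hπ', heq _ _ hγ', mul_left_comm lam]
    refine (hs _ hπ' _).trans ?_
    congr 1
    rw [mul_left_comm lam, ← h1, mul_left_comm _ c]
    rw [Finset.mul_sum]
    -- Right multiplication by `γ'⁻¹` permutes the cosets; `σ` is the induced map on the index set,
    -- injective and hence bijective by finiteness.
    have hdet : ∀ i, ∃ j, HeckeMem N δ (rep i * γ'⁻¹ * (rep j)⁻¹) := fun i =>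
      hR.surj _ (mul_mem (hR.mem i) (inv_mem hγ'))
    choose σ hσ using hdet
    have hσi : Function.Injective σ := by
      intro i j hij
      have h2 := hσ i
      rw [hij] at h2
      obtain ⟨a, ha, ea⟩ := h2
      obtain ⟨b, hb, eb⟩ := hσ j
      refine hR.inj i j ⟨a * b⁻¹, mul_mem ha (inv_mem hb), ?_⟩
      have e2 : rep i * (rep j)⁻¹
          = (rep i * γ'⁻¹ * (rep (σ j))⁻¹) * (rep j * γ'⁻¹ * (rep (σ j))⁻¹)⁻¹ := by group
      have e3 : (toGSpPos (rep j * γ'⁻¹ * (rep (σ j))⁻¹))⁻¹ * δ = δ * (toGSpPos b)⁻¹ := by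
        rw [inv_mul_eq_iff_eq_mul, ← mul_assoc, eb]; group
      rw [e2, map_mul, map_inv, mul_assoc, e3, ← mul_assoc, ea, map_mul, map_inv]
      group
    have hσb : Function.Bijective σ := Finite.injective_iff_bijective.mp hσi
    rw [← hσb.sum_comp fun j => charD χ γ' * (charD χ (rep j) *
      Φ (toGSpPos γ₁ * ((toGSpPos (rep j))⁻¹ * δ)))]
    refine congrArg (c * ·) (Finset.sum_congr rfl fun i _ => ?_)
    have hmem : rep i * γ'⁻¹ * (rep (σ i))⁻¹ ∈ Gamma0 N :=
      mul_mem (mul_mem (hR.mem i) (inv_mem hγ')) (inv_mem (hR.mem _))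
    have h3 := heq.heckeTerm hB hC hmem (hσ i) (rep (σ i)) (toGSpPos γ₁)
    have e4 : rep i * γ'⁻¹ * (rep (σ i))⁻¹ * rep (σ i) = rep i * γ'⁻¹ := by group
    rw [e4] at h3
    rw [← h3, charD_mul χ (hR.mem i)]
    have e5 : toGSpPos γ₁ * toGSpPos γ' * ((toGSpPos (rep i))⁻¹ * δ)
        = toGSpPos γ₁ * ((toGSpPos (rep i * γ'⁻¹))⁻¹ * δ) := by
      rw [map_mul, map_inv]; group
    rw [e5]
    linear_combination (-charD χ (rep i) *
      Φ (toGSpPos γ₁ * ((toGSpPos (rep i * γ'⁻¹))⁻¹ * δ))) * charD_inv_mul χ hγ'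

end

end

end SiegelEisenstein

namespace SiegelEisenstein

noncomputable section

/-! ### The two Hecke operators on Plücker coordinates -/

/-- The matrix of `T(p)` (for `s = 1`) or of `T₁(p²)` (for `s = 0`). -/
def heckeMat (s : Fin 2) (p : ℕ) (hp : p.Prime) : GSpPos :=
  if s = 1 then heckeDelta p hp else heckeDelta₁ p hp

/-- The exponents of `p` in the action of `heckeMat` on Plücker coordinates. -/
def heckeExp (s : Fin 2) : Fin 5 → ℕ := if s = 1 then ![2, 1, 1, 1, 0] else ![2, 0, 1, 2, 0]

/-- The common factor in the action of `heckeMat` on Plücker coordinates. -/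
def heckeScale (s : Fin 2) (p : ℕ) : ℝ := if s = 1 then 1 else (p : ℝ)⁻¹

theorem heckeScale_ne_zero (s : Fin 2) {p : ℕ} (hp : p.Prime) : heckeScale s p ≠ 0 := by
  have : (p : ℝ) ≠ 0 := by exact_mod_cast hp.ne_zero
  rw [heckeScale]
  split_ifs <;> simp [this]

theorem diagGSp_val (a d : Fin 2 → ℝ) (ν : ℝ) (hν : 0 < ν) (h : ∀ i, a i * d i = ν) :
    (diagGSp a d ν hν h).1.1 = diagonal (Sum.elim a d) := rfl

theorem diagGSp_inv_val (a d : Fin 2 → ℝ) (ν : ℝ) (hν : 0 < ν) (h : ∀ i, a i * d i = ν) :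
    ((diagGSp a d ν hν h)⁻¹).1.1 = diagonal (Sum.elim (ν⁻¹ • d) (ν⁻¹ • a)) := by
  have h1 : (diagGSp a d ν hν h)⁻¹ = diagGSp (ν⁻¹ • d) (ν⁻¹ • a) ν⁻¹ (inv_pos.mpr hν) (by
      intro i
      have := h i
      simp only [Pi.smul_apply, smul_eq_mul]
      field_simp
      linarith) := by
    rw [inv_eq_iff_mul_eq_one]
    apply Subtype.ext
    apply Units.ext
    change (diagonal (Sum.elim a d) : Matrix (Fin 2 ⊕ Fin 2) (Fin 2 ⊕ Fin 2) ℝ)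
      * diagonal (Sum.elim (ν⁻¹ • d) (ν⁻¹ • a)) = 1
    rw [diagonal_mul_diagonal, ← diagonal_one]
    congr 1
    ext i
    rcases i with i | i
    · have := h i
      simp only [Sum.elim_inl, Pi.smul_apply, smul_eq_mul]
      field_simp
      linarith
    · have := h i
      simp only [Sum.elim_inr, Pi.smul_apply, smul_eq_mul]
      field_simp
      linarith
  rw [h1, diagGSp_val]

theorem toBlocks_diagonal {a d : Fin 2 → ℝ} :
    (diagonal (Sum.elim a d)).toBlocks₁₁ = diagonal a ∧
    (diagonal (Sum.elim a d)).toBlocks₁₂ = 0 ∧ (diagonal (Sum.elim a d)).toBlocks₂₁ = 0 ∧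
    (diagonal (Sum.elim a d)).toBlocks₂₂ = diagonal d := by
  refine ⟨?_, ?_, ?_, ?_⟩ <;> ext i j <;>
    simp [toBlocks₁₁, toBlocks₁₂, toBlocks₂₁, toBlocks₂₂, diagonal_apply]

theorem isRational_mul_diagonal {δ : GSpPos} {t : ℝ} (ht : t ≠ 0) {a d : Fin 2 → ℝ}
    (hδ : δ.1.1 = diagonal (Sum.elim a d)) {a' d' : Fin 2 → ℤ} (ha : ∀ i, t * a i = a' i)
    (hd : ∀ i, t * d i = d' i) (γ : Sp) : IsRational (toGSpPos γ * δ) := by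
  obtain ⟨h11, h12, h21, h22⟩ := toBlocks_diagonal (a := a) (d := d)
  apply isRational_of_integral ht (C := blockC γ * diagonal a') (D := blockD γ * diagonal d')
  · rw [GSp_mul_val, toBlocks₂₁_mul, toGSpPos_block₂₁, toGSpPos_block₂₂, hδ, h11, h21]
    ext i j
    simp [← ha]
    ring
  · rw [GSp_mul_val, toBlocks₂₂_mul, toGSpPos_block₂₁, toGSpPos_block₂₂, hδ, h12, h22]
    ext i j
    simp [← hd]
    ring

section

variable (s : Fin 2) {p : ℕ} (hp : p.Prime)

theorem isRational_mul_heckeMat (γ : Sp) : IsRational (toGSpPos γ * heckeMat s p hp) := by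
  have h0 : (p : ℝ) ≠ 0 := by exact_mod_cast hp.ne_zero
  rw [heckeMat]
  split_ifs
  · exact isRational_mul_diagonal (t := 1) one_ne_zero (diagGSp_val ..) (a' := ![p, p])
      (d' := ![1, 1]) (by intro i; fin_cases i <;> simp) (by intro i; fin_cases i <;> simp) γ
  · exact isRational_mul_diagonal (t := p) h0 (diagGSp_val ..) (a' := ![p * p, p])
      (d' := ![1, p]) (by intro i; fin_cases i <;> simp)
      (by intro i; fin_cases i <;> simp [h0]) γ

theorem isRational_mul_heckeMat_inv (γ : Sp) : IsRational (toGSpPos γ * (heckeMat s p hp)⁻¹) := by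
  have h0 : (p : ℝ) ≠ 0 := by exact_mod_cast hp.ne_zero
  rw [heckeMat]
  split_ifs
  · exact isRational_mul_diagonal (t := p) h0 (diagGSp_inv_val ..) (a' := ![1, 1])
      (d' := ![p, p]) (by intro i; fin_cases i <;> simp [h0])
      (by intro i; fin_cases i <;> simp [h0]) γ
  · exact isRational_mul_diagonal (t := p) h0 (diagGSp_inv_val ..) (a' := ![1, p])
      (d' := ![p * p, p]) (by intro i; fin_cases i <;> simp [h0])
      (by intro i; fin_cases i <;> simp) γ

theorem isRational_of_mul_heckeMat (g : GSpPos) (h : IsRational (g * heckeMat s p hp)) :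
    IsRational g := by
  obtain ⟨q, hq, γ, e⟩ := h
  have : g = q * (toGSpPos γ * (heckeMat s p hp)⁻¹) := by
    rw [← mul_assoc, ← e, mul_inv_cancel_right]
  rw [this, IsRational.parabolic_mul hq]
  exact isRational_mul_heckeMat_inv s hp γ

theorem heckeMat_blocks : (heckeMat s p hp).1.1.toBlocks₁₂ = 0 ∧
    (heckeMat s p hp).1.1.toBlocks₂₁ = 0 := by
  rw [heckeMat]
  split_ifs
  · exact ⟨toBlocks_diagonal.2.1, toBlocks_diagonal.2.2.1⟩
  · exact ⟨toBlocks_diagonal.2.1, toBlocks_diagonal.2.2.1⟩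

theorem plG_mul_heckeMat (γ : Sp) (i : Fin 5) : plG (toGSpPos γ * heckeMat s p hp) i =
    heckeScale s p * ((p ^ heckeExp s i * plZ γ i : ℤ) : ℝ) := by
  have h0 : (p : ℝ) ≠ 0 := by exact_mod_cast hp.ne_zero
  rw [plG_mul, plG_toGSpPos, heckeMat, heckeScale, heckeExp]
  split_ifs
  · rw [heckeDelta, diagGSp_val, toBlocks_diagonal.1, toBlocks_diagonal.2.1,
      toBlocks_diagonal.2.2.1, toBlocks_diagonal.2.2.2]
    fin_cases i <;> simp [act, actRow, actDet] <;> ring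
  · rw [heckeDelta₁, diagGSp_val, toBlocks_diagonal.1, toBlocks_diagonal.2.1,
      toBlocks_diagonal.2.2.1, toBlocks_diagonal.2.2.2]
    fin_cases i <;> simp [act, actRow, actDet] <;> field_simp

/-- The normalisations cancel all powers of `p` that depend on `k`: for `T(p)` the determinant
contributes `p^{-k}`, for `T₁(p²)` the scale does, against `p^{k-3}`. -/
theorem hecke_const (k : ℕ) :
    ((p : ℂ) ^ ((k : ℤ) - 3) * ((((heckeMat s p hp)⁻¹).1.1.det ^ ((k : ℝ) / 2) : ℝ) : ℂ))
      * ((heckeScale s p : ℝ) : ℂ) ^ k = ((p : ℂ) ^ 3)⁻¹ := by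
  have h0 : (p : ℂ) ≠ 0 := by exact_mod_cast hp.ne_zero
  have hr : (0 : ℝ) < p := by exact_mod_cast hp.pos
  have hz : (p : ℂ) ^ ((k : ℤ) - 3) = (p : ℂ) ^ k * ((p : ℂ) ^ 3)⁻¹ := by
    rw [zpow_sub₀ h0, zpow_natCast]
    rfl
  rw [hz, heckeMat, heckeScale]
  split_ifs
  · rw [heckeDelta, diagGSp_inv_val, det_diagonal]
    have e : (∏ i, (Sum.elim ((p : ℝ)⁻¹ • (![1, 1] : Fin 2 → ℝ))
        ((p : ℝ)⁻¹ • (![p, p] : Fin 2 → ℝ)) i)) = ((p : ℝ) ^ 2)⁻¹ := by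
      simp [Fintype.prod_sum_type, hr.ne']
      field_simp
    rw [e, Real.inv_rpow (by positivity), ← Real.rpow_natCast, ← Real.rpow_mul hr.le]
    have e2 : ((2 : ℕ) : ℝ) * ((k : ℝ) / 2) = (k : ℕ) := by push_cast; ring
    rw [e2, Real.rpow_natCast]
    push_cast
    field_simp
    simp
  · rw [heckeDelta₁, diagGSp_inv_val, det_diagonal]
    have e : (∏ i, (Sum.elim ((1 : ℝ)⁻¹ • (![(p : ℝ)⁻¹, 1] : Fin 2 → ℝ))
        ((1 : ℝ)⁻¹ • (![(p : ℝ), 1] : Fin 2 → ℝ)) i)) = 1 := by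
      simp [Fintype.prod_sum_type, hr.ne']
    rw [e, Real.one_rpow]
    push_cast
    rw [inv_pow]
    field_simp

end

/-! ### Twists at the primes different from `p` -/

/-- The factor by which a local function of rank `r` changes, where `z = ψ(p)`. -/
def twist (s : Fin 2) (z : ℂ) (r : Fin 3) (a : ℕ) : ℂ := ![z ^ a, z ^ (s.1 + a), z ^ (2 - a)] r

section

variable {q : ℕ} [Fact q.Prime]

/-- In rank zero the value is read from `v 4`, multiplied by `t^0` and divided by `t^a`; in rank two
from `v 0`, with `t^2`. In rank one it is read from `v 1` or `v 3`, whose exponents have the parity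
of `s`, and parity is all that a quadratic character sees. -/
theorem locSum_twist (s : Fin 2) {ψ : DirichletCharacter ℂ q} {κ : Fin 3 → ℂ}
    (hκ : κ 1 ≠ 0 → ψ ^ 2 = 1) {t : ZMod q} (ht : t ≠ 0) {a : ℕ} (ha : a ≤ 2)
    {v w : Fin 5 → ZMod q} (h : ∀ i, t ^ heckeExp s i * v i = t ^ a * w i) :
    locSum ψ κ w = locSum ψ (fun r => κ r * twist s (ψ t) r a) v := by
  have hz0 : ψ t ≠ 0 := ((isUnit_iff_ne_zero.mpr ht).map ψ).ne_zero
  have hta : t ^ a ≠ 0 := pow_ne_zero _ ht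
  have hzero : ∀ i, w i = 0 ↔ v i = 0 := by
    intro i
    have := h i
    constructor
    · intro h0
      rw [h0, mul_zero] at this
      exact (mul_eq_zero.mp this).resolve_left (pow_ne_zero _ ht)
    · intro h0
      rw [h0, mul_zero] at this
      exact (mul_eq_zero.mp this.symm).resolve_left hta
  have hψ : ∀ i, ψ t ^ heckeExp s i * ψ (v i) = ψ t ^ a * ψ (w i) := by
    intro i
    have := congrArg ψ (h i)
    simpa using this
  have e0 : heckeExp s 0 = 2 := by rw [heckeExp]; split_ifs <;> rfl
  have e4 : heckeExp s 4 = 0 := by rw [heckeExp]; split_ifs <;> rfl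
  have h0 : loc₀ ψ w = ψ t ^ a * loc₀ ψ v := by
    simp only [loc₀, hzero]
    split_ifs
    · have h4 := hψ 4
      rw [e4, pow_zero, one_mul] at h4
      have hc : ψ t * conj (ψ t) = 1 := by
        rw [conj_char, ← map_mul, mul_inv_cancel₀ ht, map_one]
      rw [h4, map_mul, map_pow, ← mul_assoc, ← mul_pow, hc, one_pow, one_mul]
    · simp
  have h2 : loc₂ ψ w = ψ t ^ (2 - a) * loc₂ ψ v := by
    have h2 := hψ 0
    rw [e0] at h2
    have e : ψ t ^ 2 = ψ t ^ a * ψ t ^ (2 - a) := by rw [← pow_add]; congr 1; omega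
    rw [e, mul_assoc] at h2
    exact (mul_left_cancel₀ (pow_ne_zero a hz0) h2).symm
  have h1 : κ 1 * loc₁ ψ w = κ 1 * (ψ t ^ (s.1 + a) * loc₁ ψ v) := by
    by_cases hk : κ 1 = 0
    · simp [hk]
    have hsq : ψ t ^ 2 = 1 := by rw [pow_two]; exact char_sq_mul (hκ hk) ht
    have hodd : ∀ n : ℕ, ψ t ^ (n + 2) = ψ t ^ n := fun n => by rw [pow_add, hsq, mul_one]
    have key : ∀ i, (i = 1 ∨ i = 3) → ψ (w i) = ψ t ^ (s.1 + a) * ψ (v i) := by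
      intro i hi
      have h3 := hψ i
      have e : ψ t ^ heckeExp s i = ψ t ^ s.1 := by
        rcases hi with rfl | rfl <;> fin_cases s <;> simp [heckeExp, hsq]
      rw [e] at h3
      have e2 : ψ t ^ a * ψ t ^ a = 1 := by rw [← mul_pow, ← pow_two, hsq, one_pow]
      rw [pow_add]
      linear_combination (-ψ t ^ a) * h3 - ψ (w i) * e2
    simp only [loc₁, rankOneChar, hzero, key 1 (Or.inl rfl), key 3 (Or.inr rfl)]
    split_ifs <;> simp
  rw [locSum, locSum, h0, h1, h2]
  simp [twist]
  ring

/-- Equivariance under `γ⁻¹` cancels the character of `det D_γ`, and what is left is the value at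
the diagonal cusp times the twist. -/
theorem charD_mul_locSum (s : Fin 2) {ψ : DirichletCharacter ℂ q} {κ : Fin 3 → ℂ}
    (hκ : κ 1 ≠ 0 → ψ ^ 2 = 1) {t : ZMod q} (ht : t ≠ 0) {a : ℕ} (ha : a ≤ 2) {m : Fin 2 → ℤ}
    {r : Fin 3} (hm : IsNormalCusp m q r) {γ : Sp} (hγ : ∀ i j, (q : ℤ) ∣ blockC γ i j)
    {w : Fin 5 → ZMod q}
    (h : ∀ i, t ^ heckeExp s i * (plZ (diagCusp m * γ⁻¹) i : ZMod q) = t ^ a * w i) :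
    conj (ψ ((blockD γ).det : ZMod q)) * locSum ψ κ w = κ r * twist s (ψ t) r a := by
  have hγ' : ∀ i j, (q : ℤ) ∣ blockC γ⁻¹ i j := by
    intro i j
    rw [blockC_inv]
    simpa using hγ j i
  rw [locSum_twist s hκ ht ha h]
  have h1 := locSum_act (κ := fun r => κ r * twist s (ψ t) r a)
    (fun h => hκ (left_ne_zero_of_mul h)) (transpose_mul_map hγ')
    ((blockB γ⁻¹).map (Int.cast : ℤ → ZMod q)) (onQuadric_cast (plZ_onQuadric (diagCusp m)) q)
  have h2 := act_map (Int.castRingHom (ZMod q)) (blockA γ⁻¹) (blockB γ⁻¹) (blockC γ⁻¹)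
    (blockD γ⁻¹) (plZ (diagCusp m))
  rw [← plZ_mul] at h2
  have h3 : (blockC γ⁻¹).map (Int.castRingHom (ZMod q)) = 0 := map_eq_zero_of_dvd hγ'
  rw [h3] at h2
  rw [locSum_diagCusp ψ _ hm] at h1
  have h4 : locSum ψ (fun r => κ r * twist s (ψ t) r a)
      (fun i => (plZ (diagCusp m * γ⁻¹) i : ZMod q)) = _ := (congrArg _ h2.symm).trans h1
  rw [h4, ← mul_assoc, ← map_mul, ← map_mul]
  have h5 := congrArg Matrix.det (transpose_mul_map hγ)
  rw [det_mul, det_one, det_transpose] at h5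
  have e : ∀ X : Matrix (Fin 2) (Fin 2) ℤ,
      (X.map (Int.cast : ℤ → ZMod q)).det = ((X.det : ℤ) : ZMod q) := fun X =>
    (Int.cast_det (R := ZMod q) X).symm
  rw [e, e] at h5
  rw [blockD_inv, e, det_transpose, mul_comm ((blockD γ).det : ZMod q), h5]
  simp

end

end

end SiegelEisenstein

namespace SiegelEisenstein

noncomputable section

/-! ### Reduction of the eigenvalue equation to the prime `p` -/

section

variable {N : ℕ}

/-- The contribution of the prime `p` itself. -/
def localAt (χ : DirichletCharacter ℂ N) (κ : ℕ → Fin 3 → ℂ) (p : ℕ) (γ : Sp) (w : Fin 5 → ℤ) : ℂ :=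
  if p ∣ N then conj (component χ p ((blockD γ).det : ZMod p)) *
    locSum (component χ p) (κ p) (fun i => (w i : ZMod p)) else 1

theorem prod_primeFactors_erase {p : ℕ} (hN : N ≠ 0) (hp : p.Prime) (F : ℕ → ℂ) :
    ∏ q ∈ N.primeFactors, F q = (∏ q ∈ N.primeFactors.erase p, F q) * if p ∣ N then F p else 1 := by
  by_cases h : p ∣ N
  · rw [if_pos h, Finset.prod_erase_mul _ _ (Nat.mem_primeFactors.mpr ⟨hp, h, hN⟩)]
  · rw [if_neg h, mul_one, Finset.erase_eq_of_notMem]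
    intro hm
    exact h (Nat.dvd_of_mem_primeFactors hm)

theorem isPrimitiveVec_of_scale {p : ℕ} {e : Fin 5 → ℕ} {a : ℕ} {v w : Fin 5 → ℤ}
    (hv : IsPrimitiveVec v) (h : ∀ i, (p : ℤ) ^ e i * v i = p ^ a * w i)
    (hw : ∃ i, ¬ (p : ℤ) ∣ w i) (hp : p.Prime) : IsPrimitiveVec w := by
  intro l hl
  by_cases hlp : l = p
  · rw [hlp]; exact hw
  obtain ⟨i, hi⟩ := hv l hl
  refine ⟨i, fun hd => hi ?_⟩
  have h1 : (l : ℤ) ∣ (p : ℤ) ^ e i * v i := by rw [h i]; exact hd.mul_left _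
  exact ((isCoprime_of_primes hl hp hlp).pow_right).dvd_of_dvd_mul_left h1

/-- At a cusp in normal form away from `p`, a summand of the Hecke operator splits into a power of
`p`, explicit factors at `q ≠ p`, and the contribution of `p`, which alone depends on the coset
beyond the exponent `a`. -/
theorem hecke_term (hN : Squarefree N) {k : ℕ} {χ : DirichletCharacter ℂ N}
    (hχ : χ (-1) = (-1) ^ k) {κ : ℕ → Fin 3 → ℂ} (hκ : IsAdmissibleFam χ κ) (s : Fin 2) {p : ℕ}
    (hp : p.Prime) {m : Fin 2 → ℤ} {r : ℕ → Fin 3}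
    (hm : ∀ q ∈ N.primeFactors.erase p, IsNormalCusp m q (r q)) {γ : Sp} (hγ : γ ∈ Gamma0 N)
    {a : ℕ} (ha : a ≤ 2) {w : Fin 5 → ℤ}
    (h : ∀ i, (p : ℤ) ^ heckeExp s i * plZ (diagCusp m * γ⁻¹) i = p ^ a * w i)
    (hw : ∃ i, ¬ (p : ℤ) ∣ w i) :
    charD χ γ * ratSection k (famFun χ κ)
        (toGSpPos (diagCusp m) * ((toGSpPos γ)⁻¹ * heckeMat s p hp)) =
      ((heckeScale s p : ℝ) : ℂ) ^ k * ((p : ℂ) ^ a) ^ k *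
        (∏ q ∈ N.primeFactors.erase p, κ q (r q) * twist s (component χ q (p : ZMod q)) (r q) a) *
          localAt χ κ p γ w := by
  have hpar := famFun_hasParity hN hχ κ
  have hp0 : (p : ℝ) ≠ 0 := by exact_mod_cast hp.ne_zero
  have e1 : toGSpPos (diagCusp m) * ((toGSpPos γ)⁻¹ * heckeMat s p hp)
      = toGSpPos (diagCusp m * γ⁻¹) * heckeMat s p hp := by
    rw [map_mul, map_inv, mul_assoc]
  rw [e1, ratSection_eq hpar (isRational_mul_heckeMat s hp _)
    (t := heckeScale s p * (p : ℝ) ^ a) (mul_ne_zero (heckeScale_ne_zero s hp) (pow_ne_zero _ hp0))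
    (isPrimitiveVec_of_scale (plZ_primitive _) h hw hp)]
  swap
  · intro i
    rw [plG_mul_heckeMat, h i]
    push_cast
    ring
  push_cast
  rw [mul_pow, mul_left_comm, mul_assoc (_ ^ k * _ ^ k)]
  congr 1
  have hprod : charD χ γ * famFun χ κ w = ∏ q ∈ N.primeFactors,
      conj (component χ q ((blockD γ).det : ZMod q)) *
        locSum (component χ q) (κ q) (fun i => (w i : ZMod q)) := by
    rw [charD, character_eq_prod hN, map_prod, famFun, ← Finset.prod_mul_distrib]
  rw [hprod, prod_primeFactors_erase hN.ne_zero hp, localAt]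
  congr 1
  refine Finset.prod_congr rfl fun q hq => ?_
  have hqN := Finset.mem_of_mem_erase hq
  have hqp := Finset.ne_of_mem_erase hq
  have hqprime := Nat.prime_of_mem_primeFactors hqN
  have : Fact q.Prime := ⟨hqprime⟩
  refine charD_mul_locSum s (hκ q hqN) (t := (p : ZMod q)) ?_ ha (hm q hq) ?_ ?_
  · intro h0
    rw [ZMod.natCast_eq_zero_iff] at h0
    exact hqp ((Nat.prime_dvd_prime_iff_eq hqprime hp).mp h0)
  · intro i j
    exact (Int.natCast_dvd_natCast.mpr (Nat.dvd_of_mem_primeFactors hqN)).trans (hγ i j)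
  · intro i
    have := congrArg (Int.cast : ℤ → ZMod q) (h i)
    push_cast at this
    exact this

/-- The standard diagonal entries of rank `r`. -/
def stdCusp (r : Fin 3) : Fin 2 → ℤ := ![if r = 0 then 0 else 1, if r = 2 then 1 else 0]

theorem plZ_diagCusp_congr {m n : Fin 2 → ℤ} {d : ℤ} (h : ∀ i, d ∣ m i - n i) (γ : Sp) (i : Fin 5) :
    d ∣ plZ (diagCusp m * γ) i - plZ (diagCusp n * γ) i := by
  rw [plZ_mul, plZ_mul]
  apply act_dvd_sub
  intro j
  rw [plZ_diagCusp, plZ_diagCusp]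
  have h0 := h 0
  have h1 := h 1
  fin_cases j <;> simp [h0, h1]
  have : m 0 * m 1 - n 0 * n 1 = (m 0 - n 0) * m 1 + n 0 * (m 1 - n 1) := by ring
  rw [this]
  exact dvd_add (h0.mul_right _) (h1.mul_left _)

/-- At most `p²` is divided out, so a congruence modulo `p³` between the original vectors leaves one
modulo `p` between the quotients. This is why cusps are adapted to `stdCusp` modulo `p³`. -/
theorem exists_scaled_congr {p : ℕ} {e : Fin 5 → ℕ} {a : ℕ} (ha : a ≤ 2)
    {v v' w' : Fin 5 → ℤ} (hv : ∀ i, (p : ℤ) ^ 3 ∣ v i - v' i)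
    (h : ∀ i, (p : ℤ) ^ e i * v' i = p ^ a * w' i) :
    ∃ w : Fin 5 → ℤ, (∀ i, (p : ℤ) ^ e i * v i = p ^ a * w i) ∧ ∀ i, (p : ℤ) ∣ w i - w' i := by
  choose c hc using hv
  refine ⟨fun i => w' i + p ^ e i * p ^ (3 - a) * c i, fun i => ?_, fun i => ?_⟩
  · have e3 : (p : ℤ) ^ 3 = p ^ a * p ^ (3 - a) := by rw [← pow_add]; congr 1; omega
    have := hc i
    rw [e3] at this
    linear_combination (p : ℤ) ^ e i * this + h i
  · have : (3 - a) = (2 - a) + 1 := by omega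
    rw [this]
    exact ⟨p ^ e i * p ^ (2 - a) * c i, by ring⟩

theorem localAt_congr (χ : DirichletCharacter ℂ N) (κ : ℕ → Fin 3 → ℂ) {p : ℕ} (γ : Sp)
    {w w' : Fin 5 → ℤ} (h : ∀ i, (p : ℤ) ∣ w i - w' i) :
    localAt χ κ p γ w = localAt χ κ p γ w' := by
  have : (fun i => (w i : ZMod p)) = fun i => (w' i : ZMod p) := by
    ext i
    exact ((ZMod.intCast_eq_intCast_iff_dvd_sub _ _ _).mpr (h i)).symm
  rw [localAt, localAt, this]

theorem exists_adapted_cusp {p : ℕ} (hp : p.Prime) (r : ℕ → Fin 3) (rp : Fin 3) :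
    ∃ m : Fin 2 → ℤ, (∀ i, (p : ℤ) ^ 3 ∣ m i - stdCusp rp i) ∧
      ∀ q ∈ N.primeFactors.erase p, IsNormalCusp m q (r q) := by
  have key : ∀ i, ∃ n : ℤ, ∀ q ∈ insert p N.primeFactors,
      (if q = p then (p : ℤ) ^ 3 else q) ∣ n - (if q = p then stdCusp rp i else stdCusp (r q) i) := by
    intro i
    apply exists_crt _ (fun q => if q = p then (p : ℤ) ^ 3 else q)
      (fun q => if q = p then stdCusp rp i else stdCusp (r q) i)
    have hprime : ∀ q ∈ insert p N.primeFactors, q.Prime := by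
      intro q hq
      rcases Finset.mem_insert.mp hq with rfl | hq
      · exact hp
      · exact Nat.prime_of_mem_primeFactors hq
    intro a ha b hb hab
    have h := isCoprime_of_primes (hprime a ha) (hprime b hb) hab
    split_ifs with h1 h2 h2
    · exact absurd (h1.trans h2.symm) hab
    · subst h1; exact h.pow_left
    · subst h2; exact h.pow_right
    · exact h
  choose m hm using key
  refine ⟨m, fun i => by simpa using hm i p (Finset.mem_insert_self _ _), fun q hq => ?_⟩
  have hqp := Finset.ne_of_mem_erase hq
  have hmem : q ∈ insert p N.primeFactors := Finset.mem_insert_of_mem (Finset.mem_of_mem_erase hq)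
  have e : ∀ i, (m i : ZMod q) = (stdCusp (r q) i : ZMod q) := by
    intro i
    have := hm i q hmem
    rw [if_neg hqp, if_neg hqp] at this
    exact ((ZMod.intCast_eq_intCast_iff_dvd_sub _ _ _).mpr this).symm
  constructor
  · rw [e 0]; simp [stdCusp]
  · rw [e 1]; simp [stdCusp]

/-- After the choice of an adapted cusp, the product over `q ≠ p` is common to all summands apart
from `E (a i)`. It cancels, and one identity at `p` for each rank remains; the factor `p³` is the
inverse of the constant in `hecke_const`. -/
theorem hecke_eigen (hN : Squarefree N) {k : ℕ} (hk : 4 ≤ k) {χ : DirichletCharacter ℂ N}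
    (hχ : χ (-1) = (-1) ^ k) {κ : ℕ → Fin 3 → ℂ} (hκ : IsAdmissibleFam χ κ) (s : Fin 2) {p : ℕ}
    (hp : p.Prime) {R : Type*} [Fintype R] {rep : R → Sp}
    (hR : IsHeckeSystem N (heckeMat s p hp) rep) {E : ℕ → ℂ}
    (hE : ∀ a ≤ 2, ∀ r : ℕ → Fin 3,
      ∏ q ∈ N.primeFactors.erase p, κ q (r q) * twist s (component χ q (p : ZMod q)) (r q) a
        = (∏ q ∈ N.primeFactors.erase p, κ q (r q)) * E a) {lam : ℂ}
    (h : ∀ r : Fin 3, (¬ p ∣ N → r = 0) → ∃ (a : R → ℕ) (w : R → Fin 5 → ℤ), (∀ i, a i ≤ 2) ∧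
      (∀ i j, (p : ℤ) ^ heckeExp s j * plZ (diagCusp (stdCusp r) * (rep i)⁻¹) j
        = p ^ a i * w i j) ∧ (∀ i, ∃ j, ¬ (p : ℤ) ∣ w i j) ∧
      ∑ i, ((p : ℂ) ^ a i) ^ k * E (a i) * localAt χ κ p (rep i) (w i)
        = (p : ℂ) ^ 3 * (lam * if p ∣ N then κ p r else 1)) :
    heckeOp k χ p (heckeMat s p hp) (plSum k (famFun χ κ)) = lam • plSum k (famFun χ κ) := by
  have hpar := famFun_hasParity hN hχ κ
  obtain ⟨K, hK⟩ := famFun_bounded χ κ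
  refine heckeOp_eq_smul (isSection_ratSection hpar) (ratSection_equivariant hN hχ hκ)
    (ratSection_summable hk hpar hK) (fun _ => ratSection_of_not) p (heckeMat_blocks s hp).1
    (heckeMat_blocks s hp).2 (isRational_of_mul_heckeMat s hp) hR fun γ => ?_
  set r : ℕ → Fin 3 := fun q => rankMod q (plZ γ) with hr
  -- If `p ∤ N` there is no rank at `p` to respect, and the cusp is taken to vanish modulo `p³`.
  set rp : Fin 3 := if p ∣ N then r p else 0 with hrp
  obtain ⟨m, hm1, hm2⟩ := exists_adapted_cusp (N := N) hp r rp
  have hnorm : ∀ q ∈ N.primeFactors, IsNormalCusp m q (r q) := by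
    intro q hq
    by_cases hqp : q = p
    · subst hqp
      have hd := Nat.dvd_of_mem_primeFactors hq
      rw [hrp, if_pos hd] at hm1
      have e : ∀ i, (m i : ZMod q) = (stdCusp (r q) i : ZMod q) := fun i =>
        ((ZMod.intCast_eq_intCast_iff_dvd_sub _ _ _).mpr
          ((dvd_pow_self _ three_ne_zero).trans (hm1 i))).symm
      constructor
      · rw [e 0]; simp [stdCusp]
      · rw [e 1]; simp [stdCusp]
    · exact hm2 q (Finset.mem_erase.mpr ⟨hqp, hq⟩)
  obtain ⟨π, hπ, γ', hγ', e⟩ := exists_diagCusp_orbit hN γ hnorm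
  refine ⟨π, hπ, diagCusp m, γ', hγ', e, ?_⟩
  obtain ⟨a, w, ha, hw, hw1, hsum⟩ := h rp (fun hd => by rw [hrp, if_neg hd])
  have hterm : ∀ i, charD χ (rep i) * ratSection k (famFun χ κ)
        (toGSpPos (diagCusp m) * ((toGSpPos (rep i))⁻¹ * heckeMat s p hp)) =
      ((heckeScale s p : ℝ) : ℂ) ^ k * (∏ q ∈ N.primeFactors.erase p, κ q (r q)) *
        (((p : ℂ) ^ a i) ^ k * E (a i) * localAt χ κ p (rep i) (w i)) := by
    intro i
    obtain ⟨w', hw', hc⟩ := exists_scaled_congr (ha i)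
      (plZ_diagCusp_congr hm1 (rep i)⁻¹) (hw i)
    have hprim : ∃ j, ¬ (p : ℤ) ∣ w' j := by
      obtain ⟨j, hj⟩ := hw1 i
      exact ⟨j, fun hd => hj ((dvd_iff_dvd_of_dvd_sub (hc j)).mp hd)⟩
    rw [hecke_term hN hχ hκ s hp hm2 (hR.mem i) (ha i) hw' hprim, hE _ (ha i),
      localAt_congr χ κ (rep i) hc]
    ring
  rw [Finset.sum_congr rfl fun i _ => hterm i, ← Finset.mul_sum, hsum, ratSection_toGSpPos hpar,
    famFun_diagCusp χ κ hnorm, prod_primeFactors_erase hN.ne_zero hp]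
  have hc := hecke_const s hp k
  have hp0 : (p : ℂ) ^ 3 ≠ 0 := pow_ne_zero _ (by exact_mod_cast hp.ne_zero)
  have hif : (if p ∣ N then κ p rp else 1) = if p ∣ N then κ p (r p) else 1 := by
    by_cases hd : p ∣ N
    · rw [hrp, if_pos hd, if_pos hd, if_pos hd]
    · rw [if_neg hd, if_neg hd]
  rw [hif]
  generalize (if p ∣ N then κ p (r p) else 1) = X
  generalize (∏ q ∈ N.primeFactors.erase p, κ q (r q)) = Y
  linear_combination (Y * lam * X * (p : ℂ) ^ 3) * hc + (Y * lam * X) * inv_mul_cancel₀ hp0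

end

end

end SiegelEisenstein

namespace SiegelEisenstein

noncomputable section

/-! ### Membership in the Hecke subgroups -/

/-- An integral matrix conjugate to `γ` under `δ` is automatically symplectic, because `δ` is a
similitude; only integrality and the level have to be checked. -/
theorem heckeMem_of_integral {N : ℕ} {δ : GSpPos} {γ : Sp}
    {X : Matrix (Fin 2 ⊕ Fin 2) (Fin 2 ⊕ Fin 2) ℤ}
    (hX : γ.1.map (Int.cast : ℤ → ℝ) * δ.1.1 = δ.1.1 * X.map (Int.cast : ℤ → ℝ))
    (hC : ∀ i j, (N : ℤ) ∣ X.toBlocks₂₁ i j) : HeckeMem N δ γ := by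
  obtain ⟨ν, hν, hδ⟩ := δ.2
  have hγ : γ.1.map (Int.cast : ℤ → ℝ) * J (Fin 2) ℝ * (γ.1.map (Int.cast : ℤ → ℝ))ᵀ
      = J (Fin 2) ℝ :=
    SymplecticGroup.mem_iff.mp (SymplecticGroup.map_mem γ.2 (Int.castRingHom ℝ))
  have hu : IsUnit δ.1.1.det := by
    rw [← Matrix.isUnit_iff_isUnit_det]; exact δ.1.isUnit
  have hut : IsUnit δ.1.1ᵀ.det := by rwa [det_transpose]
  have h1 : δ.1.1 * (X.map (Int.cast : ℤ → ℝ) * J (Fin 2) ℝ * (X.map (Int.cast : ℤ → ℝ))ᵀ) * δ.1.1ᵀ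
      = δ.1.1 * J (Fin 2) ℝ * δ.1.1ᵀ := by
    calc _ = (δ.1.1 * X.map (Int.cast : ℤ → ℝ)) * J (Fin 2) ℝ
          * (δ.1.1 * X.map (Int.cast : ℤ → ℝ))ᵀ := by
          rw [transpose_mul]; simp only [mul_assoc]
      _ = γ.1.map (Int.cast : ℤ → ℝ) * (δ.1.1 * J (Fin 2) ℝ * δ.1.1ᵀ)
          * (γ.1.map (Int.cast : ℤ → ℝ))ᵀ := by
          rw [← hX, transpose_mul]; simp only [mul_assoc]
      _ = _ := by rw [hδ, Matrix.mul_smul, Matrix.smul_mul, hγ]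
  have h2 : X.map (Int.cast : ℤ → ℝ) * J (Fin 2) ℝ * (X.map (Int.cast : ℤ → ℝ))ᵀ = J (Fin 2) ℝ := by
    have h3 := congrArg (fun M => δ.1.1⁻¹ * (M * δ.1.1ᵀ⁻¹)) h1
    simp only [mul_nonsing_inv_cancel_right _ _ hut, nonsing_inv_mul_cancel_left _ _ hu] at h3
    exact h3
  have h4 : X * J (Fin 2) ℤ * Xᵀ = J (Fin 2) ℤ := by
    apply Matrix.map_injective (f := (Int.cast : ℤ → ℝ)) Int.cast_injective
    have e : ∀ M M' : Matrix (Fin 2 ⊕ Fin 2) (Fin 2 ⊕ Fin 2) ℤ, (M * M').map (Int.cast : ℤ → ℝ)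
        = M.map (Int.cast : ℤ → ℝ) * M'.map (Int.cast : ℤ → ℝ) := fun M M' =>
      Matrix.map_mul (f := Int.castRingHom ℝ)
    have eJ : (J (Fin 2) ℤ).map (Int.cast : ℤ → ℝ) = J (Fin 2) ℝ := by
      ext i j
      rcases i with i | i <;> rcases j with j | j <;> simp [J, Matrix.one_apply]
    beta_reduce
    rw [e, e, transpose_map, eJ, h2]
  refine ⟨⟨X, SymplecticGroup.mem_iff.mpr h4⟩, hC, ?_⟩
  apply Subtype.ext
  apply Units.ext
  exact hX

theorem map_fromBlocks_Sp (γ : Sp) : γ.1.map (Int.cast : ℤ → ℝ) =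
    fromBlocks ((blockA γ).map Int.cast) ((blockB γ).map Int.cast) ((blockC γ).map Int.cast)
      ((blockD γ).map Int.cast) := by
  conv_lhs => rw [← fromBlocks_toBlocks γ.1, fromBlocks_map]
  rfl

theorem diagonal_sumElim (a d : Fin 2 → ℝ) :
    (diagonal (Sum.elim a d) : Matrix (Fin 2 ⊕ Fin 2) (Fin 2 ⊕ Fin 2) ℝ)
      = fromBlocks (diagonal a) 0 0 (diagonal d) := by
  rw [fromBlocks_diagonal]

/-- Conjugation by `δ` sends `(A B; C D)` to `(A B/p; pC D)`. -/
theorem heckeMem_iff {N p : ℕ} (hp : p.Prime) {γ : Sp} (hγ : γ ∈ Gamma0 N) :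
    HeckeMem N (heckeMat 1 p hp) γ ↔ ∀ i j, (p : ℤ) ∣ blockB γ i j := by
  have h0 : (p : ℝ) ≠ 0 := by exact_mod_cast hp.ne_zero
  have hδ : (heckeMat 1 p hp).1.1 = diagonal (Sum.elim ![(p : ℝ), p] ![1, 1]) := rfl
  constructor
  · rintro ⟨γ', -, h⟩ i j
    have h1 := congrArg (fun g : GSpPos => g.1.1.toBlocks₁₂ i j) h
    simp only [GSp_mul_val, toBlocks₁₂_mul, hδ, toBlocks_diagonal.1, toBlocks_diagonal.2.1,
      toBlocks_diagonal.2.2.2, toGSpPos_block₁₁, toGSpPos_block₁₂] at h1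
    refine ⟨blockB γ' i j, ?_⟩
    fin_cases i <;> fin_cases j <;> simp at h1 <;> exact_mod_cast h1
  · intro h
    choose B' hB' using h
    refine heckeMem_of_integral (X := fromBlocks (blockA γ) (of B')
      (of fun i j => (p : ℤ) * blockC γ i j) (blockD γ)) ?_ ?_
    · rw [map_fromBlocks_Sp, hδ, diagonal_sumElim, fromBlocks_map, fromBlocks_multiply,
        fromBlocks_multiply]
      congr 1 <;> ext i j <;> fin_cases i <;> fin_cases j <;> simp [hB'] <;> ring
    · intro i j
      rw [toBlocks_fromBlocks₂₁]
      exact (hγ i j).mul_left _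

/-- Integrality of the conjugate requires five divisibilities. Those of `B 1 0` and `D 1 0` by `p`
follow from the other three: these make `A 0 0` a unit modulo `p`, and the symplectic relations can
be solved for the two entries. -/
theorem heckeMem_iff' {N p : ℕ} (hp : p.Prime) {γ : Sp} (hγ : γ ∈ Gamma0 N) :
    HeckeMem N (heckeMat 0 p hp) γ ↔
      (p : ℤ) ∣ blockA γ 0 1 ∧ (p : ℤ) ^ 2 ∣ blockB γ 0 0 ∧ (p : ℤ) ∣ blockB γ 0 1 := by
  have h0 : (p : ℝ) ≠ 0 := by exact_mod_cast hp.ne_zero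
  have hδ : (heckeMat 0 p hp).1.1 = diagonal (Sum.elim ![(p : ℝ), 1] ![(p : ℝ)⁻¹, 1]) := rfl
  constructor
  · rintro ⟨γ', -, h⟩
    have h1 := fun i j => congrArg (fun g : GSpPos => g.1.1.toBlocks₁₂ i j) h
    have h2 := congrArg (fun g : GSpPos => g.1.1.toBlocks₁₁ 0 1) h
    simp only [GSp_mul_val, toBlocks₁₂_mul, toBlocks₁₁_mul, hδ, toBlocks_diagonal.1,
      toBlocks_diagonal.2.1, toBlocks_diagonal.2.2.1,
      toBlocks_diagonal.2.2.2, toGSpPos_block₁₁, toGSpPos_block₁₂] at h1 h2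
    have h3 := h1 0 0
    have h4 := h1 0 1
    simp at h2 h3 h4
    refine ⟨⟨blockA γ' 0 1, by exact_mod_cast h2⟩, ⟨blockB γ' 0 0, ?_⟩,
      ⟨blockB γ' 0 1, by exact_mod_cast h4⟩⟩
    field_simp at h3
    exact_mod_cast h3
  · rintro ⟨h1, h2, h3⟩
    obtain ⟨r1, -, r3⟩ := Sp_relations γ
    have hpp : Prime (p : ℤ) := Nat.prime_iff_prime_int.mp hp
    have hp2 : (p : ℤ) ∣ blockB γ 0 0 := (dvd_pow_self _ two_ne_zero).trans h2
    have e1 := congrFun (congrFun r1 0) 1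
    have e2 := congrFun (congrFun r3 0) 0
    have e3 := congrFun (congrFun r3 0) 1
    simp [Matrix.mul_apply, Fin.sum_univ_two] at e1 e2 e3
    have hA : ¬ (p : ℤ) ∣ blockA γ 0 0 := by
      intro hA
      apply hpp.not_isUnit
      apply isUnit_of_dvd_one
      rw [← e2]
      exact dvd_sub (dvd_add (hA.mul_right _) (h1.mul_right _))
        (dvd_add (hp2.mul_right _) (h3.mul_right _))
    have h4 : (p : ℤ) ∣ blockB γ 1 0 := by
      refine (hpp.dvd_or_dvd (a := blockA γ 0 0) ?_).resolve_left hA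
      have : blockA γ 0 0 * blockB γ 1 0 = blockB γ 0 0 * blockA γ 1 0 + blockB γ 0 1 * blockA γ 1 1
          - blockA γ 0 1 * blockB γ 1 1 := by linear_combination e1
      rw [this]
      exact dvd_sub (dvd_add (hp2.mul_right _) (h3.mul_right _)) (h1.mul_right _)
    have h5 : (p : ℤ) ∣ blockD γ 1 0 := by
      refine (hpp.dvd_or_dvd (a := blockA γ 0 0) ?_).resolve_left hA
      have : blockA γ 0 0 * blockD γ 1 0 = blockB γ 0 0 * blockC γ 1 0 + blockB γ 0 1 * blockC γ 1 1
          - blockA γ 0 1 * blockD γ 1 1 := by linear_combination e3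
      rw [this]
      exact dvd_sub (dvd_add (hp2.mul_right _) (h3.mul_right _)) (h1.mul_right _)
    obtain ⟨a, ha⟩ := h1
    obtain ⟨b, hb⟩ := h2
    obtain ⟨b', hb'⟩ := h3
    obtain ⟨b'', hb''⟩ := h4
    obtain ⟨d, hd⟩ := h5
    refine heckeMem_of_integral (X := fromBlocks !![blockA γ 0 0, a; p * blockA γ 1 0, blockA γ 1 1]
      !![b, b'; b'', blockB γ 1 1]
      !![p ^ 2 * blockC γ 0 0, p * blockC γ 0 1; p * blockC γ 1 0, blockC γ 1 1]
      !![blockD γ 0 0, p * blockD γ 0 1; d, blockD γ 1 1]) ?_ ?_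
    · rw [map_fromBlocks_Sp, hδ, diagonal_sumElim, fromBlocks_map, fromBlocks_multiply,
        fromBlocks_multiply]
      congr 1 <;> ext i j <;> fin_cases i <;> fin_cases j <;>
        simp [ha, hb, hb', hb'', hd] <;> field_simp
    · intro i j
      rw [toBlocks_fromBlocks₂₁]
      fin_cases i <;> fin_cases j <;> simp
      exacts [(hγ 0 0).mul_left _, (hγ 0 1).mul_left _, (hγ 1 0).mul_left _, hγ 1 1]

theorem blockA_mul_inv (γ r : Sp) : blockA (γ * r⁻¹)
    = blockA γ * (blockD r)ᵀ - blockB γ * (blockC r)ᵀ := by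
  rw [blockA_mul, blockA_inv, blockC_inv, Matrix.mul_neg, sub_eq_add_neg]

theorem blockB_mul_inv (γ r : Sp) : blockB (γ * r⁻¹)
    = blockB γ * (blockA r)ᵀ - blockA γ * (blockB r)ᵀ := by
  rw [blockB_mul, blockB_inv, blockD_inv, Matrix.mul_neg, sub_eq_add_neg, add_comm]

theorem blockA_mul_inv_apply (γ r : Sp) (i j : Fin 2) : blockA (γ * r⁻¹) i j =
    blockA γ i 0 * blockD r j 0 + blockA γ i 1 * blockD r j 1
      - (blockB γ i 0 * blockC r j 0 + blockB γ i 1 * blockC r j 1) := by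
  rw [blockA_mul_inv]
  simp [Matrix.mul_apply, Fin.sum_univ_two]

theorem blockB_mul_inv_apply (γ r : Sp) (i j : Fin 2) : blockB (γ * r⁻¹) i j =
    blockB γ i 0 * blockA r j 0 + blockB γ i 1 * blockA r j 1
      - (blockA γ i 0 * blockB r j 0 + blockA γ i 1 * blockB r j 1) := by
  rw [blockB_mul_inv]
  simp [Matrix.mul_apply, Fin.sum_univ_two]

/-! ### Lines modulo `p` -/

/-- Unimodular matrices representing the projective line modulo `p`. -/
def lineMat (p : ℕ) : Option (ZMod p) → Matrix (Fin 2) (Fin 2) ℤ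
  | none => !![0, 1; -1, 0]
  | some t => !![1, t.cast; 0, 1]

theorem det_lineMat (p : ℕ) (o : Option (ZMod p)) : (lineMat p o).det = 1 := by
  cases o <;> simp [lineMat]

theorem dvd_cast_sub_iff {n : ℕ} (t : ZMod n) (m : ℤ) :
    (n : ℤ) ∣ (t.cast : ℤ) - m ↔ t = (m : ZMod n) := by
  rw [← ZMod.intCast_eq_intCast_iff_dvd_sub, ZMod.intCast_zmod_cast, eq_comm]

theorem exists_lineMat {p : ℕ} [Fact p.Prime] (x y : ℤ) :
    ∃ o : Option (ZMod p), (p : ℤ) ∣ y * lineMat p o 0 0 - x * lineMat p o 0 1 := by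
  by_cases hx : (x : ZMod p) = 0
  · refine ⟨none, ?_⟩
    rw [ZMod.intCast_zmod_eq_zero_iff_dvd] at hx
    simpa [lineMat] using hx
  · refine ⟨some (y * (x : ZMod p)⁻¹), ?_⟩
    rw [← ZMod.intCast_zmod_eq_zero_iff_dvd]
    simp [lineMat]
    field_simp
    simp

theorem lineMat_injective {p : ℕ} [Fact p.Prime] {o o' : Option (ZMod p)}
    (h : (p : ℤ) ∣ lineMat p o 0 1 * lineMat p o' 0 0 - lineMat p o 0 0 * lineMat p o' 0 1) :
    o = o' := by
  rw [← ZMod.intCast_zmod_eq_zero_iff_dvd] at h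
  rcases o with - | t <;> rcases o' with - | t' <;> simp [lineMat] at h
  · rfl
  · rw [sub_eq_zero] at h
    rw [h]

end

end SiegelEisenstein

namespace SiegelEisenstein

noncomputable section

/-! ### Representatives for `T(p)` -/

theorem symm_fin_two (a b c : ℤ) : (!![a, b; b, c])ᵀ = !![a, b; b, c] := by
  ext i j; fin_cases i <;> fin_cases j <;> rfl

/-- The translations by symmetric matrices modulo `p`. -/
def transRep (p : ℕ) (y : ZMod p × ZMod p × ZMod p) : Sp :=
  spUpper !![y.1.cast, y.2.1.cast; y.2.1.cast, y.2.2.cast] (symm_fin_two _ _ _)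

theorem spUpper_mem_Gamma0 (N : ℕ) (Y : Matrix (Fin 2) (Fin 2) ℤ) (h : Yᵀ = Y) :
    spUpper Y h ∈ Gamma0 N := by
  intro i j
  simp [blockC_spUpper]

theorem spLevi_mem_Gamma0 (N : ℕ) (U : Matrix (Fin 2) (Fin 2) ℤ) (h : U.det = 1) :
    spLevi U h ∈ Gamma0 N := by
  intro i j
  simp [blockC_spLevi]

theorem blockB_mul_upper_inv (γ : Sp) (Y : Matrix (Fin 2) (Fin 2) ℤ) (h : Yᵀ = Y) :
    blockB (γ * (spUpper Y h)⁻¹) = blockB γ - blockA γ * Y := by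
  rw [blockB_mul_inv, blockA_spUpper, blockB_spUpper, h, transpose_one, Matrix.mul_one]

theorem Sp_relation_AB (γ : Sp) : blockA γ 0 0 * blockB γ 1 0 + blockA γ 0 1 * blockB γ 1 1
    = blockB γ 0 0 * blockA γ 1 0 + blockB γ 0 1 * blockA γ 1 1 := by
  have := congrFun (congrFun (Sp_relations γ).1 0) 1
  simpa [Matrix.mul_apply, Fin.sum_univ_two] using this

theorem not_dvd_row_of_det {p : ℕ} (hp : p.Prime) {U : Matrix (Fin 2) (Fin 2) ℤ} (h : U.det = 1) :
    ¬ ((p : ℤ) ∣ U 0 0 ∧ (p : ℤ) ∣ U 0 1) := by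
  rintro ⟨h0, h1⟩
  apply (Nat.prime_iff_prime_int.mp hp).not_isUnit
  apply isUnit_of_dvd_one
  rw [← h, det_fin_two]
  exact dvd_sub (h0.mul_right _) (h1.mul_right _)

/-- When `A` is invertible modulo `p`, the translation is `A⁻¹ B`, symmetric by the symplectic
relation between `A` and `B`. -/
theorem exists_transRep {p : ℕ} [Fact p.Prime] (γ : Sp) (h : ¬ (p : ℤ) ∣ (blockA γ).det) :
    ∃ y, ∀ i j, (p : ℤ) ∣ blockB (γ * (transRep p y)⁻¹) i j := by
  have hrel := congrArg (Int.cast : ℤ → ZMod p) (Sp_relation_AB γ)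
  rw [← ZMod.intCast_zmod_eq_zero_iff_dvd, det_fin_two] at h
  push_cast at hrel h
  set a := (blockA γ 0 0 : ZMod p)
  set b := (blockA γ 0 1 : ZMod p)
  set c := (blockA γ 1 0 : ZMod p)
  set d := (blockA γ 1 1 : ZMod p)
  set e := (blockB γ 0 0 : ZMod p)
  set f := (blockB γ 0 1 : ZMod p)
  set g := (blockB γ 1 0 : ZMod p)
  set l := (blockB γ 1 1 : ZMod p)
  set t := (a * d - b * c)⁻¹ with ht
  have hd : t * (a * d - b * c) = 1 := inv_mul_cancel₀ h
  refine ⟨(t * (d * e - b * g), t * (d * f - b * l), t * (a * l - c * f)), fun i j => ?_⟩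
  rw [transRep, blockB_mul_upper_inv, ← ZMod.intCast_zmod_eq_zero_iff_dvd]
  fin_cases i <;> fin_cases j <;>
    simp only [Fin.zero_eta, Fin.mk_one, Matrix.sub_apply, Matrix.mul_apply, Fin.sum_univ_two,
      of_apply, cons_val_zero, cons_val_one, Int.cast_sub, Int.cast_add, Int.cast_mul,
      ZMod.intCast_zmod_cast, cons_val', cons_val_fin_one]
  · change e - (a * _ + b * _) = 0
    linear_combination (-e) * hd + t * b * hrel
  · change f - (a * _ + b * _) = 0
    linear_combination (-f) * hd
  · change g - (c * _ + d * _) = 0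
    linear_combination (-g) * hd + t * d * hrel
  · change l - (c * _ + d * _) = 0
    linear_combination (-l) * hd

theorem transRep_injective {p : ℕ} {y y' : ZMod p × ZMod p × ZMod p}
    (h : ∀ i j, (p : ℤ) ∣ blockB (transRep p y * (transRep p y')⁻¹) i j) : y = y' := by
  simp only [transRep, blockB_mul_upper_inv, blockB_spUpper, blockA_spUpper, Matrix.one_mul] at h
  have h1 := h 0 0
  have h2 := h 0 1
  have h3 := h 1 1
  simp [dvd_cast_sub_iff] at h1 h2 h3
  exact Prod.ext h1 (Prod.ext h2 h3)

theorem not_dvd_det_blockA {N p : ℕ} (hp : p.Prime) (hpN : p ∣ N) {γ : Sp} (hγ : γ ∈ Gamma0 N) :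
    ¬ (p : ℤ) ∣ (blockA γ).det := by
  have : Fact p.Prime := ⟨hp⟩
  have h := congrArg Matrix.det (transpose_mul_map (q := p) (γ := γ) fun i j =>
    (Int.natCast_dvd_natCast.mpr hpN).trans (hγ i j))
  rw [det_mul, det_one, det_transpose] at h
  rw [← ZMod.intCast_zmod_eq_zero_iff_dvd, Int.cast_det]
  intro h0
  have e : (blockA γ).map (Int.cast : ℤ → ZMod p) = (blockA γ).map (fun x => (x : ZMod p)) := rfl
  rw [e, h0] at h
  simp at h

/-- For `p ∣ N` the block `A` of an element of `Gamma0 N` is invertible modulo `p`, so the `p³`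
translations already meet every coset. -/
theorem isHeckeSystem_transRep {N p : ℕ} (hp : p.Prime) (hpN : p ∣ N) :
    IsHeckeSystem N (heckeMat 1 p hp) (transRep p) where
  mem y := spUpper_mem_Gamma0 N _ (symm_fin_two _ _ _)
  inj i j h := transRep_injective ((heckeMem_iff hp (mul_mem (spUpper_mem_Gamma0 _ _ _)
    (inv_mem (spUpper_mem_Gamma0 _ _ _)))).mp h)
  surj γ hγ := by
    have : Fact p.Prime := ⟨hp⟩
    obtain ⟨y, hy⟩ := exists_transRep γ (not_dvd_det_blockA hp hpN hγ)
    exact ⟨y, (heckeMem_iff hp (mul_mem hγ (inv_mem (spUpper_mem_Gamma0 _ _ _)))).mpr hy⟩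

/-- The Levi element of a line modulo `p`. -/
def lineLevi (p : ℕ) (o : Option (ZMod p)) : Sp := spLevi (lineMat p o) (det_lineMat p o)

/-- Representatives for `T(p)` whose upper left block has rank one modulo `p`. -/
def midRep (p : ℕ) {N : ℕ} {x₀ y₀ : ℤ} (h : p * x₀ - y₀ * N = 1)
    (i : ZMod p × Option (ZMod p)) : Sp :=
  spPair ![1, p] ![i.1.cast, y₀] ![0, N] ![1, x₀]
    (by intro j; fin_cases j <;> simp [h]) * lineLevi p i.2

/-- The representative for `T(p)` whose upper left block vanishes modulo `p`. -/
def lowRep (p : ℕ) {N : ℕ} {x₀ y₀ : ℤ} (h : p * x₀ - y₀ * N = 1) : Sp :=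
  spPair ![p, p] ![y₀, y₀] ![N, N] ![x₀, x₀] (by intro j; fin_cases j <;> simp [h])

/-! ### Representatives of `T(p)` for `p` prime to the level. -/

section

variable {p N : ℕ} {x₀ y₀ : ℤ} (h : p * x₀ - y₀ * N = 1)

theorem blockA_midRep (i) : blockA (midRep p h i) = !![lineMat p i.2 0 0, lineMat p i.2 0 1;
    p * lineMat p i.2 1 0, p * lineMat p i.2 1 1] := by
  rw [midRep, lineLevi, blockA_mul, blockA_spPair, blockA_spLevi, blockC_spLevi, Matrix.mul_zero,
    add_zero]
  ext a b
  fin_cases a <;> fin_cases b <;> simp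

theorem blockB_midRep (i) : blockB (midRep p h i) =
    !![i.1.cast * lineMat p i.2 1 1, -(i.1.cast * lineMat p i.2 1 0);
      -(y₀ * lineMat p i.2 0 1), y₀ * lineMat p i.2 0 0] := by
  rw [midRep, lineLevi, blockB_mul, blockB_spPair, blockB_spLevi, blockD_spLevi, Matrix.mul_zero,
    zero_add]
  ext a b
  fin_cases a <;> fin_cases b <;> simp [adjugate_fin_two]

theorem blockC_midRep (i) : blockC (midRep p h i) =
    !![0, 0; N * lineMat p i.2 1 0, N * lineMat p i.2 1 1] := by
  rw [midRep, lineLevi, blockC_mul', blockC_spPair, blockA_spLevi, blockC_spLevi, Matrix.mul_zero,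
    add_zero]
  ext a b
  fin_cases a <;> fin_cases b <;> simp

theorem spPair_mem_Gamma0 {x y z w : Fin 2 → ℤ} {h : ∀ i, x i * w i - y i * z i = 1}
    (hz : ∀ i, (N : ℤ) ∣ z i) : spPair x y z w h ∈ Gamma0 N := by
  intro i j
  rw [blockC_spPair, diagonal_apply]
  split_ifs
  · exact hz i
  · exact dvd_zero _

theorem midRep_mem (i) : midRep p h i ∈ Gamma0 N :=
  mul_mem (spPair_mem_Gamma0 (by intro j; fin_cases j <;> simp)) (spLevi_mem_Gamma0 _ _ _)

theorem lowRep_mem : lowRep p h ∈ Gamma0 N :=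
  spPair_mem_Gamma0 (by intro j; fin_cases j <;> simp)

/-- Representatives for `T(p)` when `p` does not divide the level. -/
def fullRep (p : ℕ) {N : ℕ} {x₀ y₀ : ℤ} (h : p * x₀ - y₀ * N = 1) :
    (ZMod p × ZMod p × ZMod p) ⊕ (ZMod p × Option (ZMod p)) ⊕ Unit → Sp :=
  Sum.elim (transRep p) (Sum.elim (midRep p h) fun _ => lowRep p h)

theorem fullRep_mem (i) : fullRep p h i ∈ Gamma0 N := by
  rcases i with y | i | u
  · exact spUpper_mem_Gamma0 N _ (symm_fin_two _ _ _)
  · exact midRep_mem h i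
  · exact lowRep_mem h

theorem not_dvd_bezout (hp : p.Prime) {x : ℤ} {m : ℕ} (hm : m ≠ 0)
    (h : (p : ℤ) ^ m * x - y₀ * N = 1) : ¬ (p : ℤ) ∣ y₀ := by
  intro hd
  apply (Nat.prime_iff_prime_int.mp hp).not_isUnit
  apply isUnit_of_dvd_one
  rw [← h]
  exact dvd_sub ((dvd_pow_self _ hm).mul_right _) (hd.mul_right _)

/-- Bézout makes `y₀` a unit modulo `p`. The congruences on `B` then separate the three types of
representatives, and within the middle type they recover first the line and then the parameter. -/
theorem fullRep_injective (hp : p.Prime) {i j}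
    (hij : ∀ a b, (p : ℤ) ∣ blockB (fullRep p h i * (fullRep p h j)⁻¹) a b) : i = j := by
  have : Fact p.Prime := ⟨hp⟩
  have hpp := Nat.prime_iff_prime_int.mp hp
  have hy : ¬ (p : ℤ) ∣ y₀ := not_dvd_bezout (N := N) hp one_ne_zero (by rw [pow_one]; exact h)
  have hself : ∀ x : ℤ, (p : ℤ) ∣ p * x := fun x => dvd_mul_right _ _
  rcases i with y | i | u <;> rcases j with y' | i' | u' <;>
    simp only [fullRep, Sum.elim_inl, Sum.elim_inr] at hij
  · rw [transRep_injective hij]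
  · exfalso
    apply not_dvd_row_of_det hp (det_lineMat p i'.2)
    have h0 := hij 0 1
    have h1 := hij 1 1
    rw [blockB_mul_inv_apply, blockA_midRep, blockB_midRep, transRep, blockA_spUpper,
      blockB_spUpper] at h0 h1
    simp [← ZMod.intCast_zmod_eq_zero_iff_dvd]
      at h0 h1 hy ⊢
    exact ⟨h1.resolve_left hy, h0.resolve_left hy⟩
  · exfalso
    have h0 := hij 0 0
    rw [blockB_mul_inv_apply, lowRep, blockA_spPair, blockB_spPair, transRep, blockA_spUpper,
      blockB_spUpper] at h0
    simp [← ZMod.intCast_zmod_eq_zero_iff_dvd] at h0 hy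
    exact hy h0
  · exfalso
    apply not_dvd_row_of_det hp (det_lineMat p i.2)
    have h0 := hij 1 0
    have h1 := hij 1 1
    rw [blockB_mul_inv_apply, blockA_midRep, blockB_midRep, transRep, blockA_spUpper,
      blockB_spUpper] at h0 h1
    simp [← ZMod.intCast_zmod_eq_zero_iff_dvd]
      at h0 h1 hy ⊢
    exact ⟨h1.resolve_left hy, h0.resolve_left hy⟩
  · have h0 := hij 0 1
    have h1 := hij 0 0
    rw [blockB_mul_inv_apply, blockA_midRep, blockB_midRep, blockA_midRep, blockB_midRep] at h0 h1
    obtain ⟨y, o⟩ := i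
    obtain ⟨y', o'⟩ := i'
    have ho : o = o' := by
      apply lineMat_injective
      simp [← ZMod.intCast_zmod_eq_zero_iff_dvd] at h0 hy ⊢
      apply mul_left_cancel₀ hy
      linear_combination -h0
    subst ho
    have hd := congrArg (Int.cast : ℤ → ZMod p) (det_lineMat p o)
    rw [det_fin_two] at hd
    simp [← ZMod.intCast_zmod_eq_zero_iff_dvd] at h1 hd
    have : y = y' := by linear_combination h1 - (y - y') * hd
    rw [this]
  · exfalso
    apply not_dvd_row_of_det hp (det_lineMat p i.2)
    have h0 := hij 0 0
    have h1 := hij 0 1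
    rw [blockB_mul_inv_apply, lowRep, blockA_spPair, blockB_spPair, blockA_midRep, blockB_midRep] at h0 h1
    simp [← ZMod.intCast_zmod_eq_zero_iff_dvd]
      at h0 h1 hy ⊢
    exact ⟨h0.resolve_right hy, h1.resolve_right hy⟩
  · exfalso
    have h0 := hij 0 0
    rw [blockB_mul_inv_apply, lowRep, blockA_spPair, blockB_spPair, transRep, blockA_spUpper,
      blockB_spUpper] at h0
    simp [← ZMod.intCast_zmod_eq_zero_iff_dvd] at h0 hy
    exact hy h0
  · exfalso
    apply not_dvd_row_of_det hp (det_lineMat p i'.2)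
    have h0 := hij 0 0
    have h1 := hij 1 0
    rw [blockB_mul_inv_apply, lowRep, blockA_spPair, blockB_spPair, blockA_midRep, blockB_midRep] at h0 h1
    simp [← ZMod.intCast_zmod_eq_zero_iff_dvd]
      at h0 h1 hy ⊢
    exact ⟨h0.resolve_left hy, h1.resolve_left hy⟩
  · rfl

/-- A coset is the Lagrangian plane spanned modulo `p` by the rows of `(A B)`. Sorting by the rank
of `A` gives `p³` planes of rank two, `p (p + 1)` of rank one and a single one of rank zero. -/
theorem exists_fullRep (hp : p.Prime) (γ : Sp) :
    ∃ i, ∀ a b, (p : ℤ) ∣ blockB (γ * (fullRep p h i)⁻¹) a b := by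
  have : Fact p.Prime := ⟨hp⟩
  by_cases hdet : ¬ (p : ℤ) ∣ (blockA γ).det
  · obtain ⟨y, hy⟩ := exists_transRep γ hdet
    exact ⟨Sum.inl y, hy⟩
  rw [not_not] at hdet
  by_cases hA : ∀ i j, (p : ℤ) ∣ blockA γ i j
  · refine ⟨Sum.inr (Sum.inr ()), fun i j => ?_⟩
    change (p : ℤ) ∣ blockB (γ * (lowRep p h)⁻¹) i j
    rw [blockB_mul_inv, lowRep, blockA_spPair, blockB_spPair, Matrix.sub_apply]
    simp only [diagonal_transpose, mul_diagonal]
    refine dvd_sub ?_ ((hA i j).mul_right _)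
    fin_cases j <;> simp
  have h0 : (blockA γ).map (Int.cast : ℤ → ZMod p) ≠ 0 := by
    intro h0
    apply hA
    intro i j
    rw [← ZMod.intCast_zmod_eq_zero_iff_dvd]
    exact congrFun (congrFun h0 i) j
  have hdet' : ((blockA γ).map (Int.cast : ℤ → ZMod p)).det = 0 := by
    rw [← ZMod.intCast_zmod_eq_zero_iff_dvd, Int.cast_det] at hdet
    exact hdet
  obtain ⟨x, n, hx, hn, e⟩ := exists_rank_one_factor h0 hdet'
  replace e : ∀ i j, (blockA γ i j : ZMod p) = x i * n j := e
  -- The row space of `A` modulo `p` is the line of `n`; its Levi element makes the second column of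
  -- `A` vanish modulo `p`.
  obtain ⟨o, ho⟩ := exists_lineMat (p := p) (n 0).cast (n 1).cast
  rw [← ZMod.intCast_zmod_eq_zero_iff_dvd] at ho
  push_cast at ho
  set γ' := γ * (lineLevi p o)⁻¹ with hγ'
  have eA : blockA γ' = blockA γ * (lineMat p o).adjugate := by
    rw [hγ', lineLevi, blockA_mul_inv, blockD_spLevi, blockC_spLevi, transpose_transpose,
      transpose_zero, Matrix.mul_zero, sub_zero]
  have hrel := congrArg (Int.cast : ℤ → ZMod p) (Sp_relation_AB γ')
  push_cast at hrel
  have hd := congrArg (Int.cast : ℤ → ZMod p) (det_lineMat p o)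
  rw [det_fin_two] at hd
  push_cast at hd
  have hcol1 : ∀ i, (blockA γ' i 1 : ZMod p) = 0 := by
    intro i
    rw [eA]
    simp [Matrix.mul_apply, Fin.sum_univ_two, adjugate_fin_two, e]
    linear_combination x i * ho
  set m : ZMod p := n 0 * lineMat p o 1 1 - n 1 * lineMat p o 1 0 with hm
  have hcol0 : ∀ i, (blockA γ' i 0 : ZMod p) = x i * m := by
    intro i
    rw [eA, hm]
    simp [Matrix.mul_apply, Fin.sum_univ_two, adjugate_fin_two, e]
    ring
  have hm0 : m ≠ 0 := by
    intro hm0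
    have h1 : n 0 = 0 := by
      linear_combination (lineMat p o 0 0 : ZMod p) * hm0 + (lineMat p o 1 0 : ZMod p) * ho
        - n 0 * hd - (lineMat p o 0 0 : ZMod p) * hm
    have h2 : n 1 = 0 := by
      linear_combination (lineMat p o 0 1 : ZMod p) * hm0 + (lineMat p o 1 1 : ZMod p) * ho
        - n 1 * hd - (lineMat p o 0 1 : ZMod p) * hm
    rcases hn with hn | hn
    · exact hn h1
    · exact hn h2
  rw [hcol1, hcol1, hcol0, hcol0] at hrel
  have hrel' : x 0 * (blockB γ' 1 0 : ZMod p) = x 1 * (blockB γ' 0 0 : ZMod p) := by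
    apply mul_left_cancel₀ hm0
    linear_combination hrel
  obtain ⟨y, hy⟩ : ∃ y : ZMod p, ∀ i, (blockB γ' i 0 : ZMod p) = x i * m * y := by
    rcases hx with hx | hx
    · refine ⟨(x 0 * m)⁻¹ * blockB γ' 0 0, fun i => ?_⟩
      fin_cases i
      · simp only [Fin.zero_eta]
        field_simp
      · simp only [Fin.mk_one]
        field_simp
        linear_combination hrel'
    · refine ⟨(x 1 * m)⁻¹ * blockB γ' 1 0, fun i => ?_⟩
      fin_cases i
      · simp only [Fin.zero_eta]
        field_simp
        linear_combination -hrel'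
      · simp only [Fin.mk_one]
        field_simp
  refine ⟨Sum.inr (Sum.inl (y, o)), fun i j => ?_⟩
  change (p : ℤ) ∣ blockB (γ * (midRep p h (y, o))⁻¹) i j
  rw [midRep, _root_.mul_inv_rev, ← mul_assoc, ← hγ', blockB_mul_inv, blockA_spPair, blockB_spPair,
    ← ZMod.intCast_zmod_eq_zero_iff_dvd]
  fin_cases j
  · simp [hcol0, hy]
  · simp [hcol1]

theorem isHeckeSystem_fullRep (hp : p.Prime) : IsHeckeSystem N (heckeMat 1 p hp) (fullRep p h) where
  mem := fullRep_mem h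
  inj i j hij := fullRep_injective h hp ((heckeMem_iff hp (mul_mem (fullRep_mem h i)
    (inv_mem (fullRep_mem h j)))).mp hij)
  surj γ hγ := by
    obtain ⟨i, hi⟩ := exists_fullRep h hp γ
    exact ⟨i, (heckeMem_iff hp (mul_mem hγ (inv_mem (fullRep_mem h i)))).mpr hi⟩

end

end

end SiegelEisenstein

namespace SiegelEisenstein

noncomputable section

/-! ### Representatives for `T₁(p²)` -/

/-- Representatives for `T₁(p²)` in the Siegel parabolic. -/
def transRep₁ (p : ℕ) (i : ZMod (p ^ 2) × ZMod p × Option (ZMod p)) : Sp :=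
  spUpper !![i.1.cast, i.2.1.cast; i.2.1.cast, 0] (symm_fin_two _ _ _) * lineLevi p i.2.2

section

variable {p : ℕ} (i : ZMod (p ^ 2) × ZMod p × Option (ZMod p))

theorem blockA_transRep₁ : blockA (transRep₁ p i) = lineMat p i.2.2 := by
  rw [transRep₁, lineLevi, blockA_mul, blockA_spUpper, blockA_spLevi, blockC_spLevi,
    Matrix.mul_zero, add_zero, Matrix.one_mul]

theorem blockB_transRep₁ : blockB (transRep₁ p i) =
    !![i.1.cast * lineMat p i.2.2 1 1 - i.2.1.cast * lineMat p i.2.2 0 1,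
      i.2.1.cast * lineMat p i.2.2 0 0 - i.1.cast * lineMat p i.2.2 1 0;
      i.2.1.cast * lineMat p i.2.2 1 1, -(i.2.1.cast * lineMat p i.2.2 1 0)] := by
  rw [transRep₁, lineLevi, blockB_mul, blockB_spUpper, blockB_spLevi, blockD_spLevi,
    Matrix.mul_zero, zero_add, adjugate_fin_two]
  ext a b
  fin_cases a <;> fin_cases b <;> simp [Matrix.mul_apply, Fin.sum_univ_two] <;> ring

theorem blockC_transRep₁ : blockC (transRep₁ p i) = 0 := by
  rw [transRep₁, lineLevi, blockC_mul', blockC_spUpper, blockC_spLevi, Matrix.mul_zero,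
    Matrix.zero_mul, add_zero]

theorem blockD_transRep₁ : blockD (transRep₁ p i) =
    !![lineMat p i.2.2 1 1, -lineMat p i.2.2 1 0; -lineMat p i.2.2 0 1, lineMat p i.2.2 0 0] := by
  rw [transRep₁, lineLevi, blockD_mul, blockC_spUpper, blockD_spUpper, blockD_spLevi,
    Matrix.zero_mul, zero_add, adjugate_fin_two, Matrix.one_mul]
  ext a b
  fin_cases a <;> fin_cases b <;> rfl

theorem transRep₁_mem (N : ℕ) : transRep₁ p i ∈ Gamma0 N :=
  mul_mem (spUpper_mem_Gamma0 _ _ _) (spLevi_mem_Gamma0 _ _ _)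

end

/-- The congruences describing the Hecke subgroup of `T₁(p²)`. -/
def TOneCongr (p : ℕ) (γ : Sp) : Prop :=
  (p : ℤ) ∣ blockA γ 0 1 ∧ (p : ℤ) ^ 2 ∣ blockB γ 0 0 ∧ (p : ℤ) ∣ blockB γ 0 1

theorem lineLevi_blocks (p : ℕ) (γ : Sp) (o : Option (ZMod p)) :
    blockA (γ * (lineLevi p o)⁻¹) = blockA γ * (lineMat p o).adjugate := by
  rw [lineLevi, blockA_mul_inv, blockD_spLevi, blockC_spLevi, transpose_transpose,
    transpose_zero, Matrix.mul_zero, sub_zero]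

/-- The first row of `A` defines a line modulo `p`, and the Levi element of that line brings the row
to the form `(unit, 0)` modulo `p`. The conditions on the first row of `B` can then be met by a
translation. -/
theorem exists_transRep₁ {p : ℕ} (hp : p.Prime) (γ : Sp)
    (h : ¬ ((p : ℤ) ∣ blockA γ 0 0 ∧ (p : ℤ) ∣ blockA γ 0 1)) :
    ∃ i, TOneCongr p (γ * (transRep₁ p i)⁻¹) := by
  have : Fact p.Prime := ⟨hp⟩
  have hpp := Nat.prime_iff_prime_int.mp hp
  obtain ⟨o, ho⟩ := exists_lineMat (p := p) (blockA γ 0 0) (blockA γ 0 1)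
  set γ' := γ * (lineLevi p o)⁻¹ with hγ'
  have eA := lineLevi_blocks p γ o
  rw [← hγ'] at eA
  have hd := det_lineMat p o
  rw [det_fin_two] at hd
  have e01 : blockA γ' 0 1 = blockA γ 0 1 * lineMat p o 0 0 - blockA γ 0 0 * lineMat p o 0 1 := by
    rw [eA]
    simp [Matrix.mul_apply, Fin.sum_univ_two, adjugate_fin_two]
    ring
  have e00 : blockA γ' 0 0 = blockA γ 0 0 * lineMat p o 1 1 - blockA γ 0 1 * lineMat p o 1 0 := by
    rw [eA]
    simp [Matrix.mul_apply, Fin.sum_univ_two, adjugate_fin_two]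
    ring
  have h01 : (p : ℤ) ∣ blockA γ' 0 1 := by rw [e01]; exact ho
  have h00 : ¬ (p : ℤ) ∣ blockA γ' 0 0 := by
    intro h00
    apply h
    have r0 : blockA γ 0 0 = blockA γ' 0 0 * lineMat p o 0 0 + blockA γ' 0 1 * lineMat p o 1 0 := by
      rw [e00, e01]; linear_combination (-blockA γ 0 0) * hd
    have r1 : blockA γ 0 1 = blockA γ' 0 0 * lineMat p o 0 1 + blockA γ' 0 1 * lineMat p o 1 1 := by
      rw [e00, e01]; linear_combination (-blockA γ 0 1) * hd
    rw [r0, r1]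
    exact ⟨dvd_add (h00.mul_right _) (h01.mul_right _), dvd_add (h00.mul_right _) (h01.mul_right _)⟩
  have hcop : IsCoprime ((p : ℤ) ^ 2) (blockA γ' 0 0) :=
    ((Prime.coprime_iff_not_dvd hpp).mpr h00).pow_left
  obtain ⟨v, u, huv⟩ := hcop
  -- `u` inverts `A 0 0` modulo `p²`, so these values solve the congruence for `B 0 1` modulo `p`
  -- and then that for `B 0 0` modulo `p²`.
  set y₂ : ZMod p := ((u * blockB γ' 0 1 : ℤ) : ZMod p) with hy₂
  set y₁ : ZMod (p ^ 2) :=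
    ((u * (blockB γ' 0 0 - blockA γ' 0 1 * y₂.cast) : ℤ) : ZMod (p ^ 2)) with hy₁
  obtain ⟨c₂, hc₂⟩ := (dvd_cast_sub_iff _ _).mpr hy₂
  obtain ⟨c₁, hc₁⟩ := (dvd_cast_sub_iff _ _).mpr hy₁
  push_cast at hc₁
  refine ⟨(y₁, y₂, o), ?_⟩
  rw [transRep₁, _root_.mul_inv_rev, ← mul_assoc, ← hγ']
  refine ⟨?_, ?_, ?_⟩
  · rw [blockA_mul_inv_apply, blockC_spUpper, blockD_spUpper]
    simpa using h01
  · rw [blockB_mul_upper_inv]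
    simp only [Matrix.sub_apply, Matrix.mul_apply, Fin.sum_univ_two, of_apply, cons_val_zero,
      cons_val_one, cons_val', cons_val_fin_one]
    refine ⟨v * (blockB γ' 0 0 - blockA γ' 0 1 * y₂.cast) - blockA γ' 0 0 * c₁, ?_⟩
    linear_combination (-blockA γ' 0 0) * hc₁
      - (blockB γ' 0 0 - blockA γ' 0 1 * y₂.cast) * huv
  · rw [blockB_mul_upper_inv]
    simp only [Matrix.sub_apply, Matrix.mul_apply, Fin.sum_univ_two, of_apply, cons_val_zero,
      cons_val_one, cons_val', cons_val_fin_one]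
    refine ⟨p * v * blockB γ' 0 1 - blockA γ' 0 0 * c₂, ?_⟩
    linear_combination (-blockA γ' 0 0) * hc₂ - blockB γ' 0 1 * huv

theorem transRep₁_injective {p : ℕ} (hp : p.Prime) {i j}
    (h : TOneCongr p (transRep₁ p i * (transRep₁ p j)⁻¹)) : i = j := by
  have : Fact p.Prime := ⟨hp⟩
  obtain ⟨h1, h2, h3⟩ := h
  rw [blockA_mul_inv_apply, blockA_transRep₁, blockB_transRep₁, blockC_transRep₁,
    blockD_transRep₁] at h1
  rw [blockB_mul_inv_apply, blockA_transRep₁, blockB_transRep₁, blockA_transRep₁,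
    blockB_transRep₁] at h2 h3
  obtain ⟨y, y', o⟩ := i
  obtain ⟨z, z', o'⟩ := j
  simp at h1 h2 h3
  have ho : o = o' := by
    apply lineMat_injective
    convert h1 using 1
    ring
  subst ho
  have hd := det_lineMat p o
  rw [det_fin_two] at hd
  have e2 : y = z := by
    rw [← ZMod.intCast_zmod_cast z, ← dvd_cast_sub_iff]
    push_cast
    convert h2 using 1
    linear_combination (-(y.cast - z.cast : ℤ)) * hd
  have e3 : y' = z' := by
    subst e2
    rw [← ZMod.intCast_zmod_cast z', ← dvd_cast_sub_iff]
    convert h3 using 1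
    linear_combination (-(y'.cast - z'.cast : ℤ)) * hd
  rw [e2, e3]

/-- For `p ∣ N` the first row of `A` cannot vanish modulo `p`, since `det A` is a unit there; this
leaves `p³ (p + 1)` cosets. -/
theorem isHeckeSystem_transRep₁ {N p : ℕ} (hp : p.Prime) (hpN : p ∣ N) :
    IsHeckeSystem N (heckeMat 0 p hp) (transRep₁ p) where
  mem i := transRep₁_mem i N
  inj i j h := transRep₁_injective hp ((heckeMem_iff' hp (mul_mem (transRep₁_mem _ _)
    (inv_mem (transRep₁_mem _ _)))).mp h)
  surj γ hγ := by
    obtain ⟨y, hy⟩ := exists_transRep₁ hp γ fun h => not_dvd_det_blockA hp hpN hγ (by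
      rw [det_fin_two]
      exact dvd_sub (h.1.mul_right _) (h.2.mul_right _))
    exact ⟨y, (heckeMem_iff' hp (mul_mem hγ (inv_mem (transRep₁_mem _ _)))).mpr hy⟩

theorem det_adjugate_lineMat (p : ℕ) (o : Option (ZMod p)) :
    ((lineMat p o).adjugateᵀ).det = 1 := by
  rw [det_transpose, det_adjugate, det_lineMat, one_pow]

/-- Representatives for `T₁(p²)` whose upper left block has first row vanishing modulo `p`. -/
def midRep₁ (p : ℕ) {N : ℕ} {x₀ y₀ : ℤ} (h : p ^ 2 * x₀ - y₀ * N = 1)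
    (i : ZMod p × Option (ZMod p)) : Sp :=
  spPair ![p ^ 2 + p * N * i.1.cast * y₀, 1] ![y₀, 0] ![N + p * N * i.1.cast * x₀, 0] ![x₀, 1]
    (by
      intro j
      fin_cases j
      · simp only [Fin.zero_eta, cons_val_zero]
        linear_combination h
      · simp) * spLevi (lineMat p i.2).adjugateᵀ (det_adjugate_lineMat _ _)

/-! ### Representatives of `T₁(p²)` for `p` prime to the level. -/

section

variable {p N : ℕ} {x₀ y₀ : ℤ} (h : p ^ 2 * x₀ - y₀ * N = 1)

theorem midRep₁_mem (i) : midRep₁ p h i ∈ Gamma0 N :=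
  mul_mem (spPair_mem_Gamma0 (by
    intro j
    fin_cases j
    · exact ⟨1 + p * i.1.cast * x₀, by simp only [Fin.zero_eta, cons_val_zero]; ring⟩
    · simp)) (spLevi_mem_Gamma0 _ _ _)

theorem blockA_midRep₁ (i) : blockA (midRep₁ p h i) =
    !![(p ^ 2 + p * N * i.1.cast * y₀) * lineMat p i.2 1 1,
      -((p ^ 2 + p * N * i.1.cast * y₀) * lineMat p i.2 1 0);
      -lineMat p i.2 0 1, lineMat p i.2 0 0] := by
  rw [midRep₁, blockA_mul, blockA_spPair, blockA_spLevi, blockC_spLevi, Matrix.mul_zero,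
    add_zero, adjugate_fin_two]
  ext a b
  fin_cases a <;> fin_cases b <;> simp

theorem adjugate_lineMat_levi (o : Option (ZMod p)) :
    ((lineMat p o).adjugateᵀ).adjugateᵀ = lineMat p o := by
  rw [adjugate_transpose, transpose_transpose, adjugate_fin_two, adjugate_fin_two]
  ext a b
  fin_cases a <;> fin_cases b <;> simp

theorem blockB_midRep₁ (i) : blockB (midRep₁ p h i) =
    !![y₀ * lineMat p i.2 0 0, y₀ * lineMat p i.2 0 1; 0, 0] := by
  rw [midRep₁, blockB_mul, blockB_spPair, blockB_spLevi, blockD_spLevi, Matrix.mul_zero,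
    zero_add, adjugate_lineMat_levi]
  ext a b
  fin_cases a <;> fin_cases b <;> simp

theorem blockC_midRep₁ (i) : blockC (midRep₁ p h i) =
    !![(N + p * N * i.1.cast * x₀) * lineMat p i.2 1 1,
      -((N + p * N * i.1.cast * x₀) * lineMat p i.2 1 0); 0, 0] := by
  rw [midRep₁, blockC_mul', blockC_spPair, blockA_spLevi, blockC_spLevi, Matrix.mul_zero,
    add_zero, adjugate_fin_two]
  ext a b
  fin_cases a <;> fin_cases b <;> simp

theorem blockD_midRep₁ (i) : blockD (midRep₁ p h i) =
    !![x₀ * lineMat p i.2 0 0, x₀ * lineMat p i.2 0 1; lineMat p i.2 1 0, lineMat p i.2 1 1] := by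
  rw [midRep₁, blockD_mul, blockD_spPair, blockB_spLevi, blockD_spLevi, Matrix.mul_zero,
    zero_add, adjugate_lineMat_levi]
  ext a b
  fin_cases a <;> fin_cases b <;> simp

/-- Representatives for `T₁(p²)` when `p` does not divide the level. -/
def fullRep₁ (p : ℕ) {N : ℕ} {x₀ y₀ : ℤ} (h : p ^ 2 * x₀ - y₀ * N = 1) :
    (ZMod (p ^ 2) × ZMod p × Option (ZMod p)) ⊕ (ZMod p × Option (ZMod p)) → Sp :=
  Sum.elim (transRep₁ p) (midRep₁ p h)

theorem fullRep₁_mem (i) : fullRep₁ p h i ∈ Gamma0 N := by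
  rcases i with y | i
  · exact transRep₁_mem _ _
  · exact midRep₁_mem h i

theorem not_dvd_bezout_level (hp : p.Prime) {x : ℤ} {m : ℕ} (hm : m ≠ 0)
    (h : (p : ℤ) ^ m * x - y₀ * N = 1) : ¬ (p : ℤ) ∣ N := by
  intro hd
  apply (Nat.prime_iff_prime_int.mp hp).not_isUnit
  apply isUnit_of_dvd_one
  rw [← h]
  exact dvd_sub ((dvd_pow_self _ hm).mul_right _) (hd.mul_left _)

/-- Bézout makes both `y₀` and `N` units modulo `p`. For two representatives of the second type the
condition modulo `p²` carries one factor `p`; after its removal it determines the parameter modulo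
`p`. -/
theorem fullRep₁_injective (hp : p.Prime) {i j}
    (hij : TOneCongr p (fullRep₁ p h i * (fullRep₁ p h j)⁻¹)) : i = j := by
  have : Fact p.Prime := ⟨hp⟩
  have hpp := Nat.prime_iff_prime_int.mp hp
  have hy : ¬ (p : ℤ) ∣ y₀ := not_dvd_bezout hp two_ne_zero h
  have hn : ¬ (p : ℤ) ∣ N := not_dvd_bezout_level hp two_ne_zero h
  rcases i with i | i <;> rcases j with j | j <;>
    simp only [fullRep₁, Sum.elim_inl, Sum.elim_inr] at hij
  · rw [transRep₁_injective hp hij]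
  · exfalso
    obtain ⟨h1, h2, -⟩ := hij
    replace h2 := (dvd_pow_self _ two_ne_zero).trans h2
    apply not_dvd_row_of_det hp (det_lineMat p i.2.2)
    have hd := congrArg (Int.cast : ℤ → ZMod p) (det_lineMat p j.2)
    rw [det_fin_two] at hd
    rw [blockA_mul_inv_apply, blockA_transRep₁, blockB_transRep₁, blockC_midRep₁,
      blockD_midRep₁] at h1
    rw [blockB_mul_inv_apply, blockA_transRep₁, blockB_transRep₁, blockA_midRep₁,
      blockB_midRep₁] at h2
    simp [← ZMod.intCast_zmod_eq_zero_iff_dvd] at h1 h2 hy hd ⊢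
    have h3 : (lineMat p i.2.2 0 0 : ZMod p) * lineMat p j.2 0 0
        + lineMat p i.2.2 0 1 * lineMat p j.2 0 1 = 0 := by
      apply mul_left_cancel₀ hy
      linear_combination -h2
    constructor
    · linear_combination (lineMat p j.2 1 1 : ZMod p) * h3 - (lineMat p j.2 0 1 : ZMod p) * h1
        - (lineMat p i.2.2 0 0 : ZMod p) * hd
    · linear_combination (lineMat p j.2 0 0 : ZMod p) * h1 - (lineMat p j.2 1 0 : ZMod p) * h3
        - (lineMat p i.2.2 0 1 : ZMod p) * hd
  · exfalso
    obtain ⟨-, h2, h3⟩ := hij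
    replace h2 := (dvd_pow_self _ two_ne_zero).trans h2
    apply not_dvd_row_of_det hp (det_lineMat p i.2)
    have hd := congrArg (Int.cast : ℤ → ZMod p) (det_lineMat p j.2.2)
    rw [det_fin_two] at hd
    rw [blockB_mul_inv_apply, blockA_transRep₁, blockB_transRep₁, blockA_midRep₁,
      blockB_midRep₁] at h2 h3
    simp [← ZMod.intCast_zmod_eq_zero_iff_dvd] at h2 h3 hy hd ⊢
    constructor
    · apply mul_left_cancel₀ hy
      linear_combination (lineMat p j.2.2 1 1 : ZMod p) * h2 - (lineMat p j.2.2 0 1 : ZMod p) * h3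
        - (y₀ * lineMat p i.2 0 0 : ZMod p) * hd
    · apply mul_left_cancel₀ hy
      linear_combination (lineMat p j.2.2 0 0 : ZMod p) * h3 - (lineMat p j.2.2 1 0 : ZMod p) * h2
        - (y₀ * lineMat p i.2 0 1 : ZMod p) * hd
  · obtain ⟨-, h2, h3⟩ := hij
    rw [blockB_mul_inv_apply, blockA_midRep₁, blockB_midRep₁, blockA_midRep₁,
      blockB_midRep₁] at h2 h3
    obtain ⟨s, o⟩ := i
    obtain ⟨s', o'⟩ := j
    simp at h2 h3
    have ho : o = o' := by
      apply lineMat_injective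
      refine (hpp.dvd_or_dvd (a := y₀) ?_).resolve_left hy
      obtain ⟨c, hc⟩ := h3
      exact ⟨c, by linear_combination hc⟩
    subst ho
    have hd := det_lineMat p o
    rw [det_fin_two] at hd
    have h4 : (p : ℤ) * p ∣ p * ((N * y₀ * y₀) * (s.cast - s'.cast)) := by
      obtain ⟨c, hc⟩ := h2
      exact ⟨-c, by linear_combination (-1) * hc
        - (p : ℤ) * N * y₀ * y₀ * (s.cast - s'.cast) * hd⟩
    have h5 := Int.dvd_of_mul_dvd_mul_left hpp.ne_zero h4
    have h6 : s = s' := by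
      rw [← ZMod.intCast_zmod_cast s', ← dvd_cast_sub_iff]
      refine (hpp.dvd_or_dvd h5).resolve_left fun h7 => ?_
      rcases hpp.dvd_or_dvd h7 with h7 | h7
      · rcases hpp.dvd_or_dvd h7 with h7 | h7
        exacts [hn h7, hy h7]
      · exact hy h7
    rw [h6]

/-- If the first row of `A` vanishes modulo `p`, that of `B` does not, by the symplectic relation,
and it supplies the line. The condition modulo `p²` on `B 0 0` becomes, after division by `p`, a
linear congruence for the parameter `s`. -/
theorem exists_fullRep₁ (hp : p.Prime) (γ : Sp) :
    ∃ i, TOneCongr p (γ * (fullRep₁ p h i)⁻¹) := by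
  have : Fact p.Prime := ⟨hp⟩
  have hpp := Nat.prime_iff_prime_int.mp hp
  have hn : ¬ (p : ℤ) ∣ N := not_dvd_bezout_level hp two_ne_zero h
  by_cases hA : ¬ ((p : ℤ) ∣ blockA γ 0 0 ∧ (p : ℤ) ∣ blockA γ 0 1)
  · obtain ⟨i, hi⟩ := exists_transRep₁ hp γ hA
    exact ⟨Sum.inl i, hi⟩
  rw [not_not] at hA
  obtain ⟨o, ho⟩ := exists_lineMat (p := p) (blockB γ 0 0) (blockB γ 0 1)
  -- The inverse transpose is used because the line is now read off from `B`, on which the Levi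
  -- subgroup acts contragrediently.
  set γ' := γ * (spLevi (lineMat p o).adjugateᵀ (det_adjugate_lineMat _ _))⁻¹ with hγ'
  have eA : blockA γ' = blockA γ * (lineMat p o)ᵀ := by
    rw [hγ', blockA_mul_inv, blockD_spLevi, blockC_spLevi, adjugate_lineMat_levi,
      transpose_zero, Matrix.mul_zero, sub_zero]
  have eB : blockB γ' = blockB γ * (lineMat p o).adjugate := by
    rw [hγ', blockB_mul_inv, blockA_spLevi, blockB_spLevi, transpose_transpose,
      transpose_zero, Matrix.mul_zero, sub_zero]
  have hA' : ∀ j, (p : ℤ) ∣ blockA γ' 0 j := by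
    intro j
    rw [eA, Matrix.mul_apply, Fin.sum_univ_two]
    exact dvd_add (hA.1.mul_right _) (hA.2.mul_right _)
  have hB' : (p : ℤ) ∣ blockB γ' 0 1 := by
    rw [eB]
    convert ho using 1
    simp [Matrix.mul_apply, Fin.sum_univ_two, adjugate_fin_two]
    ring
  have hB0 : ¬ (p : ℤ) ∣ blockB γ' 0 0 := by
    intro h0
    have e2 := congrFun (congrFun (Sp_relations γ').2.2 0) 0
    simp [Matrix.mul_apply, Fin.sum_univ_two] at e2
    apply hpp.not_isUnit
    apply isUnit_of_dvd_one
    rw [← e2]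
    exact dvd_sub (dvd_add ((hA' 0).mul_right _) ((hA' 1).mul_right _))
      (dvd_add (h0.mul_right _) (hB'.mul_right _))
  obtain ⟨α, hα⟩ := hA' 0
  set s : ZMod p := (α : ZMod p) * (N * (blockB γ' 0 0 : ZMod p))⁻¹ with hs
  have hs' : (p : ℤ) ∣ N * s.cast * blockB γ' 0 0 - α := by
    rw [← ZMod.intCast_zmod_eq_zero_iff_dvd] at hn hB0 ⊢
    push_cast at hn hB0 ⊢
    rw [hs]
    simp
    field_simp
    simp
  obtain ⟨c, hc⟩ := hs'
  refine ⟨Sum.inr (s, o), ?_⟩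
  change TOneCongr p (γ * (midRep₁ p h (s, o))⁻¹)
  rw [midRep₁, _root_.mul_inv_rev, ← mul_assoc, ← hγ']
  refine ⟨?_, ?_, ?_⟩
  · rw [blockA_mul_inv_apply, blockC_spPair, blockD_spPair]
    simpa using hA' 1
  · rw [blockB_mul_inv_apply, blockA_spPair, blockB_spPair]
    simp
    refine ⟨blockB γ' 0 0 + y₀ * c, ?_⟩
    rw [hα]
    linear_combination p * y₀ * hc
  · rw [blockB_mul_inv_apply, blockA_spPair, blockB_spPair]
    simpa using hB'

theorem isHeckeSystem_fullRep₁ (hp : p.Prime) :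
    IsHeckeSystem N (heckeMat 0 p hp) (fullRep₁ p h) where
  mem := fullRep₁_mem h
  inj i j hij := fullRep₁_injective h hp ((heckeMem_iff' hp (mul_mem (fullRep₁_mem h i)
    (inv_mem (fullRep₁_mem h j)))).mp hij)
  surj γ hγ := by
    obtain ⟨i, hi⟩ := exists_fullRep₁ h hp γ
    exact ⟨i, (heckeMem_iff' hp (mul_mem hγ (inv_mem (fullRep₁_mem h i)))).mpr hi⟩

end

end

end SiegelEisenstein

namespace SiegelEisenstein

noncomputable section

/-! ### Local terms of the Hecke operators -/

/-- `c` is the term of the Hecke operator `s` at the vector `v`: after extraction of the power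
`p ^ a` from the image of `v` a primitive vector `w` is left, and `c = p ^ (a k) E(a) L(w)`. -/
def HeckeTerm (s : Fin 2) (p k : ℕ) (E : ℕ → ℂ) (L : (Fin 5 → ℤ) → ℂ) (v : Fin 5 → ℤ) (c : ℂ) :
    Prop :=
  ∃ a ≤ 2, ∃ w : Fin 5 → ℤ, (∀ j, (p : ℤ) ^ heckeExp s j * v j = p ^ a * w j) ∧
    (∃ j, ¬ (p : ℤ) ∣ w j) ∧ ((p : ℂ) ^ a) ^ k * E a * L w = c

theorem hecke_eigen_of_terms {N : ℕ} (hN : Squarefree N) {k : ℕ} (hk : 4 ≤ k)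
    {χ : DirichletCharacter ℂ N} (hχ : χ (-1) = (-1) ^ k) {κ : ℕ → Fin 3 → ℂ}
    (hκ : IsAdmissibleFam χ κ) (s : Fin 2) {p : ℕ} (hp : p.Prime) {R : Type*} [Fintype R]
    {rep : R → Sp} (hR : IsHeckeSystem N (heckeMat s p hp) rep) {E : ℕ → ℂ}
    (hE : ∀ a ≤ 2, ∀ r : ℕ → Fin 3,
      ∏ q ∈ N.primeFactors.erase p, κ q (r q) * twist s (component χ q (p : ZMod q)) (r q) a
        = (∏ q ∈ N.primeFactors.erase p, κ q (r q)) * E a) {lam : ℂ}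
    (h : ∀ r : Fin 3, (¬ p ∣ N → r = 0) → ∃ F : R → ℂ,
      (∀ i, HeckeTerm s p k E (localAt χ κ p (rep i))
        (plZ (diagCusp (stdCusp r) * (rep i)⁻¹)) (F i)) ∧
      ∑ i, F i = (p : ℂ) ^ 3 * (lam * if p ∣ N then κ p r else 1)) :
    heckeOp k χ p (heckeMat s p hp) (plSum k (famFun χ κ)) = lam • plSum k (famFun χ κ) := by
  refine hecke_eigen hN hk hχ hκ s hp hR hE fun r hr => ?_
  obtain ⟨F, hF, hsum⟩ := h r hr
  choose a ha w hw hw1 hc using hF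
  exact ⟨a, w, ha, hw, hw1, by rw [← hsum]; exact Finset.sum_congr rfl fun i _ => hc i⟩

theorem plZ_diagCusp_mul_inv (m : Fin 2 → ℤ) (γ : Sp) : plZ (diagCusp m * γ⁻¹) =
    plucker (diagonal m * (blockD γ)ᵀ - (blockC γ)ᵀ) ((blockA γ)ᵀ - diagonal m * (blockB γ)ᵀ) := by
  rw [plZ, blockC_mul', blockD_mul, blockA_inv, blockB_inv, blockC_inv, blockD_inv, diagCusp,
    blockC_spLower, blockD_spLower, Matrix.one_mul, Matrix.one_mul, Matrix.mul_neg,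
    neg_add_eq_sub, ← sub_eq_add_neg]

theorem heckeTerm_of_eq {s : Fin 2} {p k : ℕ} {E : ℕ → ℂ} {L : (Fin 5 → ℤ) → ℂ}
    {v : Fin 5 → ℤ} {c : ℂ} (a : ℕ) (ha : a ≤ 2) (w : Fin 5 → ℤ)
    (h : ∀ j, (p : ℤ) ^ heckeExp s j * v j = p ^ a * w j) (j : Fin 5) (hj : ¬ (p : ℤ) ∣ w j)
    (hc : ((p : ℂ) ^ a) ^ k * E a * L w = c) : HeckeTerm s p k E L v c :=
  ⟨a, ha, w, h, ⟨j, hj⟩, hc⟩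

/-- The local function at `p` of an integral vector. -/
def locInt {p : ℕ} (ψ : DirichletCharacter ℂ p) (κ : Fin 3 → ℂ) (w : Fin 5 → ℤ) : ℂ :=
  locSum ψ κ fun i => (w i : ZMod p)

section

variable {p k : ℕ} [hp : Fact p.Prime] (E : ℕ → ℂ) (ψ : DirichletCharacter ℂ p) (κ : Fin 3 → ℂ)

theorem prime_not_dvd_one : ¬ (p : ℤ) ∣ 1 := fun h =>
  (Nat.prime_iff_prime_int.mp hp.out).not_isUnit (isUnit_of_dvd_one h)

theorem char_zero (ψ : DirichletCharacter ℂ p) : ψ 0 = 0 := MulChar.map_zero ψ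

theorem heckeTerm_rank_zero (s : Fin 2) :
    HeckeTerm s p k E (locInt ψ κ) ![0, 0, 0, 0, 1] (E 0 * κ 0) := by
  refine heckeTerm_of_eq 0 (by norm_num) ![0, 0, 0, 0, 1] ?_ 4 prime_not_dvd_one ?_
  · intro j
    fin_cases s <;> fin_cases j <;> simp [heckeExp]
  · simp [locInt, locSum, loc₀, loc₁, loc₂, char_zero, rankOneChar]

-- The image is `(0, 0, 0, p, d)`: of rank zero if `p ∤ d`, and of rank one after division by `p`
-- otherwise. The two cases are added because `ψ d` vanishes in the second.
open Classical in
theorem heckeTerm_T_rank_one (d : ℤ) :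
    HeckeTerm 1 p k E (locInt ψ κ) ![0, 0, 0, 1, d]
      (E 0 * κ 0 * conj (ψ d) + if (d : ZMod p) = 0 then (p : ℂ) ^ k * E 1 * κ 1 else 0) := by
  by_cases hd : (d : ZMod p) = 0
  · obtain ⟨e, rfl⟩ := (ZMod.intCast_zmod_eq_zero_iff_dvd _ _).mp hd
    refine heckeTerm_of_eq 1 (by norm_num) ![0, 0, 0, 1, e] ?_ 3 prime_not_dvd_one ?_
    · intro j
      fin_cases j <;> simp [heckeExp]
    · simp [locInt, locSum, loc₀, loc₁, loc₂, char_zero, rankOneChar]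
  · refine heckeTerm_of_eq 0 (by norm_num) ![0, 0, 0, p, d] ?_ 4 ?_ ?_
    · intro j
      fin_cases j <;> simp [heckeExp]
    · rw [← ZMod.intCast_zmod_eq_zero_iff_dvd]; exact hd
    · rw [if_neg hd]
      simp [locInt, locSum, loc₀, loc₁, loc₂, char_zero, rankOneChar]
      ring

-- Let `Q` be the middle block. The image `(p², p Q, det Q)` has content `1`, `p` or `p²` according
-- as `det Q` is a unit, `Q` has rank one, or `Q` vanishes modulo `p`; the ranks that result are
-- `0`, `1`, `2`.
open Classical in
theorem heckeTerm_T_rank_two (x y z : ℤ) :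
    HeckeTerm 1 p k E (locInt ψ κ) ![1, x, y, z, x * z - y ^ 2]
      (E 0 * κ 0 * conj (ψ (x * z - y ^ 2))
        + ((p : ℂ) ^ k * E 1 * κ 1) *
          (if (x : ZMod p) * z - y ^ 2 = 0 then rankOneChar ψ x z else 0)
        + if (x : ZMod p) = 0 ∧ (y : ZMod p) = 0 ∧ (z : ZMod p) = 0 then
            ((p : ℂ) ^ 2) ^ k * E 2 * κ 2 else 0) := by
  by_cases hd : (x : ZMod p) * z - y ^ 2 = 0
  · by_cases h0 : (x : ZMod p) = 0 ∧ (y : ZMod p) = 0 ∧ (z : ZMod p) = 0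
    · rw [if_pos hd, if_pos h0, hd, h0.1, h0.2.2]
      simp only [ZMod.intCast_zmod_eq_zero_iff_dvd] at h0
      obtain ⟨⟨x', rfl⟩, ⟨y', rfl⟩, ⟨z', rfl⟩⟩ := h0
      refine heckeTerm_of_eq 2 (by norm_num) ![1, x', y', z', x' * z' - y' ^ 2] ?_ 0
        prime_not_dvd_one ?_
      · intro j
        fin_cases j <;> simp [heckeExp] <;> ring
      · simp [locInt, locSum, loc₀, loc₁, loc₂, char_zero, rankOneChar]
    · have hdvd : (p : ℤ) ∣ x * z - y ^ 2 := by
        rw [← ZMod.intCast_zmod_eq_zero_iff_dvd]; push_cast; exact hd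
      obtain ⟨e, he⟩ := hdvd
      have hprim : ∃ j, ¬ (p : ℤ) ∣ (![(p : ℤ), x, y, z, e] : Fin 5 → ℤ) j := by
        by_contra! hc
        apply h0
        simp only [ZMod.intCast_zmod_eq_zero_iff_dvd]
        exact ⟨hc 1, hc 2, hc 3⟩
      obtain ⟨j, hj⟩ := hprim
      refine heckeTerm_of_eq 1 (by norm_num) ![p, x, y, z, e] ?_ j hj ?_
      · intro j
        fin_cases j <;> simp [heckeExp, he]
        ring
      · rw [if_pos hd, if_neg h0, hd]
        have h0' : ¬ ((x : ZMod p) = 0 ∧ (y : ZMod p) = 0 ∧ (z : ZMod p) = 0) := h0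
        simp [locInt, locSum, loc₀, loc₁, loc₂, char_zero, h0']
        ring
  · have h0 : ¬ ((x : ZMod p) = 0 ∧ (y : ZMod p) = 0 ∧ (z : ZMod p) = 0) := by
      rintro ⟨h1, h2, h3⟩
      exact hd (by rw [h1, h2, h3]; ring)
    rw [if_neg hd, if_neg h0]
    refine heckeTerm_of_eq 0 (by norm_num) ![p ^ 2, p * x, p * y, p * z, x * z - y ^ 2] ?_ 4 ?_ ?_
    · intro j
      fin_cases j <;> simp [heckeExp]
    · rw [← ZMod.intCast_zmod_eq_zero_iff_dvd]
      simpa using hd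
    · simp [locInt, locSum, loc₀, loc₁, loc₂, char_zero, rankOneChar]
      ring

-- The image is `(0, 0, 0, p², d)`. Division by `1` or `p` leaves rank zero; only for `p² ∣ d` is
-- rank one kept.
open Classical in
theorem heckeTerm_TOne_rank_one (d : ℤ) :
    HeckeTerm 0 p k E (locInt ψ κ) ![0, 0, 0, 1, d]
      (E 0 * κ 0 * conj (ψ d) + if (p : ℤ) ∣ d then
        (p : ℂ) ^ k * E 1 * κ 0 * conj (ψ (d / p : ℤ)) +
          (if (p : ℤ) ^ 2 ∣ d then ((p : ℂ) ^ 2) ^ k * E 2 * κ 1 else 0) else 0) := by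
  have hpp := Nat.prime_iff_prime_int.mp hp.out
  by_cases hd : (p : ℤ) ∣ d
  · rw [if_pos hd, (ZMod.intCast_zmod_eq_zero_iff_dvd _ _).mpr hd]
    obtain ⟨e, rfl⟩ := hd
    have hdd : (p : ℤ) ^ 2 ∣ p * e ↔ (p : ℤ) ∣ e := by
      rw [pow_two, mul_dvd_mul_iff_left hpp.ne_zero]
    rw [Int.mul_ediv_cancel_left _ hpp.ne_zero]
    by_cases he : (p : ℤ) ∣ e
    · rw [if_pos (hdd.mpr he)]
      obtain ⟨f, rfl⟩ := he
      refine heckeTerm_of_eq 2 (by norm_num) ![0, 0, 0, 1, f] ?_ 3 prime_not_dvd_one ?_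
      · intro j
        fin_cases j <;> simp [heckeExp]
        ring
      · simp [locInt, locSum, loc₀, loc₁, loc₂, char_zero, rankOneChar, pow_two]
    · rw [if_neg (mt hdd.mp he)]
      refine heckeTerm_of_eq 1 (by norm_num) ![0, 0, 0, p, e] ?_ 4 he ?_
      · intro j
        fin_cases j <;> simp [heckeExp]
        ring
      · simp [locInt, locSum, loc₀, loc₁, loc₂, char_zero, rankOneChar]
        ring
  · rw [if_neg hd]
    refine heckeTerm_of_eq 0 (by norm_num) ![0, 0, 0, p ^ 2, d] ?_ 4 hd ?_
    · intro j
      fin_cases j <;> simp [heckeExp]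
    · simp [locInt, locSum, loc₀, loc₁, loc₂, char_zero, rankOneChar]
      ring

/-- The first diagonal entry `β²` is not scaled, so the rank stays one and nothing is divided out; a
quadratic character is `1` on `β²`. -/
theorem heckeTerm_TOne_rank_one' (hκ : κ 1 ≠ 0 → ψ ^ 2 = 1) {α β : ℤ} (hβ : ¬ (p : ℤ) ∣ β) (d : ℤ) :
    HeckeTerm 0 p k E (locInt ψ κ) ![0, β ^ 2, α * β, α ^ 2, d] (E 0 * κ 1) := by
  have hpp := Nat.prime_iff_prime_int.mp hp.out
  refine heckeTerm_of_eq 0 (by norm_num) ![0, β ^ 2, p * (α * β), p ^ 2 * α ^ 2, d] ?_ 1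
    (fun h => hβ (hpp.dvd_of_dvd_pow h)) ?_
  · intro j
    fin_cases j <;> simp [heckeExp]
  · rw [← ZMod.intCast_zmod_eq_zero_iff_dvd] at hβ
    by_cases h1 : κ 1 = 0
    · simp [locInt, locSum, loc₀, loc₁, loc₂, char_zero, rankOneChar, hβ, h1]
    · have := char_sq_mul (hκ h1) hβ
      simp [locInt, locSum, loc₀, loc₁, loc₂, char_zero, rankOneChar, hβ, pow_two, this]

-- The image is `(p², x, p y, p² z, x z - y²)`. A unit `x` gives rank one, and `p ∣ x` with `y` a
-- unit gives rank zero. If `p` divides both, the content is `p` with rank one left, or `p²` with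
-- rank two left when `p² ∣ x`.
open Classical in
theorem heckeTerm_TOne_rank_two (x y z : ℤ) :
    HeckeTerm 0 p k E (locInt ψ κ) ![1, x, y, z, x * z - y ^ 2]
      (E 0 * κ 1 * ψ x + if (p : ℤ) ∣ x then
        E 0 * κ 0 * conj (ψ (-y ^ 2)) + (if (y : ZMod p) = 0 then
          (p : ℂ) ^ k * E 1 * κ 1 * ψ (x / p : ℤ) +
          (if (p : ℤ) ^ 2 ∣ x then ((p : ℂ) ^ 2) ^ k * E 2 * κ 2 else 0) else 0) else 0) := by
  have hpp := Nat.prime_iff_prime_int.mp hp.out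
  by_cases hx : (p : ℤ) ∣ x
  · rw [if_pos hx, (ZMod.intCast_zmod_eq_zero_iff_dvd _ _).mpr hx]
    obtain ⟨e, rfl⟩ := hx
    have hdd : (p : ℤ) ^ 2 ∣ p * e ↔ (p : ℤ) ∣ e := by
      rw [pow_two, mul_dvd_mul_iff_left hpp.ne_zero]
    rw [Int.mul_ediv_cancel_left _ hpp.ne_zero]
    by_cases hy : (y : ZMod p) = 0
    · rw [if_pos hy, hy]
      obtain ⟨y', rfl⟩ := (ZMod.intCast_zmod_eq_zero_iff_dvd _ _).mp hy
      by_cases he : (p : ℤ) ∣ e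
      · rw [if_pos (hdd.mpr he), (ZMod.intCast_zmod_eq_zero_iff_dvd _ _).mpr he]
        obtain ⟨f, rfl⟩ := he
        refine heckeTerm_of_eq 2 (by norm_num) ![1, f, y', z, f * z - y' ^ 2] ?_ 0
          prime_not_dvd_one ?_
        · intro j
          fin_cases j <;> simp [heckeExp] <;> ring
        · simp [locInt, locSum, loc₀, loc₁, loc₂, char_zero]
      · rw [if_neg (mt hdd.mp he)]
        refine heckeTerm_of_eq 1 (by norm_num) ![p, e, p * y', p * z, e * z - p * y' ^ 2] ?_ 1 he ?_
        · intro j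
          fin_cases j <;> simp [heckeExp] <;> ring
        · rw [← ZMod.intCast_zmod_eq_zero_iff_dvd] at he
          simp [locInt, locSum, loc₀, loc₁, loc₂, char_zero, rankOneChar, he]
          ring
    · rw [if_neg hy]
      refine heckeTerm_of_eq 0 (by norm_num)
        ![p ^ 2, p * e, p * y, p ^ 2 * z, p * e * z - y ^ 2] ?_ 4 ?_ ?_
      · intro j
        fin_cases j <;> simp [heckeExp]
      · rw [← ZMod.intCast_zmod_eq_zero_iff_dvd]
        simpa using hy
      · simp [locInt, locSum, loc₀, loc₁, loc₂, char_zero, rankOneChar]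
        ring
  · rw [if_neg hx]
    refine heckeTerm_of_eq 0 (by norm_num)
        ![p ^ 2, x, p * y, p ^ 2 * z, x * z - y ^ 2] ?_ 1 hx ?_
    · intro j
      fin_cases j <;> simp [heckeExp]
    · rw [← ZMod.intCast_zmod_eq_zero_iff_dvd] at hx
      simp [locInt, locSum, loc₀, loc₁, loc₂, char_zero, rankOneChar, hx]
      ring

end

end

end SiegelEisenstein

namespace SiegelEisenstein

noncomputable section

/-! ### Character sums modulo `p` -/

open Classical in
/-- The sum of all values of a character modulo a prime `p`. -/
def charSum {p : ℕ} (ψ : DirichletCharacter ℂ p) : ℂ := if ψ = 1 then (p : ℂ) - 1 else 0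

section

variable {p : ℕ} [hp : Fact p.Prime] (ψ : DirichletCharacter ℂ p)

theorem sum_char : ∑ t, ψ t = charSum ψ := by
  rw [charSum]
  split_ifs with h
  · rw [h, MulChar.sum_one_eq_card_units, ZMod.card_units, Nat.cast_sub hp.out.one_le, Nat.cast_one]
  · exact MulChar.sum_eq_zero_of_ne_one h

theorem charSum_inv : charSum ψ⁻¹ = charSum ψ := by
  by_cases h : ψ = 1 <;> simp [charSum, h]

theorem sum_conj_char : ∑ t, conj (ψ t) = charSum ψ := by
  rw [← charSum_inv, ← sum_char]
  refine Finset.sum_congr rfl fun t _ => ?_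
  rw [conj_char, MulChar.inv_apply']

theorem sum_conj_neg_sq : ∑ t, conj (ψ (-t ^ 2)) = ψ (-1) * charSum (ψ ^ 2) := by
  rw [← sum_conj_char, Finset.mul_sum]
  refine Finset.sum_congr rfl fun t _ => ?_
  have h : conj (ψ (-1)) = ψ (-1) := by rw [conj_char, inv_neg, inv_one]
  rw [← neg_one_mul, map_mul, map_mul, h, map_pow, MulChar.pow_apply' _ two_ne_zero]

/-- For `x ≠ 0` the map `z ↦ x z - y²` is a bijection; for `x = 0` the argument is `-y²` and `z` is
free. -/
theorem sum_conj_det : ∑ x : ZMod p, ∑ y : ZMod p, ∑ z : ZMod p, conj (ψ (x * z - y ^ 2))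
    = p * (p - 1) * charSum ψ + p * (ψ (-1) * charSum (ψ ^ 2)) := by
  have h : ∀ x : ZMod p, ∑ y : ZMod p, ∑ z : ZMod p, conj (ψ (x * z - y ^ 2))
      = if x = 0 then p * (ψ (-1) * charSum (ψ ^ 2)) else p * charSum ψ := by
    intro x
    split_ifs with hx
    · simp only [hx, zero_mul, zero_sub, Finset.sum_const, Finset.card_univ, ZMod.card, nsmul_eq_mul]
      rw [← Finset.mul_sum, sum_conj_neg_sq]
    · have e : ∀ y : ZMod p, ∑ z : ZMod p, conj (ψ (x * z - y ^ 2)) = charSum ψ := by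
        intro y
        rw [← sum_conj_char]
        exact Fintype.sum_equiv ((Equiv.mulLeft₀ x hx).trans (Equiv.subRight (y ^ 2))) _ _
          fun z => rfl
      simp [e, ZMod.card]
  simp only [h]
  rw [← Finset.add_sum_erase _ _ (Finset.mem_univ (0 : ZMod p)), if_pos rfl,
    Finset.sum_congr rfl fun x hx => if_neg (Finset.ne_of_mem_erase hx), Finset.sum_const,
    Finset.card_erase_of_mem (Finset.mem_univ _), Finset.card_univ, ZMod.card, nsmul_eq_mul,
    Nat.cast_sub hp.out.one_le]
  push_cast
  ring

-- For `x ≠ 0` each `y` determines `z`, and the value is `ψ x`. For `x = 0` also `y = 0`, and `z` is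
-- free.
open Classical in
theorem sum_rankOneChar : ∑ x : ZMod p, ∑ y : ZMod p, ∑ z : ZMod p,
    (if x * z - y ^ 2 = 0 then rankOneChar ψ x z else 0) = (p + 1) * charSum ψ := by
  have h : ∀ x : ZMod p, ∑ y : ZMod p, ∑ z : ZMod p,
      (if x * z - y ^ 2 = 0 then rankOneChar ψ x z else 0)
      = (if x = 0 then charSum ψ else 0) + p * ψ x := by
    intro x
    split_ifs with hx
    · subst hx
      rw [char_zero, mul_zero, add_zero, ← sum_char]
      rw [Finset.sum_eq_single (0 : ZMod p) _ (by simp)]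
      · simp [rankOneChar]
      · intro y _ hy
        simp [hy]
    · have e : ∀ y : ZMod p, ∑ z : ZMod p, (if x * z - y ^ 2 = 0 then rankOneChar ψ x z else 0)
          = ψ x := by
        intro y
        have e1 : ∀ z, (x * z - y ^ 2 = 0) ↔ z = x⁻¹ * y ^ 2 := by
          intro z
          rw [sub_eq_zero, eq_inv_mul_iff_mul_eq₀ hx]
        simp [e1, rankOneChar, hx]
      simp [e, ZMod.card]
  simp only [h]
  rw [Finset.sum_add_distrib, Finset.sum_ite_eq' _ (0 : ZMod p), if_pos (Finset.mem_univ _),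
    ← Finset.mul_sum, sum_char]
  ring

/-- A residue modulo `p²` is written with two `p`-adic digits `u + p z`, after the reflection `y ↦ c
- y`. -/
theorem sum_zmod_sq (c : ℤ) (H : ℤ → ℂ) (hH : ∀ n m, H (n + p ^ 2 * m) = H n) :
    ∑ y : ZMod (p ^ 2), H (c - y.cast) = ∑ u : ZMod p, ∑ z : ZMod p, H (u.cast + p * z.cast) := by
  have hp0 : p ≠ 0 := hp.out.ne_zero
  have : NeZero (p ^ 2) := ⟨pow_ne_zero 2 hp0⟩
  have hpz : (p : ℤ) ≠ 0 := by exact_mod_cast hp0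
  let f : ZMod p × ZMod p → ZMod (p ^ 2) := fun x => ((c - (x.1.cast + p * x.2.cast) : ℤ) : ZMod _)
  have hinj : Function.Injective f := by
    rintro ⟨u, z⟩ ⟨u', z'⟩ h
    have h1 := (ZMod.intCast_eq_intCast_iff_dvd_sub _ _ _).mp h
    push_cast at h1
    have hu : u = u' := by
      rw [← ZMod.intCast_zmod_cast u', ← dvd_cast_sub_iff]
      obtain ⟨e, he⟩ := h1
      exact ⟨p * e - (z.cast - z'.cast), by linear_combination he⟩
    subst hu
    have hz : z = z' := by
      rw [← ZMod.intCast_zmod_cast z', ← dvd_cast_sub_iff]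
      obtain ⟨e, he⟩ := h1
      refine ⟨e, mul_left_cancel₀ hpz ?_⟩
      linear_combination he
    rw [hz]
  have hbij : Function.Bijective f := by
    rw [Fintype.bijective_iff_injective_and_card]
    refine ⟨hinj, ?_⟩
    rw [Fintype.card_prod, ZMod.card, ZMod.card, pow_two]
  rw [← Fintype.sum_prod_type' (f := fun u z : ZMod p => H (u.cast + p * z.cast)),
    ← hbij.sum_comp fun y => H (c - y.cast)]
  refine Finset.sum_congr rfl fun x _ => ?_
  obtain ⟨e, he⟩ := (dvd_cast_sub_iff (f x) _).mpr rfl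
  push_cast at he
  rw [show c - ((f x).cast : ℤ) = (x.1.cast + p * x.2.cast) + p ^ 2 * (-e) by
    linear_combination -he, hH]

end

theorem add_sq_dvd_iff {p : ℕ} (n m : ℤ) : (p : ℤ) ^ 2 ∣ n + p ^ 2 * m ↔ (p : ℤ) ^ 2 ∣ n :=
  Int.dvd_add_left (dvd_mul_right _ _)

theorem add_sq_dvd_iff' {p : ℕ} (n m : ℤ) : (p : ℤ) ∣ n + p ^ 2 * m ↔ (p : ℤ) ∣ n :=
  Int.dvd_add_left ((dvd_pow_self _ two_ne_zero).mul_right _)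

section

variable {p : ℕ} [hp : Fact p.Prime]

theorem dvd_digits_iff (u z : ZMod p) : (p : ℤ) ∣ u.cast + p * z.cast ↔ u = 0 := by
  rw [← ZMod.intCast_zmod_eq_zero_iff_dvd]
  simp

theorem sq_dvd_digits_iff (z : ZMod p) : (p : ℤ) ^ 2 ∣ p * z.cast ↔ z = 0 := by
  have hpz : (p : ℤ) ≠ 0 := by exact_mod_cast hp.out.ne_zero
  rw [pow_two, mul_dvd_mul_iff_left hpz, ← ZMod.intCast_zmod_eq_zero_iff_dvd,
    ZMod.intCast_zmod_cast]

theorem add_sq_div (n m : ℤ) : (n + p ^ 2 * m) / p = n / p + p * m := by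
  have hpz : (p : ℤ) ≠ 0 := by exact_mod_cast hp.out.ne_zero
  rw [pow_two, mul_assoc, Int.add_mul_ediv_left _ _ hpz]

open Classical in
/-- Sums over residues modulo `p²` of functions of the first two `p`-adic digits. -/
theorem sum_two_digits (c : ℤ) (f g : ZMod p → ℂ) (X Y : ℂ) :
    ∑ y : ZMod (p ^ 2), (f ((c - y.cast : ℤ) : ZMod p) + if (p : ℤ) ∣ c - y.cast then
      Y + (g (((c - y.cast) / p : ℤ) : ZMod p) + if (p : ℤ) ^ 2 ∣ c - y.cast then X else 0) else 0)
      = p * ∑ u, f u + (p * Y + ∑ z, g z + X) := by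
  have hpz : (p : ℤ) ≠ 0 := by exact_mod_cast hp.out.ne_zero
  rw [sum_zmod_sq c (fun n => f (n : ZMod p) + if (p : ℤ) ∣ n then
      Y + (g ((n / p : ℤ) : ZMod p) + if (p : ℤ) ^ 2 ∣ n then X else 0) else 0)]
  · have h : ∀ u z : ZMod p, (f ((u.cast + p * z.cast : ℤ) : ZMod p)
        + if (p : ℤ) ∣ u.cast + p * z.cast then
          Y + (g (((u.cast + p * z.cast) / p : ℤ) : ZMod p)
            + if (p : ℤ) ^ 2 ∣ u.cast + p * z.cast then X else 0) else 0)
        = f u + if u = 0 then Y + (g z + if z = 0 then X else 0) else 0 := by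
      intro u z
      simp only [dvd_digits_iff]
      congr 1
      · simp
      · by_cases hu : u = 0
        · subst hu
          rw [if_pos rfl, if_pos rfl]
          simp only [ZMod.cast_zero, zero_add, sq_dvd_digits_iff, Int.mul_ediv_cancel_left _ hpz,
            ZMod.intCast_zmod_cast]
        · rw [if_neg hu, if_neg hu]
    simp only [h, Finset.sum_add_distrib, Finset.sum_const, Finset.card_univ, ZMod.card,
      nsmul_eq_mul]
    rw [← Finset.mul_sum, Finset.sum_comm (s := Finset.univ) (t := Finset.univ)]
    simp [Finset.sum_add_distrib, ZMod.card]
    ring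
  · intro n m
    simp only [add_sq_dvd_iff, add_sq_dvd_iff', add_sq_div]
    simp

end

end

end SiegelEisenstein

namespace SiegelEisenstein

noncomputable section

/-! ### The local conditions for eigenforms -/

section

variable {N : ℕ} {χ : DirichletCharacter ℂ N} {κ : ℕ → Fin 3 → ℂ} {p : ℕ}

theorem localAt_of_dvd (hpN : p ∣ N) {γ : Sp} (hD : (blockD γ).det = 1) :
    localAt χ κ p γ = locInt (component χ p) (κ p) := by
  ext w
  rw [localAt, if_pos hpN, hD, locInt]
  simp

theorem localAt_of_not_dvd (hpN : ¬ p ∣ N) (γ : Sp) : localAt χ κ p γ = fun _ => 1 := by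
  ext w
  rw [localAt, if_neg hpN]

/-- A function `E` describing the joint effect of the primes different from `p`. -/
def IsOuterFactor (χ : DirichletCharacter ℂ N) (κ : ℕ → Fin 3 → ℂ) (s : Fin 2) (p : ℕ)
    (E : ℕ → ℂ) : Prop :=
  ∀ a ≤ 2, ∀ r : ℕ → Fin 3,
    ∏ q ∈ N.primeFactors.erase p, κ q (r q) * twist s (component χ q (p : ZMod q)) (r q) a
      = (∏ q ∈ N.primeFactors.erase p, κ q (r q)) * E a

/-! ### Primes dividing the level. -/

theorem plZ_transRep (r : Fin 3) (y : ZMod p × ZMod p × ZMod p) :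
    plZ (diagCusp (stdCusp r) * (transRep p y)⁻¹) =
      ![![0, 0, 0, 0, 1], ![0, 0, 0, 1, 1 - y.1.cast],
        ![1, 1 - y.1.cast, -y.2.1.cast, 1 - y.2.2.cast,
          (1 - y.1.cast) * (1 - y.2.2.cast) - (-y.2.1.cast) ^ 2]] r := by
  rw [plZ_diagCusp_mul_inv, transRep, blockA_spUpper, blockB_spUpper, blockC_spUpper,
    blockD_spUpper]
  ext j
  fin_cases r <;> fin_cases j <;> simp [plucker, stdCusp]
  ring

theorem det_blockD_transRep (y : ZMod p × ZMod p × ZMod p) : (blockD (transRep p y)).det = 1 := by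
  rw [transRep, blockD_spUpper, det_one]

theorem sum_one_sub [NeZero p] (f : ZMod p → ℂ) : ∑ y, f (1 - y) = ∑ y, f y :=
  Fintype.sum_equiv (Equiv.subLeft 1) _ _ fun _ => rfl

theorem sum_neg_zmod [NeZero p] (f : ZMod p → ℂ) : ∑ y, f (-y) = ∑ y, f y :=
  Fintype.sum_equiv (Equiv.neg _) _ _ fun _ => rfl

/-- The three hypotheses are the rows of the action of `T(p)` on the values at cusps of rank `0`,
`1`, `2` at `p`. The matrix is lower triangular because the rank never increases in passing from the
cusp to the translated plane. -/
theorem heckeT_eigen_of_dvd (hN : Squarefree N) {k : ℕ} (hk : 4 ≤ k) (hχ : χ (-1) = (-1) ^ k)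
    (hκ : IsAdmissibleFam χ κ) (hp : p.Prime) {E : ℕ → ℂ} (hpN : p ∣ N) (hE : IsOuterFactor χ κ 1 p E) {lam : ℂ}
    (h0 : E 0 * κ p 0 = lam * κ p 0)
    (h1 : (p : ℂ) ^ 2 * (E 0 * κ p 0 * charSum (component χ p)
      + (p : ℂ) ^ k * E 1 * κ p 1) = (p : ℂ) ^ 3 * (lam * κ p 1))
    (h2 : E 0 * κ p 0 * (p * (p - 1) * charSum (component χ p)
        + p * (component χ p (-1) * charSum (component χ p ^ 2)))
      + (p : ℂ) ^ k * E 1 * κ p 1 * ((p + 1) * charSum (component χ p))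
      + ((p : ℂ) ^ 2) ^ k * E 2 * κ p 2 = (p : ℂ) ^ 3 * (lam * κ p 2)) :
    heckeT k χ p hp (plSum k (famFun χ κ)) = lam • plSum k (famFun χ κ) := by
  classical
  have : Fact p.Prime := ⟨hp⟩
  refine hecke_eigen_of_terms hN hk hχ hκ 1 hp (isHeckeSystem_transRep hp hpN) hE fun r _ => ?_
  simp only [if_pos hpN, localAt_of_dvd hpN (det_blockD_transRep _), plZ_transRep]
  set ψ := component χ p
  fin_cases r
  · refine ⟨_, fun i => heckeTerm_rank_zero E ψ (κ p) 1, ?_⟩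
    simp [ZMod.card]
    linear_combination (p : ℂ) ^ 3 * h0
  · refine ⟨_, fun i => heckeTerm_T_rank_one E ψ (κ p) (1 - i.1.cast), ?_⟩
    simp only [Int.cast_sub, Int.cast_one, ZMod.intCast_zmod_cast, Fintype.sum_prod_type]
    set F : ZMod p → ℂ := fun y =>
      E 0 * κ p 0 * conj (ψ y) + if y = 0 then (p : ℂ) ^ k * E 1 * κ p 1 else 0 with hF
    change ∑ x : ZMod p, ∑ _ : ZMod p, ∑ _ : ZMod p, F (1 - x) = _
    simp only [Finset.sum_const, Finset.card_univ, ZMod.card, nsmul_eq_mul]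
    rw [← Finset.mul_sum, ← Finset.mul_sum, sum_one_sub F, hF, Finset.sum_add_distrib,
      ← Finset.mul_sum, sum_conj_char]
    simp
    linear_combination h1
  · refine ⟨_, fun i => heckeTerm_T_rank_two E ψ (κ p) (1 - i.1.cast) (-i.2.1.cast)
      (1 - i.2.2.cast), ?_⟩
    simp only [Int.cast_sub, Int.cast_one, ZMod.intCast_zmod_cast, Fintype.sum_prod_type,
      Int.cast_neg]
    set F : ZMod p → ZMod p → ZMod p → ℂ := fun x y z => E 0 * κ p 0 * conj (ψ (x * z - y ^ 2))
        + ((p : ℂ) ^ k * E 1 * κ p 1) *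
          (if x * z - y ^ 2 = 0 then rankOneChar ψ x z else 0)
        + if x = 0 ∧ y = 0 ∧ z = 0 then
            ((p : ℂ) ^ 2) ^ k * E 2 * κ p 2 else 0 with hF
    have e : ∑ x, ∑ y, ∑ z, F (1 - x) (-y) (1 - z) = ∑ x, ∑ y, ∑ z, F x y z := by
      rw [sum_one_sub fun x => ∑ y, ∑ z, F x (-y) (1 - z)]
      refine Finset.sum_congr rfl fun x _ => ?_
      rw [sum_neg_zmod fun y => ∑ z, F x y (1 - z)]
      exact Finset.sum_congr rfl fun y _ => sum_one_sub _
    refine e.trans ?_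
    simp only [hF, Finset.sum_add_distrib, ← Finset.mul_sum]
    rw [sum_conj_det, sum_rankOneChar]
    have e3 : ∀ X : ℂ, ∑ x : ZMod p, ∑ y : ZMod p, ∑ z : ZMod p,
        (if x = 0 ∧ y = 0 ∧ z = 0 then X else 0) = X := by
      intro X
      simp only [ite_and]
      simp
    rw [e3]
    exact h2

theorem plZ_transRep₁ (r : Fin 3) (i : ZMod (p ^ 2) × ZMod p × Option (ZMod p)) :
    plZ (diagCusp (stdCusp r) * (transRep₁ p i)⁻¹) =
      ![![0, 0, 0, 0, 1], ![0, lineMat p i.2.2 0 1 ^ 2, lineMat p i.2.2 1 1 * lineMat p i.2.2 0 1,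
          lineMat p i.2.2 1 1 ^ 2, 1 - i.1.cast * lineMat p i.2.2 1 1 ^ 2
            + 2 * i.2.1.cast * lineMat p i.2.2 0 1 * lineMat p i.2.2 1 1],
        ![1, lineMat p i.2.2 0 0 ^ 2 + lineMat p i.2.2 0 1 ^ 2 - i.1.cast,
          lineMat p i.2.2 0 0 * lineMat p i.2.2 1 0 + lineMat p i.2.2 0 1 * lineMat p i.2.2 1 1
            - i.2.1.cast, lineMat p i.2.2 1 0 ^ 2 + lineMat p i.2.2 1 1 ^ 2,
          (lineMat p i.2.2 0 0 ^ 2 + lineMat p i.2.2 0 1 ^ 2 - i.1.cast)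
            * (lineMat p i.2.2 1 0 ^ 2 + lineMat p i.2.2 1 1 ^ 2)
            - (lineMat p i.2.2 0 0 * lineMat p i.2.2 1 0 + lineMat p i.2.2 0 1 * lineMat p i.2.2 1 1
            - i.2.1.cast) ^ 2]] r := by
  have hd := det_lineMat p i.2.2
  rw [det_fin_two] at hd
  rw [plZ_diagCusp_mul_inv, blockA_transRep₁, blockB_transRep₁, blockC_transRep₁,
    blockD_transRep₁]
  generalize lineMat p i.2.2 = U at hd ⊢
  generalize (i.1.cast : ℤ) = y
  generalize (i.2.1.cast : ℤ) = z
  ext j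
  fin_cases r <;> fin_cases j <;> simp [plucker, stdCusp]
  · linear_combination hd
  · ring
  · ring
  · ring
  · linear_combination hd
  · linear_combination hd
  · linear_combination (-y) * hd
  · linear_combination (-z) * hd
  · ring
  · linear_combination (-(U 0 0 * U 1 1 - U 0 1 * U 1 0 + z ^ 2)) * hd

theorem det_blockD_transRep₁ (i : ZMod (p ^ 2) × ZMod p × Option (ZMod p)) :
    (blockD (transRep₁ p i)).det = 1 := by
  have hd := det_lineMat p i.2.2
  rw [det_fin_two] at hd
  rw [blockD_transRep₁, det_fin_two]
  simp
  linear_combination hd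

theorem sum_option_ite [Fact p.Prime] (X Y : ℂ) :
    ∑ o : Option (ZMod p), (if o = some 0 then X else Y) = X + p * Y := by
  rw [← Finset.add_sum_erase _ _ (Finset.mem_univ (some 0)), if_pos rfl,
    Finset.sum_congr rfl fun x hx => if_neg (Finset.ne_of_mem_erase hx), Finset.sum_const,
    Finset.card_erase_of_mem (Finset.mem_univ _), Finset.card_univ, Fintype.card_option, ZMod.card,
    nsmul_eq_mul, Nat.add_sub_cancel]

/-- As for `T(p)`, the hypotheses form a lower triangular system. At a cusp of rank one, one of the
`p + 1` lines gives a sum over residues modulo `p²`, and each of the other `p` keeps rank one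
throughout. -/
theorem heckeT₁_eigen_of_dvd (hN : Squarefree N) {k : ℕ} (hk : 4 ≤ k) (hχ : χ (-1) = (-1) ^ k)
    (hκ : IsAdmissibleFam χ κ) (hp : p.Prime) {E : ℕ → ℂ} (hpN : p ∣ N)
    (hE : IsOuterFactor χ κ 0 p E) {lam : ℂ}
    (h0 : (p + 1) * (E 0 * κ p 0) = lam * κ p 0)
    (h1 : p * (p * (E 0 * κ p 0 * charSum (component χ p))
        + (p : ℂ) ^ k * E 1 * κ p 0 * charSum (component χ p) + ((p : ℂ) ^ 2) ^ k * E 2 * κ p 1)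
        + (p : ℂ) ^ 4 * (E 0 * κ p 1) = (p : ℂ) ^ 3 * (lam * κ p 1))
    (h2 : (p + 1) * ((p : ℂ) ^ 2 * (E 0 * κ p 1 * charSum (component χ p))
        + p * (E 0 * κ p 0 * (component χ p (-1) * charSum (component χ p ^ 2)))
        + (p : ℂ) ^ k * E 1 * κ p 1 * charSum (component χ p) + ((p : ℂ) ^ 2) ^ k * E 2 * κ p 2)
        = (p : ℂ) ^ 3 * (lam * κ p 2)) :
    heckeT₁ k χ p hp (plSum k (famFun χ κ)) = lam • plSum k (famFun χ κ) := by
  classical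
  have : Fact p.Prime := ⟨hp⟩
  have hp0 : p ≠ 0 := hp.ne_zero
  have : NeZero (p ^ 2) := ⟨pow_ne_zero 2 hp0⟩
  refine hecke_eigen_of_terms hN hk hχ hκ 0 hp (isHeckeSystem_transRep₁ hp hpN) hE fun r _ => ?_
  simp only [if_pos hpN, localAt_of_dvd hpN (det_blockD_transRep₁ _), plZ_transRep₁]
  have hκp : κ p 1 ≠ 0 → component χ p ^ 2 = 1 :=
    hκ p (Nat.mem_primeFactors.mpr ⟨hp, hpN, hN.ne_zero⟩)
  set ψ := component χ p
  fin_cases r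
  · refine ⟨_, fun i => heckeTerm_rank_zero E ψ (κ p) 0, ?_⟩
    simp [ZMod.card]
    linear_combination (p : ℂ) ^ 3 * h0
  -- The summand `0` fills the place of `Y` in `sum_two_digits`.
  · set G : ℤ → ℂ := fun d => E 0 * κ p 0 * conj (ψ d) + if (p : ℤ) ∣ d then
        0 + ((p : ℂ) ^ k * E 1 * κ p 0 * conj (ψ (d / p : ℤ)) +
          (if (p : ℤ) ^ 2 ∣ d then ((p : ℂ) ^ 2) ^ k * E 2 * κ p 1 else 0)) else 0 with hG
    -- The line `some 0` is the only one whose upper right entry vanishes modulo `p`.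
    refine ⟨fun i => if i.2.2 = some 0 then G (1 - i.1.cast) else E 0 * κ p 1, fun i => ?_, ?_⟩
    · obtain ⟨y, z, o⟩ := i
      by_cases ho : o = some 0
      · subst ho
        have := heckeTerm_TOne_rank_one (k := k) E ψ (κ p) (1 - y.cast)
        simpa [lineMat, hG] using this
      · simp only [if_neg ho]
        refine heckeTerm_TOne_rank_one' E ψ (κ p) hκp ?_ _
        rw [← ZMod.intCast_zmod_eq_zero_iff_dvd]
        rcases o with - | t
        · simp [lineMat]
        · simpa [lineMat] using ho
    · simp only [Fintype.sum_prod_type, sum_option_ite]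
      simp only [Finset.sum_const, Finset.card_univ, ZMod.card, nsmul_eq_mul]
      rw [← Finset.mul_sum, Finset.sum_add_distrib]
      have e := sum_two_digits (p := p) 1 (fun t => E 0 * κ p 0 * conj (ψ t))
        (fun t => (p : ℂ) ^ k * E 1 * κ p 0 * conj (ψ t)) (((p : ℂ) ^ 2) ^ k * E 2 * κ p 1) 0
      rw [hG]
      simp only
      rw [e, ← Finset.mul_sum, ← Finset.mul_sum, sum_conj_char]
      simp only [Finset.sum_const, Finset.card_univ, ZMod.card, nsmul_eq_mul]
      push_cast
      linear_combination h1
  · refine ⟨_, fun i => heckeTerm_TOne_rank_two E ψ (κ p) _ _ _, ?_⟩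
    have key : ∀ (c : ℤ) (y : ZMod p), ∑ x : ZMod (p ^ 2),
        (E 0 * κ p 1 * ψ ((c - x.cast : ℤ) : ZMod p) + if (p : ℤ) ∣ c - x.cast then
        E 0 * κ p 0 * conj (ψ (-y ^ 2)) + (if y = 0 then
          (p : ℂ) ^ k * E 1 * κ p 1 * ψ ((c - x.cast) / p : ℤ) +
          (if (p : ℤ) ^ 2 ∣ c - x.cast then ((p : ℂ) ^ 2) ^ k * E 2 * κ p 2 else 0) else 0) else 0)
        = p * (E 0 * κ p 1 * charSum ψ) + (p * (E 0 * κ p 0 * conj (ψ (-y ^ 2)))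
          + if y = 0 then ((p : ℂ) ^ k * E 1 * κ p 1 * charSum ψ
            + ((p : ℂ) ^ 2) ^ k * E 2 * κ p 2) else 0) := by
      intro c y
      by_cases hy : y = 0
      · have e := sum_two_digits (p := p) c (fun t => E 0 * κ p 1 * ψ t)
          (fun t => (p : ℂ) ^ k * E 1 * κ p 1 * ψ t) (((p : ℂ) ^ 2) ^ k * E 2 * κ p 2)
          (E 0 * κ p 0 * conj (ψ (-y ^ 2)))
        simp only [if_pos hy]
        rw [e, ← Finset.mul_sum, ← Finset.mul_sum, sum_char]
        ring
      · have e := sum_two_digits (p := p) c (fun t => E 0 * κ p 1 * ψ t)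
          (fun t => 0) 0 (E 0 * κ p 0 * conj (ψ (-y ^ 2)))
        simp only [if_neg hy]
        simp only [ite_self, add_zero, Finset.sum_const_zero] at e ⊢
        rw [e, ← Finset.mul_sum, sum_char]
    have key2 : ∀ c : ℤ, ∑ y : ZMod p, (p * (E 0 * κ p 1 * charSum ψ)
        + (p * (E 0 * κ p 0 * conj (ψ (-((c - y.cast : ℤ) : ZMod p) ^ 2)))
          + if ((c - y.cast : ℤ) : ZMod p) = 0 then ((p : ℂ) ^ k * E 1 * κ p 1 * charSum ψ
            + ((p : ℂ) ^ 2) ^ k * E 2 * κ p 2) else 0))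
        = (p : ℂ) ^ 2 * (E 0 * κ p 1 * charSum ψ)
        + p * (E 0 * κ p 0 * (ψ (-1) * charSum (ψ ^ 2)))
        + (p : ℂ) ^ k * E 1 * κ p 1 * charSum ψ + ((p : ℂ) ^ 2) ^ k * E 2 * κ p 2 := by
      intro c
      simp only [Int.cast_sub, ZMod.intCast_zmod_cast]
      refine (Fintype.sum_equiv (Equiv.subLeft (c : ZMod p)) _ (fun y : ZMod p =>
        (p * (E 0 * κ p 1 * charSum ψ)
        + (p * (E 0 * κ p 0 * conj (ψ (-y ^ 2)))
          + if y = 0 then ((p : ℂ) ^ k * E 1 * κ p 1 * charSum ψ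
            + ((p : ℂ) ^ 2) ^ k * E 2 * κ p 2) else 0))) fun _ => rfl).trans ?_
      rw [Finset.sum_add_distrib, Finset.sum_add_distrib, Finset.sum_const, ← Finset.mul_sum,
        ← Finset.mul_sum, sum_conj_neg_sq]
      simp [ZMod.card]
      ring
    set G : ℤ → ZMod p → ZMod (p ^ 2) → ℂ := fun c y x =>
      E 0 * κ p 1 * ψ ((c - x.cast : ℤ) : ZMod p) + if (p : ℤ) ∣ c - x.cast then
        E 0 * κ p 0 * conj (ψ (-y ^ 2)) + (if y = 0 then
          (p : ℂ) ^ k * E 1 * κ p 1 * ψ ((c - x.cast) / p : ℤ) +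
          (if (p : ℤ) ^ 2 ∣ c - x.cast then ((p : ℂ) ^ 2) ^ k * E 2 * κ p 2 else 0) else 0) else 0
      with hG
    let c₁ : Option (ZMod p) → ℤ := fun o => lineMat p o 0 0 ^ 2 + lineMat p o 0 1 ^ 2
    let c₂ : Option (ZMod p) → ℤ := fun o =>
      lineMat p o 0 0 * lineMat p o 1 0 + lineMat p o 0 1 * lineMat p o 1 1
    rw [Fintype.sum_prod_type]
    simp only [Fintype.sum_prod_type (α₁ := ZMod p)]
    change ∑ x : ZMod (p ^ 2), ∑ y : ZMod p, ∑ o : Option (ZMod p),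
      G (c₁ o) ((c₂ o - y.cast : ℤ) : ZMod p) x = _
    have hswap : ∑ x : ZMod (p ^ 2), ∑ y : ZMod p, ∑ o : Option (ZMod p),
        G (c₁ o) ((c₂ o - y.cast : ℤ) : ZMod p) x
        = ∑ o : Option (ZMod p), ∑ y : ZMod p, ∑ x : ZMod (p ^ 2),
        G (c₁ o) ((c₂ o - y.cast : ℤ) : ZMod p) x := by
      rw [Finset.sum_comm]
      refine (Finset.sum_congr rfl fun y _ => Finset.sum_comm).trans ?_
      exact Finset.sum_comm
    rw [hswap]
    simp only [hG, key, key2]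
    simp only [Finset.sum_const, Finset.card_univ, Fintype.card_option, ZMod.card, nsmul_eq_mul]
    push_cast
    exact h2

/-! ### Primes not dividing the level. -/

theorem plZ_midRep {x₀ y₀ : ℤ} (hb : (p : ℤ) * x₀ - y₀ * N = 1) (i : ZMod p × Option (ZMod p)) :
    plZ (diagCusp (stdCusp 0) * (midRep p hb i)⁻¹) = ![0, -(N : ℤ), 0, 0, p] := by
  have hd := det_lineMat p i.2
  rw [det_fin_two] at hd
  rw [plZ_diagCusp_mul_inv, blockA_midRep, blockC_midRep]
  generalize lineMat p i.2 = U at hd ⊢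
  ext j
  fin_cases j <;> simp [plucker, stdCusp]
  · linear_combination (-(N : ℤ)) * hd
  · ring
  · linear_combination (p : ℤ) * hd

/-- There is no local function at `p`, so only the exponents count: `p³` translations have `a = 0`,
the `p (p + 1)` representatives of rank one have `a = 1`, and the last has `a = 2`. -/
theorem heckeT_eigen_of_not_dvd (hN : Squarefree N) {k : ℕ} (hk : 4 ≤ k)
    (hχ : χ (-1) = (-1) ^ k) (hκ : IsAdmissibleFam χ κ) (hp : p.Prime) {E : ℕ → ℂ}
    (hpN : ¬ p ∣ N) (hE : IsOuterFactor χ κ 1 p E) {lam : ℂ}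
    (h : (p : ℂ) ^ 3 * E 0 + p * (p + 1) * ((p : ℂ) ^ k * E 1) + ((p : ℂ) ^ 2) ^ k * E 2
      = (p : ℂ) ^ 3 * lam) :
    heckeT k χ p hp (plSum k (famFun χ κ)) = lam • plSum k (famFun χ κ) := by
  have : Fact p.Prime := ⟨hp⟩
  obtain ⟨u, v, huv⟩ := Nat.isCoprime_iff_coprime.mpr ((Nat.Prime.coprime_iff_not_dvd hp).mpr hpN)
  have hb : (p : ℤ) * u - (-v) * N = 1 := by linear_combination huv
  refine hecke_eigen_of_terms hN hk hχ hκ 1 hp (isHeckeSystem_fullRep hb hp) hE fun r hr => ?_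
  obtain rfl := hr hpN
  simp only [if_neg hpN, localAt_of_not_dvd hpN]
  refine ⟨Sum.elim (fun _ => E 0) (Sum.elim (fun _ => (p : ℂ) ^ k * E 1)
    fun _ => ((p : ℂ) ^ 2) ^ k * E 2), ?_, ?_⟩
  · rintro (y | i | -)
    · refine heckeTerm_of_eq 0 (by norm_num) ![0, 0, 0, 0, 1] ?_ 4 prime_not_dvd_one (by simp)
      intro j
      simp only [fullRep, Sum.elim_inl, plZ_transRep]
      fin_cases j <;> simp [heckeExp]
    · refine heckeTerm_of_eq 1 (by norm_num) ![0, -N, 0, 0, 1] ?_ 4 prime_not_dvd_one (by simp)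
      intro j
      simp only [fullRep, Sum.elim_inl, Sum.elim_inr, plZ_midRep]
      fin_cases j <;> simp [heckeExp]
    · refine heckeTerm_of_eq 2 (by norm_num) ![N ^ 2, -N, 0, -N, 1] ?_ 4 prime_not_dvd_one (by simp)
      intro j
      have hv : plZ (diagCusp (stdCusp 0) * (lowRep p hb)⁻¹)
          = ![(N : ℤ) ^ 2, -(N * p : ℤ), 0, -(N * p : ℤ), (p : ℤ) ^ 2] := by
        rw [plZ_diagCusp_mul_inv, lowRep, blockA_spPair, blockB_spPair, blockC_spPair,
          blockD_spPair]
        ext j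
        fin_cases j <;> simp [plucker, stdCusp, pow_two]
      simp only [fullRep, Sum.elim_inr, hv]
      fin_cases j <;> simp [heckeExp] <;> ring
  · simp [Fintype.sum_sum_type, ZMod.card]
    linear_combination h

theorem plZ_midRep₁ {x₀ y₀ : ℤ} (hb : (p : ℤ) ^ 2 * x₀ - y₀ * N = 1) (i : ZMod p × Option (ZMod p)) :
    plZ (diagCusp (stdCusp 0) * (midRep₁ p hb i)⁻¹) =
      ![0, 0, 0, -(N + p * N * i.1.cast * x₀), p ^ 2 + p * N * i.1.cast * y₀] := by
  have hd := det_lineMat p i.2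
  rw [det_fin_two] at hd
  rw [plZ_diagCusp_mul_inv, blockA_midRep₁, blockB_midRep₁, blockC_midRep₁, blockD_midRep₁]
  generalize lineMat p i.2 = U at hd ⊢
  ext j
  fin_cases j <;> simp [plucker, stdCusp]
  · linear_combination (-(N + p * N * i.1.cast * x₀ : ℤ)) * hd
  · linear_combination (p ^ 2 + p * N * i.1.cast * y₀ : ℤ) * hd

/-- The `p³ (p + 1)` representatives in the parabolic have `a = 0`. Of the others, `a = 2` for the
`p + 1` with parameter `0` and `a = 1` for the rest. -/
theorem heckeT₁_eigen_of_not_dvd (hN : Squarefree N) {k : ℕ} (hk : 4 ≤ k)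
    (hχ : χ (-1) = (-1) ^ k) (hκ : IsAdmissibleFam χ κ) (hp : p.Prime) {E : ℕ → ℂ}
    (hpN : ¬ p ∣ N) (hE : IsOuterFactor χ κ 0 p E) {lam : ℂ}
    (h : (p + 1) * ((p : ℂ) ^ 3 * E 0 + (p - 1) * ((p : ℂ) ^ k * E 1) + ((p : ℂ) ^ 2) ^ k * E 2)
      = (p : ℂ) ^ 3 * lam) :
    heckeT₁ k χ p hp (plSum k (famFun χ κ)) = lam • plSum k (famFun χ κ) := by
  classical
  have : Fact p.Prime := ⟨hp⟩
  have : NeZero (p ^ 2) := ⟨pow_ne_zero 2 hp.ne_zero⟩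
  have hpp := Nat.prime_iff_prime_int.mp hp
  obtain ⟨u, v, huv⟩ := Nat.isCoprime_iff_coprime.mpr
    (((Nat.Prime.coprime_iff_not_dvd hp).mpr hpN).pow_left 2)
  push_cast at huv
  have hb : (p : ℤ) ^ 2 * u - (-v) * N = 1 := by linear_combination huv
  refine hecke_eigen_of_terms hN hk hχ hκ 0 hp (isHeckeSystem_fullRep₁ hb hp) hE fun r hr => ?_
  obtain rfl := hr hpN
  simp only [if_neg hpN, localAt_of_not_dvd hpN]
  refine ⟨Sum.elim (fun _ => E 0) (fun i => if i.1 = 0 then ((p : ℂ) ^ 2) ^ k * E 2 else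
    (p : ℂ) ^ k * E 1), ?_, ?_⟩
  · rintro (y | ⟨s, o⟩)
    · refine heckeTerm_of_eq 0 (by norm_num) ![0, 0, 0, 0, 1] ?_ 4 prime_not_dvd_one (by simp)
      intro j
      simp only [fullRep₁, Sum.elim_inl, plZ_transRep₁]
      fin_cases j <;> simp [heckeExp]
    · simp only [fullRep₁, Sum.elim_inr, plZ_midRep₁]
      by_cases hs : s = 0
      · subst hs
        refine heckeTerm_of_eq 2 (by norm_num) ![0, 0, 0, -N, 1] ?_ 4 prime_not_dvd_one (by simp)
        intro j
        fin_cases j <;> simp [heckeExp]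
      · refine heckeTerm_of_eq 1 (by norm_num) ![0, 0, 0, -(p * (N + p * N * s.cast * u)),
          p + N * s.cast * (-v)] ?_ 4 ?_ (by simp [hs])
        · intro j
          fin_cases j <;> simp [heckeExp] <;> ring
        · have hy := not_dvd_bezout hp two_ne_zero hb
          have hn := not_dvd_bezout_level hp two_ne_zero hb
          rw [← ZMod.intCast_zmod_eq_zero_iff_dvd] at hy hn ⊢
          simp at hy hn
          simp [hy, hn, hs]
  · simp only [Fintype.sum_sum_type, Sum.elim_inl, Sum.elim_inr, Fintype.sum_prod_type,
      Finset.sum_const, Finset.card_univ, Fintype.card_option, Fintype.card_prod, ZMod.card,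
      nsmul_eq_mul]
    change _ + ∑ x : ZMod p, ∑ _ : Option (ZMod p),
      (if x = 0 then ((p : ℂ) ^ 2) ^ k * E 2 else (p : ℂ) ^ k * E 1) = _
    simp only [Finset.sum_const, Finset.card_univ, Fintype.card_option, ZMod.card, nsmul_eq_mul]
    rw [← Finset.mul_sum, ← Finset.add_sum_erase _ _ (Finset.mem_univ (0 : ZMod p)), if_pos rfl,
      Finset.sum_congr rfl fun x hx => if_neg (Finset.ne_of_mem_erase hx), Finset.sum_const,
      Finset.card_erase_of_mem (Finset.mem_univ _), Finset.card_univ, ZMod.card, nsmul_eq_mul,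
      Nat.cast_sub hp.one_le]
    push_cast
    linear_combination h

end

end

end SiegelEisenstein

namespace SiegelEisenstein

noncomputable section

/-! ### The primes different from `p` -/

section

variable {N : ℕ}

/-- The value at `p` of the part of `χ_d` away from `p`. -/
def outer (χ : DirichletCharacter ℂ N) (p d : ℕ) : ℂ :=
  ∏ q ∈ d.primeFactors.erase p, component χ q (p : ZMod q)

theorem prod_erase_ite (S : Finset ℕ) (p : ℕ) (F : ℕ → ℂ) :
    ∏ q ∈ S.erase p, F q = ∏ q ∈ S, if q = p then 1 else F q := by
  rw [← Finset.prod_erase (a := p) S (by simp)]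
  exact Finset.prod_congr rfl fun q hq => by rw [if_neg (Finset.ne_of_mem_erase hq)]

variable (χ : DirichletCharacter ℂ N) {p : ℕ}

theorem cast_prime_ne_zero (hp : p.Prime) {q : ℕ} (hq : q.Prime) (h : q ≠ p) :
    (p : ZMod q) ≠ 0 := by
  intro h0
  rw [ZMod.natCast_eq_zero_iff] at h0
  exact h ((Nat.prime_dvd_prime_iff_eq hq hp).mp h0)

theorem norm_outer (hp : p.Prime) (d : ℕ) : ‖outer χ p d‖ = 1 := by
  rw [outer, norm_prod]
  refine Finset.prod_eq_one fun q hq => ?_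
  have hq' := Nat.prime_of_mem_primeFactors (Finset.mem_of_mem_erase hq)
  have : Fact q.Prime := ⟨hq'⟩
  have hu := isUnit_iff_ne_zero.mpr (cast_prime_ne_zero hp hq' (Finset.ne_of_mem_erase hq))
  obtain ⟨u, hu⟩ := hu
  rw [← hu]
  exact DirichletCharacter.unit_norm_eq_one _ u

theorem chi_eq_outer (hN : Squarefree N) {d : ℕ} (hd : d ∣ N) (h : ¬ p ∣ d) :
    chi χ d p = outer χ p d := by
  rw [chi_eq_prod hN χ hd, outer, Finset.erase_eq_of_notMem]
  exact fun hm => h (Nat.dvd_of_mem_primeFactors hm)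

theorem chi_div_eq_outer (hN : Squarefree N) (hp : p.Prime) {d : ℕ} (hd : d ∣ N) (h : p ∣ d) :
    chi χ (d / p) p = outer χ p d := by
  obtain ⟨e, rfl⟩ := h
  have hs : Squarefree (p * e) := hN.squarefree_of_dvd hd
  rw [Nat.mul_div_cancel_left _ hp.pos, chi_eq_prod hN χ ((dvd_mul_left _ _).trans hd), outer,
    (Nat.coprime_of_squarefree_mul hs).primeFactors_mul, hp.primeFactors, Finset.erase_union_distrib,
    Finset.erase_singleton, Finset.empty_union, Finset.erase_eq_of_notMem]
  exact not_dvd_of_mem_primeFactors hs (Nat.mem_primeFactors.mpr ⟨hp, dvd_rfl, hp.ne_zero⟩) ∘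
    Nat.dvd_of_mem_primeFactors

theorem chi_mul (hN : Squarefree N) {a b : ℕ} (h : a * b ∣ N) (n : ℕ) :
    chi χ (a * b) n = chi χ a n * chi χ b n := by
  rw [chi_eq_prod hN χ h, chi_eq_prod hN χ ((dvd_mul_right _ _).trans h),
    chi_eq_prod hN χ ((dvd_mul_left _ _).trans h),
    prod_primeFactors_mul (hN.squarefree_of_dvd h)]

theorem chi_sq (d n : ℕ) : chi χ d (n ^ 2) = chi χ d n ^ 2 := by
  rw [chi, chi, Nat.cast_pow, map_pow]

theorem outer_sq (hN : Squarefree N) {χ : DirichletCharacter ℂ N} (hp : p.Prime)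
    (ρ : CuspIndex χ) : outer χ p ρ.N₁ ^ 2 = 1 := by
  rw [outer, ← Finset.prod_pow]
  refine Finset.prod_eq_one fun q hq => ?_
  have hm := Finset.mem_of_mem_erase hq
  have hq' := Nat.prime_of_mem_primeFactors hm
  have : Fact q.Prime := ⟨hq'⟩
  rw [pow_two]
  exact char_sq_mul (ρ.sq_of_dvd hN (Nat.dvd_of_mem_primeFactors hm))
    (cast_prime_ne_zero hp hq' (Finset.ne_of_mem_erase hq))

/-- Off the rank of `ρ`, the coefficients `coeffA` and `coeffC` vanish unless `χ_q` is trivial, when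
all twists are `1`. The coefficient `coeffB` may also occur for quadratic `χ_q`, but `z ^ a = z ^ (2
- a)` when `z² = 1`. -/
theorem eigenFam_twist (s : Fin 2) {χ : DirichletCharacter ℂ N} {k : ℕ} (ρ : CuspIndex χ) {q : ℕ}
    (hq : q.Prime) (hp : p.Prime) (hqp : q ≠ p) {a : ℕ} (ha : a ≤ 2) (r : Fin 3) :
    eigenFam k χ ρ q r * twist s (component χ q (p : ZMod q)) r a
      = eigenFam k χ ρ q r * twist s (component χ q (p : ZMod q)) (tripleRank ρ.N₁ ρ.N₂ q) a := by
  have : Fact q.Prime := ⟨hq⟩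
  have hp0 := cast_prime_ne_zero hp hq hqp
  by_cases h : eigenFam k χ ρ q r = 0
  · rw [h, zero_mul, zero_mul]
  congr 1
  have h1 : component χ q = 1 → component χ q (p : ZMod q) = 1 := by
    intro h1
    rw [h1, MulChar.one_apply (isUnit_iff_ne_zero.mpr hp0)]
  have hone : ∀ r : Fin 3, twist s 1 r a = 1 := by
    intro r; fin_cases r <;> simp [twist]
  have hall : component χ q = 1 → ∀ r r', twist s (component χ q (p : ZMod q)) r a
      = twist s (component χ q (p : ZMod q)) r' a := by
    intro h2 r r'
    rw [h1 h2, hone, hone]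
  rw [eigenFam] at h
  rw [tripleRank]
  split_ifs at h ⊢ with hd2 hd1
  · fin_cases r <;> simp at h ⊢
  · fin_cases r <;> simp at h ⊢
    apply hall
    by_contra hc
    exact h (by rw [coeffC, if_neg hc])
  · fin_cases r <;> simp at h ⊢
    · apply hall
      by_contra hc
      exact h (by rw [coeffA, if_neg hc])
    · by_cases hc : component χ q = 1
      · exact hall hc _ _
      · have hsq : component χ q ^ 2 = 1 := by
          by_contra hc2
          exact h (by rw [coeffB, if_neg hc, if_neg hc2])
        have := char_sq_mul hsq hp0
        interval_cases a <;> simp [twist, pow_two, this]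

theorem isOuterFactor_eigenFam (hN : Squarefree N) {χ : DirichletCharacter ℂ N} {k : ℕ}
    (ρ : CuspIndex χ) (s : Fin 2) (hp : p.Prime) :
    IsOuterFactor χ (eigenFam k χ ρ) s p fun a =>
      outer χ p ρ.N₀ ^ a * outer χ p ρ.N₁ ^ (s.1 + a) * outer χ p ρ.N₂ ^ (2 - a) := by
  intro a ha r
  have e : ∏ q ∈ N.primeFactors.erase p,
      twist s (component χ q (p : ZMod q)) (tripleRank ρ.N₁ ρ.N₂ q) a
      = outer χ p ρ.N₀ ^ a * outer χ p ρ.N₁ ^ (s.1 + a) * outer χ p ρ.N₂ ^ (2 - a) := by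
    simp only [outer, prod_erase_ite, ← Finset.prod_pow]
    apply prod_triple hN ρ.prod_eq
    · intro q h1 h2
      split_ifs <;> simp [tripleRank, h1, h2, twist]
    · intro q h1 h2
      split_ifs <;> simp [tripleRank, h1, h2, twist]
    · intro q h2
      split_ifs <;> simp [tripleRank, h2, twist]
  beta_reduce
  rw [← e, ← Finset.prod_mul_distrib]
  refine Finset.prod_congr rfl fun q hq => ?_
  exact eigenFam_twist s ρ (Nat.prime_of_mem_primeFactors (Finset.mem_of_mem_erase hq)) hp
    (Finset.ne_of_mem_erase hq) ha (r q)

end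

/-! ### Quadratic characters at `-1` -/

/-- A quadratic character is `1` on squares. If `-1` is not a square and `ψ (-1) = 1`, then every
nonsquare is minus a square and `ψ` would be trivial. -/
theorem jacobiSym_neg_one_eq {q : ℕ} [hq : Fact q.Prime] {ψ : DirichletCharacter ℂ q} (h1 : ψ ≠ 1)
    (h2 : ψ ^ 2 = 1) : (jacobiSym (-1) q : ℂ) = ψ (-1) := by
  rw [← jacobiSym.legendreSym.to_jacobiSym, legendreSym]
  push_cast
  have hm : (-1 : ZMod q) ≠ 0 := neg_ne_zero.mpr one_ne_zero
  have hsquare : ∀ x : ZMod q, x ≠ 0 → IsSquare x → ψ x = 1 := by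
    rintro x hx ⟨y, rfl⟩
    have hy : y ≠ 0 := fun h => hx (by rw [h, mul_zero])
    rw [map_mul]
    exact char_sq_mul h2 hy
  by_cases hsq : IsSquare (-1 : ZMod q)
  · rw [(quadraticChar_one_iff_isSquare hm).mpr hsq, hsquare _ hm hsq, Int.cast_one]
  · rw [quadraticChar_neg_one_iff_not_isSquare.mpr hsq]
    have hpm := char_sq_mul h2 hm
    have hne : ψ (-1) ≠ 1 := by
      intro h
      apply h1
      ext u
      have hu : (u : ZMod q) ≠ 0 := u.ne_zero
      rw [MulChar.one_apply u.isUnit]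
      by_cases hs : IsSquare (u : ZMod q)
      · exact hsquare _ hu hs
      · have hprod : IsSquare (-(u : ZMod q)) := by
          rw [← quadraticChar_one_iff_isSquare (neg_ne_zero.mpr hu), ← neg_one_mul, map_mul,
            quadraticChar_neg_one_iff_not_isSquare.mpr hsq,
            quadraticChar_neg_one_iff_not_isSquare.mpr hs]
          norm_num
        have := hsquare _ (neg_ne_zero.mpr hu) hprod
        rwa [← neg_one_mul, map_mul, h, one_mul] at this
    rcases mul_self_eq_one_iff.mp hpm with h | h
    · exact absurd h hne
    · rw [h]; norm_num

end

end SiegelEisenstein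

namespace SiegelEisenstein

noncomputable section

/-! ### The eigenvalue equations -/

theorem sub_ne_zero_of_norm_ne {x y : ℂ} (h : ‖x‖ ≠ ‖y‖) : x - y ≠ 0 := fun h0 =>
  h (by rw [sub_eq_zero.mp h0])

section

variable {p k : ℕ}

/-- The two terms have absolute values that are different powers of `p`. This makes the denominators
of `coeffA`, `coeffB`, `coeffC` nonzero for `k ≥ 4`. -/
theorem unimodular_sub_ne_zero (hp : p.Prime) {u w : ℂ} (hu : ‖u‖ = 1) (hw : ‖w‖ = 1) {i j : ℕ}
    (hij : i ≠ j) : u * (p : ℂ) ^ i - (p : ℂ) ^ j * w ≠ 0 := by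
  apply sub_ne_zero_of_norm_ne
  rw [norm_mul, norm_mul, norm_pow, norm_pow, hu, hw, one_mul, mul_one, Complex.norm_natCast]
  intro h
  have h' : p ^ i = p ^ j := by exact_mod_cast h
  exact hij (Nat.pow_right_injective hp.two_le h')

theorem zpow_sub_eq (hp : p.Prime) :
    (p : ℂ) ^ ((k : ℤ) - 1) = (p : ℂ) ^ k / p ∧ (p : ℂ) ^ ((k : ℤ) - 2) = (p : ℂ) ^ k / p ^ 2 ∧
    (p : ℂ) ^ ((k : ℤ) - 3) = (p : ℂ) ^ k / p ^ 3 ∧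
    (p : ℂ) ^ (2 * (k : ℤ) - 2) = ((p : ℂ) ^ k) ^ 2 / p ^ 2 ∧
    (p : ℂ) ^ (2 * (k : ℤ) - 3) = ((p : ℂ) ^ k) ^ 2 / p ^ 3 := by
  have h0 : (p : ℂ) ≠ 0 := by exact_mod_cast hp.ne_zero
  have e : (p : ℂ) ^ (2 * (k : ℤ)) = ((p : ℂ) ^ k) ^ 2 := by
    rw [mul_comm, _root_.zpow_mul, zpow_natCast]
    norm_cast
  refine ⟨?_, ?_, ?_, ?_, ?_⟩
  · rw [zpow_sub₀ h0, zpow_natCast, zpow_one]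
  · rw [zpow_sub₀ h0, zpow_natCast]; norm_cast
  · rw [zpow_sub₀ h0, zpow_natCast]; norm_cast
  · rw [zpow_sub₀ h0, e]; norm_cast
  · rw [zpow_sub₀ h0, e]; norm_cast

end

section

variable {N : ℕ} {χ : DirichletCharacter ℂ N} (ρ : CuspIndex χ) {p k : ℕ}

theorem CuspIndex.dvd_level (ρ : CuspIndex χ) : ρ.N₀ ∣ N ∧ ρ.N₁ ∣ N ∧ ρ.N₂ ∣ N ∧
    ρ.N₀ * ρ.N₁ ∣ N ∧ ρ.N₁ * ρ.N₂ ∣ N ∧ ρ.N₀ * ρ.N₂ ∣ N :=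
  ⟨⟨ρ.N₁ * ρ.N₂, ρ.prod_eq.symm.trans (by ring)⟩, ⟨ρ.N₀ * ρ.N₂, ρ.prod_eq.symm.trans (by ring)⟩,
    ⟨ρ.N₀ * ρ.N₁, ρ.prod_eq.symm.trans (by ring)⟩, ⟨ρ.N₂, ρ.prod_eq.symm⟩,
    ⟨ρ.N₀, ρ.prod_eq.symm.trans (by ring)⟩, ⟨ρ.N₁, ρ.prod_eq.symm.trans (by ring)⟩⟩

theorem CuspIndex.dvd_level_iff (hp : p.Prime) : p ∣ N ↔ p ∣ ρ.N₀ ∨ p ∣ ρ.N₁ ∨ p ∣ ρ.N₂ := by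
  have h : p ∣ N ↔ p ∣ ρ.N₀ * ρ.N₁ * ρ.N₂ := ⟨fun h => h.trans (dvd_of_eq ρ.prod_eq.symm),
    fun h => h.trans (dvd_of_eq ρ.prod_eq)⟩
  rw [h, hp.dvd_mul, hp.dvd_mul, or_assoc]

theorem not_dvd_right (hN : Squarefree N) (hp : p.Prime) {a b : ℕ} (hab : a * b ∣ N) (h : p ∣ a) :
    ¬ p ∣ b := by
  have hs := hN.squarefree_of_dvd hab
  have ha : a ≠ 0 := left_ne_zero_of_mul hs.ne_zero
  exact not_dvd_of_mem_primeFactors hs (Nat.mem_primeFactors.mpr ⟨hp, h, ha⟩)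

theorem CuspIndex.not_dvd_of_dvd (hN : Squarefree N) (hp : p.Prime) :
    (p ∣ ρ.N₀ → ¬ p ∣ ρ.N₁ ∧ ¬ p ∣ ρ.N₂) ∧ (p ∣ ρ.N₁ → ¬ p ∣ ρ.N₀ ∧ ¬ p ∣ ρ.N₂) ∧
    (p ∣ ρ.N₂ → ¬ p ∣ ρ.N₀ ∧ ¬ p ∣ ρ.N₁) := by
  obtain ⟨-, -, -, h01, h12, h02⟩ := ρ.dvd_level
  exact ⟨fun h => ⟨not_dvd_right hN hp h01 h, not_dvd_right hN hp h02 h⟩,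
    fun h => ⟨not_dvd_right hN hp (mul_comm ρ.N₀ ρ.N₁ ▸ h01) h, not_dvd_right hN hp h12 h⟩,
    fun h => ⟨not_dvd_right hN hp (mul_comm ρ.N₀ ρ.N₂ ▸ h02) h,
      not_dvd_right hN hp (mul_comm ρ.N₁ ρ.N₂ ▸ h12) h⟩⟩

theorem eigenFam_of_dvd_two (h2 : p ∣ ρ.N₂) : eigenFam k χ ρ p = ![0, 0, 1] := if_pos h2

theorem eigenFam_of_dvd_one (h2 : ¬ p ∣ ρ.N₂) (h1 : p ∣ ρ.N₁) :
    eigenFam k χ ρ p = ![0, 1, coeffC k χ ρ p] := by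
  rw [eigenFam, if_neg h2, if_pos h1]

theorem eigenFam_of_not_dvd (h2 : ¬ p ∣ ρ.N₂) (h1 : ¬ p ∣ ρ.N₁) :
    eigenFam k χ ρ p = ![1, coeffA k χ ρ p, coeffB k χ ρ p] := by
  rw [eigenFam, if_neg h2, if_neg h1]

/-- The equation defining `coeffA`. -/
theorem coeffA_eq (hN : Squarefree N) (hk : 4 ≤ k) (hp : p.Prime) (h0 : p ∣ ρ.N₀)
    (hψ : component χ p = 1) :
    coeffA k χ ρ p * (outer χ p ρ.N₀ * (p : ℂ) ^ k - p * (outer χ p ρ.N₁ * outer χ p ρ.N₂))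
      = -(outer χ p ρ.N₁ * outer χ p ρ.N₂ * (p - 1)) := by
  obtain ⟨d0, d1, d2, d01, d12, d02⟩ := ρ.dvd_level
  obtain ⟨n1, n2⟩ := (ρ.not_dvd_of_dvd hN hp).1 h0
  have hp0 : (p : ℂ) ≠ 0 := by exact_mod_cast hp.ne_zero
  rw [coeffA, if_pos hψ, chi_mul χ hN d12, chi_eq_outer χ hN d1 n1, chi_eq_outer χ hN d2 n2,
    chi_div_eq_outer χ hN hp d0 h0, (zpow_sub_eq hp).1]
  have hne := unimodular_sub_ne_zero hp (norm_outer χ hp ρ.N₀) (w := outer χ p ρ.N₁ * outer χ p ρ.N₂)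
    (by rw [norm_mul, norm_outer χ hp, norm_outer χ hp, one_mul]) (i := k) (j := 1) (by omega)
  rw [pow_one] at hne
  have e : outer χ p ρ.N₀ * ((p : ℂ) ^ k / p) - outer χ p ρ.N₁ * outer χ p ρ.N₂
      = (outer χ p ρ.N₀ * (p : ℂ) ^ k - p * (outer χ p ρ.N₁ * outer χ p ρ.N₂)) / p := by
    field_simp
  rw [e]
  generalize outer χ p ρ.N₀ * (p : ℂ) ^ k - p * (outer χ p ρ.N₁ * outer χ p ρ.N₂) = A at hne
  field_simp

/-- The equation defining `coeffC`. -/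
theorem coeffC_eq (hN : Squarefree N) (hk : 4 ≤ k) (hp : p.Prime) (h1 : p ∣ ρ.N₁)
    (hψ : component χ p = 1) :
    coeffC k χ ρ p * (outer χ p ρ.N₀ * outer χ p ρ.N₁ * (p : ℂ) ^ k - p ^ 2 * outer χ p ρ.N₂)
      = -(outer χ p ρ.N₂ * (p ^ 2 - 1)) := by
  obtain ⟨d0, d1, d2, d01, d12, d02⟩ := ρ.dvd_level
  obtain ⟨n0, n2⟩ := (ρ.not_dvd_of_dvd hN hp).2.1 h1
  have hp0 : (p : ℂ) ≠ 0 := by exact_mod_cast hp.ne_zero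
  have hd : ρ.N₀ * (ρ.N₁ / p) ∣ N := (mul_dvd_mul_left _ (Nat.div_dvd_of_dvd h1)).trans d01
  rw [coeffC, if_pos hψ, chi_mul χ hN hd, chi_eq_outer χ hN d0 n0, chi_eq_outer χ hN d2 n2,
    chi_div_eq_outer χ hN hp d1 h1, (zpow_sub_eq hp).2.1]
  have hne := unimodular_sub_ne_zero hp (u := outer χ p ρ.N₀ * outer χ p ρ.N₁)
    (by rw [norm_mul, norm_outer χ hp, norm_outer χ hp, one_mul]) (norm_outer χ hp ρ.N₂)
    (i := k) (j := 2) (by omega)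
  have e : outer χ p ρ.N₀ * outer χ p ρ.N₁ * ((p : ℂ) ^ k / p ^ 2) - outer χ p ρ.N₂
      = (outer χ p ρ.N₀ * outer χ p ρ.N₁ * (p : ℂ) ^ k - p ^ 2 * outer χ p ρ.N₂) / p ^ 2 := by
    field_simp
  have e2 : (p : ℂ) ^ (-2 : ℤ) = ((p : ℂ) ^ 2)⁻¹ := by rw [_root_.zpow_neg]; norm_cast
  rw [e, e2]
  generalize outer χ p ρ.N₀ * outer χ p ρ.N₁ * (p : ℂ) ^ k - p ^ 2 * outer χ p ρ.N₂ = A at hne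
  field_simp

theorem outer_sq_sub_ne_zero (hk : 4 ≤ k) (hp : p.Prime) :
    outer χ p ρ.N₀ ^ 2 * ((p : ℂ) ^ k) ^ 2 - p ^ 3 * outer χ p ρ.N₂ ^ 2 ≠ 0 := by
  rw [← pow_mul]
  exact unimodular_sub_ne_zero hp (by rw [norm_pow, norm_outer χ hp, one_pow])
    (by rw [norm_pow, norm_outer χ hp, one_pow]) (by omega)

/-- The equation defining `coeffB` for a trivial component. -/
theorem coeffB_eq (hN : Squarefree N) (hk : 4 ≤ k) (hp : p.Prime) (h0 : p ∣ ρ.N₀)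
    (hψ : component χ p = 1) :
    coeffB k χ ρ p *
      ((outer χ p ρ.N₀ * (p : ℂ) ^ k - p * (outer χ p ρ.N₁ * outer χ p ρ.N₂)) *
        (outer χ p ρ.N₀ ^ 2 * ((p : ℂ) ^ k) ^ 2 - p ^ 3 * outer χ p ρ.N₂ ^ 2))
      = -(outer χ p ρ.N₂ ^ 2 * (p - 1) *
        (outer χ p ρ.N₀ * (p : ℂ) ^ k - p ^ 3 * (outer χ p ρ.N₁ * outer χ p ρ.N₂))) := by
  obtain ⟨d0, d1, d2, d01, d12, d02⟩ := ρ.dvd_level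
  obtain ⟨n1, n2⟩ := (ρ.not_dvd_of_dvd hN hp).1 h0
  have hp0 : (p : ℂ) ≠ 0 := by exact_mod_cast hp.ne_zero
  obtain ⟨z1, -, z3, -, z23⟩ := zpow_sub_eq (k := k) hp
  rw [coeffB, if_pos hψ, chi_mul χ hN d12, chi_sq, chi_sq, chi_eq_outer χ hN d1 n1,
    chi_eq_outer χ hN d2 n2, chi_div_eq_outer χ hN hp d0 h0, z1, z3, z23]
  have hne := unimodular_sub_ne_zero hp (norm_outer χ hp ρ.N₀) (w := outer χ p ρ.N₁ * outer χ p ρ.N₂)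
    (by rw [norm_mul, norm_outer χ hp, norm_outer χ hp, one_mul]) (i := k) (j := 1) (by omega)
  rw [pow_one] at hne
  have hne2 := outer_sq_sub_ne_zero ρ hk hp
  have e : outer χ p ρ.N₀ * ((p : ℂ) ^ k / p) - outer χ p ρ.N₁ * outer χ p ρ.N₂
      = (outer χ p ρ.N₀ * (p : ℂ) ^ k - p * (outer χ p ρ.N₁ * outer χ p ρ.N₂)) / p := by
    field_simp
  have e2 : outer χ p ρ.N₀ ^ 2 * (((p : ℂ) ^ k) ^ 2 / p ^ 3) - outer χ p ρ.N₂ ^ 2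
      = (outer χ p ρ.N₀ ^ 2 * ((p : ℂ) ^ k) ^ 2 - p ^ 3 * outer χ p ρ.N₂ ^ 2) / p ^ 3 := by
    field_simp
  have e3 : outer χ p ρ.N₀ * ((p : ℂ) ^ k / p ^ 3) - outer χ p ρ.N₁ * outer χ p ρ.N₂
      = (outer χ p ρ.N₀ * (p : ℂ) ^ k - p ^ 3 * (outer χ p ρ.N₁ * outer χ p ρ.N₂)) / p ^ 3 := by
    field_simp
  rw [e, e2, e3]
  generalize outer χ p ρ.N₀ * (p : ℂ) ^ k - p * (outer χ p ρ.N₁ * outer χ p ρ.N₂) = A at hne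
  generalize outer χ p ρ.N₀ ^ 2 * ((p : ℂ) ^ k) ^ 2 - p ^ 3 * outer χ p ρ.N₂ ^ 2 = B at hne2
  field_simp

/-- The equation defining `coeffB` for a quadratic component. -/
theorem coeffB_eq' (hN : Squarefree N) (hk : 4 ≤ k) (hp : p.Prime) (h0 : p ∣ ρ.N₀)
    (hψ : component χ p ≠ 1) (hψ2 : component χ p ^ 2 = 1) :
    coeffB k χ ρ p * (outer χ p ρ.N₀ ^ 2 * ((p : ℂ) ^ k) ^ 2 - p ^ 3 * outer χ p ρ.N₂ ^ 2)
      = -(component χ p (-1) * outer χ p ρ.N₂ ^ 2 * p * (p - 1)) := by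
  have : Fact p.Prime := ⟨hp⟩
  obtain ⟨d0, d1, d2, d01, d12, d02⟩ := ρ.dvd_level
  obtain ⟨n1, n2⟩ := (ρ.not_dvd_of_dvd hN hp).1 h0
  have hp0 : (p : ℂ) ≠ 0 := by exact_mod_cast hp.ne_zero
  obtain ⟨z1, -, z3, -, z23⟩ := zpow_sub_eq (k := k) hp
  rw [coeffB, if_neg hψ, if_pos hψ2, chi_sq, chi_sq, chi_eq_outer χ hN d2 n2,
    chi_div_eq_outer χ hN hp d0 h0, z23, jacobiSym_neg_one_eq hψ hψ2]
  have hne2 := outer_sq_sub_ne_zero ρ hk hp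
  have e2 : outer χ p ρ.N₀ ^ 2 * (((p : ℂ) ^ k) ^ 2 / p ^ 3) - outer χ p ρ.N₂ ^ 2
      = (outer χ p ρ.N₀ ^ 2 * ((p : ℂ) ^ k) ^ 2 - p ^ 3 * outer χ p ρ.N₂ ^ 2) / p ^ 3 := by
    field_simp
  have e3 : (p : ℂ) ^ (-2 : ℤ) = ((p : ℂ) ^ 2)⁻¹ := by rw [_root_.zpow_neg]; norm_cast
  rw [e2, e3]
  generalize outer χ p ρ.N₀ ^ 2 * ((p : ℂ) ^ k) ^ 2 - p ^ 3 * outer χ p ρ.N₂ ^ 2 = B at hne2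
  field_simp

end

end

end SiegelEisenstein

/-! ### Verification of the eigenvalue equations. -/

namespace SiegelEisenstein

noncomputable section

section

variable {N : ℕ} {χ : DirichletCharacter ℂ N} (ρ : CuspIndex χ) {p k : ℕ}

theorem exists_outerFactor_T (hN : Squarefree N) (hp : p.Prime) :
    ∃ E, IsOuterFactor χ (eigenFam k χ ρ) 1 p E ∧ E 0 = outer χ p ρ.N₁ * outer χ p ρ.N₂ ^ 2 ∧
      E 1 = outer χ p ρ.N₀ * outer χ p ρ.N₂ ∧ E 2 = outer χ p ρ.N₀ ^ 2 * outer χ p ρ.N₁ := by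
  have hv := outer_sq hN hp ρ
  refine ⟨_, isOuterFactor_eigenFam hN ρ 1 hp, ?_, ?_, ?_⟩
  · simp
  · simp [hv]
  · have : outer χ p ρ.N₁ ^ 3 = outer χ p ρ.N₁ := by rw [pow_succ, hv, one_mul]
    simp [this]

theorem exists_outerFactor_TOne (hN : Squarefree N) (hp : p.Prime) :
    ∃ E, IsOuterFactor χ (eigenFam k χ ρ) 0 p E ∧ E 0 = outer χ p ρ.N₂ ^ 2 ∧
      E 1 = outer χ p ρ.N₀ * outer χ p ρ.N₁ * outer χ p ρ.N₂ ∧ E 2 = outer χ p ρ.N₀ ^ 2 := by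
  have hv := outer_sq hN hp ρ
  refine ⟨_, isOuterFactor_eigenFam hN ρ 0 hp, ?_, ?_, ?_⟩
  · simp
  · simp
  · simp [hv]

theorem charSum_one : charSum (1 : DirichletCharacter ℂ p) = p - 1 := if_pos rfl

theorem charSum_of_ne {ψ : DirichletCharacter ℂ p} (h : ψ ≠ 1) : charSum ψ = 0 := if_neg h

theorem one_apply_neg_one (hp : p.Prime) : (1 : DirichletCharacter ℂ p) (-1) = 1 := by
  have : Fact p.Prime := ⟨hp⟩
  exact MulChar.one_apply (isUnit_one.neg)

theorem coeffA_of_ne (h : component χ p ≠ 1) : coeffA k χ ρ p = 0 := if_neg h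

theorem coeffC_of_ne (h : component χ p ≠ 1) : coeffC k χ ρ p = 0 := if_neg h

theorem coeffB_of_ne (h : component χ p ≠ 1) (h2 : component χ p ^ 2 ≠ 1) :
    coeffB k χ ρ p = 0 := by
  rw [coeffB, if_neg h, if_neg h2]

/-- When `p` divides `N₀` or `N₁`, the diagonal row of the local system gives the eigenvalue, and
the rows below it are the linear equations that define `coeffA`, `coeffB`, `coeffC`. When `p ∤ N`,
the count of exponents factors because `outer χ p ρ.N₁` squares to `1`. -/
theorem heckeT_eigenFam (hN : Squarefree N) (hk : 4 ≤ k) (hχ : χ (-1) = (-1) ^ k) (hp : p.Prime) :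
    heckeT k χ p hp (plSum k (famFun χ (eigenFam k χ ρ)))
      = eigenvalueT k χ ρ p • plSum k (famFun χ (eigenFam k χ ρ)) := by
  have hadm := eigenFam_admissible (k := k) hN ρ
  obtain ⟨d0, d1, d2, d01, d12, d02⟩ := ρ.dvd_level
  have hp0 : (p : ℂ) ≠ 0 := by exact_mod_cast hp.ne_zero
  obtain ⟨z1, z2, z3, z22, z23⟩ := zpow_sub_eq (k := k) hp
  obtain ⟨E, hE, E0, E1, E2⟩ := exists_outerFactor_T (k := k) ρ hN hp
  have hv := outer_sq hN hp ρ
  have hpow : ((p : ℂ) ^ 2) ^ k = ((p : ℂ) ^ k) ^ 2 := by rw [← pow_mul, ← pow_mul, mul_comm]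
  by_cases h2 : p ∣ ρ.N₂
  · obtain ⟨n0, n1⟩ := (ρ.not_dvd_of_dvd hN hp).2.2 h2
    have hlam : eigenvalueT k χ ρ p = outer χ p ρ.N₀ ^ 2 * outer χ p ρ.N₁
        * (((p : ℂ) ^ k) ^ 2 / p ^ 3) := by
      rw [eigenvalueT, if_pos h2, chi_sq, chi_eq_outer χ hN d0 n0, chi_eq_outer χ hN d1 n1, z23]
    refine heckeT_eigen_of_dvd hN hk hχ hadm hp (h2.trans d2) hE ?_ ?_ ?_ <;>
      simp only [eigenFam_of_dvd_two ρ h2, cons_val_zero, cons_val_one, cons_val] <;>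
      rw [hlam]
    · ring
    · ring
    · rw [E2, hpow]
      field_simp
      ring
  by_cases h1 : p ∣ ρ.N₁
  · obtain ⟨n0, n2⟩ := (ρ.not_dvd_of_dvd hN hp).2.1 h1
    have hlam : eigenvalueT k χ ρ p = outer χ p ρ.N₀ * outer χ p ρ.N₂ * ((p : ℂ) ^ k / p) := by
      rw [eigenvalueT, if_neg h2, if_pos h1, chi_mul χ hN d02, chi_eq_outer χ hN d0 n0,
        chi_eq_outer χ hN d2 n2, z1]
    refine heckeT_eigen_of_dvd hN hk hχ hadm hp (h1.trans d1) hE ?_ ?_ ?_ <;>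
      simp only [eigenFam_of_dvd_one ρ h2 h1, cons_val_zero, cons_val_one, cons_val] <;>
      rw [hlam]
    · ring
    · rw [E1]
      field_simp
      ring
    · rw [E1, E2, hpow]
      by_cases hψ : component χ p = 1
      · have hc := coeffC_eq ρ hN hk hp h1 hψ
        rw [hψ, charSum_one]
        field_simp
        generalize coeffC k χ ρ p = c at hc ⊢
        generalize (p : ℂ) ^ k = X at hc ⊢
        linear_combination X * outer χ p ρ.N₀ * hc
      · rw [charSum_of_ne hψ, coeffC_of_ne ρ hψ]
        ring
  by_cases h0 : p ∣ ρ.N₀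
  · have hlam : eigenvalueT k χ ρ p = outer χ p ρ.N₁ * outer χ p ρ.N₂ ^ 2 := by
      rw [eigenvalueT, if_neg h2, if_neg h1, if_pos h0, chi_sq, chi_eq_outer χ hN d1 h1,
        chi_eq_outer χ hN d2 h2]
    refine heckeT_eigen_of_dvd hN hk hχ hadm hp (h0.trans d0) hE ?_ ?_ ?_ <;>
      simp only [eigenFam_of_not_dvd ρ h2 h1, cons_val_zero, cons_val_one, cons_val] <;>
      rw [hlam]
    · rw [E0]
    · rw [E0, E1]
      by_cases hψ : component χ p = 1
      · have ha := coeffA_eq ρ hN hk hp h0 hψ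
        rw [hψ, charSum_one]
        linear_combination p ^ 2 * outer χ p ρ.N₂ * ha
      · rw [charSum_of_ne hψ, coeffA_of_ne ρ hψ]
        ring
    · rw [E0, E1, E2, hpow]
      by_cases hψ : component χ p = 1
      · have ha := coeffA_eq ρ hN hk hp h0 hψ
        have hb := coeffB_eq ρ hN hk hp h0 hψ
        have hne := unimodular_sub_ne_zero hp (norm_outer χ hp ρ.N₀)
          (w := outer χ p ρ.N₁ * outer χ p ρ.N₂)
          (by rw [norm_mul, norm_outer χ hp, norm_outer χ hp, one_mul]) (i := k) (j := 1) (by omega)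
        rw [pow_one] at hne
        rw [hψ, one_pow, charSum_one, one_apply_neg_one hp]
        -- The equation is multiplied by the denominator of `coeffA`, which `coeffB_eq` also
        -- contains.
        apply mul_left_cancel₀ hne
        generalize outer χ p ρ.N₀ = u at *
        generalize outer χ p ρ.N₁ = v at *
        generalize outer χ p ρ.N₂ = w at *
        generalize (p : ℂ) ^ k = X at *
        generalize coeffA k χ ρ p = a at *
        generalize coeffB k χ ρ p = b at *
        generalize (p : ℂ) = P at *
        linear_combination X * u * w * (P + 1) * (P - 1) * ha + v * hb
      · by_cases hψ2 : component χ p ^ 2 = 1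
        · have hb := coeffB_eq' ρ hN hk hp h0 hψ hψ2
          rw [charSum_of_ne hψ, hψ2, charSum_one]
          linear_combination outer χ p ρ.N₁ * hb
        · rw [charSum_of_ne hψ, charSum_of_ne hψ2, coeffB_of_ne ρ hψ hψ2, coeffA_of_ne ρ hψ]
          ring
  · have hpN : ¬ p ∣ N := by
      rw [ρ.dvd_level_iff hp]
      tauto
    refine heckeT_eigen_of_not_dvd hN hk hχ hadm hp hpN hE ?_
    rw [eigenvalueT, if_neg h2, if_neg h1, if_neg h0, chi_mul χ hN d01, chi_mul χ hN d12,
      chi_eq_outer χ hN d0 h0, chi_eq_outer χ hN d1 h1, chi_eq_outer χ hN d2 h2, z1, z2, E0, E1,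
      E2, hpow]
    field_simp
    generalize outer χ p ρ.N₀ = u at *
    generalize outer χ p ρ.N₁ = v at *
    generalize outer χ p ρ.N₂ = w at *
    generalize (p : ℂ) ^ k = X at *
    generalize (p : ℂ) = P at *
    linear_combination (-(P ^ 2 * X * u * w)) * hv

/-- The coefficients are already fixed by `T(p)`; here the same defining equations, with larger
multipliers, show that the second triangular system has the same eigenvectors. -/
theorem heckeT₁_eigenFam (hN : Squarefree N) (hk : 4 ≤ k) (hχ : χ (-1) = (-1) ^ k)
    (hp : p.Prime) :
    heckeT₁ k χ p hp (plSum k (famFun χ (eigenFam k χ ρ)))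
      = eigenvalueT₁ k χ ρ p • plSum k (famFun χ (eigenFam k χ ρ)) := by
  have hadm := eigenFam_admissible (k := k) hN ρ
  obtain ⟨d0, d1, d2, d01, d12, d02⟩ := ρ.dvd_level
  have hp0 : (p : ℂ) ≠ 0 := by exact_mod_cast hp.ne_zero
  obtain ⟨z1, z2, z3, z22, z23⟩ := zpow_sub_eq (k := k) hp
  obtain ⟨E, hE, E0, E1, E2⟩ := exists_outerFactor_TOne (k := k) ρ hN hp
  have hv := outer_sq hN hp ρ
  have hpow : ((p : ℂ) ^ 2) ^ k = ((p : ℂ) ^ k) ^ 2 := by rw [← pow_mul, ← pow_mul, mul_comm]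
  by_cases h2 : p ∣ ρ.N₂
  · obtain ⟨n0, n1⟩ := (ρ.not_dvd_of_dvd hN hp).2.2 h2
    have hlam : eigenvalueT₁ k χ ρ p = outer χ p ρ.N₀ ^ 2 * ((p : ℂ) + 1)
        * (((p : ℂ) ^ k) ^ 2 / p ^ 3) := by
      rw [eigenvalueT₁, if_pos h2, chi_sq, chi_eq_outer χ hN d0 n0, z23]
    refine heckeT₁_eigen_of_dvd hN hk hχ hadm hp (h2.trans d2) hE ?_ ?_ ?_ <;>
      simp only [eigenFam_of_dvd_two ρ h2, cons_val_zero, cons_val_one, cons_val] <;>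
      rw [hlam]
    · ring
    · ring
    · rw [E2, hpow]
      field_simp
      ring
  by_cases h1 : p ∣ ρ.N₁
  · obtain ⟨n0, n2⟩ := (ρ.not_dvd_of_dvd hN hp).2.1 h1
    have hlam : eigenvalueT₁ k χ ρ p = outer χ p ρ.N₀ ^ 2 * (((p : ℂ) ^ k) ^ 2 / p ^ 2)
        + outer χ p ρ.N₂ ^ 2 * p := by
      rw [eigenvalueT₁, if_neg h2, if_pos h1, chi_sq, chi_sq, chi_eq_outer χ hN d0 n0,
        chi_eq_outer χ hN d2 n2, z22]
    refine heckeT₁_eigen_of_dvd hN hk hχ hadm hp (h1.trans d1) hE ?_ ?_ ?_ <;>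
      simp only [eigenFam_of_dvd_one ρ h2 h1, cons_val_zero, cons_val_one, cons_val] <;>
      rw [hlam]
    · ring
    · rw [E0, E2, hpow]
      field_simp
      ring
    · rw [E0, E1, E2, hpow]
      by_cases hψ : component χ p = 1
      · have hc := coeffC_eq ρ hN hk hp h1 hψ
        rw [hψ, charSum_one]
        field_simp
        generalize coeffC k χ ρ p = c at *
        generalize outer χ p ρ.N₀ = u at *
        generalize outer χ p ρ.N₁ = v at *
        generalize outer χ p ρ.N₂ = w at *
        generalize (p : ℂ) ^ k = X at *
        generalize (p : ℂ) = P at *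
        linear_combination (P ^ 2 * w + u * v * X) * hc - c * u ^ 2 * X ^ 2 * hv
      · rw [charSum_of_ne hψ, coeffC_of_ne ρ hψ]
        ring
  by_cases h0 : p ∣ ρ.N₀
  · have hlam : eigenvalueT₁ k χ ρ p = outer χ p ρ.N₂ ^ 2 * ((p : ℂ) + 1) := by
      rw [eigenvalueT₁, if_neg h2, if_neg h1, if_pos h0, chi_sq, chi_eq_outer χ hN d2 h2]
    refine heckeT₁_eigen_of_dvd hN hk hχ hadm hp (h0.trans d0) hE ?_ ?_ ?_ <;>
      simp only [eigenFam_of_not_dvd ρ h2 h1, cons_val_zero, cons_val_one, cons_val] <;>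
      rw [hlam]
    · rw [E0]; ring
    · rw [E0, E1, E2, hpow]
      by_cases hψ : component χ p = 1
      · have ha := coeffA_eq ρ hN hk hp h0 hψ
        rw [hψ, charSum_one]
        generalize coeffA k χ ρ p = a at *
        generalize outer χ p ρ.N₀ = u at *
        generalize outer χ p ρ.N₁ = v at *
        generalize outer χ p ρ.N₂ = w at *
        generalize (p : ℂ) ^ k = X at *
        generalize (p : ℂ) = P at *
        linear_combination P * (P * v * w + u * X) * ha
          + P * (P - 1) * (- P * w ^ 2) * hv + a * P ^ 3 * w ^ 2 * hv
      · rw [charSum_of_ne hψ, coeffA_of_ne ρ hψ]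
        ring
    · rw [E0, E1, E2, hpow]
      by_cases hψ : component χ p = 1
      · have ha := coeffA_eq ρ hN hk hp h0 hψ
        have hb := coeffB_eq ρ hN hk hp h0 hψ
        have hne := unimodular_sub_ne_zero hp (norm_outer χ hp ρ.N₀)
          (w := outer χ p ρ.N₁ * outer χ p ρ.N₂)
          (by rw [norm_mul, norm_outer χ hp, norm_outer χ hp, one_mul]) (i := k) (j := 1) (by omega)
        rw [pow_one] at hne
        rw [hψ, one_pow, charSum_one, one_apply_neg_one hp]
        apply mul_left_cancel₀ hne
        generalize outer χ p ρ.N₀ = u at *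
        generalize outer χ p ρ.N₁ = v at *
        generalize outer χ p ρ.N₂ = w at *
        generalize (p : ℂ) ^ k = X at *
        generalize coeffA k χ ρ p = a at *
        generalize coeffB k χ ρ p = b at *
        generalize (p : ℂ) = P at *
        linear_combination (P + 1) * (P - 1) * (P ^ 2 * w ^ 2 + X * u * v * w) * ha
          + (P + 1) * hb + u * X * w ^ 2 * (P + P ^ 2 - P ^ 3 - 1) * hv
      · by_cases hψ2 : component χ p ^ 2 = 1
        · have hb := coeffB_eq' ρ hN hk hp h0 hψ hψ2
          rw [charSum_of_ne hψ, hψ2, charSum_one]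
          linear_combination (p + 1 : ℂ) * hb
        · rw [charSum_of_ne hψ, charSum_of_ne hψ2, coeffB_of_ne ρ hψ hψ2, coeffA_of_ne ρ hψ]
          ring
  · have hpN : ¬ p ∣ N := by
      rw [ρ.dvd_level_iff hp]
      tauto
    have hχp : χ (p : ZMod N) = outer χ p ρ.N₀ * outer χ p ρ.N₁ * outer χ p ρ.N₂ := by
      have e : χ (p : ZMod N) = chi χ (ρ.N₀ * ρ.N₁ * ρ.N₂) p := by
        rw [chi_eq_prod hN χ (dvd_of_eq ρ.prod_eq)]
        have := character_eq_prod hN χ p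
        rw [Int.cast_natCast] at this
        rw [this, ρ.prod_eq]
        simp
      rw [e, chi_mul χ hN (dvd_of_eq ρ.prod_eq), chi_mul χ hN d01, chi_eq_outer χ hN d0 h0,
        chi_eq_outer χ hN d1 h1, chi_eq_outer χ hN d2 h2]
    refine heckeT₁_eigen_of_not_dvd hN hk hχ hadm hp hpN hE ?_
    rw [eigenvalueT₁, if_neg h2, if_neg h1, if_neg h0, chi_sq, chi_sq,
      chi_eq_outer χ hN d0 h0, chi_eq_outer χ hN d2 h2, z23, z3, hχp, E0, E1, E2, hpow]
    field_simp
    ring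

end

end

end SiegelEisenstein

namespace SiegelEisenstein

noncomputable section

/-! ### The basis of eigenforms -/

section Basis

variable {N : ℕ} {χ : DirichletCharacter ℂ N} {k : ℕ}

/-- The ranks modulo primes of the cusp attached to `ρ`. -/
def CuspIndex.rank (ρ : CuspIndex χ) : ℕ → Fin 3 := tripleRank ρ.N₁ ρ.N₂

theorem CuspIndex.rank_eq_two_iff (ρ : CuspIndex χ) {q : ℕ} : ρ.rank q = 2 ↔ q ∣ ρ.N₂ := by
  rw [rank, tripleRank]
  split_ifs <;> simp_all

theorem CuspIndex.rank_eq_one_iff (ρ : CuspIndex χ) (hN : Squarefree N) {q : ℕ} (hq : q.Prime) :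
    ρ.rank q = 1 ↔ q ∣ ρ.N₁ := by
  have h := (ρ.not_dvd_of_dvd hN hq).2.1
  rw [rank, tripleRank]
  split_ifs with h2 h1
  · simpa using fun h1 => (h h1).2 h2
  · simpa using h1
  · simpa using h1

theorem CuspIndex.eq_of_rank_eq (hN : Squarefree N) {ρ σ : CuspIndex χ}
    (h : ∀ q ∈ N.primeFactors, ρ.rank q = σ.rank q) : ρ = σ := by
  have eq_of : ∀ {a b : ℕ}, a ∣ N → b ∣ N → (∀ q ∈ N.primeFactors, q ∣ a ↔ q ∣ b) → a = b := by
    intro a b ha hb hab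
    have hs : a.primeFactors = b.primeFactors := by
      ext q
      have ha0 := (hN.squarefree_of_dvd ha).ne_zero
      have hb0 := (hN.squarefree_of_dvd hb).ne_zero
      simp only [Nat.mem_primeFactors]
      constructor
      · rintro ⟨hq, hd, -⟩
        exact ⟨hq, (hab q (Nat.mem_primeFactors.mpr ⟨hq, hd.trans ha, hN.ne_zero⟩)).mp hd, hb0⟩
      · rintro ⟨hq, hd, -⟩
        exact ⟨hq, (hab q (Nat.mem_primeFactors.mpr ⟨hq, hd.trans hb, hN.ne_zero⟩)).mpr hd, ha0⟩
    rw [← Nat.prod_primeFactors_of_squarefree (hN.squarefree_of_dvd ha), hs,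
      Nat.prod_primeFactors_of_squarefree (hN.squarefree_of_dvd hb)]
  have h1 : ρ.N₁ = σ.N₁ := eq_of ρ.dvd_level.2.1 σ.dvd_level.2.1 fun q hq => by
    have hp := Nat.prime_of_mem_primeFactors hq
    rw [← ρ.rank_eq_one_iff hN hp, h q hq, σ.rank_eq_one_iff hN hp]
  have h2 : ρ.N₂ = σ.N₂ := eq_of ρ.dvd_level.2.2.1 σ.dvd_level.2.2.1 fun q hq => by
    rw [← ρ.rank_eq_two_iff, h q hq, σ.rank_eq_two_iff]
  have hne : ρ.N₁ * ρ.N₂ ≠ 0 := (hN.squarefree_of_dvd ρ.dvd_level.2.2.2.2.1).ne_zero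
  have h0 : ρ.N₀ = σ.N₀ := by
    apply mul_right_cancel₀ hne
    rw [← mul_assoc, ρ.prod_eq, h1, h2, ← mul_assoc, σ.prod_eq]
  cases ρ
  cases σ
  simp_all

/-- The components of the triple are the products of the primes of `N` with prescribed rank `0`,
`1`, `2`. -/
theorem CuspIndex.exists_rank (hN : Squarefree N) {r : ℕ → Fin 3}
    (hr : ∀ q ∈ N.primeFactors, r q = 1 → component χ q ^ 2 = 1) :
    ∃ ρ : CuspIndex χ, ∀ q ∈ N.primeFactors, ρ.rank q = r q := by
  set M : Fin 3 → ℕ := fun i => ∏ q ∈ N.primeFactors with r q = i, q with hM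
  have hprod : M 0 * M 1 * M 2 = N := by
    rw [← Fin.prod_univ_three, hM, Finset.prod_fiberwise,
      Nat.prod_primeFactors_of_squarefree hN]
  have hpf : ∀ i, (M i).primeFactors = N.primeFactors.filter fun q => r q = i := fun i =>
    Nat.primeFactors_prod fun q hq => Nat.prime_of_mem_primeFactors (Finset.mem_filter.mp hq).1
  have hM0 : ∀ i, M i ≠ 0 := fun i => Finset.prod_ne_zero_iff.mpr fun q hq =>
    (Nat.prime_of_mem_primeFactors (Finset.mem_filter.mp hq).1).ne_zero
  have hdvd : ∀ i, ∀ q ∈ N.primeFactors, q ∣ M i ↔ r q = i := by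
    intro i q hq
    have := congrArg (q ∈ ·) (hpf i)
    simpa [Nat.prime_of_mem_primeFactors hq, hM0 i, Nat.dvd_of_mem_primeFactors hq, hN.ne_zero]
      using this
  refine ⟨⟨M 0, M 1, M 2, hprod, component_sq_of_primes hN χ
    ⟨M 0 * M 2, hprod.symm.trans (by ring)⟩ fun q hq => ?_⟩, fun q hq => ?_⟩
  · rw [hpf, Finset.mem_filter] at hq
    exact hr q hq.1 hq.2
  · rw [rank, tripleRank]
    simp only [hdvd _ q hq]
    generalize r q = i
    fin_cases i <;> rfl

theorem finite_cuspIndex (hN : Squarefree N) (χ : DirichletCharacter ℂ N) :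
    Finite (CuspIndex χ) := by
  refine Finite.of_injective (β := N.primeFactors → Fin 3) (fun ρ q => ρ.rank q) fun ρ σ h => ?_
  exact CuspIndex.eq_of_rank_eq hN fun q hq => congrFun h ⟨q, hq⟩

theorem famFun_congr {κ κ' : ℕ → Fin 3 → ℂ} (h : ∀ q ∈ N.primeFactors, κ q = κ' q) :
    famFun χ κ = famFun χ κ' := by
  ext w
  exact Finset.prod_congr rfl fun q hq => by rw [h q hq]

/-- An admissible `γ₀` has the ranks of some triple `ρ`, and its series is a nonzero multiple of the
one for `ρ`. This bounds the dimension by the number of triples. -/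
theorem eisensteinSpace_le_span (hN : Squarefree N) (hχ : χ (-1) = (-1) ^ k) :
    eisensteinSpace k χ ≤ Submodule.span ℂ
      (Set.range fun ρ : CuspIndex χ => plSum k (famFun χ (rankFam ρ.rank))) := by
  refine Submodule.span_le.mpr ?_
  rintro _ ⟨γ₀, hγ, rfl⟩
  set r : ℕ → Fin 3 := fun q => rankMod q (plZ γ₀) with hr
  have hadm : IsAdmissibleFam χ (rankFam r) :=
    (isAdmissibleFam_rankFam_iff (fun _ _ => rfl) hN.ne_zero).mpr hγ
  obtain ⟨ρ, hρ⟩ := CuspIndex.exists_rank hN (χ := χ) (r := r) fun q hq h =>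
    hadm q hq (by simp [rankFam, h])
  have h1 := plSum_rankFam hN hχ (γ₀ := γ₀) hadm fun _ _ => rfl
  have h2 : famFun χ (rankFam r) (plZ γ₀) ≠ 0 := by
    rw [famFun_eq_mul]
    refine mul_ne_zero ?_ (famFun_plZ_ne_zero χ γ₀)
    simp [rankFam, hr]
  have h3 : famFun χ (rankFam ρ.rank) = famFun χ (rankFam r) :=
    famFun_congr fun q hq => by rw [rankFam, rankFam, hρ q hq]
  have h4 : eisenstein k χ γ₀
      = (famFun χ (rankFam r) (plZ γ₀))⁻¹ • plSum k (famFun χ (rankFam ρ.rank)) := by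
    rw [h3, h1, smul_smul, inv_mul_cancel₀ h2, one_smul]
  rw [SetLike.mem_coe, h4]
  exact Submodule.smul_mem _ _ (Submodule.subset_span ⟨ρ, rfl⟩)

theorem eigenform_mem (hN : Squarefree N) (ρ : CuspIndex χ) :
    eigenform k χ ρ ∈ eisensteinSpace k χ := by
  rw [eigenform]
  refine Submodule.sum_mem _ fun Q₀ hQ₀ => Submodule.sum_mem _ fun Q₀' hQ₀' =>
    Submodule.sum_mem _ fun Q₁ hQ₁ => ?_
  by_cases hc : ∏ q ∈ Q₀.primeFactors, coeffA k χ ρ q = 0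
  · simp [hc]
  refine Submodule.smul_mem _ _ (Submodule.subset_span ⟨_, ?_, rfl⟩)
  have hprod : ρ.N₀ / (Q₀ * Q₀') * (Q₀ * (ρ.N₁ / Q₁)) * (Q₀' * Q₁ * ρ.N₂) = N := by
    rw [← Nat.div_div_eq_div_mul]
    exact (div_mul_triple (Nat.dvd_of_mem_divisors hQ₀) (Nat.dvd_of_mem_divisors hQ₀')
      (Nat.dvd_of_mem_divisors hQ₁) _).trans ρ.prod_eq
  refine (isAdmissibleFam_rankFam_iff (rankMod_cuspRep hN hprod) hN.ne_zero).mp ?_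
  exact rankFam_admissible_of_coeffA hN ρ hQ₀ hQ₁ hc

theorem eigenFam_rank (ρ : CuspIndex χ) (q : ℕ) : eigenFam k χ ρ q (ρ.rank q) = 1 := by
  rw [eigenFam, CuspIndex.rank, tripleRank]
  split_ifs <;> simp

theorem rank_le_of_eigenFam_ne_zero (ρ : CuspIndex χ) {q : ℕ} {i : Fin 3}
    (h : eigenFam k χ ρ q i ≠ 0) : ρ.rank q ≤ i := by
  rw [eigenFam] at h
  rw [CuspIndex.rank, tripleRank]
  fin_cases i <;> split_ifs at h ⊢ <;> simp_all

/-- A linear relation can be evaluated at every cusp by `eq_zero_of_plSum_eq_zero`. The values there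
are products of entries of `eigenFam`, which is unitriangular in the ranks. -/
theorem linearIndependent_plSum_eigenFam (hN : Squarefree N) (hk : 4 ≤ k)
    (hχ : χ (-1) = (-1) ^ k) :
    LinearIndependent ℂ fun ρ : CuspIndex χ => plSum k (famFun χ (eigenFam k χ ρ)) := by
  have := finite_cuspIndex hN χ
  have := Fintype.ofFinite (CuspIndex χ)
  rw [Fintype.linearIndependent_iff]
  intro c hc
  have hval : ∀ r : ℕ → Fin 3,
      ∑ ρ, c ρ * ∏ q ∈ N.primeFactors, eigenFam k χ ρ q (r q) = 0 := by
    intro r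
    obtain ⟨m, hm⟩ := exists_normalCusp N r
    have hpar : ∀ ρ, HasParity k (famFun χ (eigenFam k χ ρ)) := fun ρ => famFun_hasParity hN hχ _
    have hbd : ∀ ρ : CuspIndex χ, ∃ K : ℝ, ∀ w, ‖famFun χ (eigenFam k χ ρ) w‖ ≤ K :=
      fun ρ => famFun_bounded χ _
    rw [← plSum_sum hk _ _ _ (fun ρ _ => hpar ρ) (fun ρ _ => hbd ρ)] at hc
    choose K hK using hbd
    have h0 := eq_zero_of_plSum_eq_zero hk (K := ∑ ρ, ‖c ρ‖ * K ρ) ?_ ?_ hc (diagCusp m)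
    · rw [← h0]
      exact Finset.sum_congr rfl fun ρ _ => by rw [famFun_diagCusp χ _ hm]
    · intro w
      rw [Finset.mul_sum]
      exact Finset.sum_congr rfl fun ρ _ => by rw [hpar ρ w]; ring
    · intro w
      refine (norm_sum_le _ _).trans (Finset.sum_le_sum fun ρ _ => ?_)
      rw [norm_mul]
      exact mul_le_mul_of_nonneg_left (hK ρ w) (norm_nonneg _)
  by_contra! hne
  obtain ⟨ρ₀, hρ₀⟩ := hne
  -- Among the indices in the relation, one of minimal total rank is isolated by evaluation at its
  -- own cusp: any other contributing index would have ranks at most those of `σ` everywhere, hence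
  -- equal ranks.
  obtain ⟨σ, hσ, hmin⟩ := Finset.exists_min_image (Finset.univ.filter fun ρ => c ρ ≠ 0)
    (fun ρ => ∑ q ∈ N.primeFactors, (ρ.rank q : ℕ)) ⟨ρ₀, by simpa using hρ₀⟩
  have h := hval σ.rank
  rw [Finset.sum_eq_single σ, Finset.prod_congr rfl fun q _ => eigenFam_rank σ q,
    Finset.prod_const_one, mul_one] at h
  · exact (Finset.mem_filter.mp hσ).2 h
  · intro ρ _ hρ
    by_contra h0
    have hle : ∀ q ∈ N.primeFactors, (ρ.rank q : ℕ) ≤ σ.rank q := fun q hq =>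
      rank_le_of_eigenFam_ne_zero ρ (Finset.prod_ne_zero_iff.mp (right_ne_zero_of_mul h0) q hq)
    have heq := (Finset.sum_eq_sum_iff_of_le hle).mp (le_antisymm (Finset.sum_le_sum hle)
      (hmin ρ (by simpa using left_ne_zero_of_mul h0)))
    exact hρ (CuspIndex.eq_of_rank_eq hN fun q hq => Fin.ext (heq q hq))
  · simp

/-- Spanning follows by counting: the independent eigenforms are as many as the generators of a
space that contains `eisensteinSpace`. -/
theorem exists_basis_eigenform (hN : Squarefree N) (hk : 4 ≤ k) (hχ : χ (-1) = (-1) ^ k) :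
    ∃ b : Module.Basis (CuspIndex χ) ℂ (eisensteinSpace k χ),
      ∀ ρ, (b ρ : H2 → ℂ) = eigenform k χ ρ := by
  have := finite_cuspIndex hN χ
  have := Fintype.ofFinite (CuspIndex χ)
  set v : CuspIndex χ → eisensteinSpace k χ := fun ρ => ⟨_, eigenform_mem hN ρ⟩ with hv
  have hli : LinearIndependent ℂ v := by
    refine LinearIndependent.of_comp (eisensteinSpace k χ).subtype ?_
    have h := linearIndependent_plSum_eigenFam hN hk hχ
    simp only [← eigenform_eq hN hk hχ] at h
    exact h
  have hspan := eisensteinSpace_le_span (k := k) hN hχ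
  have hfd : FiniteDimensional ℂ (Submodule.span ℂ
      (Set.range fun ρ : CuspIndex χ => plSum k (famFun χ (rankFam ρ.rank)))) :=
    FiniteDimensional.span_of_finite ℂ (Set.finite_range _)
  have hfd' : FiniteDimensional ℂ (eisensteinSpace k χ) :=
    Submodule.finiteDimensional_of_le hspan
  have hcard : Fintype.card (CuspIndex χ) = Module.finrank ℂ (eisensteinSpace k χ) :=
    le_antisymm hli.fintype_card_le_finrank
      ((Submodule.finrank_mono hspan).trans (finrank_range_le_card _))
  refine ⟨Module.Basis.mk hli (hli.span_eq_top_of_card_eq_finrank' hcard).ge, fun ρ => ?_⟩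
  rw [Module.Basis.mk_apply]

end Basis

end

end SiegelEisenstein

theorem theorem3p11 (N k : ℕ) (hN : Squarefree N) (hk : 4 ≤ k) (χ : DirichletCharacter ℂ N)
    (hχ : χ (-1) = (-1) ^ k) :
    ∃ b : Module.Basis (CuspIndex χ) ℂ (eisensteinSpace k χ),
      ∀ ρ : CuspIndex χ,
        (b ρ : H2 → ℂ) = eigenform k χ ρ ∧
        ∀ (p : ℕ) (hp : p.Prime),
          heckeT k χ p hp (b ρ : H2 → ℂ) = eigenvalueT k χ ρ p • (b ρ : H2 → ℂ) ∧
          heckeT₁ k χ p hp (b ρ : H2 → ℂ) = eigenvalueT₁ k χ ρ p • (b ρ : H2 → ℂ) := by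
  obtain ⟨b, hb⟩ := exists_basis_eigenform hN hk hχ
  refine ⟨b, fun ρ => ⟨hb ρ, fun p hp => ?_⟩⟩
  rw [hb, eigenform_eq hN hk hχ]
  exact ⟨heckeT_eigenFam ρ hN hk hχ hp, heckeT₁_eigenFam ρ hN hk hχ hp⟩
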